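/- **Setting.** Let $\mathcal T^h$ be a finite conforming mesh of a polygonal domain $D\subset\mathbb R^2$ whose elements $E$ (open simple polygons) are shape regular with parameter $\rho>0$: with $h_E=\operatorname{diam}E$, $E$ is star-shaped with respect to every point of a disc of radius $\rho h_E$, and all edges of $E$ have length at least $\rho h_E$. Let $\kappa$ be constant and positive on each element. For a fixed $k\ge1$ let $$V_k(E)=\{v\in H^1(E): v|_{\partial E}\in C^0(\partial E),\ v|_e\in\mathcal P_k(e)\ \forall\text{ edges } e,\ \Delta v\in\mathcal P_{k-2}(E)\},\qquad \mathcal P_{-1}=\{0\},$$ with degrees of freedom the values at the vertices, the values at the $k-1$ internal Gauss–Lobatto nodes of each edge, and the moments up to order $k-2$. Let $V^h(D)=\{v\in H^1(D): v|_E\in V_k(E)\ \forall E\}$ and $V=V_0^h(D)=V^h(D)\cap H_0^1(D)$. (For $k=1$ this is the $P_1$ finite element space on triangles and the $Q_1$ finite element space on squares.) Let $I^h w\in V^h(D)$ be the interpolant having the same degrees of freedom as $w$. For a union $\omega$ of elements, $V^h(\omega)$ is defined likewise. Let $a(u,v)=\int_D\kappa\nabla u\cdot\nabla v$, and let $A$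 be the matrix of $a$ in a basis of $V$. *Coarse mesh.* The elements are grouped into nonempty blocks (the coarse elements), $H$ is the maximal diameter of the blocks, $y_1,\dots,y_{N_c}$ are vertices of the fine mesh (the coarse nodes), and $\omega_i$ is the union of the blocks whose closure contains $y_i$. Let $\chi_i\in V^h(D)$, $0\le\chi_i\le1$, $\sum_i\chi_i=1$ on $\overline D$, $\operatorname{supp}\chi_i\subset\overline\omega_i$, $|\nabla\chi_i|\le C_\chi/H$ in every element. *Subdomains.* The elements are also grouped into nonempty subdomains $D_1,\dots,D_{N_S}$, and $D_j'\supseteq D_j$ are unions of elements. Let $\delta=\max_j\delta_j>0$, where $\delta_j$ is the maximal distance of a point of $\overline{D_j'}$ from $\overline{D_j}$. Let $\xi_j\in V^h(D)$, $0\le\xi_j\le1$, $\sum_j\xi_j=1$ on $\overline D$, $\operatorname{supp}\xi_j\subset\overline{D_j'}$, $|\nabla\xi_j|\le C_\xi/\delta$ in every element. Every element belongs to at most $N$ of the $\omega_i$ and to at most $N$ of the $D_j'$. *Coarse space.* For each $i$ let $\psi_1^{\omega_i},\psi_2^{\omega_i},\dots$ be a basis of $\{v\in V^h(\omega_i): v=0\text{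 on }\partial\omega_i\cap\partial D\}$ that is orthonormal for $\int_{\omega_i}\kappa vw$ and consists of solutions of $$\int_{\omega_i}\kappa\nabla\psi_\ell^{\omega_i}\cdot\nabla w=\lambda_\ell^{\omega_i}\int_{\omega_i}\kappa\psi_\ell^{\omega_i}w\quad\text{for all } w \text{ in this space},\qquad \lambda_1^{\omega_i}\le\lambda_2^{\omega_i}\le\cdots .$$ Let $L_i\ge0$ be smaller than the dimension of this space, with $\lambda^{\omega_i}_{L_i+1}>0$, and put $$V_0=\operatorname{span}\{I^h(\chi_i\psi_\ell^{\omega_i}):1\le i\le N_c,\ 1\le\ell\le L_i\},\qquad \lambda_{L+1}=\min_{1\le i\le N_c}\lambda^{\omega_i}_{L_i+1}.$$ Let $V_j$ be the space of functions of $V$ with support in $\overline{D_j'}$, let the columns of $R_0^T$ and $R_j^T$ be the coordinates of bases of $V_0$ and $V_j$, let $A_j=R_jAR_j^T$ for $0\le j\le N_S$, and let $$M_2^{-1}=R_0^TA_0^{-1}R_0+\sum_{j=1}^{N_S}R_j^TA_j^{-1}R_j .$$ Write $\operatorname{cond}(M_2^{-1}A)$ for the quotient of the largest and the smallest eigenvalue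 of $M_2^{-1}A$. A number $C_0>0$ is a *stable decomposition constant* if every $v\in V$ can be written as $v=v_0+\sum_{j=1}^{N_S}v_j$ with $v_0\in V_0$, $v_j\in V_j$ and $$\int_D\kappa|\nabla v_0|^2+\sum_{j=1}^{N_S}\int_{D_j'}\kappa|\nabla v_j|^2\le C_0^2\int_D\kappa|\nabla v|^2 .$$ **Corollary.** There is a constant $C>0$ that depends only on $k,\rho,N,C_\chi,C_\xi$ (in particular, not on $\kappa$, its contrast, $h$, $H$, $\delta$, the $L_i$ or the numbers of blocks and subdomains) such that in the above setting $A$, all $A_j$ ($0\le j\le N_S$) and $M_2^{-1}$ are symmetric positive definite, every stable decomposition constant $C_0$ satisfies $$\operatorname{cond}(M_2^{-1}A)\le C\,C_0^2,$$ and there is a stable decomposition constant $C_0$ with $$C_0^2\le C\max\Big\{1+\frac1{\delta^2\lambda_{L+1}},\,1+\frac1{H^2\lambda_{L+1}}\Big\}.$$ -/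

import Mathlib

open MeasureTheory Polynomial
open scoped Gradient InnerProductSpace Laplacian

/-- The Euclidean plane. -/
abbrev Plane : Type := EuclideanSpace ℝ (Fin 2)

/-- The interior of a simple closed polygon with (cyclically ordered) vertices
`vert 0`, …, `vert (n - 1)`: a bounded open connected set whose boundary is the polygon.
Angles of `180` degrees at vertices are allowed. -/
structure PolygonElement where
  /-- number of vertices -/
  n : ℕ
  three_le : 3 ≤ n
  /-- the vertices, in cyclic order -/
  vert : ZMod n → Plane
  vert_injective : Function.Injective vert
  /-- two different edges meet at most in common end points -/
  simple : ∀ i j, i ≠ j → segment ℝ (vert i) (vert (i + 1)) ∩ segment ℝ (vert j) (vert (j + 1)) ⊆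
    {vert i, vert (i + 1)} ∩ {vert j, vert (j + 1)}
  /-- the open polygonal region -/
  carrier : Set Plane
  isOpen_carrier : IsOpen carrier
  isConnected_carrier : IsConnected carrier
  isBounded_carrier : Bornology.IsBounded carrier
  frontier_carrier : frontier carrier = ⋃ i, segment ℝ (vert i) (vert (i + 1))

namespace PolygonElement

/-- The `i`-th (closed) edge. -/
def edge (E : PolygonElement) (i : ZMod E.n) : Set Plane :=
  segment ℝ (E.vert i) (E.vert (i + 1))

/-- The shape regularity condition that is usual for virtual elements: with `h_E` the diameter of
`E`, the polygon is star-shaped with respect to all points of a disc of radius `ρ h_E`, and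
every edge has length at least `ρ h_E`. -/
def IsShapeRegular (E : PolygonElement) (ρ : ℝ) : Prop :=
  (∃ c : Plane, Metric.ball c (ρ * Metric.diam E.carrier) ⊆ E.carrier ∧
    ∀ z ∈ Metric.ball c (ρ * Metric.diam E.carrier), StarConvex ℝ z E.carrier) ∧
  ∀ i, ρ * Metric.diam E.carrier ≤ dist (E.vert i) (E.vert (i + 1))

/-- `v` restricted to the closure of `E` belongs to the local virtual element space
`V_k(E) = {v ∈ H¹(E) : v|_∂E ∈ C⁰(∂E), v|_e ∈ P_k(e) for every edge e, Δ v ∈ P_{k-2}(E)}`,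
with `P_{-1}(E) = {0}`.  The functions of this space are smooth in `E` and, `E` being a polygon,
continuous up to the boundary, so that derivatives are classical ones and boundary values are point
values.  For `k = 1` the space consists of the affine functions on a triangle, and
of the bilinear functions on a square. -/
structure MemVirtual (k : ℕ) (E : PolygonElement) (v : Plane → ℝ) : Prop where
  continuousOn : ContinuousOn v (closure E.carrier)
  edge_poly : ∀ i, ∃ p : ℝ[X], p.natDegree ≤ k ∧
    ∀ t ∈ Set.Icc (0 : ℝ) 1, v (AffineMap.lineMap (E.vert i) (E.vert (i + 1)) t) = p.eval t
  contDiffOn : ContDiffOn ℝ 2 v E.carrier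
  laplacian_poly : ∃ q : MvPolynomial (Fin 2) ℝ, (q = 0 ∨ q.totalDegree + 2 ≤ k) ∧
    ∀ x ∈ E.carrier, (Δ v) x = MvPolynomial.eval (fun j => x j) q
  memLp_grad : MemLp (∇ v) 2 (volume.restrict E.carrier)

/-- The `k - 1` internal nodes of the `(k + 1)`-point Gauss-Lobatto rule on `[0, 1]`: the zeros
of the derivative of the `k`-th (shifted) Legendre polynomial. -/
def gaussLobatto (k : ℕ) : Set ℝ :=
  {t | t ∈ Set.Ioo (0 : ℝ) 1 ∧ aeval t (derivative (shiftedLegendre k)) = 0}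

/-- `u` and `w` have the same degrees of freedom in `E`: the values at the vertices, the values at
the internal Gauss-Lobatto nodes of the edges, and the moments up to order `k - 2`. For `k = 1`
these are the nodal values at the vertices. -/
def SameDof (k : ℕ) (E : PolygonElement) (u w : Plane → ℝ) : Prop :=
  (∀ i, u (E.vert i) = w (E.vert i)) ∧
  (∀ i, ∀ t ∈ gaussLobatto k, u (AffineMap.lineMap (E.vert i) (E.vert (i + 1)) t) =
    w (AffineMap.lineMap (E.vert i) (E.vert (i + 1)) t)) ∧
  ∀ p : MvPolynomial (Fin 2) ℝ, p.totalDegree + 2 ≤ k →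
    ∫ x in E.carrier, u x * MvPolynomial.eval (fun j => x j) p =
      ∫ x in E.carrier, w x * MvPolynomial.eval (fun j => x j) p

theorem MemVirtual.zero (k : ℕ) (E : PolygonElement) : MemVirtual k E 0 where
  continuousOn := continuousOn_const
  edge_poly i := ⟨0, by simp, by simp⟩
  contDiffOn := contDiffOn_const
  laplacian_poly := ⟨0, Or.inl rfl, fun x _ => by
    have h : (0 : Plane → ℝ) = fun _ => (0 : ℝ) := rfl
    rw [h, InnerProductSpace.laplacian_const]
    simp⟩
  memLp_grad := by
    have : ∇ (0 : Plane → ℝ) = 0 := by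
      funext x
      exact gradient_fun_const x (0 : ℝ)
    rw [this]
    exact MemLp.zero

theorem MemVirtual.add {k : ℕ} {E : PolygonElement} {u v : Plane → ℝ}
    (hu : MemVirtual k E u) (hv : MemVirtual k E v) : MemVirtual k E (u + v) where
  continuousOn := hu.continuousOn.add hv.continuousOn
  edge_poly i := by
    obtain ⟨p, hp, hp'⟩ := hu.edge_poly i
    obtain ⟨q, hq, hq'⟩ := hv.edge_poly i
    refine ⟨p + q, (natDegree_add_le p q).trans (max_le hp hq), fun t ht => ?_⟩
    simp [hp' t ht, hq' t ht]
  contDiffOn := hu.contDiffOn.add hv.contDiffOn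
  laplacian_poly := by
    obtain ⟨p, hp, hp'⟩ := hu.laplacian_poly
    obtain ⟨q, hq, hq'⟩ := hv.laplacian_poly
    refine ⟨p + q, ?_, fun x hx => ?_⟩
    · rcases hp with rfl | hp
      · simpa using hq
      · rcases hq with rfl | hq
        · simpa using Or.inr hp
        · have := MvPolynomial.totalDegree_add p q
          right
          omega
    · have hn := E.isOpen_carrier.mem_nhds hx
      rw [ContDiffAt.laplacian_add (hu.contDiffOn.contDiffAt hn) (hv.contDiffOn.contDiffAt hn),
        hp' x hx, hq' x hx, map_add]
  memLp_grad := by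
    refine (hu.memLp_grad.add hv.memLp_grad).ae_eq ?_
    refine (ae_restrict_mem E.isOpen_carrier.measurableSet).mono fun x hx => ?_
    have hn := E.isOpen_carrier.mem_nhds hx
    have h1 := (hu.contDiffOn.contDiffAt hn).differentiableAt (by norm_num)
    have h2 := (hv.contDiffOn.contDiffAt hn).differentiableAt (by norm_num)
    simp only [Pi.add_apply, gradient, fderiv_add h1 h2, map_add]

theorem MemVirtual.smul {k : ℕ} {E : PolygonElement} {v : Plane → ℝ} (c : ℝ)
    (hv : MemVirtual k E v) : MemVirtual k E (c • v) where
  continuousOn := hv.continuousOn.const_smul c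
  edge_poly i := by
    obtain ⟨q, hq, hq'⟩ := hv.edge_poly i
    refine ⟨c • q, (natDegree_smul_le c q).trans hq, fun t ht => ?_⟩
    simp [hq' t ht]
  contDiffOn := hv.contDiffOn.const_smul c
  laplacian_poly := by
    obtain ⟨q, hq, hq'⟩ := hv.laplacian_poly
    refine ⟨c • q, ?_, fun x hx => ?_⟩
    · rcases hq with rfl | hq
      · simp
      · have := MvPolynomial.totalDegree_smul_le c q
        right
        omega
    · have hn := E.isOpen_carrier.mem_nhds hx
      rw [InnerProductSpace.laplacian_smul c (hv.contDiffOn.contDiffAt hn), hq' x hx,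
        MvPolynomial.smul_eval, smul_eq_mul]
  memLp_grad := by
    refine (hv.memLp_grad.const_smul c).ae_eq ?_
    refine (ae_restrict_mem E.isOpen_carrier.measurableSet).mono fun x hx => ?_
    have hn := E.isOpen_carrier.mem_nhds hx
    have h2 := (hv.contDiffOn.contDiffAt hn).differentiableAt (by norm_num)
    simp only [Pi.smul_apply, gradient, fderiv_const_smul h2 c, map_smulₛₗ]
    simp

end PolygonElement

/-- A conforming polygonal mesh with elements indexed by `ι`: the (open) elements are
disjoint, and the closures of two different elements meet only in common vertices and common
edges. -/
structure PolygonalMesh (ι : Type) where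
  elem : ι → PolygonElement
  disjoint_elem : ∀ e f, e ≠ f → Disjoint (elem e).carrier (elem f).carrier
  conforming : ∀ e f, e ≠ f → ∀ x ∈ closure (elem e).carrier ∩ closure (elem f).carrier,
    (∃ i j, (elem e).vert i = x ∧ (elem f).vert j = x) ∨
    (∃ i j, (elem e).edge i = (elem f).edge j ∧ x ∈ (elem e).edge i)

namespace PolygonalMesh

variable {ι : Type} [Fintype ι]

/-- The union of the open elements in `S`; up to a null set this is the subdomain that is
formed by these elements. -/
def region (M : PolygonalMesh ι) (S : Finset ι) : Set Plane :=
  ⋃ e ∈ S, (M.elem e).carrier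

/-- The closed subdomain that is formed by the elements in `S`. -/
def closedRegion (M : PolygonalMesh ι) (S : Finset ι) : Set Plane :=
  ⋃ e ∈ S, closure (M.elem e).carrier

/-- The polygonal domain `D` that is meshed by `M`. -/
def domain (M : PolygonalMesh ι) : Set Plane :=
  interior (M.closedRegion Finset.univ)

/-- `V^h(Ω)` for the subdomain `Ω` formed by the elements in `S`, the functions being extended by
zero outside the closure of `Ω`.  A function whose restriction to every closed element of the finite
family `S` is continuous is continuous on the closure of `Ω`. -/
def space (M : PolygonalMesh ι) (k : ℕ) (S : Finset ι) : Submodule ℝ (Plane → ℝ) where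
  carrier := {v | (∀ e ∈ S, (M.elem e).MemVirtual k v) ∧ ∀ x, x ∉ M.closedRegion S → v x = 0}
  zero_mem' := ⟨fun _ _ => PolygonElement.MemVirtual.zero _ _, fun _ _ => rfl⟩
  add_mem' := fun {u v} hu hv => ⟨fun e he => (hu.1 e he).add (hv.1 e he), fun x hx => by
    simp [hu.2 x hx, hv.2 x hx]⟩
  smul_mem' := fun c v hv => ⟨fun e he => (hv.1 e he).smul c, fun x hx => by
    simp [hv.2 x hx]⟩

/-- The functions of `V^h(Ω)` that vanish on `∂Ω ∩ ∂D`.  If `S` consists of all elements, this is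
`V_0^h(D)`. -/
def dirichletSpace (M : PolygonalMesh ι) (k : ℕ) (S : Finset ι) : Submodule ℝ (Plane → ℝ) where
  carrier := {v | v ∈ M.space k S ∧ ∀ x ∈ M.closedRegion S ∩ frontier M.domain, v x = 0}
  zero_mem' := ⟨Submodule.zero_mem _, fun _ _ => rfl⟩
  add_mem' := fun {u v} hu hv => ⟨Submodule.add_mem _ hu.1 hv.1, fun x hx => by
    simp [hu.2 x hx, hv.2 x hx]⟩
  smul_mem' := fun c v hv => ⟨Submodule.smul_mem _ c hv.1, fun x hx => by
    simp [hv.2 x hx]⟩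

/-- The finite or virtual element space `V_0^h(D)`. -/
abbrev fineSpace (M : PolygonalMesh ι) (k : ℕ) : Submodule ℝ (Plane → ℝ) :=
  M.dirichletSpace k Finset.univ

/-- The functions of `V_0^h(D)` with support in the closed subdomain formed by the elements in `S`,
as a subspace of `V_0^h(D)`. -/
def localSpace (M : PolygonalMesh ι) (k : ℕ) (S : Finset ι) : Submodule ℝ (M.fineSpace k) where
  carrier := {v | ∀ x, x ∉ M.closedRegion S → (v : Plane → ℝ) x = 0}
  zero_mem' := fun _ _ => rfl
  add_mem' := fun {u v} hu hv x hx => by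
    simp only [Set.mem_ofPred_eq] at hu hv
    simp [hu x hx, hv x hx]
  smul_mem' := fun c v hv x hx => by
    simp only [Set.mem_ofPred_eq] at hv
    simp [hv x hx]

/-- `∫_Ω κ ∇u · ∇v` for the subdomain `Ω` formed by the elements in `S`. -/
noncomputable def energy (M : PolygonalMesh ι) (κ : Plane → ℝ) (S : Finset ι)
    (u v : Plane → ℝ) : ℝ :=
  ∫ x in M.region S, κ x * ⟪∇ u x, ∇ v x⟫_ℝ

/-- `∫_Ω κ u v` for the subdomain `Ω` formed by the elements in `S`. -/
noncomputable def mass (M : PolygonalMesh ι) (κ : Plane → ℝ) (S : Finset ι)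
    (u v : Plane → ℝ) : ℝ :=
  ∫ x in M.region S, κ x * u x * v x

open scoped Classical in
/-- The fine-scale interpolation `I^h w`: the function in `V^h(D)` with the same degrees of freedom
as `w`.  (Such a function exists and is unique, so the second case does not occur.) -/
noncomputable def interp (M : PolygonalMesh ι) (k : ℕ) (w : Plane → ℝ) : Plane → ℝ :=
  if h : ∃ u ∈ M.space k Finset.univ, ∀ e, (M.elem e).SameDof k u w then h.choose else 0

open scoped Classical in
/-- The elements of the neighborhood of `y`: the union of all blocks whose closure
contains `y`.  Here `blk` is a partition of the fine mesh into blocks: the block `B` consists of the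
elements `e` with `blk e = B`. -/
noncomputable def nodeNeighborhood (M : PolygonalMesh ι) {β : Type} (blk : ι → β) (y : Plane) :
    Finset ι :=
  Finset.univ.filter fun e => ∃ f, blk f = blk e ∧ y ∈ closure (M.elem f).carrier

open scoped Classical in
/-- The elements of the block `B` of a partition of the fine mesh. -/
noncomputable def block {β : Type} (blk : ι → β) (B : β) : Finset ι :=
  Finset.univ.filter fun e => blk e = B

/-- The mesh size of a partition into blocks: the maximal diameter of the blocks. -/
noncomputable def coarseSize (M : PolygonalMesh ι) {β : Type} (blk : ι → β) : ℝ :=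
  ⨆ B, Metric.diam (M.closedRegion (block blk B))

/-- The overlap `δ = max_j δ_j`, where `δ_j` is the maximal width of `D_j' \ D_j`, that is, the
maximal distance of a point of `D_j'` from `D_j`. -/
noncomputable def overlap (M : PolygonalMesh ι) {J : Type} (sub : ι → J) (D' : J → Finset ι) : ℝ :=
  ⨆ j, sSup ((fun x => Metric.infDist x (M.closedRegion (block sub j))) ''
    M.closedRegion (D' j))

/-- `χ` is a partition of unity in `V^h(D)`, subordinated to the covering of `D` by the subdomains
that are formed by the elements in `S i`, with gradients bounded by `B`. -/
structure IsPartitionOfUnity (M : PolygonalMesh ι) (k : ℕ) {ν : Type} [Fintype ν]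
    (S : ν → Finset ι) (χ : ν → Plane → ℝ) (B : ℝ) : Prop where
  mem : ∀ i, χ i ∈ M.space k Finset.univ
  nonneg : ∀ i x, 0 ≤ χ i x
  le_one : ∀ i x, χ i x ≤ 1
  sum_eq_one : ∀ x ∈ M.closedRegion Finset.univ, ∑ i, χ i x = 1
  support : ∀ i x, x ∉ M.closedRegion (S i) → χ i x = 0
  grad_le : ∀ i e, ∀ x ∈ (M.elem e).carrier, ‖∇ (χ i) x‖ ≤ B

/-- `ψ 0, …, ψ (n - 1)` are eigenfunctions, with eigenvalues `lam 0 ≤ … ≤ lam (n - 1)`, of the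
generalized eigenvalue problem `A^ω ψ = λ M^ω ψ` on the functions of `V^h(ω)` that vanish on
`∂ω ∩ ∂D`, and they form a basis of this space that is orthonormal with respect to `M^ω`. Here `ω`
is formed by the elements in `S`. -/
structure IsEigenbasis (M : PolygonalMesh ι) (k : ℕ) (κ : Plane → ℝ) (S : Finset ι) {n : ℕ}
    (ψ : Fin n → Plane → ℝ) (lam : Fin n → ℝ) : Prop where
  span_eq : Submodule.span ℝ (Set.range ψ) = M.dirichletSpace k S
  orthonormal : ∀ l m, M.mass κ S (ψ l) (ψ m) = if l = m then 1 else 0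
  eigen : ∀ l, ∀ w ∈ M.dirichletSpace k S,
    M.energy κ S (ψ l) w = lam l * M.mass κ S (ψ l) w
  monotone : Monotone lam

/-- The local spectral coarse space `V_0 = span {I^h(χ_i ψ_ℓ^{ω_i}) : ℓ ≤ L_i}`, as a subspace
of `V_0^h(D)` (the eigenfunctions are numbered from `0` here). -/
noncomputable def coarseSpace (M : PolygonalMesh ι) (k : ℕ) {ν : Type} (χ : ν → Plane → ℝ)
    {n : ν → ℕ} (ψ : ∀ i, Fin (n i) → Plane → ℝ) (L : ν → ℕ) : Submodule ℝ (M.fineSpace k) :=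
  (Submodule.span ℝ {Φ | ∃ i, ∃ l : Fin (n i), (l : ℕ) < L i ∧
    Φ = M.interp k (χ i * ψ i l)}).submoduleOf (M.fineSpace k)

/-- The stable decomposition property with constant `C₀` of `V = V_0^h(D)` into the coarse space
`V0` and the local spaces of the overlapping subdomains `D' j`. -/
def IsStableDecomposition (M : PolygonalMesh ι) (k : ℕ) (κ : Plane → ℝ) {J : Type} [Fintype J]
    (D' : J → Finset ι) (V0 : Submodule ℝ (M.fineSpace k)) (C₀ : ℝ) : Prop :=
  ∀ v : M.fineSpace k, ∃ v₀ ∈ V0, ∃ w : J → M.fineSpace k,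
    (∀ j, w j ∈ M.localSpace k (D' j)) ∧ v = v₀ + ∑ j, w j ∧
    M.energy κ Finset.univ v₀ v₀ + ∑ j, M.energy κ (D' j) (w j) (w j) ≤
      C₀ ^ 2 * M.energy κ Finset.univ v v

/-- The stiffness matrix `A` in a basis of `V_0^h(D)`. -/
noncomputable def stiffness (M : PolygonalMesh ι) (k : ℕ) (κ : Plane → ℝ) {n : ℕ}
    (b : Module.Basis (Fin n) ℝ (M.fineSpace k)) : Matrix (Fin n) (Fin n) ℝ :=
  Matrix.of fun p q => M.energy κ Finset.univ (b p) (b q)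

end PolygonalMesh

/-- The matrix `Rᵀ` of the inclusion of a subspace `W` of `V` in given bases; its columns are the
coordinates in `V` of the basis functions of `W`. -/
noncomputable def prolongation {V : Type} [AddCommGroup V] [Module ℝ V] {n m : ℕ}
    (b : Module.Basis (Fin n) ℝ V) {W : Submodule ℝ V} (c : Module.Basis (Fin m) ℝ W) :
    Matrix (Fin n) (Fin m) ℝ :=
  LinearMap.toMatrix c b W.subtype

/-- The Galerkin matrix `R A Rᵀ` of a subspace, where `P = Rᵀ`. -/
noncomputable def subspaceMatrix {n m : ℕ} (A : Matrix (Fin n) (Fin n) ℝ)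
    (P : Matrix (Fin n) (Fin m) ℝ) : Matrix (Fin m) (Fin m) ℝ :=
  P.transpose * A * P

/-- The two-level additive Schwarz preconditioner
`M₂⁻¹ = R₀ᵀ A₀⁻¹ R₀ + ∑ⱼ Rⱼᵀ Aⱼ⁻¹ Rⱼ`, where `P₀ = R₀ᵀ` and `P j = Rⱼᵀ`. -/
noncomputable def twoLevelSchwarz {n m₀ : ℕ} {J : Type} [Fintype J] {m : J → ℕ}
    (A : Matrix (Fin n) (Fin n) ℝ) (P₀ : Matrix (Fin n) (Fin m₀) ℝ)
    (P : ∀ j, Matrix (Fin n) (Fin (m j)) ℝ) : Matrix (Fin n) (Fin n) ℝ :=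
  P₀ * (subspaceMatrix A P₀)⁻¹ * P₀.transpose +
    ∑ j, P j * (subspaceMatrix A (P j))⁻¹ * (P j).transpose

/-- The (spectral) condition number `λ_max / λ_min` of a matrix with real positive eigenvalues. -/
noncomputable def spectralCond {n : ℕ} (B : Matrix (Fin n) (Fin n) ℝ) : ℝ :=
  sSup (spectrum ℝ B) / sInf (spectrum ℝ B)

/-! The bound for the condition number is abstract Schwarz theory. For an eigenvector of the
preconditioned matrix, a stable splitting and Young's inequality in each subspace show that the
eigenvalue is at least 1/C₀². An element belongs to at most N of the D_j', so the energy of a coarse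
function plus local functions is at most 2 + 2N times the sum of their energies, and no eigenvalue
exceeds 2 + 2N (`mem_Icc_of_mem_spectrum`, `energy_add_sum_le`).

For the stable decomposition (`exists_decomposition`) a fine function v is split on ω_i as p_i +
w_i, with p_i in the span of the first L_i eigenfunctions. Expansion in the eigenbasis shows that
the weighted energy of w_i is at most the energy of v on ω_i, and that its weighted mass is at most
this energy divided by λ_{L+1} (`exists_spectral_splitting`). One takes v₀ = ∑ I^h(χ_i p_i), so that
z = v − v₀ = ∑ I^h(χ_i w_i), and v_j = I^h(ξ_j z). The contrast of κ does not enter: the only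
estimate that couples different elements is the spectral one. All others are made in a single
element, where κ is a constant factor, and are then summed with the finite overlap N.

The local estimate (`exists_interpolation_stability`) concerns g = χw with virtual χ and w, and its
interpolant u in an element of diameter h: ‖∇u‖ ≤ C‖∇g‖ and ‖u − g‖ ≤ C h ‖∇g‖. Nodal interpolation
is not bounded in H¹ in general, but g is a polynomial of degree at most 2k on every edge. Hence a
trace inequality for the middle half of the edge and equivalence of norms for polynomials control u
− g on the boundary, and explicit bubbles extend it to a function r with ‖∇r‖ + ‖r‖/h ≤ C‖∇g‖. Now u
− g − r has zero boundary values, and Δu is a polynomial of degree at most k − 2, against which u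
and g have the same moments. So Green's formula leaves ∫∇u·∇(u − g − r) = ∫Δu r, and the inverse
estimate h²|Δu| ≤ C‖∇u‖ closes the argument. Star-shapedness with respect to a disc gives the
Poincaré, Friedrichs and trace inequalities with constants in terms of ρ.

The cut-off functions ξ_j have gradients of order 1/δ, while the L² bound of z contains h. This is
harmless when ρh ≤ δ. When ρh > δ, the disc inside the element is so large that the element can
belong to D_j' only if it belongs to D_j; then ξ_j = 1 on it and v_j = z there (`eq_of_overlap_lt`).

Finally, the interpolant must exist. Boundary values are extended harmonically by Perron's method,
the barriers coming from exterior rays; truncation shows that the energy is finite; moments are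
prescribed by a dimension argument. The local interpolants fit together because a polynomial on an
edge is determined by its nodal values. They keep homogeneous boundary values because an edge with
an inner point on ∂D lies in ∂D (`edge_subset_frontier_domain`). -/

section

/-! ### Perron's method for the Dirichlet problem in the plane -/

open Metric Set Filter Topology Complex InnerProductSpace Real

/-- The Poisson integral of `g` over the circle with centre `c` and radius `R`. -/
noncomputable def poissonIntegral (g : ℂ → ℝ) (c : ℂ) (R : ℝ) (w : ℂ) : ℝ :=
  circleAverage (poissonKernel c w • g) c R

theorem continuousOn_poissonKernel_sphere {c w : ℂ} {R : ℝ} (hw : w ∈ ball c R) :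
    ContinuousOn (poissonKernel c w) (sphere c |R|) := by
  rw [poissonKernel_eq_re_herglotzRieszKernel]
  exact Complex.continuous_re.comp_continuousOn (continuousOn_herglotzRieszKernel_sphere hw)

/-- The Poisson kernel is the real part of the Herglotz kernel, and averaging `g` against the latter
gives twice the Cauchy integral of `g` minus the mean of `g`. So the Poisson integral is the real
part of an analytic function. Only integrability of `g` is needed; in Perron's method it is applied
to a supremum whose continuity is not yet known. -/
theorem poissonIntegral_harmonicOnNhd {g : ℂ → ℝ} {c : ℂ} {R : ℝ} (hR : 0 < R)
    (hg : CircleIntegrable g c R) : HarmonicOnNhd (poissonIntegral g c R) (ball c R) := by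
  have hgC : CircleIntegrable (fun z => (g z : ℂ)) c R := by
    simp only [CircleIntegrable, intervalIntegrable_iff] at hg ⊢
    exact Complex.ofRealCLM.integrable_comp hg
  let G : ℂ → ℂ := fun w => (2 * π * I : ℂ)⁻¹ • ∮ z in C(c, R), (z - w)⁻¹ • (g z : ℂ)
  have hGa : AnalyticOnNhd ℂ G (ball c R) := by
    lift R to NNReal using hR.le
    have := (hasFPowerSeriesOn_cauchy_integral hgC (by exact_mod_cast hR)).analyticOnNhd
    rw [Metric.eball_coe] at this
    exact this
  have key : ∀ w ∈ ball c R, (2 * G w - ((circleAverage g c R : ℝ) : ℂ)).re =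
      poissonIntegral g c R w := by
    intro w hw
    have hGw : G w = circleAverage (fun z => (z - c) * (z - w)⁻¹ * (g z : ℂ)) c R := by
      rw [circleAverage_eq_circleIntegral hR.ne']
      show _ • _ = _ • _
      congr 1
      refine circleIntegral.integral_congr hR.le fun z hz => ?_
      have : z - c ≠ 0 := by
        rw [← norm_pos_iff, mem_sphere_iff_norm.1 hz]; exact hR
      simp only [smul_eq_mul]
      field_simp
    have hint : CircleIntegrable (fun z => (z - c) * (z - w)⁻¹ * (g z : ℂ)) c R := by
      unfold CircleIntegrable at hgC ⊢
      refine IntervalIntegrable.continuousOn_mul hgC ?_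
      refine ContinuousOn.comp (g := fun z : ℂ => (z - c) * (z - w)⁻¹) (t := sphere c |R|) ?_
        (continuous_circleMap c R).continuousOn (fun θ _ => circleMap_mem_sphere' c R θ)
      refine ContinuousOn.mul (by fun_prop) (ContinuousOn.inv₀ (by fun_prop) ?_)
      intro z hz h0
      rw [sub_eq_zero] at h0
      rw [abs_of_pos hR] at hz
      rw [mem_sphere, h0] at hz
      rw [mem_ball] at hw
      linarith
    have h1 : (G w).re = circleAverage (fun z => ((z - c) * (z - w)⁻¹ * (g z : ℂ)).re) c R := by
      rw [hGw]
      exact (Complex.reCLM.circleAverage_comp_comm hint).symm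
    have hint' : CircleIntegrable (fun z => ((z - c) * (z - w)⁻¹ * (g z : ℂ)).re) c R := by
      simp only [CircleIntegrable, intervalIntegrable_iff] at hint ⊢
      exact Complex.reCLM.integrable_comp hint
    have h2 : (2 * G w - ((circleAverage g c R : ℝ) : ℂ)).re = 2 * (G w).re - circleAverage g c R := by
      simp
    rw [h2, h1, ← smul_eq_mul, ← circleAverage_fun_smul, ← circleAverage_fun_sub _ hg]
    · refine circleAverage_congr_sphere fun z hz => ?_
      rw [abs_of_pos hR] at hz
      have hzw : z - w ≠ 0 := by
        intro h0
        rw [sub_eq_zero] at h0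
        rw [mem_sphere, h0] at hz
        rw [mem_ball] at hw
        linarith
      simp only [poissonKernel_eq_re_herglotzRieszKernel, Pi.smul_apply', Function.comp,
        herglotzRieszKernel_def, smul_eq_mul, re_mul_ofReal]
      have : (z - c + (w - c)) / (z - c - (w - c)) = 2 * ((z - c) * (z - w)⁻¹) - 1 := by
        rw [show z - c - (w - c) = z - w by ring]
        field_simp
        ring
      rw [this]
      simp
      ring
    · exact IntervalIntegrable.const_mul hint' 2
  intro w hw
  have hA : AnalyticAt ℂ (fun w => 2 * G w - ((circleAverage g c R : ℝ) : ℂ)) w :=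
    (analyticAt_const.mul (hGa w hw)).sub analyticAt_const
  refine (harmonicAt_congr_nhds ?_).1 hA.harmonicAt_re
  filter_upwards [isOpen_ball.mem_nhds hw] with x hx using key x hx

theorem poissonKernel_nonneg {c w z : ℂ} {R : ℝ} (hw : w ∈ ball c R) (hz : z ∈ sphere c R) :
    0 ≤ poissonKernel c w z := by
  rw [poissonKernel_def]
  rw [mem_ball_iff_norm] at hw
  rw [mem_sphere_iff_norm] at hz
  refine div_nonneg ?_ (by positivity)
  rw [hz]
  nlinarith [norm_nonneg (w - c)]

theorem poissonIntegral_mono {f g : ℂ → ℝ} {c w : ℂ} {R : ℝ} (hw : w ∈ ball c R)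
    (hf : CircleIntegrable f c R) (hg : CircleIntegrable g c R)
    (h : ∀ z ∈ sphere c R, f z ≤ g z) : poissonIntegral f c R w ≤ poissonIntegral g c R w := by
  have hR : 0 < R := pos_of_mem_ball hw
  have hk := continuousOn_poissonKernel_sphere hw
  refine circleAverage_mono (hf.continuousOn_smul hk) (hg.continuousOn_smul hk) fun z hz => ?_
  rw [abs_of_pos hR] at hz
  exact mul_le_mul_of_nonneg_left (h z hz) (poissonKernel_nonneg hw hz)

/-- The Poisson modification of `v` in a disc. -/
noncomputable def poissonModification (v : ℂ → ℝ) (c : ℂ) (R : ℝ) : ℂ → ℝ :=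
  open Classical in (ball c R).piecewise (poissonIntegral v c R) v

theorem poissonModification_of_mem {v : ℂ → ℝ} {c w : ℂ} {R : ℝ} (hw : w ∈ ball c R) :
    poissonModification v c R w = poissonIntegral v c R w := by
  classical exact piecewise_eq_of_mem _ _ _ hw

theorem poissonModification_of_notMem {v : ℂ → ℝ} {c w : ℂ} {R : ℝ} (hw : w ∉ ball c R) :
    poissonModification v c R w = v w := by
  classical exact piecewise_eq_of_notMem _ _ _ hw

/-- At a point `y` of the circle the affine function `L` vanishes, and on the circle it equals ‖z −
y‖²/2. So continuity of `v` gives |v − v(y)| ≤ ε/2 + K L on the circle. The Poisson integral is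
monotone and reproduces affine functions, hence the same bound holds inside the disc; no estimates
of the kernel are needed. -/
theorem poissonModification_continuousOn {v : ℂ → ℝ} {c : ℂ} {R : ℝ} (hR : 0 < R)
    (hv : ContinuousOn v (sphere c R)) :
    ContinuousOn (poissonModification v c R) (closedBall c R) := by
  have hvi : CircleIntegrable v c R := hv.circleIntegrable hR.le
  intro y hy
  by_cases hyb : y ∈ ball c R
  · refine ContinuousAt.continuousWithinAt ?_
    have h1 := (poissonIntegral_harmonicOnNhd hR hvi y hyb).1.continuousAt
    refine h1.congr ?_
    filter_upwards [isOpen_ball.mem_nhds hyb] with x hx using (poissonModification_of_mem hx).symm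
  · have hys : y ∈ sphere c R := by
      rw [mem_sphere]; rw [mem_closedBall] at hy; rw [mem_ball] at hyb; linarith
    have hyn : ‖y - c‖ = R := mem_sphere_iff_norm.1 hys
    obtain ⟨M, hM⟩ := (isCompact_sphere c R).exists_bound_of_continuousOn hv
    let L : ℂ → ℝ := fun z => (R : ℝ) ^ 2 - ((z - c) * (starRingEnd ℂ) (y - c)).re
    have hLc : Continuous L := by fun_prop
    have hLy : L y = 0 := by
      simp only [L, Complex.mul_conj, ofReal_re, normSq_eq_norm_sq, hyn]; ring
    have hLs : ∀ z ∈ sphere c R, L z = ‖z - y‖ ^ 2 / 2 := by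
      intro z hz
      have hzn := mem_sphere_iff_norm.1 hz
      have : ‖z - y‖ ^ 2 = ‖(z - c) - (y - c)‖ ^ 2 := by congr 2; ring
      rw [this, ← normSq_eq_norm_sq, normSq_sub, normSq_eq_norm_sq, normSq_eq_norm_sq, hzn, hyn]
      simp only [L]; ring
    have hLh : ∀ a K : ℝ, ∀ w ∈ ball c R,
        poissonIntegral (fun z => a + K * L z) c R w = a + K * L w := by
      intro a K w hw
      refine HarmonicContOnCl.circleAverage_poissonKernel_smul (f := fun z => a + K * L z)
        (HarmonicOnNhd.harmonicContOnCl fun z _ => ?_) hw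
      have : (fun z => a + K * L z) = fun z => ((a : ℂ) + K * ((R : ℂ) ^ 2 -
          (z - c) * (starRingEnd ℂ) (y - c))).re := by
        funext z
        simp only [L, add_re, ofReal_re, re_ofReal_mul, sub_re, ← ofReal_pow]
      rw [this]
      exact AnalyticAt.harmonicAt_re (by fun_prop)
    rw [Metric.continuousWithinAt_iff]
    intro ε hε
    obtain ⟨δ, hδ, hδ'⟩ := Metric.continuousOn_iff.1 hv y hys (ε / 2) (half_pos hε)
    let K : ℝ := 4 * (|M| + 1) / δ ^ 2
    have hK : 0 < K := by positivity
    have hbd : ∀ z ∈ sphere c R, |v z - v y| ≤ ε / 2 + K * L z := by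
      intro z hz
      rw [hLs z hz]
      by_cases hzd : dist z y < δ
      · have := hδ' z hz hzd
        rw [Real.dist_eq] at this
        have : 0 ≤ K * (‖z - y‖ ^ 2 / 2) := by positivity
        linarith
      · push Not at hzd
        rw [dist_eq_norm] at hzd
        have h1 : |v z - v y| ≤ 2 * (|M| + 1) := by
          have h2 := hM z hz
          have h3 := hM y hys
          rw [Real.norm_eq_abs] at h2 h3
          have := abs_sub (v z) (v y)
          have := le_abs_self M
          linarith
        have h4 : 2 * (|M| + 1) ≤ K * (‖z - y‖ ^ 2 / 2) := by
          have h5 : δ ^ 2 ≤ ‖z - y‖ ^ 2 := by gcongr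
          have : K * (δ ^ 2 / 2) = 2 * (|M| + 1) := by
            simp only [K]; field_simp; ring
          rw [← this]; gcongr
        linarith
    obtain ⟨η, hη, hη'⟩ := Metric.continuous_iff.1 hLc y (ε / 2 / K) (by positivity)
    have hfin : ∀ x ∈ closedBall c R, |poissonModification v c R x - v y| ≤ ε / 2 + K * L x := by
      intro x hx
      by_cases hxb : x ∈ ball c R
      · rw [poissonModification_of_mem hxb]
        have hi : ∀ a K : ℝ, CircleIntegrable (fun z => a + K * L z) c R := fun a K =>
          (by fun_prop : Continuous fun z => a + K * L z).continuousOn.circleIntegrable hR.le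
        have h1 := poissonIntegral_mono hxb hvi (hi (v y + ε / 2) K)
          (fun z hz => by have := (abs_le.1 (hbd z hz)).2; linarith)
        have h2 := poissonIntegral_mono hxb (hi (v y - ε / 2) (-K)) hvi
          (fun z hz => by have := (abs_le.1 (hbd z hz)).1; linarith)
        rw [hLh _ _ x hxb] at h1 h2
        rw [abs_le]; constructor <;> linarith
      · rw [poissonModification_of_notMem hxb]
        refine hbd x ?_
        rw [mem_sphere]; rw [mem_closedBall] at hx; rw [mem_ball] at hxb; linarith
    refine ⟨η, hη, fun x hx hxd => ?_⟩
    have h1 := hfin x hx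
    have h2 := hη' x hxd
    rw [hLy, Real.dist_eq, sub_zero] at h2
    rw [poissonModification_of_notMem hyb, Real.dist_eq]
    have h3 : K * L x < ε / 2 := by
      calc K * L x ≤ K * |L x| := by gcongr; exact le_abs_self _
        _ < K * (ε / 2 / K) := by gcongr
        _ = ε / 2 := by field_simp
    linarith

/-- The local submean value property on `U`. -/
def LocalSubmean (v : ℂ → ℝ) (U : Set ℂ) : Prop :=
  ∀ x ∈ U, ∀ᶠ r in 𝓝[>] (0 : ℝ), v x ≤ circleAverage v x r

theorem IsOpen.eventually_closedBall_subset_of_mem {U : Set ℂ} (hU : IsOpen U) {x : ℂ} (hx : x ∈ U) :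
    ∀ᶠ r in 𝓝[>] (0 : ℝ), closedBall x r ⊆ U := by
  obtain ⟨ε, hε, h⟩ := Metric.isOpen_iff.1 hU x hx
  filter_upwards [Ioo_mem_nhdsGT hε] with r hr
  exact (closedBall_subset_ball hr.2).trans h

/-- Among the maximum points a rightmost one is chosen. On a small circle around it the point with
angle 0 lies further to the right, so it is not a maximum point and the average is strictly below
the maximum. This argument does not need connectedness of `U`. -/
theorem LocalSubmean.le_of_frontier_le {v : ℂ → ℝ} {U : Set ℂ} (hU : IsOpen U)
    (hb : Bornology.IsBounded U) (hc : ContinuousOn v (closure U)) (hv : LocalSubmean v U) {m : ℝ}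
    (hf : ∀ x ∈ frontier U, v x ≤ m) : ∀ x ∈ closure U, v x ≤ m := by
  intro x₀ hx₀
  by_contra! hlt
  have hK := hb.isCompact_closure
  obtain ⟨x₁, hx₁, hmax⟩ := hK.exists_isMaxOn ⟨x₀, hx₀⟩ hc
  have hm1 : m < v x₁ := hlt.trans_le (hmax hx₀)
  have hTc : IsCompact (closure U ∩ v ⁻¹' {v x₁}) :=
    hK.of_isClosed_subset (hc.preimage_isClosed_of_isClosed isClosed_closure isClosed_singleton)
      inter_subset_left
  obtain ⟨z, ⟨hz, hzv⟩, hzm⟩ := hTc.exists_isMaxOn ⟨x₁, hx₁, rfl⟩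
    (Complex.continuous_re.continuousOn)
  rw [mem_preimage, mem_singleton_iff] at hzv
  have hzU : z ∈ U := by
    by_contra hzU
    have : z ∈ frontier U := by rw [hU.frontier_eq]; exact ⟨hz, hzU⟩
    have := hf z this
    linarith
  obtain ⟨r, hr, hsub, hr0⟩ :=
    ((hv z hzU).and ((IsOpen.eventually_closedBall_subset_of_mem hU hzU).and self_mem_nhdsWithin)).exists
  have hcirc : ∀ θ, circleMap z r θ ∈ U := fun θ =>
    hsub (sphere_subset_closedBall (circleMap_mem_sphere z hr0.le θ))
  have hcont : Continuous fun θ => v (circleMap z r θ) :=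
    continuousOn_univ.1 ((hc.mono subset_closure).comp
      (continuous_circleMap z r).continuousOn (fun θ _ => hcirc θ))
  have hle : ∀ θ, v (circleMap z r θ) ≤ v z := fun θ => by
    rw [hzv]; exact hmax (subset_closure (hcirc θ))
  have hpos : 0 < ∫ θ in (0 : ℝ)..2 * π, (v z - v (circleMap z r θ)) := by
    refine intervalIntegral.integral_pos Real.two_pi_pos
      (continuous_const.sub hcont).continuousOn
      (fun θ _ => sub_nonneg.2 (hle θ)) ⟨0, ⟨le_rfl, Real.two_pi_pos.le⟩, ?_⟩
    refine sub_pos.2 (lt_of_le_of_ne (hle 0) fun heq => ?_)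
    have := hzm (show circleMap z r 0 ∈ closure U ∩ v ⁻¹' {v x₁} from
      ⟨subset_closure (hcirc 0), by rw [mem_preimage, heq]; exact hzv⟩)
    simp [circleMap] at this
    linarith
  rw [intervalIntegral.integral_sub (by simp) (hcont.intervalIntegrable _ _)] at hpos
  rw [circleAverage_def, smul_eq_mul] at hr
  simp only [intervalIntegral.integral_const, sub_zero, smul_eq_mul] at hpos
  have : (2 * π)⁻¹ * ∫ θ in (0 : ℝ)..2 * π, v (circleMap z r θ) < v z := by
    rw [inv_mul_lt_iff₀ Real.two_pi_pos]; linarith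
  linarith

theorem ContinuousOn.eventually_circleIntegrable {v : ℂ → ℝ} {U : Set ℂ} (hU : IsOpen U)
    (hc : ContinuousOn v U) {x : ℂ} (hx : x ∈ U) :
    ∀ᶠ r in 𝓝[>] (0 : ℝ), CircleIntegrable v x r := by
  filter_upwards [IsOpen.eventually_closedBall_subset_of_mem hU hx, self_mem_nhdsWithin] with r hr hr0
  exact (hc.mono (sphere_subset_closedBall.trans hr)).circleIntegrable (mem_Ioi.1 hr0).le

theorem InnerProductSpace.HarmonicOnNhd.eventually_circleAverage_eq {h : ℂ → ℝ} {U : Set ℂ}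
    (hU : IsOpen U) (hh : HarmonicOnNhd h U) {x : ℂ} (hx : x ∈ U) :
    ∀ᶠ r in 𝓝[>] (0 : ℝ), circleAverage h x r = h x := by
  filter_upwards [IsOpen.eventually_closedBall_subset_of_mem hU hx, self_mem_nhdsWithin] with r hr hr0
  refine HarmonicOnNhd.circleAverage_eq (hh.mono ?_)
  rwa [abs_of_pos (mem_Ioi.1 hr0)]

theorem LocalSubmean.sub_harmonic {v h : ℂ → ℝ} {U : Set ℂ} (hU : IsOpen U)
    (hc : ContinuousOn v U) (hv : LocalSubmean v U) (hh : HarmonicOnNhd h U) :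
    LocalSubmean (v - h) U := by
  intro x hx
  filter_upwards [hv x hx, hh.eventually_circleAverage_eq hU hx,
    hc.eventually_circleIntegrable hU hx,
    (hh.continuousOn).eventually_circleIntegrable hU hx] with r h1 h2 h3 h4
  rw [circleAverage_sub h3 h4, h2]
  simpa using h1

theorem InnerProductSpace.HarmonicOnNhd.localSubmean {h : ℂ → ℝ} {U : Set ℂ} (hU : IsOpen U)
    (hh : HarmonicOnNhd h U) : LocalSubmean h U := fun x hx => by
  filter_upwards [hh.eventually_circleAverage_eq hU hx] with r hr using hr.ge

theorem LocalSubmean.max {v w : ℂ → ℝ} {U : Set ℂ} (hU : IsOpen U)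
    (hvc : ContinuousOn v U) (hwc : ContinuousOn w U) (hv : LocalSubmean v U)
    (hw : LocalSubmean w U) : LocalSubmean (fun x => max (v x) (w x)) U := by
  intro x hx
  filter_upwards [hv x hx, hw x hx, hvc.eventually_circleIntegrable hU hx,
    hwc.eventually_circleIntegrable hU hx,
    (hvc.sup hwc).eventually_circleIntegrable hU hx] with r h1 h2 h3 h4 h5
  exact max_le (h1.trans (circleAverage_mono h3 h5 fun z _ => le_max_left _ _))
    (h2.trans (circleAverage_mono h4 h5 fun z _ => le_max_right _ _))

theorem LocalSubmean.le_poissonModification {v : ℂ → ℝ} {U : Set ℂ}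
    (hc : ContinuousOn v U) (hv : LocalSubmean v U) {c : ℂ} {R : ℝ} (hR : 0 < R)
    (hB : closedBall c R ⊆ U) (x : ℂ) : v x ≤ poissonModification v c R x := by
  by_cases hx : x ∈ ball c R
  · have hbU : ball c R ⊆ U := ball_subset_closedBall.trans hB
    have hcs : ContinuousOn v (sphere c R) := hc.mono (sphere_subset_closedBall.trans hB)
    have hharm := poissonIntegral_harmonicOnNhd hR (hcs.circleIntegrable hR.le)
    have h1 : LocalSubmean (v - poissonIntegral v c R) (ball c R) :=
      LocalSubmean.sub_harmonic isOpen_ball (hc.mono hbU) (fun y hy => hv y (hbU hy)) hharm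
    have h2 : LocalSubmean (v - poissonModification v c R) (ball c R) := by
      intro y hy
      filter_upwards [h1 y hy, IsOpen.eventually_closedBall_subset_of_mem isOpen_ball hy, self_mem_nhdsWithin]
        with r hr hr' hr0
      rw [Pi.sub_apply, poissonModification_of_mem hy]
      refine hr.trans_eq (circleAverage_congr_sphere fun z hz => ?_)
      rw [abs_of_pos (mem_Ioi.1 hr0)] at hz
      simp only [Pi.sub_apply, poissonModification_of_mem (hr' (sphere_subset_closedBall hz))]
    have := h2.le_of_frontier_le isOpen_ball isBounded_ball (m := 0) (by
      rw [closure_ball c hR.ne']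
      exact (hc.mono hB).sub (poissonModification_continuousOn hR hcs)) (by
      intro z hz
      rw [frontier_ball c hR.ne'] at hz
      rw [Pi.sub_apply, poissonModification_of_notMem (by simp [mem_sphere.1 hz]), sub_self])
      x (subset_closure hx)
    simpa using this
  · rw [poissonModification_of_notMem hx]

/-- Inside the disc the modification is harmonic. At the other points the value is unchanged, while
averages can only grow, because the modification lies above `v` everywhere. -/
theorem LocalSubmean.poissonModification {v : ℂ → ℝ} {U : Set ℂ} (hU : IsOpen U)
    (hc : ContinuousOn v U) (hv : LocalSubmean v U) {c : ℂ} {R : ℝ} (hR : 0 < R)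
    (hB : closedBall c R ⊆ U) (hPc : ContinuousOn (poissonModification v c R) U) :
    LocalSubmean (poissonModification v c R) U := by
  intro x hx
  by_cases hxb : x ∈ ball c R
  · have hcs : ContinuousOn v (sphere c R) := hc.mono (sphere_subset_closedBall.trans hB)
    have hharm := poissonIntegral_harmonicOnNhd hR (hcs.circleIntegrable hR.le)
    filter_upwards [hharm.eventually_circleAverage_eq isOpen_ball hxb,
      IsOpen.eventually_closedBall_subset_of_mem isOpen_ball hxb, self_mem_nhdsWithin] with r hr hr' hr0
    rw [poissonModification_of_mem hxb, ← hr]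
    refine (circleAverage_congr_sphere fun z hz => ?_).le
    rw [abs_of_pos (mem_Ioi.1 hr0)] at hz
    simp only [poissonModification_of_mem (hr' (sphere_subset_closedBall hz))]
  · filter_upwards [hv x hx, hc.eventually_circleIntegrable hU hx,
      hPc.eventually_circleIntegrable hU hx] with r h1 h2 h3
    rw [poissonModification_of_notMem hxb]
    exact h1.trans (circleAverage_mono h2 h3 fun z _ =>
      hv.le_poissonModification hc hR hB z)

theorem poissonModification_continuousOn_closure {v : ℂ → ℝ} {U : Set ℂ}
    (hc : ContinuousOn v (closure U)) {c : ℂ} {R : ℝ} (hR : 0 < R) (hB : closedBall c R ⊆ U) :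
    ContinuousOn (poissonModification v c R) (closure U) := by
  have hBc : closedBall c R ⊆ closure U := hB.trans subset_closure
  have h1 := poissonModification_continuousOn hR
    (hc.mono (sphere_subset_closedBall.trans hBc))
  have h2 : ContinuousOn (poissonModification v c R) (closure U \ ball c R) :=
    (hc.mono sdiff_subset).congr fun x hx => poissonModification_of_notMem hx.2
  refine (h1.union_of_isClosed h2 isClosed_closedBall (isClosed_closure.sdiff isOpen_ball)).mono ?_
  intro x hx
  by_cases hxb : x ∈ ball c R
  · exact Or.inl (ball_subset_closedBall hxb)
  · exact Or.inr ⟨hx, hxb⟩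

/-- The subfunctions of the Dirichlet problem with boundary values `g`. -/
structure IsSubfunction (g : ℂ → ℝ) (U : Set ℂ) (v : ℂ → ℝ) : Prop where
  continuousOn : ContinuousOn v (closure U)
  submean : LocalSubmean v U
  le : ∀ x ∈ frontier U, v x ≤ g x

theorem IsSubfunction.max {g v w : ℂ → ℝ} {U : Set ℂ} (hU : IsOpen U) (hv : IsSubfunction g U v)
    (hw : IsSubfunction g U w) : IsSubfunction g U (fun x => max (v x) (w x)) where
  continuousOn := hv.continuousOn.sup hw.continuousOn
  submean := hv.submean.max hU (hv.continuousOn.mono subset_closure)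
    (hw.continuousOn.mono subset_closure) hw.submean
  le x hx := max_le (hv.le x hx) (hw.le x hx)

theorem IsSubfunction.poissonModification {g v : ℂ → ℝ} {U : Set ℂ} (hU : IsOpen U)
    (hv : IsSubfunction g U v) {c : ℂ} {R : ℝ} (hR : 0 < R) (hB : closedBall c R ⊆ U) :
    IsSubfunction g U (poissonModification v c R) := by
  have hcont := poissonModification_continuousOn_closure hv.continuousOn hR hB
  refine ⟨hcont, hv.submean.poissonModification hU (hv.continuousOn.mono subset_closure) hR hB
    (hcont.mono subset_closure), fun x hx => ?_⟩
  rw [poissonModification_of_notMem]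
  · exact hv.le x hx
  · intro hxb
    rw [hU.frontier_eq] at hx
    exact hx.2 (hB (ball_subset_closedBall hxb))

/-- Separability of the continuous functions on the compact closure replaces the family of all
subfunctions by a sequence. The Perron function is then the limit of one increasing sequence that
serves for all discs simultaneously, and it is measurable on circles. -/
theorem IsSubfunction.exists_dense_seq {g : ℂ → ℝ} {U : Set ℂ}
    (hb : Bornology.IsBounded U) {v₀ : ℂ → ℝ} (h₀ : IsSubfunction g U v₀) :
    ∃ V : ℕ → ℂ → ℝ, (∀ n, IsSubfunction g U (V n)) ∧ ∀ v, IsSubfunction g U v → ∀ ε > 0,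
      ∃ n, ∀ x ∈ closure U, |v x - V n x| < ε := by
  have : CompactSpace (closure U) := isCompact_iff_compactSpace.1 hb.isCompact_closure
  let T : Set C(closure U, ℝ) := {f | ∃ v, IsSubfunction g U v ∧ ∀ x : closure U, f x = v x}
  have : TopologicalSpace.SeparableSpace C(closure U, ℝ) := inferInstance
  have : SecondCountableTopology C(closure U, ℝ) :=
    UniformSpace.secondCountable_of_separable _
  have hT : ∀ v, IsSubfunction g U v → ∃ f : T, ∀ x : closure U, f.1 x = v x := fun v hv =>
    ⟨⟨⟨fun x => v x, hv.continuousOn.domRestrict⟩, v, hv, fun x => rfl⟩, fun x => rfl⟩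
  obtain ⟨f₀, -⟩ := hT v₀ h₀
  have : Nonempty T := ⟨f₀⟩
  obtain ⟨u, hu⟩ := TopologicalSpace.exists_dense_seq T
  choose V hV hV' using fun n => (u n).2
  refine ⟨V, hV, fun v hv ε hε => ?_⟩
  obtain ⟨f, hf⟩ := hT v hv
  obtain ⟨n, hn⟩ := hu.exists_dist_lt f hε
  refine ⟨n, fun x hx => ?_⟩
  have h1 := (ContinuousMap.dist_lt_iff hε).1 (Subtype.dist_eq f (u n) ▸ hn) ⟨x, hx⟩
  rwa [hf, hV', Real.dist_eq] at h1

/-- Perron's method: a bounded domain has a harmonic function that lies above all subfunctions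
and below all continuous supermean majorants of them. -/
theorem exists_perron {g : ℂ → ℝ} {U : Set ℂ} (hU : IsOpen U) (hb : Bornology.IsBounded U)
    {m M : ℝ} (hm : ∀ x ∈ frontier U, m ≤ g x) (hM : ∀ x ∈ frontier U, g x ≤ M) :
    ∃ u : ℂ → ℝ, HarmonicOnNhd u U ∧
      (∀ v, IsSubfunction g U v → ∀ x ∈ closure U, v x ≤ u x) ∧
      ∀ x ∈ closure U, ∀ b, (∀ v, IsSubfunction g U v → v x ≤ b) → u x ≤ b := by
  have h₀ : IsSubfunction g U (fun _ => m) :=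
    ⟨continuousOn_const, HarmonicOnNhd.localSubmean hU fun x _ => harmonicAt_const m, hm⟩
  obtain ⟨V, hV, hVd⟩ := h₀.exists_dense_seq hb
  let W : ℕ → ℂ → ℝ := fun n => n.rec (V 0) fun n w x => max (w x) (V (n + 1) x)
  have hW0 : W 0 = V 0 := rfl
  have hWs : ∀ n, W (n + 1) = fun x => max (W n x) (V (n + 1) x) := fun n => rfl
  have hWS : ∀ n, IsSubfunction g U (W n) := by
    intro n
    induction n with
    | zero => exact hV 0
    | succ n ih => rw [hWs]; exact ih.max hU (hV _)
  have hWV : ∀ n x, V n x ≤ W n x := by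
    intro n x
    cases n with
    | zero => rfl
    | succ n => rw [hWs]; exact le_max_right _ _
  have hWm : ∀ x, Monotone fun n => W n x := fun x =>
    monotone_nat_of_le_succ fun n => by rw [hWs]; exact le_max_left _ _
  have hbd : ∀ v, IsSubfunction g U v → ∀ x ∈ closure U, v x ≤ M := fun v hv =>
    hv.submean.le_of_frontier_le hU hb hv.continuousOn fun x hx => (hv.le x hx).trans (hM x hx)
  let u : ℂ → ℝ := fun x => ⨆ n, W n x
  have hbdd : ∀ x ∈ closure U, BddAbove (range fun n => W n x) := fun x hx =>
    ⟨M, by rintro _ ⟨n, rfl⟩; exact hbd _ (hWS n) x hx⟩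
  have hu1 : ∀ v, IsSubfunction g U v → ∀ x ∈ closure U, v x ≤ u x := by
    intro v hv x hx
    refine le_of_forall_pos_lt_add fun ε hε => ?_
    obtain ⟨n, hn⟩ := hVd v hv ε hε
    have h1 := (abs_lt.1 (hn x hx)).2
    have h2 := hWV n x
    have h3 := le_ciSup (hbdd x hx) n
    change W n x ≤ u x at h3
    linarith
  have hu2 : ∀ x ∈ closure U, ∀ b, (∀ v, IsSubfunction g U v → v x ≤ b) → u x ≤ b :=
    fun x hx b hb => ciSup_le fun n => hb _ (hWS n)
  have htend : ∀ x ∈ closure U, Tendsto (fun n => W n x) atTop (𝓝 (u x)) := fun x hx =>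
    tendsto_atTop_ciSup (hWm x) (hbdd x hx)
  refine ⟨u, fun x hx => ?_, hu1, hu2⟩
  obtain ⟨R, hB, hR⟩ := ((hU.eventually_closedBall_subset_of_mem hx).and self_mem_nhdsWithin).exists
  obtain ⟨m', hm'⟩ : ∃ m', ∀ n, ∀ z ∈ closure U, m' ≤ W n z := by
    obtain ⟨m', hm'⟩ := hb.isCompact_closure.exists_bound_of_continuousOn (hWS 0).continuousOn
    exact ⟨-m', fun n z hz => (neg_le_of_abs_le (hm' z hz)).trans (hWm z (Nat.zero_le n))⟩
  have hWb : ∀ n, ∀ z ∈ closure U, |W n z| ≤ max |m'| |M| := fun n z hz =>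
    abs_le_max_abs_abs (hm' n z hz) (hbd _ (hWS n) z hz)
  have hcirc : ∀ θ, circleMap x R θ ∈ closure U := fun θ =>
    subset_closure (hB (sphere_subset_closedBall (circleMap_mem_sphere x hR.le θ)))
  have hWc : ∀ n, Continuous fun θ => W n (circleMap x R θ) := fun n =>
    continuousOn_univ.1 ((hWS n).continuousOn.comp
      (continuous_circleMap x R).continuousOn (fun θ _ => hcirc θ))
  have hint : CircleIntegrable u x R := by
    unfold CircleIntegrable
    have hmeas : MeasureTheory.AEStronglyMeasurable (fun θ => u (circleMap x R θ))
        (MeasureTheory.volume.restrict (Set.uIoc 0 (2 * π))) :=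
      aestronglyMeasurable_of_tendsto_ae atTop (fun n => (hWc n).aestronglyMeasurable)
        (Eventually.of_forall fun θ => htend _ (hcirc θ))
    refine (intervalIntegrable_const (c := max |m'| |M|)).mono_fun hmeas
      (Eventually.of_forall fun θ => ?_)
    have := le_of_tendsto' (htend _ (hcirc θ)).abs fun n => hWb n _ (hcirc θ)
    simp only [Real.norm_eq_abs]
    exact this.trans (le_abs_self _)
  -- The Poisson integral of `W n` lies between `W n` and `u`, because the modification of `W n` is
  -- again a subfunction. It converges to the Poisson integral of `u` by dominated convergence, and
  -- both bounds converge to `u`.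
  have hPI : ∀ w ∈ ball x R, poissonIntegral u x R w = u w := by
    intro w hw
    have hwc : w ∈ closure U := subset_closure (hB (ball_subset_closedBall hw))
    have h1 : Tendsto (fun n => poissonIntegral (W n) x R w) atTop
        (𝓝 (poissonIntegral u x R w)) := by
      unfold poissonIntegral
      simp only [circleAverage_def]
      refine Tendsto.const_smul ?_ _
      have hkc : Continuous fun θ => poissonKernel x w (circleMap x R θ) :=
        continuousOn_univ.1 ((continuousOn_poissonKernel_sphere hw).comp
          (continuous_circleMap x R).continuousOn (fun θ _ => circleMap_mem_sphere' x R θ))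
      refine intervalIntegral.tendsto_integral_filter_of_dominated_convergence
        (fun θ => |poissonKernel x w (circleMap x R θ)| * max |m'| |M|)
        (Eventually.of_forall fun n => (hkc.mul (hWc n)).aestronglyMeasurable)
        (Eventually.of_forall fun n => Eventually.of_forall fun θ _ => ?_)
        ((hkc.abs.mul continuous_const).intervalIntegrable _ _)
        (Eventually.of_forall fun θ _ => (htend _ (hcirc θ)).const_mul _)
      simp only [Pi.smul_apply', smul_eq_mul, Real.norm_eq_abs, abs_mul]
      exact mul_le_mul_of_nonneg_left (hWb n _ (hcirc θ)) (abs_nonneg _)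
    refine tendsto_nhds_unique h1 (tendsto_of_tendsto_of_tendsto_of_le_of_le (htend w hwc)
      tendsto_const_nhds (fun n => ?_) fun n => ?_)
    · rw [← poissonModification_of_mem hw]
      exact (hWS n).submean.le_poissonModification ((hWS n).continuousOn.mono subset_closure) hR hB w
    · simp only
      rw [← poissonModification_of_mem hw]
      exact hu1 _ ((hWS n).poissonModification hU hR hB) w hwc
  refine (harmonicAt_congr_nhds ?_).1
    (poissonIntegral_harmonicOnNhd hR hint x (mem_ball_self hR))
  filter_upwards [isOpen_ball.mem_nhds (mem_ball_self hR)] with w hw using hPI w hw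

/-- The solution of the Dirichlet problem in a bounded domain with barriers. -/
theorem exists_harmonic_of_barrier {g : ℂ → ℝ} {U : Set ℂ} (hU : IsOpen U)
    (hb : Bornology.IsBounded U) (hg : ContinuousOn g (frontier U))
    (hbar : ∀ y ∈ frontier U, ∃ β : ℂ → ℝ, ContinuousOn β (closure U) ∧ HarmonicOnNhd β U ∧
      β y = 0 ∧ ∀ x ∈ closure U, x ≠ y → 0 < β x) :
    ∃ u : ℂ → ℝ, ContinuousOn u (closure U) ∧ HarmonicOnNhd u U ∧ EqOn u g (frontier U) := by
  have hfc : IsCompact (frontier U) :=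
    hb.isCompact_closure.of_isClosed_subset isClosed_frontier frontier_subset_closure
  obtain ⟨M, hM⟩ := hfc.exists_bound_of_continuousOn hg
  obtain ⟨u, hu, hu1, hu2⟩ := exists_perron (g := g) hU hb
    (fun x hx => neg_le_of_abs_le (hM x hx)) (fun x hx => le_of_abs_le (hM x hx))
  -- The constant `K` is so large that g(y) ± (ε + Kβ) enclose the boundary values; it exists since
  -- `β` has a positive minimum on the boundary away from `y`. The lower function is a subfunction,
  -- hence below `u`. The upper one is harmonic, hence above all subfunctions by the maximum
  -- principle, and so above `u`.
  have key : ∀ y ∈ frontier U, ∀ ε > 0, ∃ β : ℂ → ℝ, ContinuousOn β (closure U) ∧ β y = 0 ∧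
      ∀ x ∈ closure U, |u x - g y| ≤ ε + β x := by
    intro y hy ε hε
    obtain ⟨β, hβc, hβh, hβ0, hβp⟩ := hbar y hy
    obtain ⟨δ, hδ, hδ'⟩ := Metric.continuousOn_iff.1 hg y hy ε hε
    have hβn : ∀ x ∈ closure U, 0 ≤ β x := fun x hx => by
      by_cases hxy : x = y
      · rw [hxy, hβ0]
      · exact (hβp x hx hxy).le
    obtain ⟨K, hK, hKb⟩ : ∃ K, 0 ≤ K ∧ ∀ x ∈ frontier U, |g x - g y| ≤ ε + K * β x := by
      have hcomp : IsCompact (frontier U \ ball y δ) := hfc.diff isOpen_ball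
      rcases (frontier U \ ball y δ).eq_empty_or_nonempty with hemp | hne
      · refine ⟨0, le_rfl, fun x hx => ?_⟩
        have : x ∈ ball y δ := by
          by_contra h; exact (hemp ▸ (⟨hx, h⟩ : x ∈ frontier U \ ball y δ) : x ∈ (∅ : Set ℂ))
        have := (hδ' x hx this).le
        rw [Real.dist_eq] at this
        simpa using this
      · obtain ⟨x₀, hx₀, hmin⟩ := hcomp.exists_isMinOn hne
          (hβc.mono (sdiff_subset.trans frontier_subset_closure))
        have hx₀p : 0 < β x₀ := hβp x₀ (frontier_subset_closure hx₀.1) fun h => by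
          rw [h] at hx₀; exact hx₀.2 (mem_ball_self hδ)
        refine ⟨2 * |M| / β x₀, by positivity, fun x hx => ?_⟩
        by_cases hxb : x ∈ ball y δ
        · have h1 := (hδ' x hx hxb).le
          rw [Real.dist_eq] at h1
          have : 0 ≤ 2 * |M| / β x₀ * β x :=
            mul_nonneg (by positivity) (hβn x (frontier_subset_closure hx))
          linarith
        · have h1 : β x₀ ≤ β x := hmin ⟨hx, hxb⟩
          have h2 : 2 * |M| ≤ 2 * |M| / β x₀ * β x := by
            rw [div_mul_eq_mul_div, le_div_iff₀ hx₀p]; gcongr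
          have h3 := hM x hx
          have h4 := hM y hy
          rw [Real.norm_eq_abs] at h3 h4
          have := abs_sub (g x) (g y)
          have := le_abs_self M
          linarith
    refine ⟨fun x => K * β x, continuousOn_const.mul hβc, by simp [hβ0], fun x hx => ?_⟩
    have hKh : ∀ a k : ℝ, HarmonicOnNhd (fun x => a + k * β x) U := fun a k z hz =>
      (harmonicAt_const a).add ((hβh z hz).const_smul (c := k))
    rw [abs_le]
    constructor
    · have hs : IsSubfunction g U (fun x => (g y - ε) + (-K) * β x) :=
        ⟨continuousOn_const.add (continuousOn_const.mul hβc), (hKh _ _).localSubmean hU,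
          fun z hz => by have := (abs_le.1 (hKb z hz)).1; linarith⟩
      have := hu1 _ hs x hx
      linarith
    · have : u x ≤ (g y + ε) + K * β x := hu2 x hx _ fun v hv => by
        have h1 := (hv.submean.sub_harmonic hU (hv.continuousOn.mono subset_closure)
          (hKh (g y + ε) K)).le_of_frontier_le hU hb (m := 0)
          (hv.continuousOn.sub
            (g := fun z => (g y + ε) + K * β z) (by fun_prop))
          (fun z hz => by
            have h2 := (abs_le.1 (hKb z hz)).2
            have h3 := hv.le z hz
            simp only [Pi.sub_apply]
            linarith) x hx
        simp only [Pi.sub_apply] at h1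
        linarith
      linarith
  have hbdry : EqOn u g (frontier U) := by
    intro y hy
    refine eq_of_abs_sub_le_all fun ε hε => ?_
    obtain ⟨β, -, hβ0, h⟩ := key y hy ε hε
    have := h y (frontier_subset_closure hy)
    rwa [hβ0, add_zero] at this
  refine ⟨u, fun y hy => ?_, hu, hbdry⟩
  by_cases hyU : y ∈ U
  · exact (hu y hyU).1.continuousAt.continuousWithinAt
  · have hyf : y ∈ frontier U := by rw [hU.frontier_eq]; exact ⟨hy, hyU⟩
    rw [Metric.continuousWithinAt_iff]
    intro ε hε
    obtain ⟨β, hβc, hβ0, h⟩ := key y hyf (ε / 2) (half_pos hε)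
    obtain ⟨δ, hδ, hδ'⟩ := Metric.continuousOn_iff.1 hβc y hy (ε / 2) (half_pos hε)
    refine ⟨δ, hδ, fun x hx hxd => ?_⟩
    have h1 := hδ' x hx hxd
    rw [hβ0, Real.dist_eq, sub_zero] at h1
    rw [hbdry hyf, Real.dist_eq]
    have := h x hx
    have := le_abs_self (β x)
    linarith

/-- For `x` in the closure, different from `y`, the number (y − x)/d is not on the negative real
axis. Its principal square root is therefore analytic in `x` and has an argument in (−π/2, π/2), so
its real part is positive; at `x = y` it tends to 0. -/
theorem exists_barrier_of_ray {U : Set ℂ} {y d : ℂ} (hU : IsOpen U) (hy : y ∈ frontier U)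
    (hd : d ≠ 0) (hray : ∀ s : ℝ, 0 < s → y + s * d ∉ closure U) :
    ∃ β : ℂ → ℝ, ContinuousOn β (closure U) ∧ HarmonicOnNhd β U ∧
      β y = 0 ∧ ∀ x ∈ closure U, x ≠ y → 0 < β x := by
  have hslit : ∀ x ∈ closure U, x ≠ y → (y - x) / d ∈ slitPlane := by
    intro x hx hxy
    by_contra hns
    rw [mem_slitPlane_iff, not_or, not_lt, not_not] at hns
    obtain ⟨hre, him⟩ := hns
    have hz : (y - x) / d = (((y - x) / d).re : ℂ) := by
      apply Complex.ext <;> simp [him]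
    have hne : ((y - x) / d).re ≠ 0 := fun h0 => by
      rw [h0, ofReal_zero, div_eq_zero_iff] at hz
      rcases hz with h | h
      · exact hxy (sub_eq_zero.1 h).symm
      · exact hd h
    refine hray (-((y - x) / d).re) (by have := lt_of_le_of_ne hre hne; linarith) ?_
    have : y + ((-((y - x) / d).re : ℝ) : ℂ) * d = x := by
      rw [ofReal_neg, ← hz]; field_simp; ring
    rwa [this]
  refine ⟨fun x => (((y - x) / d) ^ (1 / 2 : ℂ)).re, ?_, ?_, by simp, ?_⟩
  · intro x hx
    refine ContinuousAt.continuousWithinAt ?_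
    have hcpow : ContinuousAt (fun z : ℂ => z ^ (1 / 2 : ℂ)) ((y - x) / d) := by
      by_cases hxy : x = y
      · rw [hxy, sub_self, zero_div]
        exact Complex.continuousAt_cpow_const_of_re_pos (Or.inl (by simp)) (by simp)
      · exact continuousAt_cpow_const (hslit x hx hxy)
    exact Complex.continuous_re.continuousAt.comp
      (ContinuousAt.comp (f := fun x => (y - x) / d) hcpow (by fun_prop))
  · intro x hx
    have hxy : x ≠ y := by
      rintro rfl
      rw [hU.frontier_eq] at hy
      exact hy.2 hx
    refine AnalyticAt.harmonicAt_re (f := fun x => ((y - x) / d) ^ (1 / 2 : ℂ)) ?_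
    exact AnalyticAt.cpow (by fun_prop) analyticAt_const (hslit x (subset_closure hx) hxy)
  · intro x hx hxy
    have hs := hslit x hx hxy
    have h0 : (y - x) / d ≠ 0 := slitPlane_ne_zero hs
    simp only
    rw [cpow_def_of_ne_zero h0, exp_re]
    refine mul_pos (Real.exp_pos _) (Real.cos_pos_of_mem_Ioo ?_)
    have h1 : (Complex.log ((y - x) / d) * (1 / 2)).im = arg ((y - x) / d) / 2 := by
      rw [show (1 / 2 : ℂ) = ((1 / 2 : ℝ) : ℂ) by simp, im_mul_ofReal, log_im]; ring
    rw [h1]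
    have h2 := neg_pi_lt_arg ((y - x) / d)
    have h3 := (mem_slitPlane_iff_arg.1 hs).1
    have h4 := lt_of_le_of_ne (arg_le_pi ((y - x) / d)) h3
    constructor <;> linarith

theorem LinearIsometryEquiv.laplacian_comp {E E' : Type*} [NormedAddCommGroup E]
    [InnerProductSpace ℝ E] [FiniteDimensional ℝ E] [NormedAddCommGroup E']
    [InnerProductSpace ℝ E'] [FiniteDimensional ℝ E'] (e : E ≃ₗᵢ[ℝ] E') (f : E' → ℝ) (x : E) :
    Laplacian.laplacian (f ∘ e) x = Laplacian.laplacian f (e x) := by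
  rw [laplacian_eq_iteratedFDeriv_orthonormalBasis _ (stdOrthonormalBasis ℝ E),
    laplacian_eq_iteratedFDeriv_orthonormalBasis _ ((stdOrthonormalBasis ℝ E).map e)]
  refine Finset.sum_congr rfl fun i _ => ?_
  have h := e.toContinuousLinearEquiv.iteratedFDerivWithin_comp_right (𝕜 := ℝ) f (x := x)
    uniqueDiffOn_univ (mem_univ _) 2
  rw [preimage_univ, iteratedFDerivWithin_univ, iteratedFDerivWithin_univ] at h
  rw [show f ∘ e = f ∘ e.toContinuousLinearEquiv from rfl, h]
  simp only [ContinuousMultilinearMap.compContinuousLinearMap_apply, OrthonormalBasis.map_apply]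
  congr 1
  funext j
  fin_cases j <;> rfl

/-- The Dirichlet problem for the Laplacian in a plane domain with an exterior ray at each boundary
point. -/
theorem exists_dirichlet_of_ray {U : Set Plane} {g : Plane → ℝ} (hU : IsOpen U)
    (hb : Bornology.IsBounded U) (hg : ContinuousOn g (frontier U))
    (hray : ∀ y ∈ frontier U, ∃ d : Plane, d ≠ 0 ∧ ∀ s : ℝ, 0 < s → y + s • d ∉ closure U) :
    ∃ u : Plane → ℝ, ContinuousOn u (closure U) ∧ ContDiffOn ℝ 2 u U ∧
      (∀ x ∈ U, Laplacian.laplacian u x = 0) ∧ EqOn u g (frontier U) := by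
  let e : ℂ ≃ₗᵢ[ℝ] Plane := Complex.orthonormalBasisOneI.repr
  have hcl : closure (e ⁻¹' U) = e ⁻¹' closure U := (e.toHomeomorph.preimage_closure U).symm
  have hfr : frontier (e ⁻¹' U) = e ⁻¹' frontier U := (e.toHomeomorph.preimage_frontier U).symm
  have hV : IsOpen (e ⁻¹' U) := hU.preimage e.continuous
  have hVb : Bornology.IsBounded (e ⁻¹' U) := by
    have := e.symm.lipschitz.isBounded_image hb
    rwa [LinearIsometryEquiv.image_eq_preimage_symm] at this
  obtain ⟨u, hu1, hu2, hu3⟩ := exists_harmonic_of_barrier (g := g ∘ e) hV hVb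
    (hg.comp e.continuous.continuousOn (by rw [hfr]; exact fun x hx => hx)) (by
      intro y hy
      rw [hfr] at hy
      obtain ⟨d, hd, hd'⟩ := hray (e y) hy
      refine exists_barrier_of_ray hV (by rw [hfr]; exact hy) (d := e.symm d) (by simpa using hd) ?_
      intro s hs hmem
      rw [hcl, mem_preimage, map_add, ← Complex.real_smul, map_smul,
        LinearIsometryEquiv.apply_symm_apply] at hmem
      exact hd' s hs hmem)
  refine ⟨u ∘ e.symm, ?_, ?_, ?_, ?_⟩
  · refine hu1.comp e.symm.continuous.continuousOn fun x hx => ?_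
    rw [hcl]; simpa using hx
  · intro x hx
    have h1 := (hu2 (e.symm x) (by simpa using hx)).1
    exact (h1.comp x e.symm.contDiff.contDiffAt).contDiffWithinAt
  · intro x hx
    have h1 := (hu2 (e.symm x) (by simpa using hx)).2.self_of_nhds
    rw [LinearIsometryEquiv.laplacian_comp, h1]; rfl
  · intro x hx
    have := hu3 (x := e.symm x) (by rw [hfr]; simpa using hx)
    simpa using this

end

/-! ### Functions with finite Dirichlet integral -/

section

open MeasureTheory Set Filter Topology Metric
open scoped Gradient InnerProductSpace Laplacian

section SquareIntegrable

variable {α F : Type*} [MeasurableSpace α] {μ : Measure α} [NormedAddCommGroup F]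
  [InnerProductSpace ℝ F] {f g : α → F}

theorem MeasureTheory.MemLp.integrable_inner_two (hf : MemLp f 2 μ) (hg : MemLp g 2 μ) :
    Integrable (fun x => ⟪f x, g x⟫_ℝ) μ := by
  refine (L2.integrable_inner (𝕜 := ℝ) (hf.toLp f) (hg.toLp g)).congr ?_
  filter_upwards [hf.coeFn_toLp, hg.coeFn_toLp] with x h1 h2
  rw [h1, h2]

theorem MeasureTheory.MemLp.sq_integral_inner_le (hf : MemLp f 2 μ) (hg : MemLp g 2 μ) :
    (∫ x, ⟪f x, g x⟫_ℝ ∂μ) ^ 2 ≤ (∫ x, ‖f x‖ ^ 2 ∂μ) * ∫ x, ‖g x‖ ^ 2 ∂μ := by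
  have key : ∀ {f g : α → F} (hf : MemLp f 2 μ) (hg : MemLp g 2 μ),
      ⟪hf.toLp f, hg.toLp g⟫_ℝ = ∫ x, ⟪f x, g x⟫_ℝ ∂μ := by
    intro f g hf hg
    rw [L2.inner_def]
    refine integral_congr_ae ?_
    filter_upwards [hf.coeFn_toLp, hg.coeFn_toLp] with x h1 h2
    rw [h1, h2]
  have h := real_inner_mul_inner_self_le (hf.toLp f) (hg.toLp g)
  rw [key, key, key] at h
  simp only [real_inner_self_eq_norm_sq] at h
  rwa [sq]

end SquareIntegrable

/-- The functions that are continuous on the closure of `U`, continuously differentiable in `U`, and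
have a finite Dirichlet integral. -/
structure MemH1 (U : Set Plane) (g : Plane → ℝ) : Prop where
  continuousOn : ContinuousOn g (closure U)
  contDiffOn : ContDiffOn ℝ 1 g U
  memLp_grad : MemLp (∇ g) 2 (volume.restrict U)

/-- The Dirichlet form `∫_U ∇u · ∇v`. -/
noncomputable def dirichletForm (U : Set Plane) (u v : Plane → ℝ) : ℝ :=
  ∫ x in U, ⟪∇ u x, ∇ v x⟫_ℝ

section Basic

variable {U : Set Plane} {u v : Plane → ℝ}

theorem norm_gradient_eq (u : Plane → ℝ) (x : Plane) : ‖∇ u x‖ = ‖fderiv ℝ u x‖ :=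
  LinearIsometryEquiv.norm_map _ _

theorem ContDiffOn.differentiableAt_of_isOpen (hU : IsOpen U) {n : WithTop ℕ∞} (hn : n ≠ 0)
    (hu : ContDiffOn ℝ n u U) {x : Plane} (hx : x ∈ U) : DifferentiableAt ℝ u x :=
  (hu.contDiffAt (hU.mem_nhds hx)).differentiableAt hn

theorem ContDiffOn.continuousOn_gradient (hU : IsOpen U) (hu : ContDiffOn ℝ 1 u U) :
    ContinuousOn (∇ u) U :=
  (InnerProductSpace.toDual ℝ Plane).symm.continuous.comp_continuousOn
    (hu.continuousOn_fderiv_of_isOpen hU (by norm_num))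

theorem gradient_add_apply {x : Plane} (hu : DifferentiableAt ℝ u x)
    (hv : DifferentiableAt ℝ v x) : ∇ (u + v) x = ∇ u x + ∇ v x := by
  simp only [gradient, fderiv_add hu hv, map_add]

theorem gradient_smul_apply {x : Plane} (c : ℝ) (hu : DifferentiableAt ℝ u x) :
    ∇ (c • u) x = c • ∇ u x := by
  simp only [gradient, fderiv_const_smul hu c, map_smulₛₗ]
  simp

theorem gradient_mul_apply {x : Plane} (hu : DifferentiableAt ℝ u x)
    (hv : DifferentiableAt ℝ v x) : ∇ (u * v) x = u x • ∇ v x + v x • ∇ u x := by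
  simp only [gradient, fderiv_mul hu hv, map_add, map_smulₛₗ]
  simp

theorem gradient_eqOn_of_eqOn (hU : IsOpen U) (h : EqOn u v U) : EqOn (∇ u) (∇ v) U := fun _ hx =>
  Filter.EventuallyEq.gradient_eq (h.eventuallyEq_of_mem (hU.mem_nhds hx))

theorem MemH1.congr (hU : IsOpen U) (hu : MemH1 U u) (h : EqOn v u (closure U)) : MemH1 U v where
  continuousOn := hu.continuousOn.congr h
  contDiffOn := hu.contDiffOn.congr fun x hx => h (subset_closure hx)
  memLp_grad := hu.memLp_grad.ae_eq ((ae_restrict_mem hU.measurableSet).mono fun x hx =>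
    (gradient_eqOn_of_eqOn hU (h.mono subset_closure) hx).symm)

theorem MemH1.add (hU : IsOpen U) (hu : MemH1 U u) (hv : MemH1 U v) : MemH1 U (u + v) where
  continuousOn := hu.continuousOn.add hv.continuousOn
  contDiffOn := hu.contDiffOn.add hv.contDiffOn
  memLp_grad := (hu.memLp_grad.add hv.memLp_grad).ae_eq
    ((ae_restrict_mem hU.measurableSet).mono fun x hx =>
      (gradient_add_apply (hu.contDiffOn.differentiableAt_of_isOpen hU one_ne_zero hx)
        (hv.contDiffOn.differentiableAt_of_isOpen hU one_ne_zero hx)).symm)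

theorem MemH1.smul (hU : IsOpen U) (c : ℝ) (hu : MemH1 U u) : MemH1 U (c • u) where
  continuousOn := hu.continuousOn.const_smul c
  contDiffOn := hu.contDiffOn.const_smul c
  memLp_grad := (hu.memLp_grad.const_smul c).ae_eq
    ((ae_restrict_mem hU.measurableSet).mono fun x hx =>
      (gradient_smul_apply c (hu.contDiffOn.differentiableAt_of_isOpen hU one_ne_zero hx)).symm)

theorem MemH1.sub (hU : IsOpen U) (hu : MemH1 U u) (hv : MemH1 U v) : MemH1 U (u - v) := by
  have := hu.add hU (hv.smul hU (-1))
  rwa [neg_one_smul, ← sub_eq_add_neg] at this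

theorem memH1_const (U : Set Plane) (c : ℝ) : MemH1 U (fun _ => c) where
  continuousOn := continuousOn_const
  contDiffOn := contDiffOn_const
  memLp_grad := by
    have : ∇ (fun _ : Plane => c) = 0 := by
      funext x
      exact gradient_fun_const x c
    rw [this]
    exact MemLp.zero

theorem MemH1.sum (hU : IsOpen U) {ι : Type*} (s : Finset ι) {u : ι → Plane → ℝ}
    (hu : ∀ i ∈ s, MemH1 U (u i)) : MemH1 U (∑ i ∈ s, u i) := by
  classical
  induction s using Finset.induction_on with
  | empty => exact memH1_const U 0
  | insert a s ha ih =>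
    rw [Finset.sum_insert ha]
    exact (hu a (Finset.mem_insert_self _ _)).add hU
      (ih fun i hi => hu i (Finset.mem_insert_of_mem hi))

theorem MemLp.two_of_bounded {F : Type*} [NormedAddCommGroup F] [InnerProductSpace ℝ F]
    [SecondCountableTopology F]
    (hU : IsOpen U) (hb : Bornology.IsBounded U)
    {f : Plane → F} (hf : ContinuousOn f U) {C : ℝ} (hC : ∀ x ∈ U, ‖f x‖ ≤ C) :
    MemLp f 2 (volume.restrict U) := by
  have : IsFiniteMeasure (volume.restrict U) :=
    isFiniteMeasure_restrict.2 hb.measure_lt_top.ne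
  exact MemLp.of_bound (hf.aestronglyMeasurable hU.measurableSet) C
    ((ae_restrict_mem hU.measurableSet).mono hC)

theorem ContinuousOn.memLp_two (hU : IsOpen U) (hb : Bornology.IsBounded U)
    (hu : ContinuousOn u (closure U)) : MemLp u 2 (volume.restrict U) := by
  obtain ⟨C, hC⟩ := hb.isCompact_closure.exists_bound_of_continuousOn hu
  exact MemLp.two_of_bounded hU hb (hu.mono subset_closure) fun x hx => hC x (subset_closure hx)

theorem MemH1.memLp (hU : IsOpen U) (hb : Bornology.IsBounded U) (hu : MemH1 U u) :
    MemLp u 2 (volume.restrict U) :=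
  hu.continuousOn.memLp_two hU hb

theorem ContDiff.memH1 (hU : IsOpen U) (hb : Bornology.IsBounded U) (hu : ContDiff ℝ 1 u) :
    MemH1 U u where
  continuousOn := hu.continuous.continuousOn
  contDiffOn := hu.contDiffOn
  memLp_grad := by
    have hc : Continuous (∇ u) := by
      have := hu.contDiffOn.continuousOn_gradient (U := univ) isOpen_univ
      exact continuousOn_univ.1 this
    obtain ⟨C, hC⟩ := hb.isCompact_closure.exists_bound_of_continuousOn hc.continuousOn
    exact MemLp.two_of_bounded hU hb hc.continuousOn fun x hx => hC x (subset_closure hx)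

theorem MemH1.mul (hU : IsOpen U) (hb : Bornology.IsBounded U) {χ w : Plane → ℝ}
    (hχ : MemH1 U χ) (hw : MemH1 U w) : MemH1 U (χ * w) where
  continuousOn := hχ.continuousOn.mul hw.continuousOn
  contDiffOn := hχ.contDiffOn.mul hw.contDiffOn
  memLp_grad := by
    have hms := hU.measurableSet
    have key : ∀ {f g : Plane → ℝ}, MemH1 U f → MemH1 U g →
        MemLp (fun x => f x • ∇ g x) 2 (volume.restrict U) := by
      intro f g hf hg
      obtain ⟨C, hC⟩ := hb.isCompact_closure.exists_bound_of_continuousOn hf.continuousOn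
      refine hg.memLp_grad.of_le_mul (c := C)
        (((hf.continuousOn.mono subset_closure).smul
          (hg.contDiffOn.continuousOn_gradient hU)).aestronglyMeasurable hms) ?_
      filter_upwards [ae_restrict_mem hms] with x hx
      rw [norm_smul]
      exact mul_le_mul_of_nonneg_right (hC x (subset_closure hx)) (norm_nonneg _)
    refine ((key hχ hw).add (key hw hχ)).ae_eq ?_
    filter_upwards [ae_restrict_mem hms] with x hx
    exact (gradient_mul_apply (hχ.contDiffOn.differentiableAt_of_isOpen hU one_ne_zero hx)
      (hw.contDiffOn.differentiableAt_of_isOpen hU one_ne_zero hx)).symm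

theorem dirichletForm_comm (U : Set Plane) (u v : Plane → ℝ) :
    dirichletForm U u v = dirichletForm U v u := by
  simp only [dirichletForm, real_inner_comm]

theorem dirichletForm_self (U : Set Plane) (u : Plane → ℝ) :
    dirichletForm U u u = ∫ x in U, ‖∇ u x‖ ^ 2 := by
  simp only [dirichletForm, real_inner_self_eq_norm_sq]

theorem dirichletForm_self_nonneg (U : Set Plane) (u : Plane → ℝ) : 0 ≤ dirichletForm U u u := by
  rw [dirichletForm_self]
  exact integral_nonneg fun x => by positivity

theorem MemH1.integrableOn_inner (hu : MemH1 U u) (hv : MemH1 U v) :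
    IntegrableOn (fun x => ⟪∇ u x, ∇ v x⟫_ℝ) U :=
  hu.memLp_grad.integrable_inner_two hv.memLp_grad

theorem MemH1.integrableOn_sq (hu : MemH1 U u) : IntegrableOn (fun x => ‖∇ u x‖ ^ 2) U := by
  have := hu.integrableOn_inner hu
  simpa only [real_inner_self_eq_norm_sq] using this

theorem dirichletForm_add_left (hU : IsOpen U) {w : Plane → ℝ} (hu : MemH1 U u) (hv : MemH1 U v)
    (hw : MemH1 U w) :
    dirichletForm U (u + v) w = dirichletForm U u w + dirichletForm U v w := by
  unfold dirichletForm
  rw [← integral_add (hu.integrableOn_inner hw) (hv.integrableOn_inner hw)]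
  refine setIntegral_congr_fun hU.measurableSet fun x hx => ?_
  rw [gradient_add_apply (hu.contDiffOn.differentiableAt_of_isOpen hU one_ne_zero hx)
    (hv.contDiffOn.differentiableAt_of_isOpen hU one_ne_zero hx), inner_add_left]

theorem dirichletForm_smul_left (hU : IsOpen U) (c : ℝ) {w : Plane → ℝ} (hu : MemH1 U u) :
    dirichletForm U (c • u) w = c * dirichletForm U u w := by
  unfold dirichletForm
  rw [← integral_const_mul]
  refine setIntegral_congr_fun hU.measurableSet fun x hx => ?_
  rw [gradient_smul_apply c (hu.contDiffOn.differentiableAt_of_isOpen hU one_ne_zero hx),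
    real_inner_smul_left]

theorem dirichletForm_sub_left (hU : IsOpen U) {w : Plane → ℝ} (hu : MemH1 U u) (hv : MemH1 U v)
    (hw : MemH1 U w) :
    dirichletForm U (u - v) w = dirichletForm U u w - dirichletForm U v w := by
  have : u - v = u + (-1 : ℝ) • v := by rw [neg_one_smul, sub_eq_add_neg]
  rw [this, dirichletForm_add_left hU hu (hv.smul hU _) hw, dirichletForm_smul_left hU _ hv]
  ring

theorem dirichletForm_congr (hU : IsOpen U) {u' v' : Plane → ℝ} (hu : EqOn u u' U)
    (hv : EqOn v v' U) : dirichletForm U u v = dirichletForm U u' v' :=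
  setIntegral_congr_fun hU.measurableSet fun x hx => by
    simp only [gradient_eqOn_of_eqOn hU hu hx, gradient_eqOn_of_eqOn hU hv hx]

theorem sq_dirichletForm_le (hu : MemH1 U u) (hv : MemH1 U v) :
    dirichletForm U u v ^ 2 ≤ dirichletForm U u u * dirichletForm U v v := by
  rw [dirichletForm_self, dirichletForm_self]
  exact hu.memLp_grad.sq_integral_inner_le hv.memLp_grad

theorem dirichletForm_sum_self_le (hU : IsOpen U) {ι : Type*} (s : Finset ι) {u : ι → Plane → ℝ}
    (hu : ∀ i ∈ s, MemH1 U (u i)) :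
    dirichletForm U (∑ i ∈ s, u i) (∑ i ∈ s, u i) ≤
      s.card * ∑ i ∈ s, dirichletForm U (u i) (u i) := by
  simp only [dirichletForm_self]
  rw [← integral_finsetSum _ fun i hi => (hu i hi).integrableOn_sq, ← integral_const_mul]
  refine setIntegral_mono_on (MemH1.sum hU s hu).integrableOn_sq
    ((integrable_finsetSum _ fun i hi => (hu i hi).integrableOn_sq).const_mul _)
    hU.measurableSet fun x hx => ?_
  have h1 : ∇ (∑ i ∈ s, u i) x = ∑ i ∈ s, ∇ (u i) x := by
    have h2 : fderiv ℝ (∑ i ∈ s, u i) x = ∑ i ∈ s, fderiv ℝ (u i) x :=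
      fderiv_sum fun i hi => (hu i hi).contDiffOn.differentiableAt_of_isOpen hU one_ne_zero hx
    simp only [gradient, h2, map_sum]
  rw [h1]
  calc ‖∑ i ∈ s, ∇ (u i) x‖ ^ 2 ≤ (∑ i ∈ s, ‖∇ (u i) x‖) ^ 2 := by
        gcongr; exact norm_sum_le _ _
    _ ≤ s.card * ∑ i ∈ s, ‖∇ (u i) x‖ ^ 2 := sq_sum_le_card_mul_sum_sq

theorem dirichletForm_add_self_le (hU : IsOpen U) (hu : MemH1 U u) (hv : MemH1 U v) :
    dirichletForm U (u + v) (u + v) ≤ 2 * (dirichletForm U u u + dirichletForm U v v) := by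
  have := dirichletForm_sum_self_le hU (Finset.univ : Finset (Fin 2)) (u := ![u, v])
    (by intro i _; fin_cases i; exacts [hu, hv])
  simpa [Fin.sum_univ_two] using this

end Basic

section NullSet

/-- The gradient vanishes almost everywhere on a level set. -/
theorem ae_gradient_eq_zero_of_eq_zero {U : Set Plane} (hU : IsOpen U) {w : Plane → ℝ}
    (hw : ContDiffOn ℝ 1 w U) : ∀ᵐ x, x ∈ U → w x = 0 → ∇ w x = 0 := by
  have hms : MeasurableSet (U ∩ w ⁻¹' {0}) := by
    have : U ∩ w ⁻¹' {0} = U \ (U ∩ w ⁻¹' {0}ᶜ) := by ext x; simp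
    rw [this]
    exact hU.measurableSet.diff (hw.continuousOn.isOpen_inter_preimage hU
      isOpen_compl_singleton).measurableSet
  have key : ∀ v : Plane, ∀ᵐ x, x ∈ U → w x = 0 → fderiv ℝ w x v = 0 := by
    intro v
    -- `Z` consists of the zeros at which the derivative in the direction `v` does not vanish. On
    -- every line parallel to `v` these points are isolated and hence form a null set, so Fubini's
    -- theorem makes `Z` a null set.
    let Z : Set Plane := (U ∩ w ⁻¹' {0}) ∩ (U ∩ (fun x => fderiv ℝ w x v) ⁻¹' {0}ᶜ)
    have hZ : MeasurableSet Z := by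
      refine hms.inter (ContinuousOn.isOpen_inter_preimage ?_ hU isOpen_compl_singleton).measurableSet
      exact (hw.continuousOn_fderiv_of_isOpen hU le_rfl).clm_apply continuousOn_const
    have h := ae_mem_of_ae_add_linearMap_mem (LinearMap.toSpanSingleton ℝ Plane v) volume volume
      (s := Zᶜ) hZ.compl ?_
    · filter_upwards [h] with x hx hxU hx0
      by_contra hne
      exact hx ⟨⟨hxU, hx0⟩, hxU, hne⟩
    · intro p
      rw [ae_iff]
      refine measure_null_of_locally_null _ fun t ht => ⟨{t}, ?_, by simp⟩
      simp only [LinearMap.toSpanSingleton_apply, mem_compl_iff, not_not, mem_ofPred_eq] at ht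
      have hd : HasDerivAt (fun s : ℝ => w (p + s • v)) (fderiv ℝ w (p + t • v) v) t := by
        have h1 := (hw.differentiableAt_of_isOpen hU one_ne_zero ht.1.1).hasFDerivAt
        have h2 : HasDerivAt (fun s : ℝ => p + s • v) v t := by
          simpa using ((hasDerivAt_id t).smul_const v).const_add p
        exact h1.comp_hasDerivAt t h2
      have h3 := hd.eventually_ne (c := 0) ht.2.2
      rw [eventually_nhdsWithin_iff] at h3
      rw [mem_nhdsWithin_iff_eventually]
      filter_upwards [h3] with s hs hsZ
      by_contra hne
      simp only [LinearMap.toSpanSingleton_apply, mem_compl_iff, not_not] at hsZ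
      exact hs hne hsZ.1.2
  filter_upwards [key (EuclideanSpace.single 0 1), key (EuclideanSpace.single 1 1)]
    with x h0 h1 hxU hx0
  have h : fderiv ℝ w x = 0 := by
    refine ContinuousLinearMap.coe_injective
      ((EuclideanSpace.basisFun (Fin 2) ℝ).toBasis.ext fun i => ?_)
    fin_cases i
    · simpa using h0 hxU hx0
    · simpa using h1 hxU hx0
  rw [gradient, h, map_zero]

end NullSet

/-! ### Truncation near zero -/

section Truncation

/-- The derivative of the truncation function. -/
noncomputable def truncDeriv (ε s : ℝ) : ℝ := max 0 (min 1 ((|s| - ε) / ε))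

/-- A continuously differentiable truncation which vanishes on `[-ε, ε]`. -/
noncomputable def trunc (ε s : ℝ) : ℝ := ∫ t in (0 : ℝ)..s, truncDeriv ε t

theorem continuous_truncDeriv (ε : ℝ) : Continuous (truncDeriv ε) := by
  unfold truncDeriv; fun_prop

theorem truncDeriv_nonneg (ε s : ℝ) : 0 ≤ truncDeriv ε s := le_max_left _ _

theorem truncDeriv_le_one (ε s : ℝ) : truncDeriv ε s ≤ 1 :=
  max_le zero_le_one (min_le_left _ _)

theorem truncDeriv_eq_zero {ε s : ℝ} (hε : 0 < ε) (hs : |s| ≤ ε) : truncDeriv ε s = 0 :=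
  max_eq_left ((min_le_right _ _).trans (div_nonpos_of_nonpos_of_nonneg (by linarith) hε.le))

theorem truncDeriv_eq_one {ε s : ℝ} (hε : 0 < ε) (hs : 2 * ε ≤ |s|) : truncDeriv ε s = 1 := by
  unfold truncDeriv
  rw [min_eq_left, max_eq_right zero_le_one]
  rw [le_div_iff₀ hε]; linarith

theorem hasDerivAt_trunc (ε s : ℝ) : HasDerivAt (trunc ε) (truncDeriv ε s) s :=
  intervalIntegral.integral_hasDerivAt_right ((continuous_truncDeriv ε).intervalIntegrable _ _)
    (continuous_truncDeriv ε).stronglyMeasurable.stronglyMeasurableAtFilter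
    (continuous_truncDeriv ε).continuousAt

theorem contDiff_trunc (ε : ℝ) : ContDiff ℝ 1 (trunc ε) := by
  rw [contDiff_one_iff_deriv]
  refine ⟨fun s => (hasDerivAt_trunc ε s).differentiableAt, ?_⟩
  have : deriv (trunc ε) = truncDeriv ε := funext fun s => (hasDerivAt_trunc ε s).deriv
  rw [this]
  exact continuous_truncDeriv ε

theorem trunc_eq_zero {ε s : ℝ} (hε : 0 < ε) (hs : |s| ≤ ε) : trunc ε s = 0 := by
  unfold trunc
  refine intervalIntegral.integral_zero_ae (Eventually.of_forall fun t ht => ?_)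
  refine truncDeriv_eq_zero hε (le_trans ?_ hs)
  rcases le_total 0 s with h | h
  · rw [uIoc_of_le h] at ht
    rw [abs_of_pos ht.1, abs_of_nonneg h]; exact ht.2
  · rw [uIoc_of_ge h] at ht
    rw [abs_of_nonpos ht.2, abs_of_nonpos h]; linarith [ht.1]

theorem abs_trunc_le (ε s : ℝ) : |trunc ε s| ≤ |s| := by
  have := intervalIntegral.norm_integral_le_of_norm_le_const (f := truncDeriv ε) (a := 0) (b := s)
    (C := 1) fun t _ => by
      rw [Real.norm_eq_abs, abs_of_nonneg (truncDeriv_nonneg ε t)]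
      exact truncDeriv_le_one ε t
  simpa [trunc] using this

theorem tendsto_truncDeriv {s : ℝ} (hs : s ≠ 0) :
    Tendsto (fun n : ℕ => truncDeriv (1 / (n + 1 : ℝ)) s) atTop (𝓝 1) := by
  refine tendsto_const_nhds.congr' ?_
  have h := tendsto_one_div_add_atTop_nhds_zero_nat (𝕜 := ℝ)
  filter_upwards [h.eventually_lt_const (u := |s| / 2) (by positivity)] with n hn
  exact (truncDeriv_eq_one Nat.one_div_pos_of_nat (by linarith)).symm

theorem tendsto_trunc (s : ℝ) :
    Tendsto (fun n : ℕ => trunc (1 / (n + 1 : ℝ)) s) atTop (𝓝 s) := by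
  have : Tendsto (fun n : ℕ => trunc (1 / (n + 1 : ℝ)) s) atTop
      (𝓝 (∫ t in (0 : ℝ)..s, (1 : ℝ))) := by
    refine intervalIntegral.tendsto_integral_filter_of_dominated_convergence (fun _ => 1)
      (Eventually.of_forall fun n => (continuous_truncDeriv _).aestronglyMeasurable)
      (Eventually.of_forall fun n => Eventually.of_forall fun t _ => ?_)
      intervalIntegrable_const ?_
    · rw [Real.norm_eq_abs, abs_of_nonneg (truncDeriv_nonneg _ t)]
      exact truncDeriv_le_one _ t
    · have h0 : ∀ᵐ t : ℝ, t ≠ 0 := by simp [ae_iff]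
      filter_upwards [h0] with t ht _ using tendsto_truncDeriv ht
  simpa using this

end Truncation

/-! ### Green's formula and finiteness of the energy -/

section IntegrationByParts

theorem integral_fderiv_apply_eq_zero {F : Plane → ℝ} (hF : ContDiff ℝ 1 F)
    (hc : HasCompactSupport F) (v : Plane) : ∫ x, fderiv ℝ F x v = 0 := by
  have hi : Integrable fun x => fderiv ℝ F x v := by
    refine Continuous.integrable_of_hasCompactSupport
      ((hF.continuous_fderiv one_ne_zero).clm_apply continuous_const) ?_
    exact (hc.fderiv ℝ).comp_left (g := fun L : Plane →L[ℝ] ℝ => L v) rfl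
  have := integral_mul_fderiv_eq_neg_fderiv_mul_of_integrable (μ := volume) (f := fun _ => (1 : ℝ))
    (g := F) (v := v) (by simp) (by simpa using hi)
    (by simpa using hF.continuous.integrable_of_hasCompactSupport hc)
    (fun x _ => differentiableAt_const _) (fun x _ => hF.differentiable one_ne_zero x)
  simpa using this

theorem laplacian_eq_sum_fderiv {u : Plane → ℝ} {x : Plane} (hu : ContDiffAt ℝ 2 u x) :
    (Δ u) x = ∑ i, fderiv ℝ (fun y => fderiv ℝ u y (EuclideanSpace.basisFun (Fin 2) ℝ i)) x
      (EuclideanSpace.basisFun (Fin 2) ℝ i) := by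
  rw [InnerProductSpace.laplacian_eq_iteratedFDeriv_orthonormalBasis _
    (EuclideanSpace.basisFun (Fin 2) ℝ)]
  refine Finset.sum_congr rfl fun i _ => ?_
  have hd : DifferentiableAt ℝ (fderiv ℝ u) x :=
    (hu.fderiv_right (m := 1) (by norm_num)).differentiableAt one_ne_zero
  rw [iteratedFDeriv_two_apply, fderiv_clm_apply hd (differentiableAt_const _)]
  simp

theorem inner_gradient_eq_sum (u v : Plane → ℝ) (x : Plane) :
    ⟪∇ u x, ∇ v x⟫_ℝ = ∑ i, fderiv ℝ u x (EuclideanSpace.basisFun (Fin 2) ℝ i) *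
      fderiv ℝ v x (EuclideanSpace.basisFun (Fin 2) ℝ i) := by
  rw [← (EuclideanSpace.basisFun (Fin 2) ℝ).sum_inner_mul_inner]
  refine Finset.sum_congr rfl fun i _ => ?_
  rw [inner_gradient_left, inner_gradient_right]
  simp

theorem contDiff_of_contDiffOn_of_eq_zero {U K : Set Plane} (hU : IsOpen U) (hK : IsCompact K)
    (hKU : K ⊆ U) {φ : Plane → ℝ} {n : WithTop ℕ∞} (hφ : ContDiffOn ℝ n φ U)
    (h0 : ∀ x, x ∉ K → φ x = 0) : ContDiff ℝ n φ := by
  refine contDiff_of_contDiffOn_union_of_isOpen hφ (t := Kᶜ)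
    (contDiffOn_const (c := (0 : ℝ)) |>.congr fun x hx => h0 x hx) ?_ hU hK.isClosed.isOpen_compl
  exact eq_univ_of_forall fun x => by
    by_cases hx : x ∈ K
    · exact Or.inl (hKU hx)
    · exact Or.inr hx

/-- Green's formula for a compactly supported test function. -/
theorem integral_inner_gradient_eq_of_compact {U K : Set Plane} (hU : IsOpen U) (hK : IsCompact K)
    (hKU : K ⊆ U) {u φ : Plane → ℝ} (hu : ContDiffOn ℝ 2 u U) (hφ : ContDiffOn ℝ 1 φ U)
    (h0 : ∀ x, x ∉ K → φ x = 0) :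
    ∫ x in U, ⟪∇ u x, ∇ φ x⟫_ℝ = - ∫ x in U, (Δ u) x * φ x := by
  let e := EuclideanSpace.basisFun (Fin 2) ℝ
  -- The components of the compactly supported field φ∇u. The integral of its divergence ∇u·∇φ + φΔu
  -- vanishes.
  let G : Fin 2 → Plane → ℝ := fun i x => φ x * fderiv ℝ u x (e i)
  have hG1 : ∀ i, ContDiffOn ℝ 1 (fun y => fderiv ℝ u y (e i)) U := fun i =>
    (hu.fderiv_of_isOpen hU (m := 1) (by norm_num)).clm_apply contDiffOn_const
  have hG : ∀ i, ContDiff ℝ 1 (G i) := fun i =>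
    contDiff_of_contDiffOn_of_eq_zero hU hK hKU (hφ.mul (hG1 i)) fun x hx => by
      simp [G, h0 x hx]
  have hGc : ∀ i, HasCompactSupport (G i) := fun i =>
    HasCompactSupport.intro hK fun x hx => by simp [G, h0 x hx]
  have hGi : ∀ i, Integrable fun x => fderiv ℝ (G i) x (e i) := fun i => by
    refine Continuous.integrable_of_hasCompactSupport
      (((hG i).continuous_fderiv one_ne_zero).clm_apply continuous_const) ?_
    exact ((hGc i).fderiv ℝ).comp_left (g := fun L : Plane →L[ℝ] ℝ => L (e i)) rfl
  have hsum : ∫ x, ∑ i, fderiv ℝ (G i) x (e i) = 0 := by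
    rw [integral_finsetSum _ fun i _ => hGi i]
    exact Finset.sum_eq_zero fun i _ => integral_fderiv_apply_eq_zero (hG i) (hGc i) _
  have hpt : ∀ x ∈ U, ∑ i, fderiv ℝ (G i) x (e i) = ⟪∇ u x, ∇ φ x⟫_ℝ + (Δ u) x * φ x := by
    intro x hx
    rw [laplacian_eq_sum_fderiv (hu.contDiffAt (hU.mem_nhds hx)), inner_gradient_eq_sum,
      Finset.sum_mul, ← Finset.sum_add_distrib]
    refine Finset.sum_congr rfl fun i _ => ?_
    have h1 := hφ.differentiableAt_of_isOpen hU one_ne_zero hx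
    have h2 := (hG1 i).differentiableAt_of_isOpen hU one_ne_zero hx
    simp only [G]
    rw [fderiv_fun_mul h1 h2]
    simp only [add_apply, smul_apply, smul_eq_mul, e]
    ring
  have hout : ∀ x, x ∉ U → ∑ i, fderiv ℝ (G i) x (e i) = 0 := by
    intro x hx
    have hxK : x ∉ K := fun h => hx (hKU h)
    refine Finset.sum_eq_zero fun i _ => ?_
    have : G i =ᶠ[𝓝 x] fun _ => 0 := by
      filter_upwards [hK.isClosed.isOpen_compl.mem_nhds hxK] with y hy
      simp [G, h0 y hy]
    rw [this.fderiv_eq]; simp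
  rw [← setIntegral_eq_integral_of_forall_compl_eq_zero (s := U) hout,
    setIntegral_congr_fun hU.measurableSet hpt] at hsum
  have hcont1 : ContinuousOn (fun x => (Δ u) x * φ x) U := by
    have h1 : ContinuousOn (fun x => ∑ i, fderiv ℝ (fun y => fderiv ℝ u y (e i)) x (e i)) U :=
      continuousOn_finsetSum _ fun i _ =>
        ((hG1 i).continuousOn_fderiv_of_isOpen hU le_rfl).clm_apply continuousOn_const
    exact (h1.congr fun x hx =>
      laplacian_eq_sum_fderiv (hu.contDiffAt (hU.mem_nhds hx))).mul hφ.continuousOn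
  have hint1 : IntegrableOn (fun x => (Δ u) x * φ x) U := by
    have h1 : IntegrableOn (fun x => (Δ u) x * φ x) K := (hcont1.mono hKU).integrableOn_compact hK
    exact h1.of_forall_sdiff_eq_zero hU.measurableSet fun x hx => by simp [h0 x hx.2]
  have hint2 : IntegrableOn (fun x => ⟪∇ u x, ∇ φ x⟫_ℝ) U := by
    have : IntegrableOn (fun x => ⟪∇ u x, ∇ φ x⟫_ℝ + (Δ u) x * φ x) U :=
      ((integrable_finsetSum Finset.univ fun i _ => hGi i).integrableOn (s := U)).congr_fun hpt
        hU.measurableSet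
    have h2 := this.sub hint1
    refine h2.congr (Eventually.of_forall fun x => ?_)
    simp
  rw [integral_add hint2 hint1] at hsum
  linarith

section Energy

variable {U : Set Plane} {u φ : Plane → ℝ}

theorem isCompact_superlevel (hb : Bornology.IsBounded U) (hφ : ContinuousOn φ (closure U)) (ε : ℝ) :
    IsCompact (closure U ∩ {x | ε ≤ |φ x|}) :=
  hb.isCompact_closure.of_isClosed_subset
    (hφ.abs.preimage_isClosed_of_isClosed isClosed_closure isClosed_Ici) inter_subset_left

theorem superlevel_subset (hU : IsOpen U) (h0 : ∀ x ∈ frontier U, φ x = 0) {ε : ℝ} (hε : 0 < ε) :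
    closure U ∩ {x | ε ≤ |φ x|} ⊆ U := by
  rintro x ⟨hx, hx'⟩
  by_contra hxU
  have := h0 x (by rw [hU.frontier_eq]; exact ⟨hx, hxU⟩)
  rw [mem_ofPred_eq, this, abs_zero] at hx'
  linarith

/-- Since `φ` is continuous on the closure and vanishes on the boundary, the set |φ| ≥ ε is a
compact subset of `U`. So the truncation of `φ` has compact support, and neither regularity of the
boundary nor integrability of `∇ u` is needed. -/
theorem integral_truncDeriv_mul_inner (hU : IsOpen U) (hb : Bornology.IsBounded U)
    (hu : ContDiffOn ℝ 2 u U) (hφ : ContinuousOn φ (closure U)) (hφ1 : ContDiffOn ℝ 1 φ U)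
    (h0 : ∀ x ∈ frontier U, φ x = 0) {ε : ℝ} (hε : 0 < ε) :
    ∫ x in U, truncDeriv ε (φ x) * ⟪∇ u x, ∇ φ x⟫_ℝ = - ∫ x in U, (Δ u) x * trunc ε (φ x) := by
  classical
  let ψ : Plane → ℝ := U.indicator fun x => trunc ε (φ x)
  have hψ : EqOn ψ (trunc ε ∘ φ) U := fun x hx => indicator_of_mem hx _
  have hψd : ContDiffOn ℝ 1 ψ U := ((contDiff_trunc ε).comp_contDiffOn hφ1).congr hψ
  have hg := integral_inner_gradient_eq_of_compact hU (isCompact_superlevel hb hφ ε)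
    (superlevel_subset hU h0 hε) hu hψd (fun x hx => by
      by_cases hxU : x ∈ U
      · rw [hψ hxU]
        refine trunc_eq_zero hε ?_
        by_contra! hlt
        exact hx ⟨subset_closure hxU, hlt.le⟩
      · exact indicator_of_notMem hxU _)
  have hr : ∫ x in U, (Δ u) x * ψ x = ∫ x in U, (Δ u) x * trunc ε (φ x) :=
    setIntegral_congr_fun hU.measurableSet fun x hx => by simp only [hψ hx, Function.comp]
  rw [← hr, ← hg]
  refine setIntegral_congr_fun hU.measurableSet fun x hx => ?_
  have hgr : ∇ ψ x = truncDeriv ε (φ x) • ∇ φ x := by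
    rw [gradient_eqOn_of_eqOn hU hψ hx]
    have h1 := (hasDerivAt_trunc ε (φ x)).comp_hasFDerivAt x
      (hφ1.differentiableAt_of_isOpen hU one_ne_zero hx).hasFDerivAt
    rw [gradient, h1.fderiv, map_smulₛₗ]
    simp [gradient]
  rw [hgr, real_inner_smul_right]

/-- **Green's formula** for test functions with zero boundary values. -/
theorem MemH1.dirichletForm_eq (hU : IsOpen U) (hb : Bornology.IsBounded U)
    (hu : ContDiffOn ℝ 2 u U) (hug : MemLp (∇ u) 2 (volume.restrict U)) {K : ℝ}
    (hK : ∀ x ∈ U, |(Δ u) x| ≤ K) (hφ : MemH1 U φ) (h0 : ∀ x ∈ frontier U, φ x = 0) :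
    dirichletForm U u φ = - ∫ x in U, (Δ u) x * φ x := by
  have hms := hU.measurableSet
  have hΔ : ContinuousOn (Δ u) U := by
    let e := EuclideanSpace.basisFun (Fin 2) ℝ
    have hG1 : ∀ i, ContDiffOn ℝ 1 (fun y => fderiv ℝ u y (e i)) U := fun i =>
      (hu.fderiv_of_isOpen hU (m := 1) (by norm_num)).clm_apply contDiffOn_const
    have h1 : ContinuousOn (fun x => ∑ i, fderiv ℝ (fun y => fderiv ℝ u y (e i)) x (e i)) U :=
      continuousOn_finsetSum _ fun i _ =>
        ((hG1 i).continuousOn_fderiv_of_isOpen hU le_rfl).clm_apply continuousOn_const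
    exact h1.congr fun x hx => laplacian_eq_sum_fderiv (hu.contDiffAt (hU.mem_nhds hx))
  have hφU : ContinuousOn φ U := hφ.continuousOn.mono subset_closure
  obtain ⟨C, hC⟩ := hb.isCompact_closure.exists_bound_of_continuousOn hφ.continuousOn
  have hint : IntegrableOn (fun x => ⟪∇ u x, ∇ φ x⟫_ℝ) U :=
    hug.integrable_inner_two hφ.memLp_grad
  have hgu : ContinuousOn (∇ u) U := (hu.of_le (by norm_num)).continuousOn_gradient hU
  have hgφ := hφ.contDiffOn.continuousOn_gradient hU
  -- Where `φ ≠ 0`, the derivative of the truncation tends to 1. Where `φ = 0`, the limit integrand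
  -- vanishes almost everywhere, because `∇ φ` does.
  have h1 : Tendsto (fun n : ℕ => ∫ x in U, truncDeriv (1 / (n + 1 : ℝ)) (φ x) *
      ⟪∇ u x, ∇ φ x⟫_ℝ) atTop (𝓝 (∫ x in U, ⟪∇ u x, ∇ φ x⟫_ℝ)) := by
    refine tendsto_integral_of_dominated_convergence (fun x => ‖⟪∇ u x, ∇ φ x⟫_ℝ‖)
      (fun n => ?_) hint.norm (fun n => Eventually.of_forall fun x => ?_) ?_
    · exact ((((continuous_truncDeriv _).comp_continuousOn hφU)).mul
        (hgu.inner hgφ)).aestronglyMeasurable hms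
    · rw [norm_mul, Real.norm_eq_abs, abs_of_nonneg (truncDeriv_nonneg _ _)]
      exact mul_le_of_le_one_left (norm_nonneg _) (truncDeriv_le_one _ _)
    · filter_upwards [ae_restrict_of_ae (ae_gradient_eq_zero_of_eq_zero hU hφ.contDiffOn),
        ae_restrict_mem hms] with x hx hxU
      by_cases hx0 : φ x = 0
      · simp [hx hxU hx0]
      · simpa using (tendsto_truncDeriv hx0).mul_const (⟪∇ u x, ∇ φ x⟫_ℝ)
  have hfin : volume U ≠ ⊤ := hb.measure_lt_top.ne
  have h2 : Tendsto (fun n : ℕ => - ∫ x in U, (Δ u) x * trunc (1 / (n + 1 : ℝ)) (φ x)) atTop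
      (𝓝 (- ∫ x in U, (Δ u) x * φ x)) := by
    refine (tendsto_integral_of_dominated_convergence (fun _ => K * C)
      (fun n => ?_) (integrableOn_const hfin) (fun n => ?_) ?_).neg
    · exact (hΔ.mul ((contDiff_trunc _).continuous.comp_continuousOn hφU)).aestronglyMeasurable hms
    · filter_upwards [ae_restrict_mem hms] with x hx
      rw [norm_mul]
      exact mul_le_mul (hK x hx) ((abs_trunc_le _ _).trans (hC x (subset_closure hx)))
        (norm_nonneg _) ((abs_nonneg _).trans (hK x hx))
    · exact Eventually.of_forall fun x => (tendsto_trunc _).const_mul _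
  refine tendsto_nhds_unique h1 (h2.congr fun n => ?_)
  rw [integral_truncDeriv_mul_inner hU hb hu hφ.continuousOn hφ.contDiffOn h0
    Nat.one_div_pos_of_nat]

/-- A harmonic function whose boundary values have an extension with finite Dirichlet integral has
itself a finite Dirichlet integral. -/
theorem MemH1.of_harmonic (hU : IsOpen U) (hb : Bornology.IsBounded U)
    (hu : ContDiffOn ℝ 2 u U) (huc : ContinuousOn u (closure U)) (hΔ : ∀ x ∈ U, (Δ u) x = 0)
    {Φ : Plane → ℝ} (hΦ : MemH1 U Φ) (h0 : EqOn u Φ (frontier U)) : MemH1 U u := by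
  have hms := hU.measurableSet
  have hu1 : ContDiffOn ℝ 1 u U := hu.of_le (by norm_num)
  let w : Plane → ℝ := u - Φ
  have hwc : ContinuousOn w (closure U) := huc.sub hΦ.continuousOn
  have hw1 : ContDiffOn ℝ 1 w U := hu1.sub hΦ.contDiffOn
  have hw0 : ∀ x ∈ frontier U, w x = 0 := fun x hx => sub_eq_zero.2 (h0 hx)
  have hgu : ContinuousOn (∇ u) U := hu1.continuousOn_gradient hU
  have hgΦ := hΦ.contDiffOn.continuousOn_gradient hU
  have hgw : ∀ x ∈ U, ∇ w x = ∇ u x - ∇ Φ x := by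
    intro x hx
    have hd := hΦ.contDiffOn.differentiableAt_of_isOpen hU one_ne_zero hx
    have : w = u + (-1 : ℝ) • Φ := by rw [neg_one_smul, ← sub_eq_add_neg]
    rw [this, gradient_add_apply (hu1.differentiableAt_of_isOpen hU one_ne_zero hx)
      (hd.const_smul _), gradient_smul_apply _ hd]
    simp [sub_eq_add_neg]
  have hgu2 : ContinuousOn (fun x => ‖∇ u x‖ ^ 2) U := hgu.norm.pow 2
  have htw : ∀ n : ℕ, ContinuousOn (fun x => truncDeriv (1 / (n + 1 : ℝ)) (w x)) U := fun n =>
    (continuous_truncDeriv _).comp_continuousOn (hwc.mono subset_closure)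
  have hint : ∀ n : ℕ, ∀ f : Plane → ℝ, ContinuousOn f U →
      IntegrableOn (fun x => truncDeriv (1 / (n + 1 : ℝ)) (w x) * f x) U := by
    intro n f hf
    have hpos : (0 : ℝ) < 1 / (n + 1 : ℝ) := Nat.one_div_pos_of_nat
    have h1 := (((htw n).mul hf).mono (superlevel_subset hU hw0 hpos)).integrableOn_compact
      (μ := volume) (isCompact_superlevel hb hwc (1 / (n + 1 : ℝ)))
    refine h1.of_forall_sdiff_eq_zero hms fun x hx => ?_
    have : truncDeriv (1 / (n + 1 : ℝ)) (w x) = 0 := by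
      refine truncDeriv_eq_zero hpos ?_
      by_contra! hlt
      exact hx.2 ⟨subset_closure hx.1, hlt.le⟩
    rw [Pi.mul_apply, this, zero_mul]
  -- With t the derivative of the truncation at w = u − Φ, harmonicity gives ∫ t ∇u·∇w = 0. The
  -- integrand below equals |∇Φ|² + t|∇u|² − 2t ∇u·∇Φ, which is nonnegative because 0 ≤ t ≤ 1. The
  -- resulting bound is independent of the truncation level.
  have hsq : ∀ n : ℕ, ∫ x in U, truncDeriv (1 / (n + 1 : ℝ)) (w x) * ‖∇ u x‖ ^ 2 ≤
      ∫ x in U, ‖∇ Φ x‖ ^ 2 := by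
    intro n
    have h1 := integral_truncDeriv_mul_inner hU hb hu hwc hw1 hw0 (ε := 1 / (n + 1 : ℝ))
      Nat.one_div_pos_of_nat
    have h0' : ∫ x in U, (Δ u) x * trunc (1 / (n + 1 : ℝ)) (w x) = 0 :=
      setIntegral_eq_zero_of_forall_eq_zero fun x hx => by simp only [hΔ x hx, zero_mul]
    rw [h0', neg_zero] at h1
    have h2 : 0 ≤ ∫ x in U, (‖∇ Φ x‖ ^ 2 - truncDeriv (1 / (n + 1 : ℝ)) (w x) * ‖∇ u x‖ ^ 2 +
        2 * (truncDeriv (1 / (n + 1 : ℝ)) (w x) * ⟪∇ u x, ∇ w x⟫_ℝ)) := by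
      refine setIntegral_nonneg hms fun x hx => ?_
      rw [hgw x hx, inner_sub_right, real_inner_self_eq_norm_sq]
      have h3 := truncDeriv_nonneg (1 / (n + 1 : ℝ)) (w x)
      have h4 := truncDeriv_le_one (1 / (n + 1 : ℝ)) (w x)
      have h5 := abs_le.1 (abs_real_inner_le_norm (∇ u x) (∇ Φ x))
      nlinarith [sq_nonneg (‖∇ u x‖ - ‖∇ Φ x‖), mul_nonneg h3 (sq_nonneg (‖∇ u x‖ - ‖∇ Φ x‖)),
        mul_nonneg h3 (sub_nonneg.2 h5.2), mul_nonneg (sub_nonneg.2 h4) (sq_nonneg ‖∇ Φ x‖)]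
    have hi1 := hint n _ hgu2
    have hi2 := hint n (fun x => ⟪∇ u x, ∇ w x⟫_ℝ)
      (hgu.inner (hw1.continuousOn_gradient hU))
    have hi3 : IntegrableOn (fun x => ‖∇ Φ x‖ ^ 2 -
        truncDeriv (1 / (n + 1 : ℝ)) (w x) * ‖∇ u x‖ ^ 2) U := hΦ.integrableOn_sq.sub hi1
    rw [integral_add hi3 (hi2.const_mul 2), integral_const_mul, h1,
      integral_sub hΦ.integrableOn_sq hi1] at h2
    linarith
  have hmeas : AEStronglyMeasurable (∇ u) (volume.restrict U) := hgu.aestronglyMeasurable hms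
  -- Fatou's lemma makes `∇ u` square integrable off the zero set of `w`. On the zero set it
  -- coincides almost everywhere with `∇ Φ`.
  have hZ : MemLp (fun x => (if w x = 0 then (0 : ℝ) else 1) • ∇ u x) 2 (volume.restrict U) := by
    have hlim : ∀ x, Tendsto (fun n : ℕ => truncDeriv (1 / (n + 1 : ℝ)) (w x)) atTop
        (𝓝 (if w x = 0 then (0 : ℝ) else 1)) := by
      intro x
      split_ifs with hx
      · refine tendsto_const_nhds.congr fun n => (truncDeriv_eq_zero Nat.one_div_pos_of_nat ?_).symm
        rw [hx, abs_zero]; positivity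
      · exact tendsto_truncDeriv hx
    have hae : AEStronglyMeasurable (fun x => (if w x = 0 then (0 : ℝ) else 1) • ∇ u x)
        (volume.restrict U) :=
      aestronglyMeasurable_of_tendsto_ae atTop
        (fun n => ((htw n).smul hgu).aestronglyMeasurable hms)
        (Eventually.of_forall fun x => (hlim x).smul_const _)
    rw [memLp_two_iff_integrable_sq_norm hae]
    refine ⟨hae.norm.pow 2, ?_⟩
    rw [hasFiniteIntegral_iff_ofReal (Eventually.of_forall fun x => by positivity)]
    have hfat : ∀ x, Filter.liminf (fun n : ℕ => ENNReal.ofReal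
        (truncDeriv (1 / (n + 1 : ℝ)) (w x) * ‖∇ u x‖ ^ 2)) atTop =
        ENNReal.ofReal (‖(if w x = 0 then (0 : ℝ) else 1) • ∇ u x‖ ^ 2) := by
      intro x
      refine Tendsto.liminf_eq ?_
      have h1 := (ENNReal.tendsto_ofReal ((hlim x).mul_const (‖∇ u x‖ ^ 2)))
      convert h1 using 2
      split_ifs <;> simp
    simp_rw [← hfat]
    refine (lintegral_liminf_le' fun n =>
      (((htw n).mul (hgu.norm.pow 2)).aemeasurable hms).ennreal_ofReal).trans_lt ?_
    refine lt_of_le_of_lt (b := ENNReal.ofReal (∫ x in U, ‖∇ Φ x‖ ^ 2)) ?_ ENNReal.ofReal_lt_top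
    refine Filter.liminf_le_of_le (by isBoundedDefault) fun b hb => ?_
    obtain ⟨n, hn⟩ := hb.exists
    refine hn.trans ?_
    refine (ofReal_integral_eq_lintegral_ofReal (hint n _ hgu2) (Eventually.of_forall fun x =>
      mul_nonneg (truncDeriv_nonneg _ _) (sq_nonneg ‖∇ u x‖))).symm.trans_le ?_
    exact ENNReal.ofReal_le_ofReal (hsq n)
  refine ⟨huc, hu1, ?_⟩
  refine (hZ.norm.add hΦ.memLp_grad.norm).mono hmeas ?_
  filter_upwards [ae_restrict_of_ae (ae_gradient_eq_zero_of_eq_zero hU hw1),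
    ae_restrict_mem hms] with x hx hxU
  have hnn : 0 ≤ ‖(if w x = 0 then (0 : ℝ) else 1) • ∇ u x‖ + ‖∇ Φ x‖ := by positivity
  rw [Pi.add_apply, Real.norm_of_nonneg hnn]
  by_cases hx0 : w x = 0
  · have := hx hxU hx0
    rw [hgw x hxU, sub_eq_zero] at this
    simp [hx0, this]
  · simp [hx0]

end Energy

end IntegrationByParts

end

/-! ### Geometry of star-shaped domains -/

section

open MeasureTheory Set Filter Topology Metric
open scoped Gradient InnerProductSpace Laplacian

section PosPartSq

theorem hasDerivAt_posPart_sq (s : ℝ) :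
    HasDerivAt (fun s : ℝ => max s 0 ^ 2) (2 * max s 0) s := by
  rcases lt_trichotomy s 0 with h | rfl | h
  · rw [max_eq_right h.le, mul_zero]
    refine (hasDerivAt_const s (0 : ℝ)).congr_of_eventuallyEq ?_
    filter_upwards [Iio_mem_nhds h] with t ht
    rw [max_eq_right (le_of_lt ht)]; norm_num
  · rw [max_self, mul_zero, hasDerivAt_iff_tendsto_slope_zero]
    refine squeeze_zero_norm' (a := fun t => |t|) (Eventually.of_forall fun t => ?_) ?_
    · simp only [zero_add, max_self, smul_eq_mul, Real.norm_eq_abs, abs_mul, abs_inv]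
      norm_num
      rcases eq_or_ne t 0 with rfl | ht
      · simp
      · rw [inv_mul_le_iff₀ (abs_pos.2 ht), ← sq, sq_abs]
        rcases le_total t 0 with h0 | h0
        · simpa [max_eq_right h0] using sq_nonneg t
        · rw [max_eq_left h0]
    · have : Tendsto (fun t : ℝ => |t|) (𝓝 0) (𝓝 0) := by
        simpa using (continuous_abs.tendsto (0 : ℝ))
      exact this.mono_left nhdsWithin_le_nhds
  · rw [max_eq_left h.le]
    have := (hasDerivAt_id s).pow 2
    refine (this.congr_of_eventuallyEq ?_).congr_deriv (by simp)
    filter_upwards [Ioi_mem_nhds h] with t ht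
    rw [max_eq_left (le_of_lt ht)]; rfl

/-- The class `MemH1` requires continuous differentiability in the whole open set. Cut-offs are
therefore built from the square of the positive part, which is C¹, and not from the positive part
itself. -/
theorem contDiff_posPart_sq : ContDiff ℝ 1 (fun s : ℝ => max s 0 ^ 2) := by
  rw [contDiff_one_iff_deriv]
  refine ⟨fun s => (hasDerivAt_posPart_sq s).differentiableAt, ?_⟩
  rw [show deriv (fun s : ℝ => max s 0 ^ 2) = fun s => 2 * max s 0 from
    funext fun s => (hasDerivAt_posPart_sq s).deriv]
  fun_prop

end PosPartSq

section Star

/-- The determinant of two plane vectors. -/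
def det2 (v w : Plane) : ℝ := v 0 * w 1 - v 1 * w 0

theorem abs_det2_le (v w : Plane) : |det2 v w| ≤ ‖v‖ * ‖w‖ := by
  rw [← abs_of_nonneg (mul_nonneg (norm_nonneg v) (norm_nonneg w)), ← sq_le_sq, mul_pow,
    EuclideanSpace.real_norm_sq_eq, EuclideanSpace.real_norm_sq_eq, Fin.sum_univ_two,
    Fin.sum_univ_two, det2]
  nlinarith [sq_nonneg (v 0 * w 0 + v 1 * w 1)]

/-- `U` contains the disc with centre `c` and radius `R`, and it is star-shaped with respect to
all points of this disc. -/
structure IsStarDisc (U : Set Plane) (c : Plane) (R : ℝ) : Prop where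
  pos : 0 < R
  ball_subset : ball c R ⊆ U
  starConvex : ∀ z ∈ ball c R, StarConvex ℝ z U

variable {U : Set Plane} {c : Plane} {R : ℝ}

theorem IsStarDisc.center_mem (h : IsStarDisc U c R) : c ∈ U := h.ball_subset (mem_ball_self h.pos)

/-- A point of the closure is approximated by some `x'` in `U`; the error is compensated by moving
the apex `z` inside the open disc, so that the segment from the new apex to `x'` passes through the
same point. -/
theorem IsStarDisc.add_smul_mem (h : IsStarDisc U c R) {z x : Plane} (hz : z ∈ ball c R)
    (hx : x ∈ closure U) {t : ℝ} (ht0 : 0 ≤ t) (ht1 : t < 1) : z + t • (x - z) ∈ U := by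
  have h1t : 0 < 1 - t := by linarith
  have hcont : Continuous fun x' : Plane => z + (t / (1 - t)) • (x - x') := by fun_prop
  have hopen := (isOpen_ball (x := c) (ε := R)).preimage hcont
  obtain ⟨x', hx'1, hx'2⟩ := mem_closure_iff.1 hx _ hopen (by simpa using hz)
  have := h.starConvex _ hx'1 hx'2 h1t.le ht0 (by ring)
  convert this using 1
  have h2 : (1 - t) * (t / (1 - t)) = t := by field_simp
  rw [smul_add, smul_smul, h2]
  module

theorem IsStarDisc.add_smul_mem' (h : IsStarDisc U c R) {z x : Plane} (hz : z ∈ ball c R)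
    (hx : x ∈ U) {t : ℝ} (ht0 : 0 ≤ t) (ht1 : t ≤ 1) : z + t • (x - z) ∈ U := by
  have := h.starConvex z hz hx (sub_nonneg.2 ht1) ht0 (by ring)
  convert this using 1
  module

theorem notMem_of_mem_frontier (hU : IsOpen U) {x : Plane} (hx : x ∈ frontier U) : x ∉ U := by
  rw [hU.frontier_eq] at hx; exact hx.2

/-- The ray continues the segment from `c` to `y`. If a later point were in the closure, then `y`
would lie strictly before it as seen from `c`, hence in `U`. -/
theorem IsStarDisc.exterior_ray (h : IsStarDisc U c R) (hU : IsOpen U) {y : Plane}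
    (hy : y ∈ frontier U) : ∃ d : Plane, d ≠ 0 ∧ ∀ s : ℝ, 0 < s → y + s • d ∉ closure U := by
  have hyU := notMem_of_mem_frontier hU hy
  refine ⟨y - c, fun h0 => hyU (by rw [sub_eq_zero.1 h0]; exact h.center_mem), fun s hs hmem => ?_⟩
  have := h.add_smul_mem (mem_ball_self h.pos) hmem (t := 1 / (1 + s)) (by positivity)
    (by rw [div_lt_one (by positivity)]; linarith)
  refine hyU ?_
  convert this using 1
  have h1 : (1 / (1 + s)) * (1 + s) = 1 := by field_simp
  have h2 : y + s • (y - c) - c = (1 + s) • (y - c) := by module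
  rw [h2, smul_smul, h1]; module

/-- The distance of `c` from the line through a boundary edge. -/
theorem IsStarDisc.mul_dist_le_det2 (h : IsStarDisc U c R) (hU : IsOpen U) {a b : Plane}
    (hab : a ≠ b) (hseg : segment ℝ a b ⊆ frontier U) :
    R * dist a b ≤ |det2 (a - c) (b - c)| := by
  by_contra! hlt
  let v := b - a
  let w := c - a
  have hv : 0 < ‖v‖ := norm_pos_iff.2 (sub_ne_zero.2 hab.symm)
  have hn : ‖v‖ ^ 2 = v 0 ^ 2 + v 1 ^ 2 := by
    rw [EuclideanSpace.real_norm_sq_eq, Fin.sum_univ_two]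
  have hdet : det2 (a - c) (b - c) = v 0 * w 1 - v 1 * w 0 := by
    simp only [det2, v, w, PiLp.sub_apply]; ring
  -- `z = a + l (b − a)` is the foot of the perpendicular from `c`. If the distance of the line were
  -- less than `R`, then `z` would lie in the disc. Either `z` is on the edge, or one end point lies
  -- strictly between `z` and the other one; in each case a boundary point would belong to `U`.
  let l : ℝ := (v 0 * w 0 + v 1 * w 1) / ‖v‖ ^ 2
  let z : Plane := a + l • v
  have hz : z ∈ ball c R := by
    rw [mem_ball, EuclideanSpace.dist_eq, Fin.sum_univ_two, Real.dist_eq, Real.dist_eq, sq_abs,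
      sq_abs]
    have e0 : z 0 - c 0 = det2 (a - c) (b - c) * v 1 / ‖v‖ ^ 2 := by
      have : z 0 - c 0 = l * v 0 - w 0 := by
        simp only [z, w, v, PiLp.add_apply, PiLp.smul_apply, PiLp.sub_apply, smul_eq_mul]; ring
      rw [this, hdet, eq_div_iff (by positivity), sub_mul]
      simp only [l]; rw [div_mul_eq_mul_div, div_mul_cancel₀ _ (by positivity), hn]; ring
    have e1 : z 1 - c 1 = - (det2 (a - c) (b - c) * v 0) / ‖v‖ ^ 2 := by
      have : z 1 - c 1 = l * v 1 - w 1 := by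
        simp only [z, w, v, PiLp.add_apply, PiLp.smul_apply, PiLp.sub_apply, smul_eq_mul]; ring
      rw [this, hdet, eq_div_iff (by positivity), sub_mul]
      simp only [l]; rw [div_mul_eq_mul_div, div_mul_cancel₀ _ (by positivity), hn]; ring
    have e2 : (z 0 - c 0) ^ 2 + (z 1 - c 1) ^ 2 = (|det2 (a - c) (b - c)| / ‖v‖) ^ 2 := by
      rw [e0, e1, div_pow, div_pow, div_pow, sq_abs]
      field_simp
      rw [hn]; ring
    rw [e2, Real.sqrt_sq (by positivity), div_lt_iff₀ hv]
    have : dist a b = ‖v‖ := by rw [dist_comm, dist_eq_norm]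
    rwa [this] at hlt
  have hzU : z ∈ U := h.ball_subset hz
  have haf : a ∈ frontier U := hseg (left_mem_segment ℝ a b)
  have hbf : b ∈ frontier U := hseg (right_mem_segment ℝ a b)
  rcases lt_or_ge l 0 with hl | hl
  · refine notMem_of_mem_frontier hU haf ?_
    have := h.add_smul_mem hz (frontier_subset_closure hbf) (t := -l / (1 - l))
      (div_nonneg (by linarith) (by linarith)) (by rw [div_lt_one (by linarith)]; linarith)
    convert this using 1
    have h1 : b - z = (1 - l) • v := by simp only [z, v]; module
    have h2 : -l / (1 - l) * (1 - l) = -l := div_mul_cancel₀ _ (by linarith)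
    rw [h1, smul_smul, h2]; simp only [z]; module
  · rcases le_or_gt l 1 with hl1 | hl1
    · refine notMem_of_mem_frontier hU (hseg ?_) hzU
      exact ⟨1 - l, l, by linarith, hl, by ring, by simp only [z, v]; module⟩
    · refine notMem_of_mem_frontier hU hbf ?_
      have := h.add_smul_mem hz (frontier_subset_closure haf) (t := (l - 1) / l)
        (div_nonneg (by linarith) (by linarith)) (by rw [div_lt_one (by linarith)]; linarith)
      convert this using 1
      have h1 : a - z = (-l) • v := by simp only [z]; module
      have h2 : (l - 1) / l * -l = 1 - l := by field_simp; ring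
      rw [h1, smul_smul, h2]; simp only [z, v]; module

end Star

section Coordinates

/-- The first coordinate of `x - c` with respect to `a - c` and `b - c`. -/
noncomputable def coordL (c a b x : Plane) : ℝ := det2 (x - c) (b - c) / det2 (a - c) (b - c)

/-- The second coordinate of `x - c` with respect to `a - c` and `b - c`. -/
noncomputable def coordR (c a b x : Plane) : ℝ := det2 (a - c) (x - c) / det2 (a - c) (b - c)

variable {c a b : Plane}

theorem sub_eq_coord (hD : det2 (a - c) (b - c) ≠ 0) (x : Plane) :
    x - c = coordL c a b x • (a - c) + coordR c a b x • (b - c) := by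
  ext i
  simp only [PiLp.add_apply, PiLp.smul_apply, smul_eq_mul, coordL, coordR]
  rw [div_mul_eq_mul_div, div_mul_eq_mul_div, ← add_div, eq_div_iff hD]
  fin_cases i <;> simp [det2] <;> ring

theorem coord_of_eq (hD : det2 (a - c) (b - c) ≠ 0) {x : Plane} {α β : ℝ}
    (hx : x - c = α • (a - c) + β • (b - c)) : coordL c a b x = α ∧ coordR c a b x = β := by
  constructor
  · rw [coordL, div_eq_iff hD, hx]; simp [det2]; ring
  · rw [coordR, div_eq_iff hD, hx]; simp [det2]; ring

theorem coord_lineMap (hD : det2 (a - c) (b - c) ≠ 0) (t : ℝ) :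
    coordL c a b (AffineMap.lineMap a b t) = 1 - t ∧ coordR c a b (AffineMap.lineMap a b t) = t :=
  coord_of_eq hD (by rw [AffineMap.lineMap_apply, vsub_eq_sub, vadd_eq_add]; module)

/-- The linear form `x ↦ det (x, w)`. -/
noncomputable def det2CLM (w : Plane) : Plane →L[ℝ] ℝ :=
  w 1 • EuclideanSpace.proj (𝕜 := ℝ) (0 : Fin 2) - w 0 • EuclideanSpace.proj (𝕜 := ℝ) (1 : Fin 2)

theorem det2CLM_apply (w v : Plane) : det2CLM w v = det2 v w := by
  simp [det2CLM, det2]; ring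

theorem norm_det2CLM_le (w : Plane) : ‖det2CLM w‖ ≤ ‖w‖ :=
  ContinuousLinearMap.opNorm_le_bound _ (norm_nonneg _) fun v => by
    rw [det2CLM_apply, Real.norm_eq_abs, mul_comm]; exact abs_det2_le v w

theorem hasFDerivAt_coordL (x : Plane) : HasFDerivAt (coordL c a b)
    ((det2 (a - c) (b - c))⁻¹ • det2CLM (b - c)) x := by
  have h : coordL c a b = fun x => (det2 (a - c) (b - c))⁻¹ • det2CLM (b - c) (x - c) := by
    funext y; rw [det2CLM_apply, coordL, smul_eq_mul, div_eq_inv_mul]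
  rw [h]
  have h1 : HasFDerivAt (fun x => det2CLM (b - c) (x - c)) (det2CLM (b - c)) x := by
    simpa [Function.comp_def] using
      (det2CLM (b - c)).hasFDerivAt.comp x ((hasFDerivAt_id x).sub_const c)
  exact h1.const_smul (det2 (a - c) (b - c))⁻¹

theorem hasFDerivAt_coordR (x : Plane) : HasFDerivAt (coordR c a b)
    (-(det2 (a - c) (b - c))⁻¹ • det2CLM (a - c)) x := by
  have h : coordR c a b = fun x => -(det2 (a - c) (b - c))⁻¹ • det2CLM (a - c) (x - c) := by
    funext y; rw [det2CLM_apply, coordR, smul_eq_mul, div_eq_inv_mul]; simp only [det2]; ring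
  rw [h]
  have h1 : HasFDerivAt (fun x => det2CLM (a - c) (x - c)) (det2CLM (a - c)) x := by
    simpa [Function.comp_def] using
      (det2CLM (a - c)).hasFDerivAt.comp x ((hasFDerivAt_id x).sub_const c)
  exact h1.const_smul (-(det2 (a - c) (b - c))⁻¹)

theorem contDiff_coordL {n : WithTop ℕ∞} : ContDiff ℝ n (coordL c a b) := by
  have h : coordL c a b = fun x => (det2 (a - c) (b - c))⁻¹ • det2CLM (b - c) (x - c) := by
    funext y; rw [det2CLM_apply, coordL, smul_eq_mul, div_eq_inv_mul]
  rw [h]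
  exact ((det2CLM (b - c)).contDiff.comp (contDiff_id.sub contDiff_const)).const_smul _

theorem contDiff_coordR {n : WithTop ℕ∞} : ContDiff ℝ n (coordR c a b) := by
  have h : coordR c a b = fun x => -(det2 (a - c) (b - c))⁻¹ • det2CLM (a - c) (x - c) := by
    funext y; rw [det2CLM_apply, coordR, smul_eq_mul, div_eq_inv_mul]; simp only [det2]; ring
  rw [h]
  exact ((det2CLM (a - c)).contDiff.comp (contDiff_id.sub contDiff_const)).const_smul _

variable {U : Set Plane} {R : ℝ}

theorem eq_add_smul_lineMap (hD : det2 (a - c) (b - c) ≠ 0) {x : Plane} {s : ℝ}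
    (hs : s = coordL c a b x + coordR c a b x) (hs0 : s ≠ 0) :
    x = c + s • (AffineMap.lineMap a b (coordR c a b x / s) - c) := by
  have h := sub_eq_coord hD x
  have h1 : s * (coordR c a b x / s) = coordR c a b x := by field_simp
  have h2 : s • ((AffineMap.lineMap a b (coordR c a b x / s) : Plane) - c) =
      (s - s * (coordR c a b x / s)) • (a - c) + (s * (coordR c a b x / s)) • (b - c) := by
    rw [AffineMap.lineMap_apply, vsub_eq_sub, vadd_eq_add]; module
  rw [h2, h1, hs, add_sub_cancel_right, ← h]; abel

theorem lineMap_mem_segment_of_mem {t : ℝ} (h0 : 0 ≤ t) (h1 : t ≤ 1) :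
    AffineMap.lineMap a b t ∈ segment ℝ a b := by
  rw [segment_eq_image_lineMap]; exact ⟨t, ⟨h0, h1⟩, rfl⟩

/-- A point of the closure that lies in the cone over an edge and beyond the edge would put the
point where its segment to `c` crosses the edge into `U`. -/
theorem IsStarDisc.coord_add_le_one (h : IsStarDisc U c R) (hU : IsOpen U)
    (hD : det2 (a - c) (b - c) ≠ 0) (hseg : segment ℝ a b ⊆ frontier U) {x : Plane}
    (hx : x ∈ closure U) (h0 : 0 ≤ coordL c a b x) (h1 : 0 ≤ coordR c a b x) :
    coordL c a b x + coordR c a b x ≤ 1 := by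
  by_contra! hlt
  set s := coordL c a b x + coordR c a b x with hs
  have hs0 : 0 < s := by linarith
  have hx2 := eq_add_smul_lineMap hD hs hs0.ne'
  have hy := hseg (lineMap_mem_segment_of_mem (a := a) (b := b) (t := coordR c a b x / s)
    (by positivity) (by rw [div_le_one hs0]; linarith))
  refine notMem_of_mem_frontier hU hy ?_
  have := h.add_smul_mem (mem_ball_self h.pos) hx (t := 1 / s) (by positivity)
    (by rw [div_lt_one hs0]; exact hlt)
  have hxc : x - c = s • ((AffineMap.lineMap a b (coordR c a b x / s) : Plane) - c) := by
    rw [sub_eq_iff_eq_add']; exact hx2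
  rw [hxc, smul_smul, one_div_mul_cancel hs0.ne', one_smul, add_sub_cancel] at this
  exact this

theorem IsStarDisc.coord_add_lt_one (h : IsStarDisc U c R) (hU : IsOpen U)
    (hD : det2 (a - c) (b - c) ≠ 0) (hseg : segment ℝ a b ⊆ frontier U) {x : Plane}
    (hx : x ∈ U) (h0 : 0 ≤ coordL c a b x) (h1 : 0 ≤ coordR c a b x) :
    coordL c a b x + coordR c a b x < 1 := by
  refine lt_of_le_of_ne (h.coord_add_le_one hU hD hseg (subset_closure hx) h0 h1) fun heq => ?_
  have hx2 := eq_add_smul_lineMap hD heq.symm one_ne_zero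
  rw [one_smul, add_sub_cancel, div_one] at hx2
  have hy := hseg (lineMap_mem_segment_of_mem (a := a) (b := b) (t := coordR c a b x)
    h1 (by linarith))
  rw [← hx2] at hy
  exact notMem_of_mem_frontier hU hy hx

/-- The open triangle with vertices `c`, `a`, `b`. -/
def openTriangle (c a b : Plane) : Set Plane :=
  {x | 0 < coordL c a b x ∧ 0 < coordR c a b x ∧ coordL c a b x + coordR c a b x < 1}

theorem isOpen_openTriangle : IsOpen (openTriangle c a b) := by
  have h1 : Continuous (coordL c a b) := (contDiff_coordL (n := 0)).continuous
  have h2 : Continuous (coordR c a b) := (contDiff_coordR (n := 0)).continuous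
  exact (isOpen_lt continuous_const h1).inter
    ((isOpen_lt continuous_const h2).inter (isOpen_lt (h1.add h2) continuous_const))

theorem IsStarDisc.openTriangle_subset (h : IsStarDisc U c R)
    (hD : det2 (a - c) (b - c) ≠ 0) (hseg : segment ℝ a b ⊆ frontier U) :
    openTriangle c a b ⊆ U := by
  rintro x ⟨h0, h1, hlt⟩
  have hs0 : 0 < coordL c a b x + coordR c a b x := by linarith
  rw [eq_add_smul_lineMap hD rfl hs0.ne']
  refine h.add_smul_mem (mem_ball_self h.pos) (frontier_subset_closure (hseg
    (lineMap_mem_segment_of_mem (by positivity) ?_))) hs0.le hlt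
  rw [div_le_one hs0]; linarith

theorem mem_openTriangle_iff_of_mem (h : IsStarDisc U c R) (hU : IsOpen U)
    (hD : det2 (a - c) (b - c) ≠ 0) (hseg : segment ℝ a b ⊆ frontier U) {x : Plane} (hx : x ∈ U) :
    x ∈ openTriangle c a b ↔ 0 < coordL c a b x ∧ 0 < coordR c a b x :=
  ⟨fun hx => ⟨hx.1, hx.2.1⟩, fun hp => ⟨hp.1, hp.2,
    h.coord_add_lt_one hU hD hseg hx hp.1.le hp.2.le⟩⟩

end Coordinates

/-! ### Edge bubbles -/

section Bubble

variable {c a b : Plane} {U : Set Plane} {R : ℝ}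

/-- An extension to the triangle with vertices `c`, `a`, `b`, and by zero beyond its sides that
contain `c`, of the function `t ↦ t (1 - t) q(t)` on the edge from `a` to `b`. -/
noncomputable def edgeBubble (c a b : Plane) (q : Polynomial ℝ) (x : Plane) : ℝ :=
  max (coordL c a b x) 0 ^ 2 * max (coordR c a b x) 0 ^ 2 * q.eval (coordR c a b x) /
    ((1 - coordL c a b x) * (1 - coordR c a b x))

theorem edgeBubble_eq_zero {q : Polynomial ℝ} {x : Plane}
    (hx : coordL c a b x ≤ 0 ∨ coordR c a b x ≤ 0) : edgeBubble c a b q x = 0 := by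
  rcases hx with hx | hx <;> simp [edgeBubble, max_eq_right hx]

/-- On the edge the coordinates are 1 − t and t, so the denominator cancels one factor of each
square. The squares are there for a C¹ extension by zero across the sides through `c`. In the closed
triangle the denominator vanishes only at `a` and `b`, which are boundary points of the element. -/
theorem edgeBubble_lineMap (hD : det2 (a - c) (b - c) ≠ 0) (q : Polynomial ℝ) {t : ℝ} (h0 : 0 ≤ t)
    (h1 : t ≤ 1) : edgeBubble c a b q (AffineMap.lineMap a b t) = t * (1 - t) * q.eval t := by
  obtain ⟨e0, e1⟩ := coord_lineMap hD t
  rw [edgeBubble, e0, e1, max_eq_left h0, max_eq_left (by linarith)]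
  rcases h0.eq_or_lt with rfl | h0
  · simp
  · rcases h1.eq_or_lt with rfl | h1
    · simp
    · have : 1 - t ≠ 0 := by linarith
      rw [sub_sub_cancel]
      field_simp

theorem contDiffAt_edgeBubble {q : Polynomial ℝ} {x : Plane}
    (hx : coordL c a b x < 0 ∨ coordR c a b x < 0 ∨ (coordL c a b x < 1 ∧ coordR c a b x < 1)) :
    ContDiffAt ℝ 1 (edgeBubble c a b q) x := by
  have hcL : Continuous (coordL c a b) := (contDiff_coordL (n := 0)).continuous
  have hcR : Continuous (coordR c a b) := (contDiff_coordR (n := 0)).continuous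
  have hz : (∀ᶠ y in 𝓝 x, coordL c a b y ≤ 0 ∨ coordR c a b y ≤ 0) →
      ContDiffAt ℝ 1 (edgeBubble c a b q) x := fun h =>
    (contDiffAt_const (c := (0 : ℝ))).congr_of_eventuallyEq
      (h.mono fun y hy => edgeBubble_eq_zero hy)
  rcases hx with hx | hx | ⟨hx0, hx1⟩
  · refine hz ?_
    filter_upwards [hcL.continuousAt.eventually_lt_const hx] with y hy using Or.inl hy.le
  · refine hz ?_
    filter_upwards [hcR.continuousAt.eventually_lt_const hx] with y hy using Or.inr hy.le
  · refine ContDiffAt.div ?_ ?_ (mul_ne_zero (by linarith) (by linarith))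
    · refine ((contDiff_posPart_sq.comp contDiff_coordL).mul
        (contDiff_posPart_sq.comp contDiff_coordR)).contDiffAt.mul ?_
      exact ((q.contDiff_aeval 1).comp contDiff_coordR).contDiffAt
    · exact ((contDiff_const.sub contDiff_coordL).mul
        (contDiff_const.sub contDiff_coordR)).contDiffAt

/-- In the triangle αβ ≤ (1 − α)(1 − β), so the denominator is absorbed by one factor αβ. This is
what yields continuity at the two end points of the edge, where the quotient is 0/0. -/
theorem abs_edgeBubble_le {q : Polynomial ℝ} {x : Plane}
    (hx : 0 ≤ coordL c a b x → 0 ≤ coordR c a b x → coordL c a b x + coordR c a b x ≤ 1) :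
    |edgeBubble c a b q x| ≤
      max (coordL c a b x) 0 * max (coordR c a b x) 0 * |q.eval (coordR c a b x)| := by
  by_cases h : coordL c a b x ≤ 0 ∨ coordR c a b x ≤ 0
  · rw [edgeBubble_eq_zero h, abs_zero]; positivity
  · push Not at h
    obtain ⟨h0, h1⟩ := h
    have h2 := hx h0.le h1.le
    rw [edgeBubble, max_eq_left h0.le, max_eq_left h1.le]
    set α := coordL c a b x
    set β := coordR c a b x
    rcases h2.eq_or_lt with h3 | h3
    · have ha : 1 - α = β := by linarith
      have hb : 1 - β = α := by linarith
      rw [ha, hb, abs_div, abs_mul, abs_of_pos (by positivity : 0 < α ^ 2 * β ^ 2),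
        abs_of_pos (by positivity : 0 < β * α), div_le_iff₀ (by positivity)]
      exact le_of_eq (by ring)
    · have ha : 0 < 1 - α := by linarith
      have hb : 0 < 1 - β := by linarith
      rw [abs_div, abs_mul, abs_of_pos (by positivity : 0 < α ^ 2 * β ^ 2),
        abs_of_pos (by positivity : 0 < (1 - α) * (1 - β)), div_le_iff₀ (by positivity)]
      have : α * β ≤ (1 - α) * (1 - β) := by nlinarith
      have hq := abs_nonneg (q.eval β)
      calc α ^ 2 * β ^ 2 * |q.eval β| = α * β * |q.eval β| * (α * β) := by ring
        _ ≤ α * β * |q.eval β| * ((1 - α) * (1 - β)) := by gcongr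

theorem IsStarDisc.continuousOn_edgeBubble (h : IsStarDisc U c R) (hU : IsOpen U)
    (hD : det2 (a - c) (b - c) ≠ 0) (hseg : segment ℝ a b ⊆ frontier U) (q : Polynomial ℝ) :
    ContinuousOn (edgeBubble c a b q) (closure U) := by
  intro x hx
  have hcL : Continuous (coordL c a b) := (contDiff_coordL (n := 0)).continuous
  have hcR : Continuous (coordR c a b) := (contDiff_coordR (n := 0)).continuous
  by_cases hx' : coordL c a b x < 0 ∨ coordR c a b x < 0 ∨ (coordL c a b x < 1 ∧ coordR c a b x < 1)
  · exact (contDiffAt_edgeBubble hx').continuousAt.continuousWithinAt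
  · push Not at hx'
    obtain ⟨h0, h1, h2⟩ := hx'
    have h3 := h.coord_add_le_one hU hD hseg hx h0 h1
    have hzero : max (coordL c a b x) 0 * max (coordR c a b x) 0 *
        |q.eval (coordR c a b x)| = 0 := by
      by_cases h4 : coordL c a b x < 1
      · have h5 := h2 h4
        have : coordL c a b x = 0 := by linarith
        simp [this]
      · have : coordR c a b x = 0 := by linarith
        simp [this]
    have hb0 : edgeBubble c a b q x = 0 := by
      have := abs_edgeBubble_le (q := q) (x := x) fun h0 h1 => h3
      rw [hzero] at this
      exact abs_nonpos_iff.1 this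
    rw [ContinuousWithinAt, hb0]
    have hcont : Continuous fun y => max (coordL c a b y) 0 * max (coordR c a b y) 0 *
        |q.eval (coordR c a b y)| := by
      have := q.continuous.comp hcR
      fun_prop
    have hlim := hcont.continuousAt.continuousWithinAt (s := closure U) (x := x)
    rw [ContinuousWithinAt, hzero] at hlim
    refine squeeze_zero_norm' ?_ hlim
    filter_upwards [self_mem_nhdsWithin] with y hy
    exact abs_edgeBubble_le fun h0 h1 => h.coord_add_le_one hU hD hseg hy h0 h1

theorem IsStarDisc.contDiffOn_edgeBubble (h : IsStarDisc U c R) (hU : IsOpen U)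
    (hD : det2 (a - c) (b - c) ≠ 0) (hseg : segment ℝ a b ⊆ frontier U) (q : Polynomial ℝ) :
    ContDiffOn ℝ 1 (edgeBubble c a b q) U := by
  intro x hx
  refine (contDiffAt_edgeBubble ?_).contDiffWithinAt
  by_contra! hx'
  obtain ⟨h0, h1, h2⟩ := hx'
  have h3 := h.coord_add_lt_one hU hD hseg hx h0 h1
  linarith [h2 (by linarith)]

/-- In the triangle the bubble is the product of α²/(1 − β), β²/(1 − α) and q(β). The first two
factors are at most 1 and have gradients of norm at most 3G, where `G` bounds the gradients of the
coordinates; the third has a gradient of norm at most AG. This gives 7 = 1 + 3 + 3. -/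
theorem norm_gradient_edgeBubble_le {q : Polynomial ℝ} {A G : ℝ}
    (hq : ∀ t ∈ Icc (0 : ℝ) 1, |q.eval t| ≤ A)
    (hq' : ∀ t ∈ Icc (0 : ℝ) 1, |q.derivative.eval t| ≤ A)
    (ha : ‖a - c‖ ≤ G * |det2 (a - c) (b - c)|) (hb : ‖b - c‖ ≤ G * |det2 (a - c) (b - c)|)
    {x : Plane} (hx : x ∈ openTriangle c a b) :
    ‖∇ (edgeBubble c a b q) x‖ ≤ 7 * A * G := by
  have hcL : Continuous (coordL c a b) := (contDiff_coordL (n := 0)).continuous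
  have hcR : Continuous (coordR c a b) := (contDiff_coordR (n := 0)).continuous
  have hD : 0 < |det2 (a - c) (b - c)| := by
    rw [abs_pos]; intro h0
    have := hx.1
    rw [coordL, h0, div_zero] at this
    exact lt_irrefl _ this
  obtain ⟨h0, h1, hlt⟩ := hx
  set L0 : Plane →L[ℝ] ℝ := (det2 (a - c) (b - c))⁻¹ • det2CLM (b - c) with hL0
  set L1 : Plane →L[ℝ] ℝ := -(det2 (a - c) (b - c))⁻¹ • det2CLM (a - c) with hL1
  have hn0 : ‖L0‖ ≤ G := by
    rw [hL0, norm_smul, norm_inv, Real.norm_eq_abs, inv_mul_le_iff₀ hD, mul_comm]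
    exact (norm_det2CLM_le _).trans hb
  have hn1 : ‖L1‖ ≤ G := by
    rw [hL1, norm_smul, norm_neg, norm_inv, Real.norm_eq_abs, inv_mul_le_iff₀ hD, mul_comm]
    exact (norm_det2CLM_le _).trans ha
  have hG : 0 ≤ G := (norm_nonneg _).trans hn0
  have hd0 : HasFDerivAt (coordL c a b) L0 x := hasFDerivAt_coordL x
  have hd1 : HasFDerivAt (coordR c a b) L1 x := hasFDerivAt_coordR x
  clear_value L0 L1
  set α := coordL c a b x with hα
  set β := coordR c a b x with hβ
  have hβ1 : 0 < 1 - β := by linarith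
  have hα1 : 0 < 1 - α := by linarith
  let P : Plane → ℝ := fun y => coordL c a b y ^ 2 * (1 - coordR c a b y)⁻¹
  let Q : Plane → ℝ := fun y => coordR c a b y ^ 2 * (1 - coordL c a b y)⁻¹
  let S : Plane → ℝ := fun y => q.eval (coordR c a b y)
  have hP : HasFDerivAt P (α ^ 2 • ((1 - β) ^ 2)⁻¹ • L1 + (1 - β)⁻¹ • (2 * α) • L0) x := by
    have e1 : HasFDerivAt (fun y => coordL c a b y ^ 2) ((2 * α) • L0) x := by
      simpa using hd0.pow 2
    have e2 : HasFDerivAt (fun y => (1 - coordR c a b y)⁻¹) (((1 - β) ^ 2)⁻¹ • L1) x := by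
      have := (hasDerivAt_inv hβ1.ne').comp_hasFDerivAt x (hd1.const_sub 1)
      simpa [Function.comp_def] using this
    exact e1.mul e2
  have hQ : HasFDerivAt Q (β ^ 2 • ((1 - α) ^ 2)⁻¹ • L0 + (1 - α)⁻¹ • (2 * β) • L1) x := by
    have e1 : HasFDerivAt (fun y => coordR c a b y ^ 2) ((2 * β) • L1) x := by
      simpa using hd1.pow 2
    have e2 : HasFDerivAt (fun y => (1 - coordL c a b y)⁻¹) (((1 - α) ^ 2)⁻¹ • L0) x := by
      have := (hasDerivAt_inv hα1.ne').comp_hasFDerivAt x (hd0.const_sub 1)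
      simpa [Function.comp_def] using this
    exact e1.mul e2
  have hS : HasFDerivAt S (q.derivative.eval β • L1) x :=
    HasDerivAt.comp_hasFDerivAt (h₂ := fun y => q.eval y) x (q.hasDerivAt β) hd1
  have heq : edgeBubble c a b q =ᶠ[𝓝 x] fun y => P y * Q y * S y := by
    filter_upwards [hcL.continuousAt.eventually_const_lt h0,
      hcR.continuousAt.eventually_const_lt h1] with y hy0 hy1
    simp only [edgeBubble, P, Q, S, max_eq_left hy0.le, max_eq_left hy1.le, div_eq_mul_inv,
      mul_inv]
    ring
  have hdP : ‖α ^ 2 • ((1 - β) ^ 2)⁻¹ • L1 + (1 - β)⁻¹ • (2 * α) • L0‖ ≤ 3 * G := by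
    have b1 : α ^ 2 * ((1 - β) ^ 2)⁻¹ ≤ 1 := by
      rw [← div_eq_mul_inv, div_le_one (by positivity)]; gcongr; linarith
    have b2 : (1 - β)⁻¹ * (2 * α) ≤ 2 := by
      rw [inv_mul_le_iff₀ hβ1]; linarith
    rw [smul_smul, smul_smul]
    refine (norm_add_le _ _).trans ?_
    rw [norm_smul, norm_smul, Real.norm_of_nonneg (by positivity),
      Real.norm_of_nonneg (mul_nonneg (inv_nonneg.2 hβ1.le) (by positivity))]
    have := mul_le_mul b1 hn1 (norm_nonneg _) zero_le_one
    have := mul_le_mul b2 hn0 (norm_nonneg _) zero_le_two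
    linarith
  have hdQ : ‖β ^ 2 • ((1 - α) ^ 2)⁻¹ • L0 + (1 - α)⁻¹ • (2 * β) • L1‖ ≤ 3 * G := by
    have b1 : β ^ 2 * ((1 - α) ^ 2)⁻¹ ≤ 1 := by
      rw [← div_eq_mul_inv, div_le_one (by positivity)]; gcongr; linarith
    have b2 : (1 - α)⁻¹ * (2 * β) ≤ 2 := by
      rw [inv_mul_le_iff₀ hα1]; linarith
    rw [smul_smul, smul_smul]
    refine (norm_add_le _ _).trans ?_
    rw [norm_smul, norm_smul, Real.norm_of_nonneg (by positivity),
      Real.norm_of_nonneg (mul_nonneg (inv_nonneg.2 hα1.le) (by positivity))]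
    have := mul_le_mul b1 hn0 (norm_nonneg _) zero_le_one
    have := mul_le_mul b2 hn1 (norm_nonneg _) zero_le_two
    linarith
  have hPx : |P x| ≤ 1 := by
    have : 0 ≤ P x := mul_nonneg (sq_nonneg _) (inv_nonneg.2 hβ1.le)
    rw [abs_of_nonneg this]
    show α ^ 2 * (1 - β)⁻¹ ≤ 1
    rw [← div_eq_mul_inv, div_le_one hβ1]; nlinarith
  have hQx : |Q x| ≤ 1 := by
    have : 0 ≤ Q x := mul_nonneg (sq_nonneg _) (inv_nonneg.2 hα1.le)
    rw [abs_of_nonneg this]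
    show β ^ 2 * (1 - α)⁻¹ ≤ 1
    rw [← div_eq_mul_inv, div_le_one hα1]; nlinarith
  have hβI : β ∈ Icc (0 : ℝ) 1 := ⟨h1.le, by linarith⟩
  have hSx : |S x| ≤ A := hq β hβI
  have hA : 0 ≤ A := (abs_nonneg _).trans hSx
  rw [norm_gradient_eq, heq.fderiv_eq, show (fun y => P y * Q y * S y) = P * Q * S from rfl,
    ((hP.mul hQ).mul hS).fderiv]
  refine (norm_add_le _ _).trans ?_
  have t1 : ‖(P x * Q x) • q.derivative.eval β • L1‖ ≤ A * G := by
    rw [norm_smul, norm_smul, norm_mul]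
    simp only [Real.norm_eq_abs]
    calc |P x| * |Q x| * (|q.derivative.eval β| * ‖L1‖) ≤ 1 * 1 * (A * G) := by
          gcongr; exact hq' β hβI
      _ = A * G := by ring
  have t2 : ‖S x • (P x • (β ^ 2 • ((1 - α) ^ 2)⁻¹ • L0 + (1 - α)⁻¹ • (2 * β) • L1) +
      Q x • (α ^ 2 • ((1 - β) ^ 2)⁻¹ • L1 + (1 - β)⁻¹ • (2 * α) • L0))‖ ≤ A * (6 * G) := by
    rw [norm_smul]
    refine mul_le_mul hSx ((norm_add_le _ _).trans ?_) (norm_nonneg _) hA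
    rw [norm_smul, norm_smul]
    simp only [Real.norm_eq_abs]
    calc _ ≤ 1 * (3 * G) + 1 * (3 * G) := by gcongr
      _ = 6 * G := by ring
  calc _ ≤ A * G + A * (6 * G) := add_le_add t1 t2
    _ = 7 * A * G := by ring

theorem IsStarDisc.ae_gradient_edgeBubble (h : IsStarDisc U c R) (hU : IsOpen U)
    (hD : det2 (a - c) (b - c) ≠ 0) (hseg : segment ℝ a b ⊆ frontier U) (q : Polynomial ℝ) :
    ∀ᵐ x, x ∈ U → x ∉ openTriangle c a b → ∇ (edgeBubble c a b q) x = 0 := by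
  filter_upwards [ae_gradient_eq_zero_of_eq_zero hU (h.contDiffOn_edgeBubble hU hD hseg q)]
    with x hx hxU hxT
  refine hx hxU (edgeBubble_eq_zero ?_)
  rw [mem_openTriangle_iff_of_mem h hU hD hseg hxU, not_and_or, not_lt, not_lt] at hxT
  exact hxT

theorem exists_bound_eval_Icc (q : Polynomial ℝ) : ∃ A, ∀ t ∈ Icc (0 : ℝ) 1, |q.eval t| ≤ A :=
  isCompact_Icc.exists_bound_of_continuousOn q.continuous.continuousOn

theorem IsStarDisc.memH1_edgeBubble (h : IsStarDisc U c R) (hU : IsOpen U)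
    (hb : Bornology.IsBounded U)
    (hD : det2 (a - c) (b - c) ≠ 0) (hseg : segment ℝ a b ⊆ frontier U) (q : Polynomial ℝ) :
    MemH1 U (edgeBubble c a b q) where
  continuousOn := h.continuousOn_edgeBubble hU hD hseg q
  contDiffOn := h.contDiffOn_edgeBubble hU hD hseg q
  memLp_grad := by
    obtain ⟨A, hA⟩ := exists_bound_eval_Icc q
    obtain ⟨A', hA'⟩ := exists_bound_eval_Icc q.derivative
    have hD' : 0 < |det2 (a - c) (b - c)| := abs_pos.2 hD
    let G := max (‖a - c‖ / |det2 (a - c) (b - c)|) (‖b - c‖ / |det2 (a - c) (b - c)|)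
    have hG1 : ‖a - c‖ ≤ G * |det2 (a - c) (b - c)| := by
      rw [← div_le_iff₀ hD']; exact le_max_left _ _
    have hG2 : ‖b - c‖ ≤ G * |det2 (a - c) (b - c)| := by
      rw [← div_le_iff₀ hD']; exact le_max_right _ _
    have : IsFiniteMeasure (volume.restrict U) :=
      isFiniteMeasure_restrict.2 hb.measure_lt_top.ne
    refine MemLp.of_bound (((h.contDiffOn_edgeBubble hU hD hseg q).continuousOn_gradient
      hU).aestronglyMeasurable hU.measurableSet) (7 * max A A' * G) ?_
    filter_upwards [ae_restrict_mem hU.measurableSet,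
      ae_restrict_of_ae (h.ae_gradient_edgeBubble hU hD hseg q)] with x hxU hx
    by_cases hxT : x ∈ openTriangle c a b
    · exact norm_gradient_edgeBubble_le (fun t ht => (hA t ht).trans (le_max_left _ _))
        (fun t ht => (hA' t ht).trans (le_max_right _ _)) hG1 hG2 hxT
    · rw [hx hxU hxT, norm_zero]
      have : 0 ≤ A := (abs_nonneg _).trans (hA 0 ⟨le_rfl, zero_le_one⟩)
      have : 0 ≤ G := le_max_of_le_left (by positivity)
      positivity

end Bubble

end

/-! ### Sums of bubbles on a polygonal element -/

section

open MeasureTheory Set Filter Topology Metric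
open scoped Gradient InnerProductSpace Laplacian

namespace PolygonElement

variable (E : PolygonElement)

instance : NeZero E.n := ⟨by have := E.three_le; omega⟩

theorem vert_ne_vert_add_one (i : ZMod E.n) : E.vert i ≠ E.vert (i + 1) := by
  intro h
  have h1 := E.vert_injective h
  have h2 : (1 : ZMod E.n) = 0 := by simpa using h1.symm
  have : Fact (1 < E.n) := ⟨by have := E.three_le; omega⟩
  exact one_ne_zero h2

theorem edge_subset_frontier (i : ZMod E.n) : E.edge i ⊆ frontier E.carrier := by
  rw [E.frontier_carrier]; exact subset_iUnion (fun i => segment ℝ (E.vert i) (E.vert (i + 1))) i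

theorem vert_mem_edge (i : ZMod E.n) : E.vert i ∈ E.edge i := left_mem_segment ℝ _ _

theorem vert_mem_frontier (i : ZMod E.n) : E.vert i ∈ frontier E.carrier :=
  E.edge_subset_frontier i (E.vert_mem_edge i)

theorem lineMap_mem_edge (i : ZMod E.n) {t : ℝ} (ht : t ∈ Icc (0 : ℝ) 1) :
    AffineMap.lineMap (E.vert i) (E.vert (i + 1)) t ∈ E.edge i :=
  lineMap_mem_segment_of_mem ht.1 ht.2

theorem exists_lineMap_of_mem_frontier {x : Plane} (hx : x ∈ frontier E.carrier) :
    ∃ i, ∃ t ∈ Icc (0 : ℝ) 1, AffineMap.lineMap (E.vert i) (E.vert (i + 1)) t = x := by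
  rw [E.frontier_carrier, mem_iUnion] at hx
  obtain ⟨i, hi⟩ := hx
  rw [segment_eq_image_lineMap] at hi
  exact ⟨i, hi⟩

theorem dist_le_diam {x y : Plane} (hx : x ∈ closure E.carrier) (hy : y ∈ closure E.carrier) :
    dist x y ≤ diam E.carrier := by
  rw [← diam_closure]; exact dist_le_diam_of_mem E.isBounded_carrier.closure hx hy

theorem diam_pos : 0 < diam E.carrier :=
  (dist_pos.2 (E.vert_ne_vert_add_one 0)).trans_le (E.dist_le_diam
    (frontier_subset_closure (E.vert_mem_frontier _))
    (frontier_subset_closure (E.vert_mem_frontier _)))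

variable {E} in
theorem IsShapeRegular.exists_isStarDisc {ρ : ℝ} (hE : E.IsShapeRegular ρ) (hρ : 0 < ρ) :
    ∃ c, IsStarDisc E.carrier c (ρ * diam E.carrier) := by
  obtain ⟨⟨c, h1, h2⟩, -⟩ := hE
  exact ⟨c, mul_pos hρ E.diam_pos, h1, h2⟩

theorem volume_real_carrier_le : volume.real E.carrier ≤ 4 * diam E.carrier ^ 2 := by
  obtain ⟨z, hz⟩ := E.isConnected_carrier.nonempty
  have hsub : E.carrier ⊆ closedBall z (diam E.carrier) := fun x hx =>
    mem_closedBall.2 (E.dist_le_diam (subset_closure hx) (subset_closure hz))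
  have h1 : volume.real E.carrier ≤ volume.real (closedBall z (diam E.carrier)) :=
    measureReal_mono hsub (isCompact_closedBall _ _).measure_ne_top
  refine h1.trans ?_
  rw [Measure.real, EuclideanSpace.volume_closedBall_fin_two, ENNReal.toReal_mul,
    ENNReal.toReal_pow, ENNReal.toReal_ofReal diam_nonneg]
  rw [ENNReal.toReal_ofReal Real.pi_pos.le]
  nlinarith [Real.pi_le_four, sq_nonneg (diam E.carrier)]

section

variable {E} {c : Plane} {R : ℝ}

theorem mul_self_le_abs_det2 (h : IsStarDisc E.carrier c R)
    (hR : ∀ i, R ≤ dist (E.vert i) (E.vert (i + 1))) (i : ZMod E.n) :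
    R ^ 2 ≤ |det2 (E.vert i - c) (E.vert (i + 1) - c)| := by
  refine le_trans ?_ (h.mul_dist_le_det2 E.isOpen_carrier (E.vert_ne_vert_add_one i)
    (E.edge_subset_frontier i))
  rw [sq]; exact mul_le_mul_of_nonneg_left (hR i) h.pos.le

theorem det2_ne_zero (h : IsStarDisc E.carrier c R) (i : ZMod E.n) :
    det2 (E.vert i - c) (E.vert (i + 1) - c) ≠ 0 := by
  rw [← abs_pos]
  exact (mul_pos h.pos (dist_pos.2 (E.vert_ne_vert_add_one i))).trans_le
    (h.mul_dist_le_det2 E.isOpen_carrier (E.vert_ne_vert_add_one i) (E.edge_subset_frontier i))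

/-- A boundary point in the open cone over an edge lies on this edge: it cannot lie beyond it, and
before it the points belong to the open element. It is not an end point, so simplicity of the
polygon excludes the other edges. Consequently a bubble vanishes on all edges but its own. -/
theorem eq_of_mem_edge_of_coord_pos (h : IsStarDisc E.carrier c R) {i j : ZMod E.n} {x : Plane}
    (hx : x ∈ E.edge i) (h0 : 0 < coordL c (E.vert j) (E.vert (j + 1)) x)
    (h1 : 0 < coordR c (E.vert j) (E.vert (j + 1)) x) : i = j := by
  by_contra hij
  have hD := det2_ne_zero h j
  have hseg : segment ℝ (E.vert j) (E.vert (j + 1)) ⊆ frontier E.carrier :=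
    E.edge_subset_frontier j
  have hxf := E.edge_subset_frontier i hx
  have hle := h.coord_add_le_one E.isOpen_carrier hD hseg (frontier_subset_closure hxf) h0.le h1.le
  have hs0 : 0 < coordL c (E.vert j) (E.vert (j + 1)) x + coordR c (E.vert j) (E.vert (j + 1)) x := by
    linarith
  have hx2 := eq_add_smul_lineMap hD rfl hs0.ne'
  have hmem := hseg (lineMap_mem_segment_of_mem (a := E.vert j) (b := E.vert (j + 1))
    (t := coordR c (E.vert j) (E.vert (j + 1)) x / (coordL c (E.vert j) (E.vert (j + 1)) x +
      coordR c (E.vert j) (E.vert (j + 1)) x)) (by positivity)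
    (by rw [div_le_one hs0]; linarith))
  rcases hle.eq_or_lt with heq | hlt
  · rw [heq, one_smul, add_sub_cancel, div_one] at hx2
    have hxj : x ∈ segment ℝ (E.vert j) (E.vert (j + 1)) := by
      rw [hx2]; exact lineMap_mem_segment_of_mem h1.le (by linarith)
    rcases (E.simple i j hij ⟨hx, hxj⟩).2 with hxv | hxv
    · have h2 := (coord_lineMap hD 0).2
      rw [AffineMap.lineMap_apply_zero] at h2
      rw [hxv, h2] at h1
      exact lt_irrefl _ h1
    · have h2 := (coord_lineMap hD 1).1
      rw [AffineMap.lineMap_apply_one, sub_self] at h2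
      rw [mem_singleton_iff.1 hxv, h2] at h0
      exact lt_irrefl _ h0
  · refine notMem_of_mem_frontier E.isOpen_carrier hxf ?_
    rw [hx2]
    exact h.add_smul_mem (mem_ball_self h.pos) (frontier_subset_closure hmem) hs0.le hlt

theorem coord_add_smul (hD : det2 (E.vert i - c) (E.vert (i + 1) - c) ≠ 0) (x : Plane) (s : ℝ) :
    coordL c (E.vert i) (E.vert (i + 1)) (c + s • (x - c)) =
        s * coordL c (E.vert i) (E.vert (i + 1)) x ∧
      coordR c (E.vert i) (E.vert (i + 1)) (c + s • (x - c)) =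
        s * coordR c (E.vert i) (E.vert (i + 1)) x := by
  refine coord_of_eq hD ?_
  rw [add_sub_cancel_left]
  conv_lhs => rw [sub_eq_coord hD x]
  module

/-- Radial projection from `c` moves a common point onto the first edge and keeps it in the open
cone over the second. -/
theorem disjoint_openTriangle (h : IsStarDisc E.carrier c R) {i j : ZMod E.n} (hij : i ≠ j) :
    Disjoint (openTriangle c (E.vert i) (E.vert (i + 1)))
      (openTriangle c (E.vert j) (E.vert (j + 1))) := by
  rw [Set.disjoint_left]
  rintro x ⟨h0, h1, -⟩ ⟨h0', h1', -⟩
  have hD := det2_ne_zero h i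
  set s := coordL c (E.vert i) (E.vert (i + 1)) x + coordR c (E.vert i) (E.vert (i + 1)) x with hs
  have hs0 : 0 < s := by linarith
  have hx2 := eq_add_smul_lineMap hD hs hs0.ne'
  have hmem : AffineMap.lineMap (E.vert i) (E.vert (i + 1))
      (coordR c (E.vert i) (E.vert (i + 1)) x / s) ∈ E.edge i :=
    lineMap_mem_segment_of_mem (by positivity) (by rw [div_le_one hs0]; linarith)
  have hy : (AffineMap.lineMap (E.vert i) (E.vert (i + 1))
      (coordR c (E.vert i) (E.vert (i + 1)) x / s) : Plane) = c + s⁻¹ • (x - c) := by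
    have : x - c = s • ((AffineMap.lineMap (E.vert i) (E.vert (i + 1))
        (coordR c (E.vert i) (E.vert (i + 1)) x / s) : Plane) - c) := by
      rw [sub_eq_iff_eq_add']; exact hx2
    rw [this, smul_smul, inv_mul_cancel₀ hs0.ne', one_smul, add_sub_cancel]
  rw [hy] at hmem
  obtain ⟨e0, e1⟩ := coord_add_smul (det2_ne_zero h j) x s⁻¹
  refine hij (eq_of_mem_edge_of_coord_pos h hmem ?_ ?_)
  · rw [e0]; positivity
  · rw [e1]; positivity

/-- The sum of the edge bubbles of all edges. -/
noncomputable def bubbleSum (E : PolygonElement) (c : Plane) (q : ZMod E.n → Polynomial ℝ)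
    (x : Plane) : ℝ :=
  ∑ i, edgeBubble c (E.vert i) (E.vert (i + 1)) (q i) x

theorem memH1_bubbleSum (h : IsStarDisc E.carrier c R) (q : ZMod E.n → Polynomial ℝ) :
    MemH1 E.carrier (E.bubbleSum c q) := by
  have := MemH1.sum E.isOpen_carrier Finset.univ
    (u := fun i => edgeBubble c (E.vert i) (E.vert (i + 1)) (q i))
    fun i _ => h.memH1_edgeBubble E.isOpen_carrier E.isBounded_carrier (det2_ne_zero h i)
      (E.edge_subset_frontier i) (q i)
  rwa [show ∑ i, edgeBubble c (E.vert i) (E.vert (i + 1)) (q i) = E.bubbleSum c q from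
    funext fun y => by simp [bubbleSum]] at this

theorem bubbleSum_lineMap (h : IsStarDisc E.carrier c R) (q : ZMod E.n → Polynomial ℝ)
    (i : ZMod E.n) {t : ℝ} (ht : t ∈ Icc (0 : ℝ) 1) :
    E.bubbleSum c q (AffineMap.lineMap (E.vert i) (E.vert (i + 1)) t) =
      t * (1 - t) * (q i).eval t := by
  rw [bubbleSum, Finset.sum_eq_single i, edgeBubble_lineMap (det2_ne_zero h i) _ ht.1 ht.2]
  · intro j _ hj
    refine edgeBubble_eq_zero ?_
    by_contra! hpos
    exact hj (eq_of_mem_edge_of_coord_pos h (E.lineMap_mem_edge i ht) hpos.1 hpos.2).symm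
  · simp

/-- At every point of the element at most one bubble is nonzero, because the triangles are disjoint.
So the bound contains no factor for the number of edges. -/
theorem abs_bubbleSum_le (h : IsStarDisc E.carrier c R) {q : ZMod E.n → Polynomial ℝ}
    {A : ZMod E.n → ℝ} (hq : ∀ i, ∀ t ∈ Icc (0 : ℝ) 1, |(q i).eval t| ≤ A i) {x : Plane}
    (hx : x ∈ E.carrier) : (E.bubbleSum c q x) ^ 2 ≤ ∑ i, A i ^ 2 := by
  have hA : ∀ i, 0 ≤ A i := fun i => (abs_nonneg _).trans (hq i 0 ⟨le_rfl, zero_le_one⟩)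
  by_cases hx' : ∃ i, x ∈ openTriangle c (E.vert i) (E.vert (i + 1))
  · obtain ⟨i, hi⟩ := hx'
    have hs : E.bubbleSum c q x = edgeBubble c (E.vert i) (E.vert (i + 1)) (q i) x := by
      refine Finset.sum_eq_single i (fun j _ hj => edgeBubble_eq_zero ?_) (by simp)
      by_contra! hpos
      exact (Set.disjoint_left.1 (disjoint_openTriangle h hj.symm) hi)
        ((mem_openTriangle_iff_of_mem h E.isOpen_carrier (det2_ne_zero h j)
          (E.edge_subset_frontier j) hx).2 hpos)
    obtain ⟨h0, h1, hlt⟩ := hi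
    have hb := abs_edgeBubble_le (q := q i) (x := x) (c := c) (a := E.vert i) (b := E.vert (i + 1))
      fun _ _ => hlt.le
    rw [max_eq_left h0.le, max_eq_left h1.le] at hb
    have h2 := hq i _ ⟨h1.le, by linarith⟩
    have h3 : |edgeBubble c (E.vert i) (E.vert (i + 1)) (q i) x| ≤ A i := by
      refine hb.trans ?_
      have : coordL c (E.vert i) (E.vert (i + 1)) x * coordR c (E.vert i) (E.vert (i + 1)) x ≤ 1 := by
        nlinarith
      calc _ ≤ 1 * A i := mul_le_mul this h2 (abs_nonneg _) zero_le_one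
        _ = A i := one_mul _
    rw [hs, ← sq_abs]
    calc _ ≤ A i ^ 2 := pow_le_pow_left₀ (abs_nonneg _) h3 2
      _ ≤ _ := Finset.single_le_sum (f := fun i => A i ^ 2) (fun i _ => sq_nonneg _)
        (Finset.mem_univ i)
  · push Not at hx'
    have : E.bubbleSum c q x = 0 := by
      refine Finset.sum_eq_zero fun j _ => edgeBubble_eq_zero ?_
      by_contra! hpos
      exact hx' j ((mem_openTriangle_iff_of_mem h E.isOpen_carrier (det2_ne_zero h j)
          (E.edge_subset_frontier j) hx).2 hpos)
    rw [this, zero_pow two_ne_zero]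
    exact Finset.sum_nonneg fun i _ => sq_nonneg _

/-- At most one gradient contributes: outside its triangle a bubble vanishes, and so does its
gradient almost everywhere. The determinants are at least R², as `c` has distance at least `R` from
the line of each edge and the edges have length at least `R`; hence the gradients of the coordinates
are at most diam/R². -/
theorem ae_norm_gradient_bubbleSum_le (h : IsStarDisc E.carrier c R)
    (hR : ∀ i, R ≤ dist (E.vert i) (E.vert (i + 1))) {q : ZMod E.n → Polynomial ℝ}
    {A : ZMod E.n → ℝ} (hq : ∀ i, ∀ t ∈ Icc (0 : ℝ) 1, |(q i).eval t| ≤ A i)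
    (hq' : ∀ i, ∀ t ∈ Icc (0 : ℝ) 1, |(q i).derivative.eval t| ≤ A i) :
    ∀ᵐ x, x ∈ E.carrier → ‖∇ (E.bubbleSum c q) x‖ ^ 2 ≤
      (7 * (diam E.carrier / R ^ 2)) ^ 2 * ∑ i, A i ^ 2 := by
  have hA : ∀ i, 0 ≤ A i := fun i => (abs_nonneg _).trans (hq i 0 ⟨le_rfl, zero_le_one⟩)
  have hb : ∀ i, MemH1 E.carrier (edgeBubble c (E.vert i) (E.vert (i + 1)) (q i)) := fun i =>
    h.memH1_edgeBubble E.isOpen_carrier E.isBounded_carrier (det2_ne_zero h i)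
      (E.edge_subset_frontier i) (q i)
  have hae := ae_all_iff.2 fun i => h.ae_gradient_edgeBubble E.isOpen_carrier (det2_ne_zero h i)
      (E.edge_subset_frontier i) (q i)
  filter_upwards [hae] with x hx hxU
  have hsum : ∇ (E.bubbleSum c q) x =
      ∑ i, ∇ (edgeBubble c (E.vert i) (E.vert (i + 1)) (q i)) x := by
    have h1 : HasFDerivAt (E.bubbleSum c q)
        (∑ i, fderiv ℝ (edgeBubble c (E.vert i) (E.vert (i + 1)) (q i)) x) x := by
      have := HasFDerivAt.sum (u := Finset.univ) (x := x)
        (A := fun i => edgeBubble c (E.vert i) (E.vert (i + 1)) (q i))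
        fun i _ => ((hb i).contDiffOn.differentiableAt_of_isOpen E.isOpen_carrier one_ne_zero
          hxU).hasFDerivAt
      rwa [show ∑ i, edgeBubble c (E.vert i) (E.vert (i + 1)) (q i) = E.bubbleSum c q from
        funext fun y => by simp [bubbleSum]] at this
    rw [gradient, h1.fderiv, map_sum]; rfl
  have hG : ∀ i, ‖E.vert i - c‖ ≤ diam E.carrier := fun i => by
    rw [← dist_eq_norm]
    exact E.dist_le_diam (frontier_subset_closure (E.vert_mem_frontier i))
      (subset_closure h.center_mem)
  have hG2 : ∀ i j, ‖E.vert i - c‖ ≤ diam E.carrier / R ^ 2 *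
      |det2 (E.vert j - c) (E.vert (j + 1) - c)| := fun i j => by
    refine (hG i).trans ?_
    have hp := h.pos
    rw [div_mul_eq_mul_div, le_div_iff₀ (by positivity)]
    exact mul_le_mul_of_nonneg_left (mul_self_le_abs_det2 h hR j) diam_nonneg
  by_cases hx' : ∃ i, x ∈ openTriangle c (E.vert i) (E.vert (i + 1))
  · obtain ⟨i, hi⟩ := hx'
    rw [hsum, Finset.sum_eq_single i]
    · have := norm_gradient_edgeBubble_le (hq i) (hq' i) (hG2 i i) (hG2 (i + 1) i) hi
      calc _ ≤ (7 * A i * (diam E.carrier / R ^ 2)) ^ 2 := pow_le_pow_left₀ (norm_nonneg _) this 2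
        _ = (7 * (diam E.carrier / R ^ 2)) ^ 2 * A i ^ 2 := by ring
        _ ≤ _ := mul_le_mul_of_nonneg_left (Finset.single_le_sum (f := fun i => A i ^ 2)
          (fun i _ => sq_nonneg _) (Finset.mem_univ i)) (sq_nonneg _)
    · exact fun j _ hj => hx j hxU (Set.disjoint_left.1 (disjoint_openTriangle h hj.symm) hi)
    · simp
  · push Not at hx'
    rw [hsum, Finset.sum_eq_zero fun j _ => hx j hxU (hx' j)]
    rw [norm_zero, zero_pow two_ne_zero]
    exact mul_nonneg (sq_nonneg _) (Finset.sum_nonneg fun i _ => sq_nonneg _)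

theorem dirichletForm_bubbleSum_le (h : IsStarDisc E.carrier c R)
    (hR : ∀ i, R ≤ dist (E.vert i) (E.vert (i + 1))) {q : ZMod E.n → Polynomial ℝ}
    {A : ZMod E.n → ℝ} (hq : ∀ i, ∀ t ∈ Icc (0 : ℝ) 1, |(q i).eval t| ≤ A i)
    (hq' : ∀ i, ∀ t ∈ Icc (0 : ℝ) 1, |(q i).derivative.eval t| ≤ A i) :
    dirichletForm E.carrier (E.bubbleSum c q) (E.bubbleSum c q) ≤
      4 * diam E.carrier ^ 2 * ((7 * (diam E.carrier / R ^ 2)) ^ 2 * ∑ i, A i ^ 2) := by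
  rw [dirichletForm_self]
  have : IsFiniteMeasure (volume.restrict E.carrier) :=
      isFiniteMeasure_restrict.2 E.isBounded_carrier.measure_lt_top.ne
  calc _ ≤ ∫ x in E.carrier, (7 * (diam E.carrier / R ^ 2)) ^ 2 * ∑ i, A i ^ 2 := by
        refine integral_mono_ae ?_ (integrable_const _) ?_
        · exact (memH1_bubbleSum h q).memLp_grad.integrable_norm_pow (by norm_num)
        · exact (ae_restrict_iff' E.isOpen_carrier.measurableSet).2
            (ae_norm_gradient_bubbleSum_le h hR hq hq')
    _ = volume.real E.carrier * ((7 * (diam E.carrier / R ^ 2)) ^ 2 * ∑ i, A i ^ 2) := by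
        rw [setIntegral_const, smul_eq_mul]
    _ ≤ _ := mul_le_mul_of_nonneg_right E.volume_real_carrier_le (by positivity)

theorem integral_bubbleSum_sq_le (h : IsStarDisc E.carrier c R) {q : ZMod E.n → Polynomial ℝ}
    {A : ZMod E.n → ℝ} (hq : ∀ i, ∀ t ∈ Icc (0 : ℝ) 1, |(q i).eval t| ≤ A i) :
    ∫ x in E.carrier, (E.bubbleSum c q x) ^ 2 ≤ 4 * diam E.carrier ^ 2 * ∑ i, A i ^ 2 := by
  have : IsFiniteMeasure (volume.restrict E.carrier) :=
      isFiniteMeasure_restrict.2 E.isBounded_carrier.measure_lt_top.ne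
  calc _ ≤ ∫ x in E.carrier, ∑ i, A i ^ 2 := by
        refine integral_mono_ae ?_ (integrable_const _) ?_
        · exact ((memH1_bubbleSum h q).memLp E.isOpen_carrier E.isBounded_carrier).integrable_sq
        · exact (ae_restrict_iff' E.isOpen_carrier.measurableSet).2
            (Eventually.of_forall fun x hx => abs_bubbleSum_le h hq hx)
    _ = volume.real E.carrier * ∑ i, A i ^ 2 := by
        rw [setIntegral_const, smul_eq_mul]
    _ ≤ _ := mul_le_mul_of_nonneg_right E.volume_real_carrier_le
      (Finset.sum_nonneg fun i _ => sq_nonneg _)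

end

end PolygonElement

end

/-! ### Poincaré and trace inequalities -/

section

open MeasureTheory Set Filter Topology Metric
open scoped Gradient InnerProductSpace Laplacian ENNReal

section ChangeOfVariables

theorem lintegral_comp_add_smul {F : Plane → ℝ≥0∞} (hF : Measurable F) (w : Plane) {t : ℝ}
    (ht : 1 / 2 ≤ t) : ∫⁻ x, F (w + t • x) ≤ 4 * ∫⁻ x, F x := by
  have ht0 : 0 < t := by linarith
  have h1 : ∫⁻ x, F (w + t • x) = ∫⁻ x, F (w + x) ∂(Measure.map (t • ·) volume) := by
    rw [lintegral_map (by fun_prop) (by fun_prop)]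
  rw [h1, Measure.map_addHaar_smul _ ht0.ne', lintegral_smul_measure,
    lintegral_add_left_eq_self F w, finrank_euclideanSpace, Fintype.card_fin, smul_eq_mul]
  gcongr
  rw [abs_of_pos (by positivity), show (4 : ℝ≥0∞) = ENNReal.ofReal 4 by norm_num]
  refine ENNReal.ofReal_le_ofReal (inv_le_of_inv_le₀ (by norm_num) ?_)
  nlinarith

/-- For t ≥ 1/2 one integrates first over the end point `p.1`, on which the argument depends with
factor t; for t ≤ 1/2 first over `p.2`, with factor 1 − t. The Jacobian then costs at most 4,
uniformly in `t`. -/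
theorem lintegral_comp_segment_le {F : Plane → ℝ≥0∞} (hF : Measurable F) {A B : Set Plane}
    (hBA : volume B ≤ volume A) (t : ℝ) :
    ∫⁻ p, F (p.2 + t • (p.1 - p.2)) ∂((volume.restrict A).prod (volume.restrict B)) ≤
      4 * volume A * ∫⁻ x, F x := by
  have hm : AEMeasurable (fun p : Plane × Plane => F (p.2 + t • (p.1 - p.2)))
      ((volume.restrict A).prod (volume.restrict B)) := by
    refine Measurable.aemeasurable ?_
    fun_prop
  rcases le_total (1 / 2) t with ht | ht
  · rw [lintegral_prod_symm _ hm]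
    calc _ ≤ ∫⁻ _ in B, 4 * ∫⁻ x, F x := by
          refine lintegral_mono fun z => (setLIntegral_le_lintegral _ _).trans ?_
          refine le_trans (le_of_eq ?_) (lintegral_comp_add_smul hF (z - t • z) ht)
          refine lintegral_congr fun x => ?_
          congr 1; module
      _ = 4 * volume B * ∫⁻ x, F x := by rw [setLIntegral_const]; ring
      _ ≤ _ := by gcongr
  · rw [lintegral_prod _ hm]
    calc _ ≤ ∫⁻ _ in A, 4 * ∫⁻ x, F x := by
          refine lintegral_mono fun x => (setLIntegral_le_lintegral _ _).trans ?_
          refine le_trans (le_of_eq ?_)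
            (lintegral_comp_add_smul hF (t • x) (t := 1 - t) (by linarith))
          refine lintegral_congr fun z => ?_
          congr 1; simp only; module
      _ = _ := by rw [setLIntegral_const]; ring

/-- Integration over a parallelogram. -/
theorem lintegral_parallelogram {F : Plane → ℝ≥0∞} (hF : Measurable F) (a v w : Plane)
    (hD : det2 v w ≠ 0) :
    ∫⁻ p : ℝ × ℝ, F (a + (p.1 • v + p.2 • w)) = ENNReal.ofReal |det2 v w|⁻¹ * ∫⁻ x, F x := by
  let T : Plane →ₗ[ℝ] Plane :=
    Matrix.toLin (EuclideanSpace.basisFun (Fin 2) ℝ).toBasis (EuclideanSpace.basisFun (Fin 2) ℝ).toBasis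
      !![v 0, w 0; v 1, w 1]
  have hT : ∀ x, T x = x 0 • v + x 1 • w := by
    intro x
    ext i
    rw [Matrix.toLin_apply]
    fin_cases i <;> simp [Matrix.mulVec, dotProduct, Fin.sum_univ_two] <;> ring
  have hdet : LinearMap.det T = det2 v w := by
    rw [LinearMap.det_toLin, Matrix.det_fin_two_of, det2]; ring
  have hTm : Measurable T := (LinearMap.continuous_of_finiteDimensional T).measurable
  have h1 := Measure.map_linearMap_addHaar_eq_smul_addHaar (volume : Measure Plane)
    (f := T) (by rwa [hdet])
  have h2 : ∫⁻ x : Plane, F (a + T x) = ENNReal.ofReal |det2 v w|⁻¹ * ∫⁻ x, F x := by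
    have h3 : ∫⁻ x : Plane, F (a + T x) = ∫⁻ x, F (a + x) ∂(Measure.map T volume) := by
      rw [lintegral_map (by fun_prop) hTm]
    rw [h3, h1, lintegral_smul_measure, lintegral_add_left_eq_self F a, hdet, abs_inv, smul_eq_mul]
  rw [← h2]
  have h4 := (volume_preserving_finTwoArrow ℝ).comp (PiLp.volume_preserving_ofLp (Fin 2))
  have h5 := h4.lintegral_comp (f := fun p : ℝ × ℝ => F (a + (p.1 • v + p.2 • w))) (by fun_prop)
  rw [← h5]
  refine lintegral_congr fun x => ?_
  rw [hT]
  rfl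

end ChangeOfVariables

section OneDimensional

/-- The right-hand side may be infinite, so integrability of `φ` up to the end points is not
assumed. Gradients may be unbounded near the boundary of an element. -/
theorem ofReal_sub_le_lintegral {H H' φ : ℝ → ℝ} {b : ℝ} (hb : 0 ≤ b)
    (hc : ContinuousOn H (Icc 0 b)) (hd : ∀ s ∈ Ioo 0 b, HasDerivAt H (H' s) s)
    (hφ : ContinuousOn φ (Ioo 0 b)) (h0 : ∀ s, 0 ≤ φ s) (hle : ∀ s ∈ Ioo 0 b, H' s ≤ φ s) :
    ENNReal.ofReal (H b - H 0) ≤ ∫⁻ s in Ioo 0 b, ENNReal.ofReal (φ s) := by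
  have hm : AEStronglyMeasurable φ (volume.restrict (Ioo 0 b)) :=
    hφ.aestronglyMeasurable measurableSet_Ioo
  by_cases htop : ∫⁻ s in Ioo 0 b, ENNReal.ofReal (φ s) = ∞
  · rw [htop]; exact le_top
  have hint : IntegrableOn φ (Ioo 0 b) :=
    (lintegral_ofReal_ne_top_iff_integrable hm (Eventually.of_forall h0)).1 htop
  have hint' : IntegrableOn φ (Icc 0 b) := (integrableOn_Icc_iff_integrableOn_Ioo).2 hint
  have := intervalIntegral.sub_le_integral_of_hasDeriv_right_of_le hb hc
    (fun s hs => (hd s hs).hasDerivWithinAt) hint' hle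
  rw [intervalIntegral.integral_of_le hb, integral_Ioc_eq_integral_Ioo] at this
  rw [← ofReal_integral_eq_lintegral_ofReal hint (Eventually.of_forall h0)]
  exact ENNReal.ofReal_le_ofReal this

/-- The Cauchy–Schwarz inequality in linearized form: with m = f(1) − f(0), (f' − m)² ≥ 0 means f'²
≥ 2mf' − m², and the integral of the right-hand side is m². -/
theorem ofReal_sub_sq_le_lintegral {f f' : ℝ → ℝ} (hc : ContinuousOn f (Icc 0 1))
    (hd : ∀ s ∈ Ioo (0 : ℝ) 1, HasDerivAt f (f' s) s) (hf' : ContinuousOn f' (Ioo 0 1)) :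
    ENNReal.ofReal ((f 1 - f 0) ^ 2) ≤ ∫⁻ s in Ioo (0 : ℝ) 1, ENNReal.ofReal (f' s ^ 2) := by
  set m := f 1 - f 0 with hm
  have := ofReal_sub_le_lintegral (H := fun s => 2 * m * f s - m ^ 2 * s)
    (H' := fun s => 2 * m * f' s - m ^ 2) (φ := fun s => f' s ^ 2) zero_le_one
    ((hc.const_smul (2 * m)).sub (by fun_prop)) (fun s hs => by
      refine (((hd s hs).const_mul (2 * m)).sub
        ((hasDerivAt_id s).const_mul (m ^ 2))).congr_deriv ?_
      rw [mul_one]) (hf'.pow 2) (fun s => sq_nonneg _)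
    fun s _ => by nlinarith [sq_nonneg (f' s - m)]
  refine le_trans (le_of_eq ?_) this
  congr 1; rw [hm]; ring

/-- The weight 2s − 1 is −1 at 0 and 0 at 1/2, so the increment of (2s − 1) f² is f(0)². Its
derivative is estimated by Young's inequality. -/
theorem ofReal_sq_le_lintegral {f f' : ℝ → ℝ} (hc : ContinuousOn f (Icc 0 (1 / 2)))
    (hd : ∀ s ∈ Ioo (0 : ℝ) (1 / 2), HasDerivAt f (f' s) s)
    (hf' : ContinuousOn f' (Ioo 0 (1 / 2))) :
    ENNReal.ofReal (f 0 ^ 2) ≤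
      ∫⁻ s in Ioo (0 : ℝ) (1 / 2), ENNReal.ofReal (3 * f s ^ 2 + f' s ^ 2) := by
  have := ofReal_sub_le_lintegral (H := fun s => (2 * s - 1) * f s ^ 2)
    (H' := fun s => 2 * f s ^ 2 + (2 * s - 1) * (2 * f s * f' s))
    (φ := fun s => 3 * f s ^ 2 + f' s ^ 2) (b := 1 / 2) (by norm_num)
    (ContinuousOn.mul (by fun_prop) (hc.pow 2)) (fun s hs => by
      have h1 : HasDerivAt (fun s : ℝ => 2 * s - 1) 2 s := by
        simpa using ((hasDerivAt_id s).const_mul 2).sub_const 1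
      have h2 := h1.mul ((hd s hs).pow 2)
      refine h2.congr_deriv ?_
      simp) (((hc.mono Ioo_subset_Icc_self).pow 2 |>.const_smul (3 : ℝ)).add (hf'.pow 2))
      (fun s => by positivity) fun s hs => by
      obtain ⟨h1, h2⟩ := hs
      have e1 : |(2 * s - 1)| ≤ 1 := by rw [abs_le]; constructor <;> linarith
      have e2 : (2 * s - 1) * (2 * f s * f' s) ≤ |2 * f s * f' s| := by
        refine (le_abs_self _).trans ?_
        rw [abs_mul]
        exact mul_le_of_le_one_left (abs_nonneg _) e1
      have e3 : |2 * f s * f' s| ≤ f s ^ 2 + f' s ^ 2 := by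
        rw [abs_le]; constructor <;> nlinarith [sq_nonneg (f s + f' s), sq_nonneg (f s - f' s)]
      linarith
  refine le_trans (le_of_eq ?_) this
  congr 1; ring

end OneDimensional

section Poincare

variable {U : Set Plane} {g : Plane → ℝ}

open scoped Classical in
theorem ContinuousOn.measurable_indicator_ofReal {φ : Plane → ℝ} {T : Set Plane} (hT : IsOpen T)
    (hφ : ContinuousOn φ T) : Measurable (T.indicator fun x => ENNReal.ofReal (φ x)) := by
  rw [← piecewise_eq_indicator]
  exact ContinuousOn.measurable_piecewise (ENNReal.continuous_ofReal.comp_continuousOn hφ)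
    continuousOn_const hT.measurableSet

theorem hasDerivAt_comp_add_smul (hU : IsOpen U) (hg : ContDiffOn ℝ 1 g U) {z w : Plane} {s : ℝ}
    (hs : z + s • w ∈ U) :
    HasDerivAt (fun s : ℝ => g (z + s • w)) (⟪∇ g (z + s • w), w⟫_ℝ) s := by
  have h1 := (hg.differentiableAt_of_isOpen hU one_ne_zero hs).hasFDerivAt
  have h2 : HasDerivAt (fun s : ℝ => z + s • w) w s := by
    simpa using ((hasDerivAt_id s).smul_const w).const_add z
  have h3 := h1.comp_hasDerivAt s h2
  have h4 : fderiv ℝ g (z + s • w) w = ⟪∇ g (z + s • w), w⟫_ℝ := by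
    rw [gradient, InnerProductSpace.toDual_symm_apply]
  rw [h4] at h3
  exact h3

theorem inner_sq_le_of_norm_le {v w : Plane} {d : ℝ} (hw : ‖w‖ ≤ d) :
    ⟪v, w⟫_ℝ ^ 2 ≤ d ^ 2 * ‖v‖ ^ 2 := by
  have h1 := abs_real_inner_le_norm v w
  rw [← sq_abs, ← mul_pow]
  refine pow_le_pow_left₀ (abs_nonneg _) (h1.trans ?_) 2
  rw [mul_comm]; gcongr

/-- The difference g(x) − g(z) is integrated along the segment from a point `z` of the disc to `x`.
After averaging over `z` there is some `z` that does not exceed the average, and `γ = g z` serves as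
the constant. The factor d²/R² comes from the ratio of the areas of `U` and the disc. -/
theorem IsStarDisc.exists_integral_sub_sq_le {c : Plane} {R : ℝ} (h : IsStarDisc U c R)
    (hU : IsOpen U) (hb : Bornology.IsBounded U) (hg : MemH1 U g) {d : ℝ}
    (hd : ∀ x ∈ U, ∀ y ∈ U, dist x y ≤ d) :
    ∃ γ : ℝ, ∫ x in U, (g x - γ) ^ 2 ≤ 4 * d ^ 4 / R ^ 2 * dirichletForm U g g := by
  have hR := h.pos
  have hd0 : 0 ≤ d := dist_nonneg.trans (hd c h.center_mem c h.center_mem)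
  set F : Plane → ℝ≥0∞ := U.indicator fun x => ENNReal.ofReal (d ^ 2 * ‖∇ g x‖ ^ 2) with hFdef
  have hF : Measurable F := ContinuousOn.measurable_indicator_ofReal hU
    (((hg.contDiffOn.continuousOn_gradient hU).norm.pow 2).const_smul (d ^ 2))
  have hFint : ∫⁻ x, F x = ENNReal.ofReal (d ^ 2 * dirichletForm U g g) := by
    rw [hFdef, lintegral_indicator hU.measurableSet, dirichletForm_self, ← integral_const_mul,
      ofReal_integral_eq_lintegral_ofReal (hg.integrableOn_sq.const_mul _)
        (Eventually.of_forall fun x => by positivity)]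
  have hBA : volume (ball c R) ≤ volume U := measure_mono h.ball_subset
  have hpt : ∀ x ∈ U, ∀ z ∈ ball c R, ENNReal.ofReal ((g x - g z) ^ 2) ≤
      ∫⁻ t in Ioo (0 : ℝ) 1, F (z + t • (x - z)) := by
    intro x hx z hz
    have hmem : ∀ t ∈ Icc (0 : ℝ) 1, z + t • (x - z) ∈ U := fun t ht =>
      h.add_smul_mem' hz hx ht.1 ht.2
    have hcont : Continuous fun t : ℝ => z + t • (x - z) := by fun_prop
    have h1 := ofReal_sub_sq_le_lintegral (f := fun t => g (z + t • (x - z)))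
      (f' := fun t => ⟪∇ g (z + t • (x - z)), x - z⟫_ℝ)
      (hg.contDiffOn.continuousOn.comp hcont.continuousOn hmem)
      (fun s hs => hasDerivAt_comp_add_smul hU hg.contDiffOn (hmem s (Ioo_subset_Icc_self hs)))
      (((hg.contDiffOn.continuousOn_gradient hU).comp hcont.continuousOn
        fun t ht => hmem t (Ioo_subset_Icc_self ht)).inner continuousOn_const)
    simp only [one_smul, zero_smul, add_zero, add_sub_cancel] at h1
    refine h1.trans (setLIntegral_mono' measurableSet_Ioo fun t ht => ?_)
    rw [hFdef, indicator_of_mem (hmem t (Ioo_subset_Icc_self ht))]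
    refine ENNReal.ofReal_le_ofReal (inner_sq_le_of_norm_le ?_)
    rw [← dist_eq_norm]; exact hd x hx z (h.ball_subset hz)
  have hmF : Measurable fun q : (Plane × Plane) × ℝ => F (q.1.2 + q.2 • (q.1.1 - q.1.2)) := by
    fun_prop
  have htot : ∫⁻ z in ball c R, ∫⁻ x in U, ∫⁻ t in Ioo (0 : ℝ) 1, F (z + t • (x - z)) ≤
      4 * volume U * ∫⁻ x, F x := by
    have e1 : ∫⁻ z in ball c R, ∫⁻ x in U, ∫⁻ t in Ioo (0 : ℝ) 1, F (z + t • (x - z)) =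
        ∫⁻ p : Plane × Plane, (∫⁻ t in Ioo (0 : ℝ) 1, F (p.2 + t • (p.1 - p.2)))
          ∂((volume.restrict U).prod (volume.restrict (ball c R))) := by
      rw [lintegral_prod_symm]
      exact (Measurable.lintegral_prod_right' hmF).aemeasurable
    rw [e1, lintegral_lintegral_swap hmF.aemeasurable]
    calc _ ≤ ∫⁻ _ in Ioo (0 : ℝ) 1, 4 * volume U * ∫⁻ x, F x :=
          lintegral_mono fun t => lintegral_comp_segment_le hF hBA t
      _ = _ := by rw [setLIntegral_const]; simp
  have hmJ : Measurable fun z => ∫⁻ x in U, ∫⁻ t in Ioo (0 : ℝ) 1, F (z + t • (x - z)) := by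
    have h2 : Measurable fun q : (Plane × Plane) × ℝ => F (q.1.1 + q.2 • (q.1.2 - q.1.1)) := by
      fun_prop
    exact Measurable.lintegral_prod_right' (Measurable.lintegral_prod_right' h2)
  have hB0 : volume (ball c R) ≠ 0 := (measure_ball_pos _ _ hR).ne'
  have hBt : volume (ball c R) ≠ ∞ := measure_ball_lt_top.ne
  obtain ⟨z, hz, hle⟩ := exists_le_setLAverage hB0 hBt hmJ.aemeasurable
  refine ⟨g z, ?_⟩
  have hUB : volume U ≤ ENNReal.ofReal (d ^ 2 / R ^ 2) * volume (ball c R) := by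
    have hsub : U ⊆ closedBall c d := fun x hx => mem_closedBall.2 (hd x hx c h.center_mem)
    refine (measure_mono hsub).trans (le_of_eq ?_)
    rw [EuclideanSpace.volume_closedBall_fin_two, EuclideanSpace.volume_ball_fin_two, ← mul_assoc,
      ← ENNReal.ofReal_pow hd0, ← ENNReal.ofReal_pow hR.le,
      ← ENNReal.ofReal_mul (p := d ^ 2 / R ^ 2) (by positivity),
      div_mul_cancel₀ _ (by positivity)]
  have hD := dirichletForm_self_nonneg U g
  have hfin : ∫⁻ x in U, ENNReal.ofReal ((g x - g z) ^ 2) ≤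
      ENNReal.ofReal (4 * d ^ 4 / R ^ 2 * dirichletForm U g g) := by
    calc _ ≤ ∫⁻ x in U, ∫⁻ t in Ioo (0 : ℝ) 1, F (z + t • (x - z)) :=
          setLIntegral_mono' hU.measurableSet fun x hx => hpt x hx z hz
      _ ≤ _ := hle
      _ ≤ (4 * volume U * ∫⁻ x, F x) / volume (ball c R) := by
          rw [setLAverage_eq]; gcongr
      _ ≤ 4 * (ENNReal.ofReal (d ^ 2 / R ^ 2) * volume (ball c R)) * (∫⁻ x, F x) /
          volume (ball c R) := by gcongr
      _ = 4 * ENNReal.ofReal (d ^ 2 / R ^ 2) * ∫⁻ x, F x := by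
          rw [show 4 * (ENNReal.ofReal (d ^ 2 / R ^ 2) * volume (ball c R)) * (∫⁻ x, F x) =
            (4 * ENNReal.ofReal (d ^ 2 / R ^ 2) * ∫⁻ x, F x) * volume (ball c R) by ring,
            ENNReal.mul_div_cancel_right hB0 hBt]
      _ = _ := by
          rw [hFint, show (4 : ℝ≥0∞) = ENNReal.ofReal 4 by norm_num,
            ← ENNReal.ofReal_mul (by positivity), ← ENNReal.ofReal_mul (by positivity)]
          congr 1; ring
  have hint : IntegrableOn (fun x => (g x - g z) ^ 2) U :=
    ((hg.sub hU (memH1_const U (g z))).memLp hU hb).integrable_sq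
  rw [← ofReal_integral_eq_lintegral_ofReal hint (Eventually.of_forall fun x => sq_nonneg _)] at hfin
  exact (ENNReal.ofReal_le_ofReal_iff (by positivity)).1 hfin

end Poincare

section Trace

variable {U : Set Plane} {g : Plane → ℝ} {c a b : Plane} {R : ℝ}

theorem coord_parallelogram (hD : det2 (a - c) (b - c) ≠ 0) (t s : ℝ) :
    coordL c a b (AffineMap.lineMap a b t + s • (c - midpoint ℝ a b)) = 1 - t - s / 2 ∧
      coordR c a b (AffineMap.lineMap a b t + s • (c - midpoint ℝ a b)) = t - s / 2 := by
  refine coord_of_eq hD ?_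
  rw [midpoint_eq_smul_add, AffineMap.lineMap_apply, vsub_eq_sub, vadd_eq_add, invOf_eq_inv]
  match_scalars <;> ring

/-- A trace inequality for the middle half of an edge. -/
theorem IsStarDisc.lintegral_edge_le (h : IsStarDisc U c R) (hU : IsOpen U)
    (hD : det2 (a - c) (b - c) ≠ 0) (hseg : segment ℝ a b ⊆ frontier U)
    (hg : MemH1 U g) {d : ℝ} (hd : ‖c - midpoint ℝ a b‖ ≤ d) :
    ∫⁻ t in Ioo (1 / 4 : ℝ) (3 / 4), ENNReal.ofReal (g (AffineMap.lineMap a b t) ^ 2) ≤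
      ENNReal.ofReal |det2 (a - c) (b - c)|⁻¹ * ∫⁻ x in openTriangle c a b,
        ENNReal.ofReal (3 * g x ^ 2 + d ^ 2 * ‖∇ g x‖ ^ 2) := by
  -- The parallelogram of the points at parameter t in (1/4, 3/4) on the edge, shifted by `s • w`
  -- with s in (0, 1/2), lies in the triangle: the coordinates 1 − t − s/2 and t − s/2 are positive
  -- and their sum is 1 − s. The middle half of the edge suffices since the boundary data are
  -- polynomials there.
  set w := c - midpoint ℝ a b with hw
  set F : Plane → ℝ≥0∞ := (openTriangle c a b).indicator fun x =>
    ENNReal.ofReal (3 * g x ^ 2 + d ^ 2 * ‖∇ g x‖ ^ 2) with hFdef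
  have hT : IsOpen (openTriangle c a b) := isOpen_openTriangle
  have hTU := h.openTriangle_subset hD hseg
  have hF : Measurable F := ContinuousOn.measurable_indicator_ofReal hT
    (((hg.contDiffOn.continuousOn.mono hTU).pow 2 |>.const_smul (3 : ℝ)).add
      ((((hg.contDiffOn.continuousOn_gradient hU).mono hTU).norm.pow 2).const_smul (d ^ 2)))
  have hmem : ∀ t ∈ Ioo (1 / 4 : ℝ) (3 / 4), ∀ s ∈ Ioo (0 : ℝ) (1 / 2),
      AffineMap.lineMap a b t + s • w ∈ openTriangle c a b := by
    rintro t ⟨ht0, ht1⟩ s ⟨hs0, hs1⟩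
    obtain ⟨e0, e1⟩ := coord_parallelogram hD t s
    refine ⟨?_, ?_, ?_⟩
    · rw [e0]; linarith
    · rw [e1]; linarith
    · rw [e0, e1]; linarith
  have hpt : ∀ t ∈ Ioo (1 / 4 : ℝ) (3 / 4), ENNReal.ofReal (g (AffineMap.lineMap a b t) ^ 2) ≤
      ∫⁻ s in Ioo (0 : ℝ) (1 / 2), F (AffineMap.lineMap a b t + s • w) := by
    intro t ht
    have hcont : Continuous fun s : ℝ => (AffineMap.lineMap a b t : Plane) + s • w := by fun_prop
    have hcl : ∀ s ∈ Icc (0 : ℝ) (1 / 2), (AffineMap.lineMap a b t : Plane) + s • w ∈ closure U := by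
      intro s hs
      rw [← closure_Ioo (by norm_num : (0 : ℝ) ≠ 1 / 2)] at hs
      exact closure_mono hTU (map_mem_closure (f := fun s : ℝ => (AffineMap.lineMap a b t : Plane) + s • w) hcont hs
        fun s hs => hmem t ht s hs)
    have h1 := ofReal_sq_le_lintegral (f := fun s => g (AffineMap.lineMap a b t + s • w))
      (f' := fun s => ⟪∇ g (AffineMap.lineMap a b t + s • w), w⟫_ℝ)
      (hg.continuousOn.comp hcont.continuousOn hcl)
      (fun s hs => hasDerivAt_comp_add_smul hU hg.contDiffOn (hTU (hmem t ht s hs)))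
      (((hg.contDiffOn.continuousOn_gradient hU).comp hcont.continuousOn
        fun s hs => hTU (hmem t ht s hs)).inner continuousOn_const)
    simp only [zero_smul, add_zero] at h1
    refine h1.trans (setLIntegral_mono' measurableSet_Ioo fun s hs => ?_)
    rw [hFdef, indicator_of_mem (hmem t ht s hs)]
    exact ENNReal.ofReal_le_ofReal (add_le_add le_rfl (inner_sq_le_of_norm_le hd))
  have hdet : det2 (b - a) w = det2 (a - c) (b - c) := by
    rw [hw, midpoint_eq_smul_add]
    simp [det2]; ring
  have hm2 : Measurable fun p : ℝ × ℝ => F ((AffineMap.lineMap a b p.1 : Plane) + p.2 • w) := by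
    refine hF.comp ?_
    have : Continuous fun p : ℝ × ℝ => (AffineMap.lineMap a b p.1 : Plane) + p.2 • w := by
      simp only [AffineMap.lineMap_apply, vsub_eq_sub, vadd_eq_add]; fun_prop
    exact this.measurable
  calc _ ≤ ∫⁻ t in Ioo (1 / 4 : ℝ) (3 / 4), ∫⁻ s in Ioo (0 : ℝ) (1 / 2),
        F (AffineMap.lineMap a b t + s • w) := setLIntegral_mono' measurableSet_Ioo hpt
    _ ≤ ∫⁻ t, ∫⁻ s, F (AffineMap.lineMap a b t + s • w) :=
        (setLIntegral_le_lintegral _ _).trans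
          (lintegral_mono fun t => setLIntegral_le_lintegral _ _)
    _ = ∫⁻ p : ℝ × ℝ, F (a + (p.1 • (b - a) + p.2 • w)) := by
        rw [Measure.volume_eq_prod, lintegral_prod]
        · refine lintegral_congr fun t => lintegral_congr fun s => ?_
          rw [AffineMap.lineMap_apply, vsub_eq_sub, vadd_eq_add]
          congr 1; module
        · refine Measurable.aemeasurable ?_
          fun_prop
    _ = _ := by
        rw [lintegral_parallelogram hF a (b - a) w (by rwa [hdet]), hdet, hFdef,
          lintegral_indicator hT.measurableSet]

end Trace

end

/-! ### Gauss–Lobatto nodes and polynomials on an edge -/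

section

open MeasureTheory Set Filter Topology Metric
open scoped Gradient InnerProductSpace Laplacian ENNReal

section FiniteDimensional

/-- On a finite-dimensional space, every linear map is bounded with respect to every
inner product. -/
theorem exists_norm_sq_le_of_definite {X Y : Type*} [AddCommGroup X] [Module ℝ X]
    [FiniteDimensional ℝ X] [NormedAddCommGroup Y] [NormedSpace ℝ Y] (B : X → X → ℝ)
    (hsymm : ∀ x y, B x y = B y x) (hadd : ∀ x y z, B (x + y) z = B x z + B y z)
    (hsmul : ∀ (r : ℝ) x y, B (r • x) y = r * B x y) (hnn : ∀ x, 0 ≤ B x x)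
    (hdef : ∀ x, B x x = 0 → x = 0) (T : X →ₗ[ℝ] Y) :
    ∃ C : ℝ, 0 ≤ C ∧ ∀ x, ‖T x‖ ^ 2 ≤ C * B x x := by
  let core : InnerProductSpace.Core ℝ X :=
    { inner := B
      conj_inner_symm := fun x y => by rw [conj_trivial]; exact hsymm y x
      re_inner_nonneg := hnn
      add_left := hadd
      smul_left := fun x y r => by rw [conj_trivial]; exact hsmul r x y
      definite := hdef }
  letI : NormedAddCommGroup X := core.toNormedAddCommGroup
  letI : InnerProductSpace ℝ X := InnerProductSpace.ofCore core.toCore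
  let T' : X →L[ℝ] Y := LinearMap.toContinuousLinearMap T
  refine ⟨‖T'‖ ^ 2, sq_nonneg _, fun x => ?_⟩
  have h1 : ‖x‖ ^ 2 = B x x := (real_inner_self_eq_norm_sq x).symm
  calc ‖T x‖ ^ 2 ≤ (‖T'‖ * ‖x‖) ^ 2 := pow_le_pow_left₀ (norm_nonneg _) (T'.le_opNorm x) 2
    _ = _ := by rw [mul_pow, h1]

end FiniteDimensional

section GaussLobatto

open Polynomial in
/-- Rolle's theorem for the zeros of a polynomial. -/
theorem exists_finset_zeros_derivative {p : ℝ[X]} (s : Finset ℝ)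
    (hs : ∀ t ∈ s, t ∈ Icc (0 : ℝ) 1 ∧ p.eval t = 0) :
    ∃ s' : Finset ℝ, (∀ t ∈ s', t ∈ Ioo (0 : ℝ) 1 ∧ (derivative p).eval t = 0) ∧
      s.card ≤ s'.card + 1 := by
  classical
  by_cases hp : derivative p = 0
  · obtain ⟨s', h1, h2⟩ := (Ioo_infinite (zero_lt_one (α := ℝ))).exists_subset_card_eq s.card
    exact ⟨s', fun t ht => ⟨h1 ht, by simp [hp]⟩, by omega⟩
  refine ⟨(derivative p).roots.toFinset.filter fun t => t ∈ Ioo (0 : ℝ) 1, fun t ht => ?_, ?_⟩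
  · simp only [Finset.mem_filter, Multiset.mem_toFinset, mem_roots hp] at ht
    exact ⟨ht.2, ht.1⟩
  · refine (Finset.card_le_sdiff_of_interleaved (t := (derivative p).roots.toFinset.filter fun t =>
      t ∈ Ioo (0 : ℝ) 1) fun x hx y hy hxy _ => ?_).trans
      (Nat.add_le_add_right (Finset.card_le_card Finset.sdiff_subset) 1)
    obtain ⟨z, hz1, hz2⟩ := exists_deriv_eq_zero hxy p.continuous.continuousOn
      ((hs x hx).2.trans (hs y hy).2.symm)
    refine ⟨z, ?_, hz1⟩
    simp only [Finset.mem_filter, Multiset.mem_toFinset, mem_roots hp]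
    refine ⟨by rwa [Polynomial.deriv] at hz2, (hs x hx).1.1.trans_lt hz1.1,
      hz1.2.trans_le (hs y hy).1.2⟩

-- By Rodrigues' formula the Legendre polynomial is a multiple of the k-th derivative of xᵏ(1 − x)ᵏ.
-- Up to order k − 1 the derivatives vanish at 0 and 1, so repeated use of Rolle's theorem produces
-- k zeros of the k-th derivative in (0, 1) and k − 1 of the next one. The degree allows no more.
open Polynomial PolygonElement in
theorem exists_gaussLobatto (k : ℕ) (hk : 1 ≤ k) :
    ∃ s : Finset ℝ, (s : Set ℝ) = gaussLobatto k ∧ s.card = k - 1 := by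
  classical
  set Q : ℝ[X] := X ^ k * (1 - X) ^ k with hQ
  have hind : ∀ j ≤ k, ∃ s : Finset ℝ, (∀ t ∈ s, t ∈ Ioo (0 : ℝ) 1 ∧
      (derivative^[j] Q).eval t = 0) ∧ j ≤ s.card := by
    intro j
    induction j with
    | zero => exact fun _ => ⟨∅, by simp, le_rfl⟩
    | succ j ih =>
      intro hj
      obtain ⟨s, hs, hcard⟩ := ih (by omega)
      have h0 : (derivative^[j] Q).eval 0 = 0 := by
        obtain ⟨r, hr⟩ := pow_sub_dvd_iterate_derivative_of_pow_dvd (p := Q) (q := X) (n := k) j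
          (Dvd.intro _ rfl)
        rw [hr]; simp [show k - j ≠ 0 by omega]
      have h1 : (derivative^[j] Q).eval 1 = 0 := by
        obtain ⟨r, hr⟩ := pow_sub_dvd_iterate_derivative_of_pow_dvd (p := Q) (q := 1 - X) (n := k) j
          (Dvd.intro_left _ rfl)
        rw [hr]; simp [show k - j ≠ 0 by omega]
      obtain ⟨s', hs', hcard'⟩ := exists_finset_zeros_derivative (p := derivative^[j] Q)
        (insert 0 (insert 1 s)) (by
          intro t ht
          simp only [Finset.mem_insert] at ht
          rcases ht with rfl | rfl | ht
          · exact ⟨⟨le_rfl, zero_le_one⟩, h0⟩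
          · exact ⟨⟨zero_le_one, le_rfl⟩, h1⟩
          · exact ⟨Ioo_subset_Icc_self (hs t ht).1, (hs t ht).2⟩)
      refine ⟨s', ?_, ?_⟩
      · simpa only [Function.iterate_succ_apply'] using hs'
      · rw [Finset.card_insert_of_notMem, Finset.card_insert_of_notMem] at hcard'
        · omega
        · exact fun h => lt_irrefl _ (hs 1 h).1.2
        · rw [Finset.mem_insert, not_or]
          exact ⟨zero_ne_one, fun h => lt_irrefl _ (hs 0 h).1.1⟩
  obtain ⟨s, hs, hcard⟩ := hind k le_rfl
  obtain ⟨s', hs', hcard'⟩ := exists_finset_zeros_derivative (p := derivative^[k] Q) s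
    fun t ht => ⟨Ioo_subset_Icc_self (hs t ht).1, (hs t ht).2⟩
  set P : ℝ[X] := (shiftedLegendre k).map (Int.castRingHom ℝ) with hP
  have hrod : (k.factorial : ℝ[X]) * P = derivative^[k] Q := by
    have := congrArg (Polynomial.map (Int.castRingHom ℝ)) (factorial_mul_shiftedLegendre_eq k)
    rw [Polynomial.map_mul, ← iterate_derivative_map] at this
    simpa [hP, hQ] using this
  have hmem : ∀ t, aeval t (derivative (shiftedLegendre k)) = 0 ↔ (derivative P).eval t = 0 := by
    intro t
    rw [hP, derivative_map, eval_map, aeval_def]; rfl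
  have hdeg : P.natDegree = k := by
    rw [hP, natDegree_map_eq_of_injective Int.cast_injective, natDegree_shiftedLegendre]
  have hP' : derivative P ≠ 0 := fun h => by
    have := derivative_eq_zero.1 h
    omega
  have hder : derivative (derivative^[k] Q) = (k.factorial : ℝ[X]) * derivative P := by
    rw [← hrod, derivative_natCast_mul]
  have hfin : (derivative P).roots.toFinset.card ≤ k - 1 :=
    (Multiset.toFinset_card_le _).trans ((card_roots' _).trans
      ((natDegree_derivative_le P).trans (by omega)))
  have hsub : s' ⊆ (derivative P).roots.toFinset.filter fun t => t ∈ Ioo (0 : ℝ) 1 := by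
    intro t ht
    have h1 := (hs' t ht).2
    rw [hder, eval_mul, eval_natCast] at h1
    simp only [Finset.mem_filter, Multiset.mem_toFinset, mem_roots hP']
    exact ⟨(mul_eq_zero.1 h1).resolve_left (by exact_mod_cast k.factorial_ne_zero), (hs' t ht).1⟩
  refine ⟨(derivative P).roots.toFinset.filter fun t => t ∈ Ioo (0 : ℝ) 1, ?_, ?_⟩
  · ext t
    simp only [gaussLobatto, Finset.coe_filter, Multiset.mem_toFinset, mem_roots hP', mem_ofPred_eq,
      hmem, IsRoot.def]
    exact and_comm
  · have h1 := Finset.card_le_card hsub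
    have h2 := Finset.card_filter_le (derivative P).roots.toFinset fun t => t ∈ Ioo (0 : ℝ) 1
    omega

-- The symmetry of the Legendre polynomial. It is needed because two neighbouring elements may run
-- through a common edge in opposite directions.
open Polynomial PolygonElement in
theorem one_sub_mem_gaussLobatto {k : ℕ} {t : ℝ} (ht : t ∈ gaussLobatto k) :
    1 - t ∈ gaussLobatto k := by
  obtain ⟨⟨h0, h1⟩, h2⟩ := ht
  refine ⟨⟨by linarith, by linarith⟩, ?_⟩
  have h3 := congrArg (fun p => aeval t (derivative p))
    (neg_one_pow_mul_shiftedLegendre_comp_one_sub_X_eq k)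
  beta_reduce at h3
  rw [h2, show ((-1 : ℤ[X]) ^ k) = C ((-1) ^ k) by simp, derivative_C_mul, derivative_comp] at h3
  simpa [aeval_comp] using h3

open PolygonElement in
/-- The end points and the Gauss-Lobatto nodes. -/
theorem exists_edgeNodes (k : ℕ) (hk : 1 ≤ k) :
    ∃ s : Finset ℝ, (∀ t, t ∈ s ↔ t = 0 ∨ t = 1 ∨ t ∈ gaussLobatto k) ∧ s.card = k + 1 := by
  classical
  obtain ⟨s, hs, hc⟩ := exists_gaussLobatto k hk
  have hs' : ∀ t, t ∈ s ↔ t ∈ gaussLobatto k := fun t => by rw [← hs]; rfl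
  refine ⟨insert 0 (insert 1 s), fun t => by simp [hs'], ?_⟩
  rw [Finset.card_insert_of_notMem, Finset.card_insert_of_notMem, hc]
  · omega
  · rw [hs']; exact fun h => lt_irrefl _ h.1.2
  · rw [Finset.mem_insert, hs', not_or]
    exact ⟨zero_ne_one, fun h => lt_irrefl _ h.1.1⟩

open Polynomial PolygonElement in
theorem eq_of_eval_edgeNodes {k : ℕ} (hk : 1 ≤ k) {p q : ℝ[X]} (hp : p.natDegree ≤ k)
    (hq : q.natDegree ≤ k) (h0 : p.eval 0 = q.eval 0) (h1 : p.eval 1 = q.eval 1)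
    (h : ∀ t ∈ gaussLobatto k, p.eval t = q.eval t) : p = q := by
  obtain ⟨s, hs, hc⟩ := exists_edgeNodes k hk
  rw [← sub_eq_zero]
  refine eq_zero_of_natDegree_lt_card_of_eval_eq_zero' _ s (fun t ht => ?_) ?_
  · rw [eval_sub, sub_eq_zero]
    rcases (hs t).1 ht with rfl | rfl | ht
    exacts [h0, h1, h t ht]
  · have := natDegree_sub_le p q
    omega

open Polynomial PolygonElement in
theorem exists_edge_interpolant {k : ℕ} (hk : 1 ≤ k) (f : ℝ → ℝ) :
    ∃ p : ℝ[X], p.natDegree ≤ k ∧ p.eval 0 = f 0 ∧ p.eval 1 = f 1 ∧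
      ∀ t ∈ gaussLobatto k, p.eval t = f t := by
  obtain ⟨s, hs, hc⟩ := exists_edgeNodes k hk
  have hev : ∀ t ∈ s, (Lagrange.interpolate s id f).eval t = f t := fun t ht =>
    Lagrange.eval_interpolate_at_node (v := id) f (Function.injective_id.injOn) ht
  refine ⟨Lagrange.interpolate s id f, ?_, hev 0 ((hs 0).2 (Or.inl rfl)),
    hev 1 ((hs 1).2 (Or.inr (Or.inl rfl))), fun t ht => hev t ((hs t).2 (Or.inr (Or.inr ht)))⟩
  have h1 := Lagrange.degree_interpolate_lt (s := s) (v := id) f Function.injective_id.injOn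
  rw [hc] at h1
  exact natDegree_le_of_degree_le (Order.le_of_lt_succ h1)

theorem exists_eq_mul_of_eval_eq_zero {p : Polynomial ℝ} (h0 : p.eval 0 = 0) (h1 : p.eval 1 = 0) :
    ∃ q : Polynomial ℝ, p = Polynomial.X * (1 - Polynomial.X) * q := by
  obtain ⟨q, hq⟩ := Polynomial.dvd_iff_isRoot.2 (show p.IsRoot 0 from h0)
  rw [map_zero, sub_zero] at hq
  have h2 : q.IsRoot 1 := by
    rw [hq] at h1; simpa using h1
  obtain ⟨r, hr⟩ := Polynomial.dvd_iff_isRoot.2 h2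
  refine ⟨-r, ?_⟩
  rw [hq, hr, map_one]; ring

end GaussLobatto

section EdgeStability

open Polynomial PolygonElement

theorem finite_degreeLT (n : ℕ) : FiniteDimensional ℝ (degreeLT ℝ n) :=
  Module.Finite.equiv (degreeLTEquiv ℝ n).symm

/-- The difference `t (1 - t) q` of a polynomial `s` on an edge and its interpolant is bounded by
values of `s` in the middle half of the edge. -/
theorem exists_edge_stability (k : ℕ) (hk : 1 ≤ k) : ∃ C : ℝ, 0 ≤ C ∧ ∀ p s q : ℝ[X],
    p.natDegree ≤ k → s.natDegree ≤ 2 * k → p - s = X * (1 - X) * q →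
    (∀ t ∈ gaussLobatto k, p.eval t = s.eval t) → ∀ t ∈ Icc (0 : ℝ) 1,
      |q.eval t| ^ 2 ≤ C * ∫ t in Ioo (1 / 4 : ℝ) (3 / 4), s.eval t ^ 2 ∧
      |(derivative q).eval t| ^ 2 ≤ C * ∫ t in Ioo (1 / 4 : ℝ) (3 / 4), s.eval t ^ 2 := by
  have := finite_degreeLT (2 * k + 1)
  -- Pairs (s, q) for which p = s + x(1 − x)q has degree at most k and q vanishes at the inner
  -- nodes. On this finite-dimensional space ∫ s² over (1/4, 3/4) is definite: if s = 0, then x(1 −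
  -- x)q has degree at most k and vanishes at all k + 1 nodes, so q = 0. Equivalence of norms then
  -- gives a constant that depends on k only.
  let X₀ : Submodule ℝ (degreeLT ℝ (2 * k + 1) × degreeLT ℝ (2 * k + 1)) :=
    { carrier := {z | (z.1 : ℝ[X]) + X * (1 - X) * (z.2 : ℝ[X]) ∈ degreeLT ℝ (k + 1) ∧
        ∀ t ∈ gaussLobatto k, (z.2 : ℝ[X]).eval t = 0}
      zero_mem' := by simp
      add_mem' := by
        rintro a b ⟨ha1, ha2⟩ ⟨hb1, hb2⟩
        refine ⟨?_, fun t ht => by simp [ha2 t ht, hb2 t ht]⟩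
        have := add_mem ha1 hb1
        convert this using 1
        simp only [Prod.fst_add, Prod.snd_add, Submodule.coe_add]; ring
      smul_mem' := by
        rintro r a ⟨ha1, ha2⟩
        refine ⟨?_, fun t ht => by simp [ha2 t ht]⟩
        have := Submodule.smul_mem _ r ha1
        convert this using 1
        simp only [Prod.smul_fst, Prod.smul_snd, Submodule.coe_smul, smul_add, mul_smul_comm] }
  let B : X₀ → X₀ → ℝ := fun z z' => ∫ t in Ioo (1 / 4 : ℝ) (3 / 4),
    (z.1.1 : ℝ[X]).eval t * (z'.1.1 : ℝ[X]).eval t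
  have hint : ∀ p q : ℝ[X], IntegrableOn (fun t => p.eval t * q.eval t) (Ioo (1 / 4 : ℝ) (3 / 4)) :=
    fun p q => ((p.continuous.mul q.continuous).integrableOn_Icc).mono_set Ioo_subset_Icc_self
  have hsymm : ∀ x y, B x y = B y x := fun x y => by simp only [B, mul_comm]
  have hadd : ∀ x y z, B (x + y) z = B x z + B y z := fun x y z => by
    simp only [B]
    rw [← integral_add (hint _ _) (hint _ _)]
    refine integral_congr_ae (Eventually.of_forall fun t => ?_)
    simp [add_mul]
  have hsmul : ∀ (r : ℝ) x y, B (r • x) y = r * B x y := fun r x y => by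
    simp only [B]
    rw [← integral_const_mul]
    refine integral_congr_ae (Eventually.of_forall fun t => ?_)
    simp [mul_assoc]
  have hnn : ∀ x, 0 ≤ B x x := fun x => integral_nonneg fun t => mul_self_nonneg _
  have hdef : ∀ x, B x x = 0 → x = 0 := by
    rintro ⟨⟨s, q⟩, h1, h2⟩ h
    have h3 : (s : ℝ[X]) = 0 := by
      have h4 := (integral_eq_zero_iff_of_nonneg (fun t => mul_self_nonneg _)
        (hint (s : ℝ[X]) (s : ℝ[X]))).1 h
      have h5 := Measure.eqOn_open_of_ae_eq h4 isOpen_Ioo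
        ((s : ℝ[X]).continuous.mul (s : ℝ[X]).continuous).continuousOn continuousOn_const
      refine eq_zero_of_infinite_isRoot _ ((Ioo_infinite (by norm_num :
        (1 / 4 : ℝ) < 3 / 4)).mono fun t ht => ?_)
      exact mul_self_eq_zero.1 (h5 ht)
    have h6 : X * (1 - X) * (q : ℝ[X]) = 0 := by
      simp only [h3, zero_add] at h1
      refine eq_of_eval_edgeNodes hk ?_ (by simp) (by simp) (by simp) fun t ht => ?_
      · exact natDegree_le_of_degree_le (Order.le_of_lt_succ (mem_degreeLT.1 h1))
      · simp only at h2
        simp [h2 t ht]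
    have h7 : (q : ℝ[X]) = 0 := by
      rcases mul_eq_zero.1 h6 with h | h
      · exfalso
        have := congrArg (Polynomial.eval (1 / 2 : ℝ)) h
        norm_num at this
      · exact h
    ext1
    ext1
    · exact Subtype.ext h3
    · exact Subtype.ext h7
  let T₁ : X₀ →ₗ[ℝ] C(Icc (0 : ℝ) 1, ℝ) := (toContinuousMapOnAlgHom (Icc (0 : ℝ) 1)).toLinearMap ∘ₗ
    (degreeLT ℝ (2 * k + 1)).subtype ∘ₗ LinearMap.snd ℝ _ _ ∘ₗ X₀.subtype
  let T₂ : X₀ →ₗ[ℝ] C(Icc (0 : ℝ) 1, ℝ) := (toContinuousMapOnAlgHom (Icc (0 : ℝ) 1)).toLinearMap ∘ₗ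
    derivative ∘ₗ (degreeLT ℝ (2 * k + 1)).subtype ∘ₗ LinearMap.snd ℝ _ _ ∘ₗ X₀.subtype
  obtain ⟨C₁, hC₁, h₁⟩ := exists_norm_sq_le_of_definite B hsymm hadd hsmul hnn hdef T₁
  obtain ⟨C₂, hC₂, h₂⟩ := exists_norm_sq_le_of_definite B hsymm hadd hsmul hnn hdef T₂
  refine ⟨max C₁ C₂, le_max_of_le_left hC₁, fun p s q hp hs hq hgl t ht => ?_⟩
  have hs' : s ∈ degreeLT ℝ (2 * k + 1) := mem_degreeLT.2
    ((degree_le_of_natDegree_le hs).trans_lt (by exact_mod_cast Nat.lt_succ_self _))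
  have hp' : p ∈ degreeLT ℝ (k + 1) := mem_degreeLT.2
    ((degree_le_of_natDegree_le hp).trans_lt (by exact_mod_cast Nat.lt_succ_self _))
  have hq' : q ∈ degreeLT ℝ (2 * k + 1) := by
    rcases eq_or_ne q 0 with rfl | hq0
    · exact zero_mem _
    have h1 : (X * (1 - X) : ℝ[X]).natDegree = 2 := by compute_degree!
    have h2 : (X * (1 - X) : ℝ[X]) ≠ 0 := fun h => by rw [h] at h1; simp at h1
    have h3 := natDegree_mul h2 hq0
    rw [← hq, h1] at h3
    have h4 := natDegree_sub_le p s
    exact mem_degreeLT.2 (degree_le_natDegree.trans_lt (by exact_mod_cast (by omega)))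
  have hz : ∀ t ∈ gaussLobatto k, q.eval t = 0 := fun t ht => by
    have h1 := congrArg (Polynomial.eval t) hq
    simp only [eval_sub, hgl t ht, sub_self, eval_mul, eval_X, eval_one] at h1
    rcases mul_eq_zero.1 h1.symm with h | h
    · exact absurd h (mul_ne_zero ht.1.1.ne' (sub_pos.2 ht.1.2).ne')
    · exact h
  let z : X₀ := ⟨(⟨s, hs'⟩, ⟨q, hq'⟩), by
    refine ⟨?_, hz⟩
    rw [← hq, add_sub_cancel]; exact hp'⟩
  have hB : B z z = ∫ t in Ioo (1 / 4 : ℝ) (3 / 4), s.eval t ^ 2 := by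
    simp only [B, z, sq]
  have hnnz := hnn z
  rw [← hB]
  constructor
  · have h4 : |q.eval t| ≤ ‖T₁ z‖ := (T₁ z).norm_coe_le_norm ⟨t, ht⟩
    calc _ ≤ ‖T₁ z‖ ^ 2 := pow_le_pow_left₀ (abs_nonneg _) h4 2
      _ ≤ C₁ * B z z := h₁ z
      _ ≤ _ := mul_le_mul_of_nonneg_right (le_max_left _ _) hnnz
  · have h4 : |(derivative q).eval t| ≤ ‖T₂ z‖ := (T₂ z).norm_coe_le_norm ⟨t, ht⟩
    calc _ ≤ ‖T₂ z‖ ^ 2 := pow_le_pow_left₀ (abs_nonneg _) h4 2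
      _ ≤ C₂ * B z z := h₂ z
      _ ≤ _ := mul_le_mul_of_nonneg_right (le_max_right _ _) hnnz

end EdgeStability

end

/-! ### Friedrichs' inequality and the inverse estimate -/

section

open MeasureTheory Polynomial Set Filter Topology Metric
open scoped Gradient InnerProductSpace Laplacian ENNReal

section Friedrichs

variable {U : Set Plane} {c : Plane} {d : ℝ}

theorem hasFDerivAt_norm_sub_sq (c x : Plane) :
    HasFDerivAt (fun y : Plane => ‖y - c‖ ^ 2 / 4) ((1 / 2 : ℝ) • innerSL ℝ (x - c)) x := by
  have h1 := ((hasFDerivAt_id x).sub_const c).norm_sq.const_mul (1 / 4 : ℝ)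
  have h2 : (fun y : Plane => ‖y - c‖ ^ 2 / 4) = fun y => 1 / 4 * ‖id y - c‖ ^ 2 := by
    funext y; simp only [id]; ring
  rw [h2]
  refine h1.congr_fderiv ?_
  ext v
  simp
  ring

theorem contDiff_norm_sub_sq (c : Plane) {n : WithTop ℕ∞} :
    ContDiff ℝ n (fun y : Plane => ‖y - c‖ ^ 2 / 4) :=
  ((contDiff_id.sub contDiff_const).norm_sq ℝ).div_const 4

theorem laplacian_norm_sub_sq (c x : Plane) : (Δ (fun y => ‖y - c‖ ^ 2 / 4 : Plane → ℝ)) x = 1 := by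
  rw [laplacian_eq_sum_fderiv (contDiff_norm_sub_sq c).contDiffAt]
  have h1 : ∀ v : Plane, (fun y => fderiv ℝ (fun y : Plane => ‖y - c‖ ^ 2 / 4) y v) =
      fun y => (1 / 2 : ℝ) * ⟪v, y - c⟫_ℝ := fun v => by
    funext y
    rw [(hasFDerivAt_norm_sub_sq c y).fderiv]
    simp [inner_sub_left, inner_sub_right, real_inner_comm]
  have h2 : ∀ v : Plane, HasFDerivAt (fun y => (1 / 2 : ℝ) * ⟪v, y - c⟫_ℝ)
      ((1 / 2 : ℝ) • innerSL ℝ v) x := fun v => by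
    have := ((innerSL ℝ v).hasFDerivAt.comp x ((hasFDerivAt_id x).sub_const c)).const_mul (1 / 2 : ℝ)
    simpa [Function.comp_def] using this
  simp only [h1, (h2 _).fderiv, Fin.sum_univ_two]
  simp
  norm_num

/-- Friedrichs' inequality. -/
theorem MemH1.integral_sq_le (hU : IsOpen U) (hsub : U ⊆ closedBall c d) {φ : Plane → ℝ}
    (hφ : MemH1 U φ) (h0 : ∀ x ∈ frontier U, φ x = 0) :
    ∫ x in U, φ x ^ 2 ≤ d ^ 2 * dirichletForm U φ φ := by
  -- The function ψ = |x − c|²/4 has Laplacian 1. Green's formula for ψ and φ² gives ∫φ² = −∫ φ (x −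
  -- c)·∇φ, and half of the left-hand side is absorbed by Young's inequality.
  have hb : Bornology.IsBounded U := isBounded_closedBall.subset hsub
  have hψ := (contDiff_norm_sub_sq c (n := 1)).memH1 hU hb
  have hφ2 := hφ.mul hU hb hφ
  have hgreen := MemH1.dirichletForm_eq hU hb (contDiff_norm_sub_sq c (n := 2)).contDiffOn
    hψ.memLp_grad (K := 1) (fun x _ => by rw [laplacian_norm_sub_sq, abs_one]) hφ2
    (fun x hx => by simp [h0 x hx])
  have hsq : IntegrableOn (fun x => φ x ^ 2) U := (hφ.memLp hU hb).integrable_sq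
  have h1 : ∫ x in U, φ x ^ 2 = -dirichletForm U (fun y : Plane => ‖y - c‖ ^ 2 / 4) (φ * φ) := by
    rw [hgreen, neg_neg]
    refine integral_congr_ae (Eventually.of_forall fun x => ?_)
    simp only [laplacian_norm_sub_sq, Pi.mul_apply]; ring
  have h2 : ∫ x in U, φ x ^ 2 ≤ ∫ x in U, (φ x ^ 2 / 2 + d ^ 2 / 2 * ‖∇ φ x‖ ^ 2) := by
    conv_lhs => rw [h1]
    rw [dirichletForm, ← integral_neg]
    refine setIntegral_mono_on (hψ.integrableOn_inner hφ2).neg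
      ((hsq.div_const 2).add (hφ.integrableOn_sq.const_mul _)) hU.measurableSet fun x hx => ?_
    have hd := hφ.contDiffOn.differentiableAt_of_isOpen hU one_ne_zero hx
    have hg : ∇ (fun y : Plane => ‖y - c‖ ^ 2 / 4) x = (1 / 2 : ℝ) • (x - c) := by
      refine ext_inner_right ℝ fun v => ?_
      rw [inner_gradient_left, (hasFDerivAt_norm_sub_sq c x).fderiv]
      simp [real_inner_smul_left, inner_sub_left]
    rw [hg, gradient_mul_apply hd hd, ← add_smul, real_inner_smul_left, real_inner_smul_right]
    have hle := abs_real_inner_le_norm (x - c) (∇ φ x)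
    have hxd : ‖x - c‖ ≤ d := by
      have := hsub hx
      rwa [mem_closedBall, dist_eq_norm] at this
    have h3 : |⟪x - c, ∇ φ x⟫_ℝ| ≤ d * ‖∇ φ x‖ :=
      hle.trans (mul_le_mul_of_nonneg_right hxd (norm_nonneg _))
    have h4 : |φ x * ⟪x - c, ∇ φ x⟫_ℝ| ≤ |φ x| * (d * ‖∇ φ x‖) := by
      rw [abs_mul]; exact mul_le_mul_of_nonneg_left h3 (abs_nonneg _)
    have h5 := (abs_le.1 h4).1
    nlinarith [sq_nonneg (|φ x| - d * ‖∇ φ x‖), sq_abs (φ x)]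
  rw [integral_add (hsq.div_const 2) (hφ.integrableOn_sq.const_mul _), integral_div,
    integral_const_mul, ← dirichletForm_self] at h2
  linarith

end Friedrichs

section PolynomialFunctions

open MvPolynomial

theorem contDiff_mvPolynomial_eval (p : MvPolynomial (Fin 2) ℝ) {n : WithTop ℕ∞} :
    ContDiff ℝ n fun x : Plane => eval (fun j => x j) p := by
  induction p using MvPolynomial.induction_on with
  | C a => simpa using contDiff_const
  | add p q hp hq => simpa using hp.add hq
  | mul_X p i hp =>
    simp only [map_mul, MvPolynomial.eval_X]
    exact hp.mul (contDiff_piLp_apply (i := i) (p := 2))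

theorem totalDegree_aeval_le (p : MvPolynomial (Fin 2) ℝ) (f : Fin 2 → MvPolynomial (Fin 2) ℝ)
    (hf : ∀ j, (f j).totalDegree ≤ 1) : (aeval f p).totalDegree ≤ p.totalDegree := by
  rw [MvPolynomial.aeval_def, eval₂_eq]
  refine totalDegree_finsetSum_le fun m hm => ?_
  refine (totalDegree_mul _ _).trans ?_
  rw [algebraMap_eq, totalDegree_C, zero_add]
  refine (totalDegree_finsetProd _ _).trans ?_
  refine le_trans ?_ (le_totalDegree hm)
  rw [Finsupp.sum]
  refine Finset.sum_le_sum fun j _ => (totalDegree_pow _ _).trans ?_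
  exact mul_le_of_le_one_right' (hf j)

theorem eq_zero_of_eval_eq_zero_on_ball {p : MvPolynomial (Fin 2) ℝ} {c : Plane} {r : ℝ}
    (hr : 0 < r) (h : ∀ x ∈ ball c r, eval (fun j => x j) p = 0) : p = 0 := by
  refine funext_set (fun j => Ioo (c j - r / 2) (c j + r / 2))
    (fun j => Ioo_infinite (by linarith)) fun z hz => ?_
  rw [map_zero]
  refine h (WithLp.toLp 2 z) ?_
  rw [mem_ball, EuclideanSpace.dist_eq, Fin.sum_univ_two, Real.sqrt_lt' hr, Real.dist_eq,
    Real.dist_eq, sq_abs, sq_abs]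
  have h0 := hz 0 (mem_univ _)
  have h1 := hz 1 (mem_univ _)
  simp only [mem_Ioo] at h0 h1
  nlinarith

/-- A bump function with support in the disc of radius `ρ` times a polynomial. -/
noncomputable def bumpMul (ρ : ℝ) (p : MvPolynomial (Fin 2) ℝ) (y : Plane) : ℝ :=
  max (1 - ‖y‖ ^ 2 / ρ ^ 2) 0 ^ 2 * eval (fun j => y j) p

theorem contDiff_bumpMul (ρ : ℝ) (p : MvPolynomial (Fin 2) ℝ) : ContDiff ℝ 1 (bumpMul ρ p) :=
  (contDiff_posPart_sq.comp (contDiff_const.sub ((contDiff_id.norm_sq ℝ).div_const _))).mul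
    (contDiff_mvPolynomial_eval p)

theorem bumpMul_eq_zero {ρ : ℝ} (hρ : 0 < ρ) (p : MvPolynomial (Fin 2) ℝ) {y : Plane}
    (hy : ρ ≤ ‖y‖) : bumpMul ρ p y = 0 := by
  have : 1 - ‖y‖ ^ 2 / ρ ^ 2 ≤ 0 := by
    rw [sub_nonpos, one_le_div (by positivity)]
    exact pow_le_pow_left₀ hρ.le hy 2
  rw [bumpMul, max_eq_right this]; simp

theorem bumpMul_add (ρ : ℝ) (p q : MvPolynomial (Fin 2) ℝ) :
    bumpMul ρ (p + q) = bumpMul ρ p + bumpMul ρ q := by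
  funext y; simp [bumpMul, mul_add]

theorem bumpMul_smul (ρ r : ℝ) (p : MvPolynomial (Fin 2) ℝ) :
    bumpMul ρ (r • p) = r • bumpMul ρ p := by
  funext y; simp [bumpMul, smul_eval]; ring

theorem integrable_bumpMul_mul {ρ : ℝ} (hρ : 0 < ρ) (p q : MvPolynomial (Fin 2) ℝ) :
    Integrable fun y : Plane => bumpMul ρ p y * eval (fun j => y j) q := by
  refine Continuous.integrable_of_hasCompactSupport ((contDiff_bumpMul ρ p).continuous.mul
    (contDiff_mvPolynomial_eval q (n := 0)).continuous) ?_
  refine HasCompactSupport.mul_right ?_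
  refine HasCompactSupport.intro (isCompact_closedBall (0 : Plane) ρ) fun y hy => ?_
  rw [mem_closedBall_zero_iff, not_le] at hy
  exact bumpMul_eq_zero hρ p hy.le

/-- An inverse estimate for polynomials on the unit disc. -/
theorem exists_bump_stability (k : ℕ) {ρ : ℝ} (hρ : 0 < ρ) : ∃ C : ℝ, 0 ≤ C ∧
    ∀ p : MvPolynomial (Fin 2) ℝ, p.totalDegree ≤ k → ∀ y ∈ closedBall (0 : Plane) 1,
      (eval (fun j => y j) p) ^ 2 ≤ C * ∫ y : Plane, bumpMul ρ p y * eval (fun j => y j) p ∧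
      ‖fderiv ℝ (bumpMul ρ p) y‖ ^ 2 ≤ C * ∫ y : Plane, bumpMul ρ p y * eval (fun j => y j) p := by
  -- The weight of this form is positive in the disc of radius `ρ`, so the form is definite on
  -- polynomials. On the finite-dimensional space of degree at most `k` it dominates the maximum of
  -- p² and of the squared derivative of the bump times p, with constants depending on k and `ρ`.
  let W := restrictTotalDegree (Fin 2) ℝ k
  let B : W → W → ℝ := fun p q => ∫ y : Plane, bumpMul ρ p y * eval (fun j => y j) (q : MvPolynomial (Fin 2) ℝ)
  have hsymm : ∀ x y, B x y = B y x := fun x y => by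
    simp only [B]
    refine integral_congr_ae (Eventually.of_forall fun t => ?_)
    simp only [bumpMul]; ring
  have hadd : ∀ x y z, B (x + y) z = B x z + B y z := fun x y z => by
    simp only [B]
    rw [← integral_add (integrable_bumpMul_mul hρ _ _) (integrable_bumpMul_mul hρ _ _)]
    refine integral_congr_ae (Eventually.of_forall fun t => ?_)
    simp [bumpMul_add, add_mul]
  have hsmul : ∀ (r : ℝ) x y, B (r • x) y = r * B x y := fun r x y => by
    simp only [B]
    rw [← integral_const_mul]
    refine integral_congr_ae (Eventually.of_forall fun t => ?_)
    simp [bumpMul_smul, mul_assoc]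
  have hnn' : ∀ (p : MvPolynomial (Fin 2) ℝ) (y : Plane),
      0 ≤ bumpMul ρ p y * eval (fun j => y j) p := fun p y => by
    rw [bumpMul, mul_assoc]; exact mul_nonneg (sq_nonneg _) (mul_self_nonneg _)
  have hnn : ∀ x, 0 ≤ B x x := fun x => integral_nonneg fun t => hnn' _ _
  have hdef : ∀ x, B x x = 0 → x = 0 := by
    rintro ⟨p, hp⟩ h
    have h4 := (integral_eq_zero_iff_of_nonneg (hnn' p) (integrable_bumpMul_mul hρ p p)).1 h
    have h5 := (Continuous.ae_eq_iff_eq volume ((contDiff_bumpMul ρ p).continuous.mul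
      (contDiff_mvPolynomial_eval p (n := 0)).continuous) continuous_const).1 h4
    refine Subtype.ext (eq_zero_of_eval_eq_zero_on_ball (c := 0) hρ fun y hy => ?_)
    have h6 : bumpMul ρ p y * eval (fun j => y j) p = 0 := congrFun h5 y
    rw [bumpMul, mul_assoc] at h6
    rw [mem_ball_zero_iff] at hy
    have h7 : 0 < 1 - ‖y‖ ^ 2 / ρ ^ 2 := by
      rw [sub_pos, div_lt_one (by positivity)]
      exact pow_lt_pow_left₀ hy (norm_nonneg _) two_ne_zero
    rw [max_eq_left h7.le] at h6
    exact mul_self_eq_zero.1 ((mul_eq_zero.1 h6).resolve_left (by positivity))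
  let T₁ : W →ₗ[ℝ] C(closedBall (0 : Plane) 1, ℝ) :=
    { toFun := fun p => ⟨fun y => eval (fun j => (y : Plane) j) (p : MvPolynomial (Fin 2) ℝ),
        (contDiff_mvPolynomial_eval (p : MvPolynomial (Fin 2) ℝ)
          (n := 0)).continuous.comp continuous_subtype_val⟩
      map_add' := fun p q => by ext y; simp
      map_smul' := fun r p => by ext y; simp [smul_eval] }
  let T₂ : W →ₗ[ℝ] C(closedBall (0 : Plane) 1, Plane →L[ℝ] ℝ) :=
    { toFun := fun p => ⟨fun y => fderiv ℝ (bumpMul ρ p) y,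
        ((contDiff_bumpMul ρ p).continuous_fderiv one_ne_zero).comp continuous_subtype_val⟩
      map_add' := fun p q => by
        refine ContinuousMap.ext fun y => ?_
        show fderiv ℝ (bumpMul ρ ((p : MvPolynomial (Fin 2) ℝ) + q)) y = _
        rw [bumpMul_add, fderiv_add ((contDiff_bumpMul ρ p).differentiable one_ne_zero _)
          ((contDiff_bumpMul ρ q).differentiable one_ne_zero _)]
        rfl
      map_smul' := fun r p => by
        refine ContinuousMap.ext fun y => ?_
        show fderiv ℝ (bumpMul ρ (r • (p : MvPolynomial (Fin 2) ℝ))) y = _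
        rw [bumpMul_smul, fderiv_const_smul ((contDiff_bumpMul ρ p).differentiable one_ne_zero _)]
        rfl }
  have hcompact : CompactSpace (closedBall (0 : Plane) 1) :=
    isCompact_iff_compactSpace.1 (isCompact_closedBall _ _)
  obtain ⟨C₁, hC₁, h₁⟩ := exists_norm_sq_le_of_definite B hsymm hadd hsmul hnn hdef T₁
  obtain ⟨C₂, hC₂, h₂⟩ := exists_norm_sq_le_of_definite
    (Y := C(closedBall (0 : Plane) 1, Plane →L[ℝ] ℝ)) B hsymm hadd hsmul hnn hdef T₂
  refine ⟨max C₁ C₂, le_max_of_le_left hC₁, fun p hp y hy => ?_⟩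
  let z : W := ⟨p, (mem_restrictTotalDegree _ _ _).2 hp⟩
  constructor
  · have h4 : ‖eval (fun j => y j) p‖ ≤ ‖T₁ z‖ := (T₁ z).norm_coe_le_norm ⟨y, hy⟩
    calc _ = ‖eval (fun j => y j) p‖ ^ 2 := by rw [Real.norm_eq_abs, sq_abs]
      _ ≤ ‖T₁ z‖ ^ 2 := pow_le_pow_left₀ (norm_nonneg _) h4 2
      _ ≤ C₁ * B z z := h₁ z
      _ ≤ _ := mul_le_mul_of_nonneg_right (le_max_left _ _) (hnn z)
  · have h4 : ‖fderiv ℝ (bumpMul ρ p) y‖ ≤ ‖T₂ z‖ := (T₂ z).norm_coe_le_norm ⟨y, hy⟩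
    calc _ ≤ ‖T₂ z‖ ^ 2 := pow_le_pow_left₀ (norm_nonneg _) h4 2
      _ ≤ C₂ * B z z := h₂ z
      _ ≤ _ := mul_le_mul_of_nonneg_right (le_max_right _ _) (hnn z)

end PolynomialFunctions

section InverseEstimate

open MvPolynomial

/-- An inverse estimate for functions with a polynomial Laplacian. -/
theorem exists_inverse_estimate (k : ℕ) {ρ : ℝ} (hρ : 0 < ρ) : ∃ C : ℝ, 0 ≤ C ∧
    ∀ {U : Set Plane} {c : Plane} {d : ℝ} {u : Plane → ℝ} {q : MvPolynomial (Fin 2) ℝ},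
      IsOpen U → 0 < d → ball c (ρ * d) ⊆ U → U ⊆ closedBall c d → MemH1 U u →
      ContDiffOn ℝ 2 u U → q.totalDegree ≤ k → (∀ x ∈ U, (Δ u) x = eval (fun j => x j) q) →
      ∀ x ∈ U, (Δ u) x ^ 2 ≤ C / d ^ 4 * dirichletForm U u u := by
  obtain ⟨C, hC, hst⟩ := exists_bump_stability k hρ
  refine ⟨4 * C * C, by positivity, ?_⟩
  intro U c d u q hU hd hball hsub hu hu2 hq hΔ x hx
  have hb : Bornology.IsBounded U := isBounded_closedBall.subset hsub
  -- The Laplacian is pulled back to the unit disc, so that the constant of the reference situation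
  -- applies for every `c` and `d`.
  let p : MvPolynomial (Fin 2) ℝ := aeval (fun j => MvPolynomial.C (c j) + MvPolynomial.C d * X j) q
  have hpd : p.totalDegree ≤ k := by
    refine (totalDegree_aeval_le q _ fun j => ?_).trans hq
    refine (totalDegree_add _ _).trans (max_le (by simp) ?_)
    refine (totalDegree_mul _ _).trans ?_
    simp
  have hpe : ∀ x : Plane, eval (fun j => x j) q = eval (fun j => (d⁻¹ • (x - c)) j) p := by
    intro x
    simp only [p]
    rw [MvPolynomial.aeval_def, eval_eval₂]
    have : eval (fun j => x j) q = eval₂ (RingHom.id ℝ) (fun j => x j) q := rfl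
    rw [this]
    congr 1
    · ext r; simp
    · funext j
      simp
      field_simp
      ring
  let β := ∫ y : Plane, bumpMul ρ p y * eval (fun j => y j) p
  have hy : ∀ x ∈ U, d⁻¹ • (x - c) ∈ closedBall (0 : Plane) 1 := fun x hx => by
    have := hsub hx
    rw [mem_closedBall, dist_eq_norm] at this
    rw [mem_closedBall_zero_iff, norm_smul, norm_inv, Real.norm_of_nonneg hd.le,
      inv_mul_le_iff₀ hd, mul_one]
    exact this
  -- The test function is the Laplacian times a bump that is supported in the disc inside `U`; it
  -- vanishes on the boundary, so boundary values of `u` play no role. Green's formula gives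
  -- |∫∇u·∇φ| = d²β, and the energy of `φ` is at most 4Cβ. Hence d⁴β ≤ 4C ∫|∇u|², and β controls the
  -- maximum of (Δu)².
  let φ : Plane → ℝ := fun x => bumpMul ρ p (d⁻¹ • (x - c))
  have haff : ContDiff ℝ 1 fun x : Plane => d⁻¹ • (x - c) :=
    (contDiff_id.sub contDiff_const).const_smul _
  have hφ1 : ContDiff ℝ 1 φ := (contDiff_bumpMul ρ p).comp haff
  have hφ : MemH1 U φ := hφ1.memH1 hU hb
  have hφ0 : ∀ x, x ∉ U → φ x = 0 := fun x hx => by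
    refine bumpMul_eq_zero hρ p ?_
    have : x ∉ ball c (ρ * d) := fun h => hx (hball h)
    rw [mem_ball, dist_eq_norm, not_lt] at this
    rwa [norm_smul, norm_inv, Real.norm_of_nonneg hd.le, le_inv_mul_iff₀ hd, mul_comm]
  obtain ⟨K, hK⟩ := hb.isCompact_closure.exists_bound_of_continuousOn
    (contDiff_mvPolynomial_eval q (n := 0)).continuous.continuousOn
  have hgreen := MemH1.dirichletForm_eq hU hb hu2 hu.memLp_grad (K := K) (fun x hx => by
    rw [hΔ x hx]; exact hK x (subset_closure hx)) hφ
    (fun x hx => hφ0 x (notMem_of_mem_frontier hU hx))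
  have hint : ∫ x in U, (Δ u) x * φ x = d ^ 2 * β := by
    have e1 : ∫ x in U, (Δ u) x * φ x = ∫ x in U, eval (fun j => x j) q * φ x :=
      setIntegral_congr_fun hU.measurableSet fun x hx => by rw [hΔ x hx]
    rw [e1, setIntegral_eq_integral_of_forall_compl_eq_zero fun x hx => by rw [hφ0 x hx, mul_zero]]
    have e2 : ∀ x : Plane, eval (fun j => x j) q * φ x =
        (fun y : Plane => bumpMul ρ p y * eval (fun j => y j) p) (d⁻¹ • (x - c)) := fun x => by
      rw [hpe x]; simp only [φ]; ring
    simp only [e2]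
    have e3 := Measure.integral_comp_inv_smul_of_nonneg (volume : Measure Plane)
      (fun y : Plane => bumpMul ρ p y * eval (fun j => y j) p) hd.le
    rw [finrank_euclideanSpace, Fintype.card_fin, smul_eq_mul] at e3
    rw [← e3]
    exact integral_sub_right_eq_self (fun x => (fun y : Plane => bumpMul ρ p y *
      eval (fun j => y j) p) (d⁻¹ • x)) c
  have hD : dirichletForm U φ φ ≤ 4 * C * β := by
    have hpt : ∀ x ∈ U, ‖∇ φ x‖ ^ 2 ≤ (d ^ 2)⁻¹ * (C * β) := fun x hx => by
      have h1 : HasFDerivAt φ (d⁻¹ • fderiv ℝ (bumpMul ρ p) (d⁻¹ • (x - c))) x := by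
        have h2 : HasFDerivAt (fun x : Plane => d⁻¹ • (x - c))
            (d⁻¹ • ContinuousLinearMap.id ℝ Plane) x :=
          ((hasFDerivAt_id x).sub_const c).const_smul d⁻¹
        have h3 := ((contDiff_bumpMul ρ p).differentiable one_ne_zero
          (d⁻¹ • (x - c))).hasFDerivAt.comp x h2
        refine h3.congr_fderiv ?_
        ext v; simp
      rw [norm_gradient_eq, h1.fderiv, norm_smul, norm_inv, Real.norm_of_nonneg hd.le, mul_pow,
        inv_pow]
      exact mul_le_mul_of_nonneg_left (hst p hpd _ (hy x hx)).2 (by positivity)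
    rw [dirichletForm_self]
    have : IsFiniteMeasure (volume.restrict U) := isFiniteMeasure_restrict.2 hb.measure_lt_top.ne
    have hβC : 0 ≤ C * β := (sq_nonneg _).trans (hst p hpd _ (hy x hx)).1
    calc _ ≤ ∫ x in U, (d ^ 2)⁻¹ * (C * β) :=
          setIntegral_mono_on hφ.integrableOn_sq (integrable_const _) hU.measurableSet hpt
      _ = volume.real U * ((d ^ 2)⁻¹ * (C * β)) := by rw [setIntegral_const, smul_eq_mul]
      _ ≤ 4 * d ^ 2 * ((d ^ 2)⁻¹ * (C * β)) := by
          refine mul_le_mul_of_nonneg_right ?_ (by positivity)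
          refine (measureReal_mono hsub (isCompact_closedBall _ _).measure_ne_top).trans ?_
          rw [Measure.real, EuclideanSpace.volume_closedBall_fin_two, ENNReal.toReal_mul,
            ENNReal.toReal_pow, ENNReal.toReal_ofReal hd.le, ENNReal.toReal_ofReal Real.pi_pos.le]
          nlinarith [Real.pi_le_four, sq_nonneg d]
      _ = 4 * C * β := by field_simp
  have hcs := sq_dirichletForm_le hu hφ
  rw [hgreen, hint, neg_sq] at hcs
  have hDu := dirichletForm_self_nonneg U u
  have hβ : d ^ 4 * β ≤ 4 * C * dirichletForm U u u := by
    have h1 : (d ^ 2 * β) ^ 2 ≤ dirichletForm U u u * (4 * C * β) :=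
      hcs.trans (mul_le_mul_of_nonneg_left hD hDu)
    rcases le_or_gt β 0 with h0 | h0
    · have : d ^ 4 * β ≤ 0 := mul_nonpos_of_nonneg_of_nonpos (by positivity) h0
      exact this.trans (by positivity)
    · refine le_of_mul_le_mul_right ?_ h0
      nlinarith
  rw [hΔ x hx, hpe x]
  refine (hst p hpd _ (hy x hx)).1.trans ?_
  have h2 : C * β = C / d ^ 4 * (d ^ 4 * β) := by field_simp
  show C * β ≤ _
  rw [h2]
  calc _ ≤ C / d ^ 4 * (4 * C * dirichletForm U u u) := mul_le_mul_of_nonneg_left hβ (by positivity)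
    _ = _ := by ring

end InverseEstimate

end

/-! ### Stability of the local interpolation -/

section

open MeasureTheory Polynomial Set Filter Topology Metric
open scoped Gradient InnerProductSpace Laplacian ENNReal

namespace PolygonElement

variable {E : PolygonElement} {c : Plane} {R : ℝ} {k : ℕ} {u g : Plane → ℝ}

theorem MemVirtual.memH1 (hu : E.MemVirtual k u) : MemH1 E.carrier u where
  continuousOn := hu.continuousOn
  contDiffOn := hu.contDiffOn.of_le (by norm_num)
  memLp_grad := hu.memLp_grad

/-- The values of `g` on every edge form a polynomial of degree at most `m`. -/
def EdgePoly (E : PolygonElement) (m : ℕ) (g : Plane → ℝ) : Prop :=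
  ∀ i, ∃ p : Polynomial ℝ, p.natDegree ≤ m ∧
    ∀ t ∈ Icc (0 : ℝ) 1, g (AffineMap.lineMap (E.vert i) (E.vert (i + 1)) t) = p.eval t

theorem carrier_subset_closedBall (h : IsStarDisc E.carrier c R) :
    E.carrier ⊆ closedBall c (diam E.carrier) := fun _ hx =>
  mem_closedBall.2 (E.dist_le_diam (subset_closure hx) (subset_closure h.center_mem))

theorem norm_sub_midpoint_le (h : IsStarDisc E.carrier c R) (i : ZMod E.n) :
    ‖c - midpoint ℝ (E.vert i) (E.vert (i + 1))‖ ≤ diam E.carrier := by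
  rw [← dist_eq_norm]
  refine E.dist_le_diam (subset_closure h.center_mem)
    (frontier_subset_closure (E.edge_subset_frontier i ?_))
  exact midpoint_mem_segment _ _

/-- The trace inequality, summed over all edges. -/
theorem sum_integral_edge_le (h : IsStarDisc E.carrier c R)
    (hR : ∀ i, R ≤ dist (E.vert i) (E.vert (i + 1))) (hg : MemH1 E.carrier g)
    {s : ZMod E.n → Polynomial ℝ} (hs : ∀ i, ∀ t ∈ Icc (0 : ℝ) 1,
      g (AffineMap.lineMap (E.vert i) (E.vert (i + 1)) t) = (s i).eval t) :
    ∑ i, ∫ t in Ioo (1 / 4 : ℝ) (3 / 4), (s i).eval t ^ 2 ≤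
      1 / R ^ 2 * (3 * (∫ x in E.carrier, g x ^ 2) +
        diam E.carrier ^ 2 * dirichletForm E.carrier g g) := by
  have hRp := h.pos
  set f : Plane → ℝ := fun x => 3 * g x ^ 2 + diam E.carrier ^ 2 * ‖∇ g x‖ ^ 2 with hf
  have hfnn : ∀ x, 0 ≤ f x := fun x => by positivity
  have hg2 : IntegrableOn (fun x => g x ^ 2) E.carrier :=
    (hg.memLp E.isOpen_carrier E.isBounded_carrier).integrable_sq
  have hfint : IntegrableOn f E.carrier :=
    (hg2.const_mul 3).add (hg.integrableOn_sq.const_mul _)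
  let T := fun i => openTriangle c (E.vert i) (E.vert (i + 1))
  have hTU : ∀ i, T i ⊆ E.carrier := fun i =>
    h.openTriangle_subset (det2_ne_zero h i) (E.edge_subset_frontier i)
  have h1 : ∀ i, ∫ t in Ioo (1 / 4 : ℝ) (3 / 4), (s i).eval t ^ 2 ≤
      1 / R ^ 2 * ∫ x in T i, f x := by
    intro i
    have hle := h.lintegral_edge_le E.isOpen_carrier (det2_ne_zero h i) (E.edge_subset_frontier i)
      hg (norm_sub_midpoint_le h i)
    have e1 : ∫⁻ t in Ioo (1 / 4 : ℝ) (3 / 4),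
        ENNReal.ofReal (g (AffineMap.lineMap (E.vert i) (E.vert (i + 1)) t) ^ 2) =
        ENNReal.ofReal (∫ t in Ioo (1 / 4 : ℝ) (3 / 4), (s i).eval t ^ 2) := by
      rw [ofReal_integral_eq_lintegral_ofReal]
      · refine setLIntegral_congr_fun measurableSet_Ioo fun t ht => ?_
        rw [hs i t ⟨by linarith [ht.1], by linarith [ht.2]⟩]
      · exact (((s i).continuous.pow 2).integrableOn_Icc).mono_set Ioo_subset_Icc_self
      · exact Eventually.of_forall fun t => sq_nonneg _
    have hTint : IntegrableOn f (T i) := hfint.mono_set (hTU i)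
    have hTnn : 0 ≤ ∫ x in T i, f x := integral_nonneg hfnn
    rw [e1, ← ofReal_integral_eq_lintegral_ofReal hTint (Eventually.of_forall hfnn),
      ← ENNReal.ofReal_mul (by positivity),
      ENNReal.ofReal_le_ofReal_iff (mul_nonneg (by positivity) hTnn)] at hle
    refine hle.trans (mul_le_mul_of_nonneg_right ?_ hTnn)
    rw [one_div]
    exact inv_anti₀ (by positivity) (mul_self_le_abs_det2 h hR i)
  calc _ ≤ ∑ i, 1 / R ^ 2 * ∫ x in T i, f x := Finset.sum_le_sum fun i _ => h1 i
    _ = 1 / R ^ 2 * ∫ x in ⋃ i ∈ (Finset.univ : Finset (ZMod E.n)), T i, f x := by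
        rw [← Finset.mul_sum, integral_biUnion_finset]
        · exact fun i _ => isOpen_openTriangle.measurableSet
        · exact fun i _ j _ hij => disjoint_openTriangle h hij
        · exact fun i _ => hfint.mono_set (hTU i)
    _ ≤ 1 / R ^ 2 * ∫ x in E.carrier, f x := by
        refine mul_le_mul_of_nonneg_left (setIntegral_mono_set hfint
          (Eventually.of_forall hfnn) (LE.le.eventuallyLE ?_)) (by positivity)
        exact iUnion₂_subset fun i _ => hTU i
    _ = _ := by
        rw [hf, integral_add (hg2.const_mul 3) (hg.integrableOn_sq.const_mul _),
          integral_const_mul, integral_const_mul, ← dirichletForm_self]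

/-- An extension of the difference between a function and its interpolant on the boundary. -/
theorem exists_boundary_extension (k : ℕ) (hk : 1 ≤ k) {ρ : ℝ} (hρ : 0 < ρ) :
    ∃ C : ℝ, 0 ≤ C ∧ ∀ (E : PolygonElement) (c : Plane) (u g : Plane → ℝ),
      IsStarDisc E.carrier c (ρ * diam E.carrier) → E.IsShapeRegular ρ →
      E.EdgePoly k u → E.EdgePoly (2 * k) g → MemH1 E.carrier g →
      (∀ i, u (E.vert i) = g (E.vert i)) →
      (∀ i, ∀ t ∈ gaussLobatto k, u (AffineMap.lineMap (E.vert i) (E.vert (i + 1)) t) =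
        g (AffineMap.lineMap (E.vert i) (E.vert (i + 1)) t)) →
      ∃ r, MemH1 E.carrier r ∧ (∀ x ∈ frontier E.carrier, r x = u x - g x) ∧
        dirichletForm E.carrier r r ≤ C * dirichletForm E.carrier g g ∧
        ∫ x in E.carrier, r x ^ 2 ≤ C * diam E.carrier ^ 2 * dirichletForm E.carrier g g := by
  obtain ⟨C₀, hC₀, hst⟩ := exists_edge_stability k hk
  -- The factors 196 = 4·7² and 4 come from the energy and the mass of the bubbles, `C₀` from the
  -- stability on an edge, 12 = 3·4 from the trace inequality combined with Poincaré's inequality,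
  -- and 1/ρ² from the gradient term of the trace inequality.
  refine ⟨max (196 / ρ ^ 4) 4 * (C₀ * (12 / ρ ^ 4 + 1 / ρ ^ 2)), by positivity, ?_⟩
  intro E c u g h hE hu hg hg1 hv hn
  set d := diam E.carrier with hd
  have hd0 : 0 < d := E.diam_pos
  -- Subtracting the same constant from `u` and `g` does not change their difference on the
  -- boundary. With this choice the L² term of the trace inequality is bounded by the gradient of
  -- `g` alone.
  obtain ⟨γ, hγ⟩ := h.exists_integral_sub_sq_le E.isOpen_carrier E.isBounded_carrier hg1
    (d := d) fun x hx y hy => E.dist_le_diam (subset_closure hx) (subset_closure hy)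
  choose pu hpu hpu' using hu
  choose pg hpg hpg' using hg
  have h01 : (0 : ℝ) ∈ Icc (0 : ℝ) 1 := ⟨le_rfl, zero_le_one⟩
  have h11 : (1 : ℝ) ∈ Icc (0 : ℝ) 1 := ⟨zero_le_one, le_rfl⟩
  have hex : ∀ i, ∃ q, pu i - pg i = Polynomial.X * (1 - Polynomial.X) * q := fun i => by
    refine exists_eq_mul_of_eval_eq_zero ?_ ?_
    · rw [Polynomial.eval_sub, ← hpu' i 0 h01, ← hpg' i 0 h01, AffineMap.lineMap_apply_zero, hv,
        sub_self]
    · rw [Polynomial.eval_sub, ← hpu' i 1 h11, ← hpg' i 1 h11, AffineMap.lineMap_apply_one, hv,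
        sub_self]
  choose q hq using hex
  let s : ZMod E.n → Polynomial ℝ := fun i => pg i - Polynomial.C γ
  let I : ZMod E.n → ℝ := fun i => ∫ t in Ioo (1 / 4 : ℝ) (3 / 4), (s i).eval t ^ 2
  have hI : ∀ i, 0 ≤ C₀ * I i := fun i => mul_nonneg hC₀ (integral_nonneg fun t => sq_nonneg _)
  let A : ZMod E.n → ℝ := fun i => √(C₀ * I i)
  have hA : ∀ i, A i ^ 2 = C₀ * I i := fun i => Real.sq_sqrt (hI i)
  have hb : ∀ i, ∀ t ∈ Icc (0 : ℝ) 1, |(q i).eval t| ^ 2 ≤ C₀ * I i ∧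
      |(q i).derivative.eval t| ^ 2 ≤ C₀ * I i := fun i => by
    refine hst (pu i - Polynomial.C γ) (s i) (q i) ?_ ?_ ?_ ?_
    · exact (Polynomial.natDegree_sub_C).trans_le (hpu i)
    · exact (Polynomial.natDegree_sub_C).trans_le (hpg i)
    · rw [← hq i]; simp only [s]; ring
    · intro t ht
      have ht' := Ioo_subset_Icc_self ht.1
      simp only [s, Polynomial.eval_sub, ← hpu' i t ht', ← hpg' i t ht', hn i t ht]
  have hqA : ∀ i, ∀ t ∈ Icc (0 : ℝ) 1, |(q i).eval t| ≤ A i := fun i t ht =>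
    Real.le_sqrt_of_sq_le (hb i t ht).1
  have hqA' : ∀ i, ∀ t ∈ Icc (0 : ℝ) 1, |(q i).derivative.eval t| ≤ A i := fun i t ht =>
    Real.le_sqrt_of_sq_le (hb i t ht).2
  have hgγ : MemH1 E.carrier (g - fun _ => γ) := hg1.sub E.isOpen_carrier (memH1_const _ γ)
  have hDγ : dirichletForm E.carrier (g - fun _ => γ) (g - fun _ => γ) =
      dirichletForm E.carrier g g := by
    rw [dirichletForm_self, dirichletForm_self]
    refine setIntegral_congr_fun E.isOpen_carrier.measurableSet fun x hx => ?_
    simp only [norm_gradient_eq]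
    rw [show (g - fun _ => γ) = fun x => g x - γ from rfl, fderiv_sub_const]
  have hsum := sum_integral_edge_le h hE.2 hgγ (s := s) fun i t ht => by
    simp only [s, Polynomial.eval_sub, Polynomial.eval_C, ← hpg' i t ht]; rfl
  rw [hDγ] at hsum
  simp only [Pi.sub_apply] at hsum
  have hD := dirichletForm_self_nonneg E.carrier g
  have hsumA : ∑ i, A i ^ 2 ≤ C₀ * (12 / ρ ^ 4 + 1 / ρ ^ 2) * dirichletForm E.carrier g g := by
    simp only [hA]
    rw [← Finset.mul_sum, mul_assoc]
    refine mul_le_mul_of_nonneg_left (hsum.trans ?_) hC₀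
    have h2 : 3 * (∫ x in E.carrier, (g x - γ) ^ 2) + d ^ 2 * dirichletForm E.carrier g g ≤
        3 * (4 * d ^ 4 / (ρ * d) ^ 2 * dirichletForm E.carrier g g) +
          d ^ 2 * dirichletForm E.carrier g g := by
      linarith
    refine (mul_le_mul_of_nonneg_left h2 (by positivity)).trans (le_of_eq ?_)
    field_simp
    ring
  have hSnn : 0 ≤ ∑ i, A i ^ 2 := Finset.sum_nonneg fun i _ => sq_nonneg _
  refine ⟨E.bubbleSum c q, memH1_bubbleSum h q, fun x hx => ?_, ?_, ?_⟩
  · obtain ⟨i, t, ht, rfl⟩ := E.exists_lineMap_of_mem_frontier hx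
    rw [bubbleSum_lineMap h q i ht, hpu' i t ht, hpg' i t ht, ← Polynomial.eval_sub, hq i]
    simp
  · refine (dirichletForm_bubbleSum_le h hE.2 hqA hqA').trans ?_
    have : 4 * d ^ 2 * ((7 * (d / (ρ * d) ^ 2)) ^ 2 * ∑ i, A i ^ 2) =
        196 / ρ ^ 4 * ∑ i, A i ^ 2 := by
      field_simp; ring
    rw [this, mul_assoc]
    exact mul_le_mul (le_max_left _ _) hsumA hSnn (by positivity)
  · refine (integral_bubbleSum_sq_le h hqA).trans ?_
    calc 4 * d ^ 2 * ∑ i, A i ^ 2 = d ^ 2 * (4 * ∑ i, A i ^ 2) := by ring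
      _ ≤ d ^ 2 * (max (196 / ρ ^ 4) 4 *
          (C₀ * (12 / ρ ^ 4 + 1 / ρ ^ 2) * dirichletForm E.carrier g g)) := by
          refine mul_le_mul_of_nonneg_left ?_ (by positivity)
          exact mul_le_mul (le_max_right _ _) hsumA hSnn (by positivity)
      _ = _ := by ring

/-- Stability and approximation property of the local interpolation. -/
theorem exists_interpolation_stability (k : ℕ) (hk : 1 ≤ k) {ρ : ℝ} (hρ : 0 < ρ) :
    ∃ C : ℝ, 0 ≤ C ∧ ∀ (E : PolygonElement) (u g : Plane → ℝ), E.IsShapeRegular ρ →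
      E.MemVirtual k u → MemH1 E.carrier g → E.EdgePoly (2 * k) g → E.SameDof k u g →
      dirichletForm E.carrier u u ≤ C * dirichletForm E.carrier g g ∧
      ∫ x in E.carrier, (u x - g x) ^ 2 ≤
        C * diam E.carrier ^ 2 * dirichletForm E.carrier g g := by
  obtain ⟨C₁, hC₁, hext⟩ := exists_boundary_extension k hk hρ
  obtain ⟨C₂, hC₂, hinv⟩ := exists_inverse_estimate k hρ
  -- The energy of `u` will be a sum of three terms whose squares are at most 1, C₁ and 4C₂C₁ times
  -- the product of the energies of `u` and `g`; the factor 3 comes from the square of the sum.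
  set K := 3 * (1 + C₁ + 4 * C₂ * C₁) with hK
  refine ⟨K + 2 * (2 * K + 4 * (1 + C₁) + C₁), by positivity, ?_⟩
  intro E u g hE hu hg hgp hdof
  obtain ⟨c, h⟩ := hE.exists_isStarDisc hρ
  obtain ⟨r, hr, hrf, hrD, hrI⟩ := hext E c u g h hE hu.edge_poly hgp hg hdof.1 hdof.2.1
  have hU := E.isOpen_carrier
  have hb := E.isBounded_carrier
  have hu1 := hu.memH1
  set d := diam E.carrier with hd
  have hd0 : 0 < d := E.diam_pos
  have hgr := hg.add hU hr
  have hφ : MemH1 E.carrier (u - (g + r)) := hu1.sub hU hgr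
  have hφ0 : ∀ x ∈ frontier E.carrier, (u - (g + r)) x = 0 := fun x hx => by
    simp only [Pi.sub_apply, Pi.add_apply, hrf x hx]; ring
  obtain ⟨q, hq, hΔ⟩ := hu.laplacian_poly
  have hqk : q.totalDegree ≤ k := by
    rcases hq with rfl | hq
    · simp
    · omega
  have hbd := hinv hU hd0 h.ball_subset (carrier_subset_closedBall h) hu1 hu.contDiffOn hqk hΔ
  have hqc : ContinuousOn (fun x : Plane => MvPolynomial.eval (fun j => x j) q)
      (closure E.carrier) := (contDiff_mvPolynomial_eval q (n := 0)).continuous.continuousOn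
  have hqL : MemLp (fun x : Plane => MvPolynomial.eval (fun j => x j) q) 2
      (volume.restrict E.carrier) := hqc.memLp_two hU hb
  obtain ⟨M, hM⟩ := hb.isCompact_closure.exists_bound_of_continuousOn hqc
  have hgreen := MemH1.dirichletForm_eq hU hb hu.contDiffOn hu.memLp_grad (K := M)
    (fun x hx => by rw [hΔ x hx]; exact hM x (subset_closure hx)) hφ hφ0
  have hint : ∀ {w : Plane → ℝ}, MemH1 E.carrier w → IntegrableOn (fun x : Plane =>
      MvPolynomial.eval (fun j => x j) q * w x) E.carrier := fun hw =>
    hqL.integrable_mul (hw.memLp hU hb)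
  have hmom : ∫ x in E.carrier, MvPolynomial.eval (fun j => x j) q * u x =
      ∫ x in E.carrier, MvPolynomial.eval (fun j => x j) q * g x := by
    rcases hq with rfl | hq
    · simp
    · simpa only [mul_comm] using hdof.2.2 q hq
  set J := ∫ x in E.carrier, MvPolynomial.eval (fun j => x j) q * r x with hJ
  -- The decisive cancellation: the Laplacian of `u` is an admissible weight for the moments, so u −
  -- g contributes nothing and only the boundary correction `r` remains.
  have hgreen' : dirichletForm E.carrier u (u - (g + r)) = J := by
    have e1 : ∫ x in E.carrier, (Δ u) x * (u - (g + r)) x = ∫ x in E.carrier,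
        (MvPolynomial.eval (fun j => x j) q * u x - (MvPolynomial.eval (fun j => x j) q * g x +
          MvPolynomial.eval (fun j => x j) q * r x)) :=
      setIntegral_congr_fun hU.measurableSet fun x hx => by
        simp only [hΔ x hx, Pi.sub_apply, Pi.add_apply]; ring
    have e2 : IntegrableOn (fun x : Plane => MvPolynomial.eval (fun j => x j) q * g x +
      MvPolynomial.eval (fun j => x j) q * r x) E.carrier := (hint hg).add (hint hr)
    rw [hgreen, e1, integral_sub (hint hu1) e2,
      integral_add (hint hg) (hint hr), hmom]
    ring
  set Du := dirichletForm E.carrier u u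
  set Dg := dirichletForm E.carrier g g
  have hDu : 0 ≤ Du := dirichletForm_self_nonneg _ _
  have hDg : 0 ≤ Dg := dirichletForm_self_nonneg _ _
  have hDr : 0 ≤ dirichletForm E.carrier r r := dirichletForm_self_nonneg _ _
  have hsplit : Du = dirichletForm E.carrier u g + dirichletForm E.carrier u r + J := by
    have e1 := dirichletForm_sub_left hU hu1 hgr hu1
    rw [dirichletForm_add_left hU hg hr hu1, dirichletForm_comm _ _ u, hgreen',
      dirichletForm_comm _ g, dirichletForm_comm _ r] at e1
    linarith
  have hJ2 : J ^ 2 ≤ 4 * C₂ * C₁ * Du * Dg := by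
    have e1 := hqL.sq_integral_inner_le (hr.memLp hU hb)
    have e2 : ∫ x in E.carrier, ‖MvPolynomial.eval (fun j => x j) q‖ ^ 2 ≤
        4 * d ^ 2 * (C₂ / d ^ 4 * Du) := by
      have : IsFiniteMeasure (volume.restrict E.carrier) :=
        isFiniteMeasure_restrict.2 hb.measure_lt_top.ne
      calc _ ≤ ∫ x in E.carrier, C₂ / d ^ 4 * Du := by
            refine setIntegral_mono_on (hqL.integrable_norm_pow (by norm_num)) (integrable_const _)
              hU.measurableSet fun x hx => ?_
            rw [Real.norm_eq_abs, sq_abs, ← hΔ x hx]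
            exact hbd x hx
        _ = volume.real E.carrier * (C₂ / d ^ 4 * Du) := by rw [setIntegral_const, smul_eq_mul]
        _ ≤ _ := mul_le_mul_of_nonneg_right E.volume_real_carrier_le (by positivity)
    have e3 : J ^ 2 = (∫ x in E.carrier, ⟪MvPolynomial.eval (fun j => x j) q, r x⟫_ℝ) ^ 2 := by
      rw [hJ]; congr 2; funext x; simp [mul_comm]
    rw [e3]
    refine e1.trans ?_
    simp only [Real.norm_eq_abs, sq_abs] at e2 ⊢
    calc _ ≤ 4 * d ^ 2 * (C₂ / d ^ 4 * Du) * (C₁ * d ^ 2 * Dg) :=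
          mul_le_mul e2 hrI (integral_nonneg fun x => sq_nonneg _) (by positivity)
      _ = _ := by field_simp
  have h1 : dirichletForm E.carrier u g ^ 2 ≤ Du * Dg := sq_dirichletForm_le hu1 hg
  have h2 : dirichletForm E.carrier u r ^ 2 ≤ C₁ * Du * Dg :=
    (sq_dirichletForm_le hu1 hr).trans (by
      calc _ ≤ Du * (C₁ * Dg) := mul_le_mul_of_nonneg_left hrD hDu
        _ = _ := by ring)
  have hmain : Du ≤ K * Dg := by
    have h3 : Du * Du ≤ K * Dg * Du := by
      have : Du * Du = (dirichletForm E.carrier u g + dirichletForm E.carrier u r + J) ^ 2 := by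
        rw [← hsplit, sq]
      rw [this, hK]
      nlinarith [sq_nonneg (dirichletForm E.carrier u g - dirichletForm E.carrier u r),
        sq_nonneg (dirichletForm E.carrier u g - J), sq_nonneg (dirichletForm E.carrier u r - J)]
    rcases hDu.eq_or_lt with h0 | h0
    · rw [← h0]; positivity
    · exact le_of_mul_le_mul_right h3 h0
  constructor
  · refine hmain.trans (mul_le_mul_of_nonneg_right ?_ hDg)
    have : 0 ≤ K := by positivity
    linarith
  -- The approximation property: u − g is the sum of u − (g + r), which has zero boundary values and
  -- is subject to Friedrichs' inequality, and of `r`, whose L² norm is already bounded.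
  · have hF := hφ.integral_sq_le hU (carrier_subset_closedBall h) hφ0
    have hDφ : dirichletForm E.carrier (u - (g + r)) (u - (g + r)) ≤
        (2 * K + 4 * (1 + C₁)) * Dg := by
      have e1 := dirichletForm_add_self_le hU hu1 (hgr.smul hU (-1))
      have e2 : u + (-1 : ℝ) • (g + r) = u - (g + r) := by rw [neg_one_smul, sub_eq_add_neg]
      have e3 : dirichletForm E.carrier ((-1 : ℝ) • (g + r)) ((-1 : ℝ) • (g + r)) =
          dirichletForm E.carrier (g + r) (g + r) := by
        rw [dirichletForm_smul_left hU _ hgr, dirichletForm_comm,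
          dirichletForm_smul_left hU _ hgr]; ring
      have e4 := dirichletForm_add_self_le hU hg hr
      rw [e2, e3] at e1
      change _ ≤ 2 * (Du + _) at e1
      change _ ≤ 2 * (Dg + _) at e4
      nlinarith
    have hφ2 : IntegrableOn (fun x => (u - (g + r)) x ^ 2) E.carrier :=
      (hφ.memLp hU hb).integrable_sq
    have hr2 : IntegrableOn (fun x => r x ^ 2) E.carrier := (hr.memLp hU hb).integrable_sq
    have hug : IntegrableOn (fun x => (u x - g x) ^ 2) E.carrier :=
      ((hu1.sub hU hg).memLp hU hb).integrable_sq
    calc ∫ x in E.carrier, (u x - g x) ^ 2 ≤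
        ∫ x in E.carrier, (2 * (u - (g + r)) x ^ 2 + 2 * r x ^ 2) := by
          refine integral_mono hug ((hφ2.const_mul 2).add (hr2.const_mul 2)) fun x => ?_
          simp only [Pi.sub_apply, Pi.add_apply]
          nlinarith [sq_nonneg (u x - (g x + r x) - r x)]
      _ = 2 * (∫ x in E.carrier, (u - (g + r)) x ^ 2) + 2 * ∫ x in E.carrier, r x ^ 2 := by
          rw [integral_add (hφ2.const_mul 2) (hr2.const_mul 2), integral_const_mul,
            integral_const_mul]
      _ ≤ 2 * (d ^ 2 * ((2 * K + 4 * (1 + C₁)) * Dg)) + 2 * (C₁ * d ^ 2 * Dg) := by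
          refine add_le_add (mul_le_mul_of_nonneg_left (hF.trans
            (mul_le_mul_of_nonneg_left hDφ (by positivity))) zero_le_two)
            (mul_le_mul_of_nonneg_left hrI zero_le_two)
      _ = 2 * (2 * K + 4 * (1 + C₁) + C₁) * d ^ 2 * Dg := by ring
      _ ≤ _ := by
          refine mul_le_mul_of_nonneg_right (mul_le_mul_of_nonneg_right ?_ (by positivity)) hDg
          have : 0 ≤ K := by positivity
          linarith

end PolygonElement

end

/-! ### Polynomial right-hand sides and vertex interpolation -/

section

open MeasureTheory Polynomial Set Filter Topology Metric
open scoped Gradient InnerProductSpace Laplacian ENNReal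

theorem laplacian_add_smul_apply {f g : Plane → ℝ} {x : Plane} (hf : ContDiffAt ℝ 2 f x)
    (hg : ContDiffAt ℝ 2 g x) (r : ℝ) : (Δ (f + r • g)) x = (Δ f) x + r * (Δ g) x := by
  have h : ContDiffAt ℝ 2 (r • g) x := hg.const_smul r
  rw [ContDiffAt.laplacian_add hf h, InnerProductSpace.laplacian_smul _ hg, smul_eq_mul]

section LaplacianOfMonomials

/-- The monomial `x₀ ^ a * x₁ ^ b`. -/
def planeMonomial (a b : ℕ) (x : Plane) : ℝ := x 0 ^ a * x 1 ^ b

theorem contDiff_planeMonomial (a b : ℕ) {n : WithTop ℕ∞} : ContDiff ℝ n (planeMonomial a b) :=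
  ((contDiff_piLp_apply (i := (0 : Fin 2)) (p := 2)).pow a).mul
    ((contDiff_piLp_apply (i := (1 : Fin 2)) (p := 2)).pow b)

theorem fderiv_planeMonomial (a b : ℕ) (x v : Plane) :
    fderiv ℝ (planeMonomial a b) x v =
      a * planeMonomial (a - 1) b x * v 0 + b * planeMonomial a (b - 1) x * v 1 := by
  have h : ∀ i : Fin 2, HasFDerivAt (fun x : Plane => x i) (EuclideanSpace.proj (𝕜 := ℝ) i) x :=
    fun i => (EuclideanSpace.proj (𝕜 := ℝ) i : Plane →L[ℝ] ℝ).hasFDerivAt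
  have h1 : HasFDerivAt (planeMonomial a b) _ x := ((h 0).pow a).mul ((h 1).pow b)
  rw [h1.fderiv]
  simp [planeMonomial]
  ring

theorem laplacian_planeMonomial (a b : ℕ) (x : Plane) :
    (Δ (planeMonomial a b)) x = a * ((a - 1 : ℕ) : ℝ) * planeMonomial (a - 2) b x +
      b * ((b - 1 : ℕ) : ℝ) * planeMonomial a (b - 2) x := by
  rw [laplacian_eq_sum_fderiv (contDiff_planeMonomial a b).contDiffAt, Fin.sum_univ_two]
  have h0 : (fun y => fderiv ℝ (planeMonomial a b) y (EuclideanSpace.basisFun (Fin 2) ℝ 0)) =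
      fun y => (a : ℝ) * planeMonomial (a - 1) b y := by
    funext y; rw [fderiv_planeMonomial]; simp
  have h1 : (fun y => fderiv ℝ (planeMonomial a b) y (EuclideanSpace.basisFun (Fin 2) ℝ 1)) =
      fun y => (b : ℝ) * planeMonomial a (b - 1) y := by
    funext y; rw [fderiv_planeMonomial]; simp
  have hd : ∀ a b, DifferentiableAt ℝ (planeMonomial a b) x := fun a b =>
    (contDiff_planeMonomial a b (n := 1)).differentiable one_ne_zero x
  rw [h0, h1, fderiv_const_mul (hd _ _), fderiv_const_mul (hd _ _)]
  simp only [smul_apply, fderiv_planeMonomial, smul_eq_mul]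
  simp [Nat.sub_sub]
  ring

/-- The Laplacian of x₀^(a+2) x₁^b / ((a+2)(a+1)) is the required monomial plus a multiple of
x₀^(a+2) x₁^(b−2). The remainder is absent for b < 2 and is otherwise removed by induction on `b`.
-/
theorem exists_laplacian_eq_planeMonomial (b : ℕ) : ∀ a : ℕ, ∃ P : Plane → ℝ, ContDiff ℝ 2 P ∧
    ∀ x, (Δ P) x = planeMonomial a b x := by
  induction b using Nat.strong_induction_on with
  | _ b ih =>
    intro a
    have hc := contDiff_planeMonomial (a + 2) b (n := 2)
    set r : ℝ := ((a + 2 : ℕ) : ℝ) * ((a + 1 : ℕ) : ℝ) with hr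
    have hr0 : r ≠ 0 := by positivity
    have hlap : ∀ x, (Δ (r⁻¹ • planeMonomial (a + 2) b)) x = planeMonomial a b x +
        r⁻¹ * (b * ((b - 1 : ℕ) : ℝ)) * planeMonomial (a + 2) (b - 2) x := fun x => by
      rw [InnerProductSpace.laplacian_smul _ hc.contDiffAt, laplacian_planeMonomial, smul_eq_mul]
      simp only [Nat.add_sub_cancel, show a + 2 - 1 = a + 1 by omega, ← hr]
      field_simp
    by_cases hb : b < 2
    · refine ⟨r⁻¹ • planeMonomial (a + 2) b, contDiff_const.smul hc, fun x => ?_⟩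
      rw [hlap]
      have : (b : ℝ) * ((b - 1 : ℕ) : ℝ) = 0 := by interval_cases b <;> simp
      rw [this]; ring
    · obtain ⟨P, hP, hPl⟩ := ih (b - 2) (by omega) (a + 2)
      have hc' : ContDiff ℝ 2 (r⁻¹ • planeMonomial (a + 2) b) := contDiff_const.smul hc
      refine ⟨r⁻¹ • planeMonomial (a + 2) b + (-(r⁻¹ * (b * ((b - 1 : ℕ) : ℝ)))) • P,
        hc'.add (contDiff_const.smul hP), fun x => ?_⟩
      rw [laplacian_add_smul_apply hc'.contDiffAt hP.contDiffAt, hlap, hPl]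
      ring

theorem exists_laplacian_eq (q : MvPolynomial (Fin 2) ℝ) : ∃ P : Plane → ℝ, ContDiff ℝ 2 P ∧
    ∀ x, (Δ P) x = MvPolynomial.eval (fun j => x j) q := by
  induction q using MvPolynomial.induction_on' with
  | monomial m r =>
    obtain ⟨P, hP, hPl⟩ := exists_laplacian_eq_planeMonomial (m 1) (m 0)
    refine ⟨r • P, hP.const_smul r, fun x => ?_⟩
    rw [InnerProductSpace.laplacian_smul _ hP.contDiffAt, hPl, MvPolynomial.eval_monomial,
      Finsupp.prod_fintype _ _ (fun i => pow_zero _), Fin.prod_univ_two]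
    rfl
  | add p q hp hq =>
    obtain ⟨P, hP, hPl⟩ := hp
    obtain ⟨Q, hQ, hQl⟩ := hq
    exact ⟨P + Q, hP.add hQ, fun x => by
      rw [ContDiffAt.laplacian_add hP.contDiffAt hQ.contDiffAt, hPl, hQl, map_add]⟩

end LaplacianOfMonomials

section VertexInterpolation

/-- Lagrange interpolation in the plane: `L i j` is the affine function that varies in the direction
from `v j` to `v i` and takes the values 0 and 1 there. The degree is irrelevant; the polynomial
only has to provide an extension of the vertex values with finite energy. -/
theorem exists_mvPolynomial_interpolation {ι : Type*} [Fintype ι] (v : ι → Plane)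
    (hv : Function.Injective v) (f : ι → ℝ) :
    ∃ Q : MvPolynomial (Fin 2) ℝ, ∀ i, MvPolynomial.eval (fun j => v i j) Q = f i := by
  classical
  let L : ι → ι → MvPolynomial (Fin 2) ℝ := fun i j => MvPolynomial.C (‖v i - v j‖ ^ 2)⁻¹ *
    ∑ l, (MvPolynomial.X l - MvPolynomial.C (v j l)) * MvPolynomial.C (v i l - v j l)
  have hL0 : ∀ i j, MvPolynomial.eval (fun l => v j l) (L i j) = 0 := fun i j => by
    simp [L]
  have hL1 : ∀ i j, i ≠ j → MvPolynomial.eval (fun l => v i l) (L i j) = 1 := fun i j hij => by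
    have h1 : ‖v i - v j‖ ^ 2 ≠ 0 := by
      have := sub_ne_zero.2 (hv.ne hij)
      positivity
    have h2 : ‖v i - v j‖ ^ 2 = ∑ l, (v i l - v j l) * (v i l - v j l) := by
      rw [EuclideanSpace.real_norm_sq_eq]
      simp [sq]
    simp only [L, map_mul, MvPolynomial.eval_C, map_sum, map_sub, MvPolynomial.eval_X]
    rw [← h2, inv_mul_cancel₀ h1]
  refine ⟨∑ i, MvPolynomial.C (f i) * ∏ j ∈ Finset.univ.erase i, L i j, fun i => ?_⟩
  rw [map_sum, Finset.sum_eq_single i]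
  · rw [map_mul, map_prod, MvPolynomial.eval_C, Finset.prod_eq_one, mul_one]
    intro j hj
    exact hL1 i j (Finset.ne_of_mem_erase hj).symm
  · intro j _ hj
    rw [map_mul, map_prod, Finset.prod_eq_zero (Finset.mem_erase.2 ⟨hj.symm, Finset.mem_univ i⟩)
      (hL0 j i), mul_zero]
  · simp

theorem exists_polynomial_on_line (Q : MvPolynomial (Fin 2) ℝ) (a b : Plane) : ∃ p : ℝ[X],
    ∀ t : ℝ, MvPolynomial.eval (fun j => (AffineMap.lineMap a b t : Plane) j) Q = p.eval t := by
  induction Q using MvPolynomial.induction_on with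
  | C r => exact ⟨C r, fun t => by simp⟩
  | add p q hp hq =>
    obtain ⟨p', hp⟩ := hp
    obtain ⟨q', hq⟩ := hq
    exact ⟨p' + q', fun t => by simp [hp, hq]⟩
  | mul_X p i hp =>
    obtain ⟨p', hp⟩ := hp
    refine ⟨p' * (C (a i) + X * C (b i - a i)), fun t => ?_⟩
    rw [map_mul, hp, MvPolynomial.eval_X, eval_mul]
    congr 1
    simp [AffineMap.lineMap_apply]
    ring

end VertexInterpolation

/-! ### Unisolvence of the local degrees of freedom -/

namespace PolygonElement

variable {E : PolygonElement} {c : Plane} {R : ℝ} {k : ℕ} {u v g : Plane → ℝ}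

/-- Continuous piecewise polynomial boundary values have an extension with finite energy. -/
theorem exists_extension (h : IsStarDisc E.carrier c R) (f : ZMod E.n → ℝ) (p : ZMod E.n → ℝ[X])
    (h0 : ∀ i, (p i).eval 0 = f i) (h1 : ∀ i, (p i).eval 1 = f (i + 1)) :
    ∃ Φ, MemH1 E.carrier Φ ∧ ∀ i, ∀ t ∈ Icc (0 : ℝ) 1,
      Φ (AffineMap.lineMap (E.vert i) (E.vert (i + 1)) t) = (p i).eval t := by
  obtain ⟨Q, hQ⟩ := exists_mvPolynomial_interpolation E.vert E.vert_injective f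
  choose l hl using fun i => exists_polynomial_on_line Q (E.vert i) (E.vert (i + 1))
  have hex : ∀ i, ∃ q, p i - l i = X * (1 - X) * q := fun i => by
    refine exists_eq_mul_of_eval_eq_zero ?_ ?_
    · rw [eval_sub, ← hl, AffineMap.lineMap_apply_zero, hQ, h0, sub_self]
    · rw [eval_sub, ← hl, AffineMap.lineMap_apply_one, hQ, h1, sub_self]
  choose q hq using hex
  refine ⟨(fun x => MvPolynomial.eval (fun j => x j) Q) + E.bubbleSum c q,
    ((contDiff_mvPolynomial_eval Q).memH1 E.isOpen_carrier E.isBounded_carrier).add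
      E.isOpen_carrier (memH1_bubbleSum h q), fun i t ht => ?_⟩
  rw [Pi.add_apply, bubbleSum_lineMap h q i ht, hl]
  have := congrArg (Polynomial.eval t) (hq i)
  simp only [eval_sub, eval_mul, eval_X, eval_one] at this
  linarith

theorem eq_zero_of_dirichletForm_nonpos (h : IsStarDisc E.carrier c R) {φ : Plane → ℝ}
    (hφ : MemH1 E.carrier φ) (h0 : ∀ x ∈ frontier E.carrier, φ x = 0)
    (hD : dirichletForm E.carrier φ φ ≤ 0) : ∀ x ∈ closure E.carrier, φ x = 0 := by
  have h1 := hφ.integral_sq_le E.isOpen_carrier (carrier_subset_closedBall h) h0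
  have h2 : ∫ x in E.carrier, φ x ^ 2 = 0 := le_antisymm
    (h1.trans (mul_nonpos_of_nonneg_of_nonpos (sq_nonneg _) hD)) (integral_nonneg fun x => sq_nonneg _)
  have h3 := (integral_eq_zero_iff_of_nonneg (fun x => sq_nonneg _)
    (hφ.memLp E.isOpen_carrier E.isBounded_carrier).integrable_sq).1 h2
  have h4 := Measure.eqOn_open_of_ae_eq h3 E.isOpen_carrier (hφ.contDiffOn.continuousOn.pow 2)
    continuousOn_const
  intro x hx
  by_cases hxU : x ∈ E.carrier
  · exact pow_eq_zero_iff two_ne_zero |>.1 (h4 hxU)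
  · exact h0 x (by rw [E.isOpen_carrier.frontier_eq]; exact ⟨hx, hxU⟩)

theorem MemVirtual.sub (hu : E.MemVirtual k u) (hv : E.MemVirtual k v) :
    E.MemVirtual k (u - v) := by
  have := hu.add (hv.smul (-1))
  rwa [neg_one_smul, ← sub_eq_add_neg] at this

/-- Green's formula for virtual functions. -/
theorem MemVirtual.exists_dirichletForm_eq (hu : E.MemVirtual k u) :
    ∃ q : MvPolynomial (Fin 2) ℝ, (q = 0 ∨ q.totalDegree + 2 ≤ k) ∧
      ∀ φ, MemH1 E.carrier φ → (∀ x ∈ frontier E.carrier, φ x = 0) →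
        dirichletForm E.carrier u φ =
          -∫ x in E.carrier, φ x * MvPolynomial.eval (fun j => x j) q := by
  obtain ⟨q, hq, hΔ⟩ := hu.laplacian_poly
  refine ⟨q, hq, fun φ hφ h0 => ?_⟩
  obtain ⟨M, hM⟩ := E.isBounded_carrier.isCompact_closure.exists_bound_of_continuousOn
    (contDiff_mvPolynomial_eval q (n := 0)).continuous.continuousOn
  rw [MemH1.dirichletForm_eq E.isOpen_carrier E.isBounded_carrier hu.contDiffOn hu.memLp_grad
    (K := M) (fun x hx => by rw [hΔ x hx]; exact hM x (subset_closure hx)) hφ h0]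
  congr 1
  refine setIntegral_congr_fun E.isOpen_carrier.measurableSet fun x hx => ?_
  simp only [hΔ x hx, mul_comm]

/-- A virtual function is determined by its degrees of freedom. -/
theorem MemVirtual.eqOn_of_sameDof (hk : 1 ≤ k) (h : IsStarDisc E.carrier c R)
    (hu : E.MemVirtual k u) (hv : E.MemVirtual k v) (hd : E.SameDof k u v) :
    EqOn u v (closure E.carrier) := by
  have hw := hu.sub hv
  have h0 : ∀ x ∈ frontier E.carrier, (u - v) x = 0 := fun x hx => by
    obtain ⟨i, t, ht, rfl⟩ := E.exists_lineMap_of_mem_frontier hx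
    obtain ⟨p, hp, hp'⟩ := hu.edge_poly i
    obtain ⟨q, hq, hq'⟩ := hv.edge_poly i
    have h01 : (0 : ℝ) ∈ Icc (0 : ℝ) 1 := ⟨le_rfl, zero_le_one⟩
    have h11 : (1 : ℝ) ∈ Icc (0 : ℝ) 1 := ⟨zero_le_one, le_rfl⟩
    have hpq : p = q := by
      refine eq_of_eval_edgeNodes hk hp hq ?_ ?_ fun s hs => ?_
      · rw [← hp' 0 h01, ← hq' 0 h01, AffineMap.lineMap_apply_zero, hd.1]
      · rw [← hp' 1 h11, ← hq' 1 h11, AffineMap.lineMap_apply_one, hd.1]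
      · have hs' := Ioo_subset_Icc_self hs.1
        rw [← hp' s hs', ← hq' s hs', hd.2.1 i s hs]
    rw [Pi.sub_apply, hp' t ht, hq' t ht, hpq, sub_self]
  obtain ⟨q, hq, hgreen⟩ := hw.exists_dirichletForm_eq
  -- By Green's formula the energy of u − v is, up to sign, its integral against its own Laplacian,
  -- a polynomial of degree at most k − 2; this is a difference of equal moments.
  have hD : dirichletForm E.carrier (u - v) (u - v) ≤ 0 := by
    rw [hgreen _ hw.memH1 h0]
    rcases hq with rfl | hq
    · simp
    · have hqL : MemLp (fun x : Plane => MvPolynomial.eval (fun j => x j) q) 2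
          (volume.restrict E.carrier) :=
        (contDiff_mvPolynomial_eval q (n := 0)).continuous.continuousOn.memLp_two
          E.isOpen_carrier E.isBounded_carrier
      have e1 := hd.2.2 q hq
      have hi : ∀ {f : Plane → ℝ}, MemH1 E.carrier f → IntegrableOn (fun x : Plane =>
          f x * MvPolynomial.eval (fun j => x j) q) E.carrier := fun hf =>
        (hf.memLp E.isOpen_carrier E.isBounded_carrier).integrable_mul hqL
      simp only [Pi.sub_apply, sub_mul]
      rw [integral_sub (hi hu.memH1) (hi hv.memH1), e1]
      simp
  intro x hx
  exact sub_eq_zero.1 (eq_zero_of_dirichletForm_nonpos h hw.memH1 h0 hD x hx)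

/-- The Dirichlet problem with polynomial right-hand side. -/
theorem exists_dirichlet_solution (h : IsStarDisc E.carrier c R) {Φ : Plane → ℝ}
    (hΦ : MemH1 E.carrier Φ) (q : MvPolynomial (Fin 2) ℝ) :
    ∃ u, MemH1 E.carrier u ∧ ContDiffOn ℝ 2 u E.carrier ∧
      (∀ x ∈ E.carrier, (Δ u) x = MvPolynomial.eval (fun j => x j) q) ∧
      EqOn u Φ (frontier E.carrier) := by
  -- Subtracting a smooth solution of ΔP = q leaves a harmonic problem with boundary values Φ − P.
  -- Since Φ − P has finite energy, so has the harmonic function.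
  obtain ⟨P, hP, hPl⟩ := exists_laplacian_eq q
  have hP1 : MemH1 E.carrier P := (hP.of_le (by norm_num)).memH1 E.isOpen_carrier E.isBounded_carrier
  have hΨ := hΦ.sub E.isOpen_carrier hP1
  obtain ⟨w, hw1, hw2, hw3, hw4⟩ := exists_dirichlet_of_ray E.isOpen_carrier E.isBounded_carrier
    (hΨ.continuousOn.mono frontier_subset_closure) fun y hy => h.exterior_ray E.isOpen_carrier hy
  have hw := MemH1.of_harmonic E.isOpen_carrier E.isBounded_carrier hw2 hw1 hw3 hΨ hw4
  refine ⟨w + P, hw.add E.isOpen_carrier hP1, hw2.add hP.contDiffOn, fun x hx => ?_, fun x hx => ?_⟩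
  · rw [ContDiffAt.laplacian_add (hw2.contDiffAt (E.isOpen_carrier.mem_nhds hx)) hP.contDiffAt,
      hw3 x hx, hPl, zero_add]
  · rw [Pi.add_apply, hw4 hx, Pi.sub_apply, sub_add_cancel]

theorem memVirtual_of_solution {q : MvPolynomial (Fin 2) ℝ} {Φ : Plane → ℝ}
    (hq : q = 0 ∨ q.totalDegree + 2 ≤ k) (hu : MemH1 E.carrier u) (hu2 : ContDiffOn ℝ 2 u E.carrier)
    (hΔ : ∀ x ∈ E.carrier, (Δ u) x = MvPolynomial.eval (fun j => x j) q)
    (heq : EqOn u Φ (frontier E.carrier)) (hΦ : E.EdgePoly k Φ) : E.MemVirtual k u where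
  continuousOn := hu.continuousOn
  edge_poly i := by
    obtain ⟨p, hp, hp'⟩ := hΦ i
    exact ⟨p, hp, fun t ht => by
      rw [heq (E.edge_subset_frontier i (E.lineMap_mem_edge i ht)), hp' t ht]⟩
  contDiffOn := hu2
  laplacian_poly := ⟨q, hq, hΔ⟩
  memLp_grad := hu.memLp_grad

/-- There is a virtual function with zero boundary values and arbitrary moments. -/
theorem exists_memVirtual_moments (h : IsStarDisc E.carrier c R) (m : ℕ)
    (F : Module.Dual ℝ (MvPolynomial.restrictTotalDegree (Fin 2) ℝ m)) :
    ∃ u, E.MemVirtual (m + 2) u ∧ (∀ x ∈ frontier E.carrier, u x = 0) ∧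
      ∀ p : MvPolynomial.restrictTotalDegree (Fin 2) ℝ m,
        ∫ x in E.carrier, u x * MvPolynomial.eval (fun j => x j) (p : MvPolynomial (Fin 2) ℝ) =
          F p := by
  let W := MvPolynomial.restrictTotalDegree (Fin 2) ℝ m
  have hWd : ∀ q : W, (q : MvPolynomial (Fin 2) ℝ) = 0 ∨
      (q : MvPolynomial (Fin 2) ℝ).totalDegree + 2 ≤ m + 2 := fun q =>
    Or.inr (Nat.add_le_add_right ((MvPolynomial.mem_restrictTotalDegree _ _ _).1 q.2) 2)
  choose w hw1 hw2 hwΔ hw0 using fun q : W => exists_dirichlet_solution h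
    (memH1_const E.carrier 0) (q : MvPolynomial (Fin 2) ℝ)
  have hz : E.EdgePoly (m + 2) (fun _ => (0 : ℝ)) := fun i => ⟨0, by simp, by simp⟩
  have hwV : ∀ q, E.MemVirtual (m + 2) (w q) := fun q =>
    memVirtual_of_solution (hWd q) (hw1 q) (hw2 q) (hwΔ q) (hw0 q) hz
  have huniq : ∀ φ, MemH1 E.carrier φ → ContDiffOn ℝ 2 φ E.carrier →
      (∀ x ∈ E.carrier, (Δ φ) x = 0) → (∀ x ∈ frontier E.carrier, φ x = 0) →
      ∀ x ∈ E.carrier, φ x = 0 := fun φ hφ hφ2 hφΔ hφ0 x hx => by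
    refine eq_zero_of_dirichletForm_nonpos h hφ hφ0 ?_ x (subset_closure hx)
    have := MemH1.dirichletForm_eq E.isOpen_carrier E.isBounded_carrier hφ2 hφ.memLp_grad (K := 0)
      (fun x hx => by rw [hφΔ x hx, abs_zero]) hφ hφ0
    rw [this, setIntegral_congr_fun E.isOpen_carrier.measurableSet
      (g := fun _ => (0 : ℝ)) fun x hx => by simp only [hφΔ x hx, zero_mul]]
    simp
  have hcd : ∀ q, ∀ x ∈ E.carrier, ContDiffAt ℝ 2 (w q) x := fun q x hx =>
    (hw2 q).contDiffAt (E.isOpen_carrier.mem_nhds hx)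
  have hadd : ∀ p q, ∀ x ∈ E.carrier, w (p + q) x = w p x + w q x := fun p q x hx => by
    have := huniq (w (p + q) - (w p + w q)) ((hw1 _).sub E.isOpen_carrier
      ((hw1 p).add E.isOpen_carrier (hw1 q))) ((hw2 _).sub ((hw2 p).add (hw2 q)))
      (fun x hx => by
        have e : w (p + q) - (w p + w q) = w (p + q) + (-1 : ℝ) • (w p + w q) := by
          rw [neg_one_smul, sub_eq_add_neg]
        rw [e, laplacian_add_smul_apply (g := w p + w q) (hcd _ x hx)
          ((hcd p x hx).add (hcd q x hx)),
          ContDiffAt.laplacian_add (hcd p x hx) (hcd q x hx), hwΔ _ x hx, hwΔ _ x hx, hwΔ _ x hx]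
        simp) (fun x hx => by simp [hw0 _ hx]) x hx
    simpa [sub_eq_zero] using this
  have hsmul : ∀ (r : ℝ) q, ∀ x ∈ E.carrier, w (r • q) x = r * w q x := fun r q x hx => by
    have := huniq (w (r • q) - r • w q) ((hw1 _).sub E.isOpen_carrier
      ((hw1 q).smul E.isOpen_carrier r)) ((hw2 _).sub ((hw2 q).const_smul r))
      (fun x hx => by
        have e : w (r • q) - r • w q = w (r • q) + (-r) • w q := by
          rw [neg_smul, sub_eq_add_neg]
        rw [e, laplacian_add_smul_apply (hcd _ x hx) (hcd q x hx), hwΔ _ x hx, hwΔ _ x hx]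
        simp [MvPolynomial.smul_eval]) (fun x hx => by simp [hw0 _ hx]) x hx
    simpa [sub_eq_zero] using this
  have hint : ∀ (q p : W), IntegrableOn (fun x : Plane => w q x *
      MvPolynomial.eval (fun j => x j) (p : MvPolynomial (Fin 2) ℝ)) E.carrier := fun q p =>
    ((hw1 q).memLp E.isOpen_carrier E.isBounded_carrier).integrable_mul
      ((contDiff_mvPolynomial_eval _ (n := 0)).continuous.continuousOn.memLp_two
        E.isOpen_carrier E.isBounded_carrier)
  have hms := E.isOpen_carrier.measurableSet
  -- `T` maps `q` to the moments of the solution `w q` of Δw = q with zero boundary values; the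
  -- chosen solutions depend linearly on `q` by uniqueness. If all moments of `w q` vanish, so does
  -- ∫ w q = −∫|∇w|², hence w = 0 and q = 0. So `T` is injective, and bijective because the dual has
  -- the same dimension.
  let T : W →ₗ[ℝ] Module.Dual ℝ W := LinearMap.mk₂ ℝ (fun q p => ∫ x in E.carrier, w q x *
      MvPolynomial.eval (fun j => x j) (p : MvPolynomial (Fin 2) ℝ))
    (fun p q z => by
      rw [← integral_add (hint _ _) (hint _ _)]
      exact setIntegral_congr_fun hms fun x hx => by simp only [hadd p q x hx]; ring)
    (fun r q z => by
      rw [smul_eq_mul, ← integral_const_mul]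
      exact setIntegral_congr_fun hms fun x hx => by simp only [hsmul r q x hx]; ring)
    (fun p q z => by
      rw [← integral_add (hint _ _) (hint _ _)]
      exact setIntegral_congr_fun hms fun x hx => by simp [mul_add])
    (fun r q z => by
      rw [smul_eq_mul, ← integral_const_mul]
      exact setIntegral_congr_fun hms fun x hx => by
        simp only [Submodule.coe_smul, MvPolynomial.smul_eval]; ring)
  have hinj : Function.Injective T := by
    rw [← LinearMap.ker_eq_bot, LinearMap.ker_eq_bot']
    intro q hq
    have h1 : ∫ x in E.carrier, w q x *
        MvPolynomial.eval (fun j => x j) (q : MvPolynomial (Fin 2) ℝ) = 0 := by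
      have := congrArg (fun f => f q) hq
      simpa [T] using this
    obtain ⟨M, hM⟩ := E.isBounded_carrier.isCompact_closure.exists_bound_of_continuousOn
      (contDiff_mvPolynomial_eval (q : MvPolynomial (Fin 2) ℝ) (n := 0)).continuous.continuousOn
    have h2 := MemH1.dirichletForm_eq E.isOpen_carrier E.isBounded_carrier (hw2 q)
      (hw1 q).memLp_grad (K := M) (fun x hx => by
        rw [hwΔ q x hx]; exact hM x (subset_closure hx)) (hw1 q) (fun x hx => hw0 q hx)
    rw [setIntegral_congr_fun hms (g := fun x => w q x *
        MvPolynomial.eval (fun j => x j) (q : MvPolynomial (Fin 2) ℝ)) fun x hx => by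
        simp only [hwΔ q x hx, mul_comm], h1, neg_zero] at h2
    have h3 := eq_zero_of_dirichletForm_nonpos h (hw1 q) (fun x hx => hw0 q hx) h2.le
    refine Subtype.ext (eq_zero_of_eval_eq_zero_on_ball (c := c) h.pos fun x hx => ?_)
    have hxU := h.ball_subset hx
    rw [← hwΔ q x hxU]
    have h4 : w q =ᶠ[𝓝 x] fun _ => (0 : ℝ) := by
      filter_upwards [E.isOpen_carrier.mem_nhds hxU] with y hy using h3 y (subset_closure hy)
    rw [InnerProductSpace.laplacian_congr_nhds h4 |>.eq_of_nhds, InnerProductSpace.laplacian_const]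
    rfl
  obtain ⟨q, hq⟩ := (LinearMap.injective_iff_surjective_of_finrank_eq_finrank
    (Subspace.dual_finrank_eq (K := ℝ) (V := W)).symm).1 hinj F
  exact ⟨w q, hwV q, fun x hx => hw0 q hx, fun p => by rw [← hq]; rfl⟩

/-- The local interpolant exists. -/
theorem exists_local_interpolant (hk : 1 ≤ k) (h : IsStarDisc E.carrier c R)
    (hg : ContinuousOn g (closure E.carrier)) : ∃ u, E.MemVirtual k u ∧ E.SameDof k u g := by
  choose p hp hp0 hp1 hpn using fun i => exists_edge_interpolant hk
    fun t => g (AffineMap.lineMap (E.vert i) (E.vert (i + 1)) t)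
  simp only [AffineMap.lineMap_apply_zero, AffineMap.lineMap_apply_one] at hp0 hp1
  obtain ⟨Φ, hΦ, hΦp⟩ := exists_extension h (fun i => g (E.vert i)) p hp0 hp1
  obtain ⟨u, hu, hu2, huΔ, huΦ⟩ := exists_dirichlet_solution h hΦ 0
  have huV : E.MemVirtual k u := memVirtual_of_solution (Or.inl rfl) hu hu2 huΔ huΦ
    fun i => ⟨p i, hp i, hΦp i⟩
  have hue : ∀ i, ∀ t ∈ Icc (0 : ℝ) 1,
      u (AffineMap.lineMap (E.vert i) (E.vert (i + 1)) t) = (p i).eval t := fun i t ht => by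
    rw [huΦ (E.edge_subset_frontier i (E.lineMap_mem_edge i ht)), hΦp i t ht]
  have huv : ∀ i, u (E.vert i) = g (E.vert i) := fun i => by
    have := hue i 0 ⟨le_rfl, zero_le_one⟩
    rwa [AffineMap.lineMap_apply_zero, hp0] at this
  have hun : ∀ i, ∀ t ∈ gaussLobatto k, u (AffineMap.lineMap (E.vert i) (E.vert (i + 1)) t) =
      g (AffineMap.lineMap (E.vert i) (E.vert (i + 1)) t) := fun i t ht => by
    rw [hue i t (Ioo_subset_Icc_self ht.1), hpn i t ht]
  -- The harmonic function `u` already has the right boundary values. For `k < 2` there are no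
  -- moments; otherwise a virtual function with zero boundary values corrects them.
  by_cases hk2 : k < 2
  · exact ⟨u, huV, huv, hun, fun q hq => by omega⟩
  obtain ⟨m, rfl⟩ := Nat.exists_eq_add_of_le' (not_lt.1 hk2)
  have hd : MemLp (g - u) 2 (volume.restrict E.carrier) :=
    (hg.sub hu.continuousOn).memLp_two E.isOpen_carrier E.isBounded_carrier
  have hint : ∀ {f : Plane → ℝ}, MemLp f 2 (volume.restrict E.carrier) →
      ∀ q : MvPolynomial (Fin 2) ℝ, IntegrableOn (fun x : Plane => f x *
        MvPolynomial.eval (fun j => x j) q) E.carrier := fun hf q =>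
    hf.integrable_mul
      ((contDiff_mvPolynomial_eval _ (n := 0)).continuous.continuousOn.memLp_two
        E.isOpen_carrier E.isBounded_carrier)
  let F : Module.Dual ℝ (MvPolynomial.restrictTotalDegree (Fin 2) ℝ m) :=
    { toFun := fun q => ∫ x in E.carrier, (g - u) x *
        MvPolynomial.eval (fun j => x j) (q : MvPolynomial (Fin 2) ℝ)
      map_add' := fun p q => by
        rw [← integral_add (hint hd _) (hint hd _)]
        refine integral_congr_ae (Eventually.of_forall fun x => ?_)
        simp [mul_add]
      map_smul' := fun r p => by
        rw [RingHom.id_apply, smul_eq_mul, ← integral_const_mul]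
        refine integral_congr_ae (Eventually.of_forall fun x => ?_)
        simp only [Submodule.coe_smul, MvPolynomial.smul_eval]; ring }
  obtain ⟨w, hw, hw0, hwF⟩ := exists_memVirtual_moments h m F
  refine ⟨u + w, huV.add hw, fun i => ?_, fun i t ht => ?_, fun q hq => ?_⟩
  · rw [Pi.add_apply, hw0 _ (E.vert_mem_frontier i), add_zero, huv]
  · rw [Pi.add_apply, hw0 _ (E.edge_subset_frontier i (E.lineMap_mem_edge i
      (Ioo_subset_Icc_self ht.1))), add_zero, hun i t ht]
  · have e1 := hwF ⟨q, (MvPolynomial.mem_restrictTotalDegree _ _ _).2 (by omega)⟩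
    have hu' := hu.memLp E.isOpen_carrier E.isBounded_carrier
    have hg' := hg.memLp_two E.isOpen_carrier E.isBounded_carrier
    change ∫ x in E.carrier, w x * MvPolynomial.eval (fun j => x j) q =
      ∫ x in E.carrier, (g - u) x * MvPolynomial.eval (fun j => x j) q at e1
    simp only [Pi.sub_apply, sub_mul] at e1
    rw [integral_sub (hint hg' q) (hint hu' q)] at e1
    simp only [Pi.add_apply, add_mul]
    rw [integral_add (hint hu' q) (hint (hw.memH1.memLp E.isOpen_carrier E.isBounded_carrier) q),
      e1]
    ring

end PolygonElement

end

/-! ### The global interpolation -/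

section

open MeasureTheory Polynomial Set Filter Topology Metric
open scoped Gradient InnerProductSpace Laplacian ENNReal

section Segments

/-- Equal segments have equal lengths, so the parameters of `a` and `b` on the second segment differ
by at least 1 and must be 0 and 1 in some order. -/
theorem eq_or_eq_swap_of_segment_eq {a b a' b' : Plane} (hab : a ≠ b)
    (h : segment ℝ a b = segment ℝ a' b') : (a = a' ∧ b = b') ∨ (a = b' ∧ b = a') := by
  have key : ∀ {a b a' b' : Plane}, segment ℝ a b ⊆ segment ℝ a' b' → dist a b ≤ dist a' b' := by
    intro a b a' b' h
    have ha := h (left_mem_segment ℝ a b)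
    have hb := h (right_mem_segment ℝ a b)
    rw [segment_eq_image_lineMap] at ha hb
    obtain ⟨s, hs, rfl⟩ := ha
    obtain ⟨t, ht, rfl⟩ := hb
    rw [dist_lineMap_lineMap, Real.dist_eq]
    refine mul_le_of_le_one_left dist_nonneg ?_
    rw [abs_le]
    constructor <;> linarith [hs.1, hs.2, ht.1, ht.2]
  have ha : a ∈ segment ℝ a' b' := h ▸ left_mem_segment ℝ a b
  have hb : b ∈ segment ℝ a' b' := h ▸ right_mem_segment ℝ a b
  have hd := key h.symm.subset
  have hpos := (dist_pos.2 hab).trans_le (key h.subset)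
  rw [segment_eq_image_lineMap] at ha hb
  obtain ⟨s, hs, rfl⟩ := ha
  obtain ⟨t, ht, rfl⟩ := hb
  rw [dist_lineMap_lineMap, Real.dist_eq] at hd
  have h1 : 1 ≤ |s - t| := le_of_mul_le_mul_right (by simpa using hd) hpos
  rcases le_abs.1 h1 with h1 | h1
  · have h2 : s = 1 := by linarith [hs.2, ht.1]
    have h3 : t = 0 := by linarith [hs.2, ht.1]
    right; simp [h2, h3]
  · have h2 : s = 0 := by linarith [hs.1, ht.2]
    have h3 : t = 1 := by linarith [hs.1, ht.2]
    left; simp [h2, h3]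

theorem exists_polynomial_swap {k : ℕ} {u : Plane → ℝ} {a b : Plane}
    (h : ∃ p : ℝ[X], p.natDegree ≤ k ∧
      ∀ t ∈ Icc (0 : ℝ) 1, u (AffineMap.lineMap a b t) = p.eval t) :
    ∃ p : ℝ[X], p.natDegree ≤ k ∧
      ∀ t ∈ Icc (0 : ℝ) 1, u (AffineMap.lineMap b a t) = p.eval t := by
  obtain ⟨p, hp, hp'⟩ := h
  refine ⟨p.comp (1 - X), ?_, fun t ht => ?_⟩
  · refine natDegree_comp_le.trans ?_
    have : (1 - X : ℝ[X]).natDegree ≤ 1 := (natDegree_sub_le _ _).trans (by simp)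
    nlinarith
  · rw [← AffineMap.lineMap_apply_one_sub, hp' _ ⟨by linarith [ht.2], by linarith [ht.1]⟩, eval_comp]
    simp

/-- Polynomials on an edge are determined by their values at the nodes. -/
theorem eqOn_segment_of_nodes {k : ℕ} (hk : 1 ≤ k) {u v : Plane → ℝ} {a b : Plane}
    (hu : ∃ p : ℝ[X], p.natDegree ≤ k ∧
      ∀ t ∈ Icc (0 : ℝ) 1, u (AffineMap.lineMap a b t) = p.eval t)
    (hv : ∃ p : ℝ[X], p.natDegree ≤ k ∧
      ∀ t ∈ Icc (0 : ℝ) 1, v (AffineMap.lineMap a b t) = p.eval t)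
    (ha : u a = v a) (hb : u b = v b)
    (hn : ∀ t ∈ PolygonElement.gaussLobatto k, u (AffineMap.lineMap a b t) = v (AffineMap.lineMap a b t)) :
    EqOn u v (segment ℝ a b) := by
  obtain ⟨p, hp, hp'⟩ := hu
  obtain ⟨q, hq, hq'⟩ := hv
  have h01 : (0 : ℝ) ∈ Icc (0 : ℝ) 1 := ⟨le_rfl, zero_le_one⟩
  have h11 : (1 : ℝ) ∈ Icc (0 : ℝ) 1 := ⟨zero_le_one, le_rfl⟩
  have hpq : p = q := by
    refine eq_of_eval_edgeNodes hk hp hq ?_ ?_ fun s hs => ?_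
    · rw [← hp' 0 h01, ← hq' 0 h01, AffineMap.lineMap_apply_zero, ha]
    · rw [← hp' 1 h11, ← hq' 1 h11, AffineMap.lineMap_apply_one, hb]
    · have hs' := Ioo_subset_Icc_self hs.1
      rw [← hp' s hs', ← hq' s hs', hn s hs]
  intro x hx
  rw [segment_eq_image_lineMap] at hx
  obtain ⟨t, ht, rfl⟩ := hx
  rw [hp' t ht, hq' t ht, hpq]

end Segments

namespace PolygonElement

variable {E F : PolygonElement} {k : ℕ} {u v w w' : Plane → ℝ}

theorem lineMap_mem_closure (E : PolygonElement) (i : ZMod E.n) {t : ℝ} (ht : t ∈ Icc (0 : ℝ) 1) :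
    AffineMap.lineMap (E.vert i) (E.vert (i + 1)) t ∈ closure E.carrier :=
  frontier_subset_closure (E.edge_subset_frontier i (E.lineMap_mem_edge i ht))

theorem vert_mem_closure (E : PolygonElement) (i : ZMod E.n) : E.vert i ∈ closure E.carrier :=
  frontier_subset_closure (E.vert_mem_frontier i)

theorem MemVirtual.congr (hu : E.MemVirtual k u) (h : EqOn v u (closure E.carrier)) :
    E.MemVirtual k v where
  continuousOn := hu.continuousOn.congr h
  edge_poly i := by
    obtain ⟨p, hp, hp'⟩ := hu.edge_poly i
    exact ⟨p, hp, fun t ht => by rw [h (E.lineMap_mem_closure i ht), hp' t ht]⟩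
  contDiffOn := hu.contDiffOn.congr fun x hx => h (subset_closure hx)
  laplacian_poly := by
    obtain ⟨q, hq, hq'⟩ := hu.laplacian_poly
    refine ⟨q, hq, fun x hx => ?_⟩
    have h4 : v =ᶠ[𝓝 x] u := by
      filter_upwards [E.isOpen_carrier.mem_nhds hx] with y hy using h (subset_closure hy)
    rw [(InnerProductSpace.laplacian_congr_nhds h4).eq_of_nhds, hq' x hx]
  memLp_grad := (hu.memH1.congr E.isOpen_carrier h).memLp_grad

theorem SameDof.symm (h : E.SameDof k u w) : E.SameDof k w u :=
  ⟨fun i => (h.1 i).symm, fun i t ht => (h.2.1 i t ht).symm, fun p hp => (h.2.2 p hp).symm⟩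

theorem SameDof.trans (h : E.SameDof k u v) (h' : E.SameDof k v w) : E.SameDof k u w :=
  ⟨fun i => (h.1 i).trans (h'.1 i), fun i t ht => (h.2.1 i t ht).trans (h'.2.1 i t ht),
    fun p hp => (h.2.2 p hp).trans (h'.2.2 p hp)⟩

theorem sameDof_of_eqOn (h : EqOn u w (closure E.carrier)) : E.SameDof k u w :=
  ⟨fun i => h (E.vert_mem_closure i),
    fun i _ ht => h (E.lineMap_mem_closure i (Ioo_subset_Icc_self ht.1)),
    fun _ _ => setIntegral_congr_fun E.isOpen_carrier.measurableSet fun x hx => by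
      simp only [h (subset_closure hx)]⟩

theorem integrableOn_mul_eval (hu : ContinuousOn u (closure E.carrier))
    (q : MvPolynomial (Fin 2) ℝ) :
    IntegrableOn (fun x : Plane => u x * MvPolynomial.eval (fun j => x j) q) E.carrier :=
  (hu.memLp_two E.isOpen_carrier E.isBounded_carrier).integrable_mul
    ((contDiff_mvPolynomial_eval _ (n := 0)).continuous.continuousOn.memLp_two
      E.isOpen_carrier E.isBounded_carrier)

theorem SameDof.add (hu : ContinuousOn u (closure E.carrier))
    (hv : ContinuousOn v (closure E.carrier)) (hw : ContinuousOn w (closure E.carrier))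
    (hw' : ContinuousOn w' (closure E.carrier))
    (h : E.SameDof k u w) (h' : E.SameDof k v w') : E.SameDof k (u + v) (w + w') := by
  refine ⟨fun i => by simp [h.1 i, h'.1 i], fun i t ht => by simp [h.2.1 i t ht, h'.2.1 i t ht],
    fun p hp => ?_⟩
  simp only [Pi.add_apply, add_mul]
  rw [integral_add (integrableOn_mul_eval hu p) (integrableOn_mul_eval hv p),
    integral_add (integrableOn_mul_eval hw p) (integrableOn_mul_eval hw' p), h.2.2 p hp,
    h'.2.2 p hp]

theorem SameDof.smul (c : ℝ) (h : E.SameDof k u w) : E.SameDof k (c • u) (c • w) := by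
  refine ⟨fun i => by simp [h.1 i], fun i t ht => by simp [h.2.1 i t ht], fun p hp => ?_⟩
  simp only [Pi.smul_apply, smul_eq_mul, mul_assoc, integral_const_mul]
  rw [h.2.2 p hp]

/-- The interpolants on two elements agree on a common edge. -/
theorem eqOn_edge_of_sameDof (hk : 1 ≤ k) (hu : E.MemVirtual k u) (hv : F.MemVirtual k v)
    (hd : E.SameDof k u w) (hd' : F.SameDof k v w) {i : ZMod E.n} {j : ZMod F.n}
    (hij : E.edge i = F.edge j) : EqOn u v (E.edge i) := by
  rcases eq_or_eq_swap_of_segment_eq (E.vert_ne_vert_add_one i) hij with ⟨h1, h2⟩ | ⟨h1, h2⟩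
  · refine eqOn_segment_of_nodes hk (hu.edge_poly i) ?_ ?_ ?_ fun t ht => ?_
    · rw [h1, h2]; exact hv.edge_poly j
    · rw [hd.1 i, h1, hd'.1]
    · rw [hd.1, h2, hd'.1]
    · rw [hd.2.1 i t ht, h1, h2, hd'.2.1 j t ht]
  · refine eqOn_segment_of_nodes hk (hu.edge_poly i) ?_ ?_ ?_ fun t ht => ?_
    · rw [h1, h2]; exact exists_polynomial_swap (hv.edge_poly j)
    · rw [hd.1 i, h1, hd'.1]
    · rw [hd.1, h2, hd'.1]
    · rw [hd.2.1 i t ht, h1, h2, ← AffineMap.lineMap_apply_one_sub,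
        hd'.2.1 j _ (one_sub_mem_gaussLobatto ht)]

theorem eq_of_mem_edge_of_lineMap {i j : ZMod E.n} {t : ℝ} (ht : t ∈ Ioo (0 : ℝ) 1)
    (hx : AffineMap.lineMap (E.vert i) (E.vert (i + 1)) t ∈ E.edge j) : j = i := by
  by_contra hij
  have h1 := (E.simple i j (Ne.symm hij)
    ⟨E.lineMap_mem_edge i (Ioo_subset_Icc_self ht), hx⟩).1
  rcases h1 with h1 | h1
  · rw [AffineMap.lineMap_eq_left_iff] at h1
    exact h1.elim (E.vert_ne_vert_add_one i) ht.1.ne'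
  · rw [mem_singleton_iff, AffineMap.lineMap_eq_right_iff] at h1
    exact h1.elim (E.vert_ne_vert_add_one i) ht.2.ne

theorem lineMap_ne_vert {i j : ZMod E.n} {t : ℝ} (ht : t ∈ Ioo (0 : ℝ) 1) :
    AffineMap.lineMap (E.vert i) (E.vert (i + 1)) t ≠ E.vert j := by
  intro h
  have hj := eq_of_mem_edge_of_lineMap ht (h ▸ E.vert_mem_edge j)
  rw [hj, AffineMap.lineMap_eq_left_iff] at h
  exact h.elim (E.vert_ne_vert_add_one i) ht.1.ne'

end PolygonElement

namespace PolygonalMesh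

variable {ι : Type} [Fintype ι] {M : PolygonalMesh ι} {k : ℕ} {S : Finset ι} {u v w w' : Plane → ℝ}

/-- Every element is star-shaped with respect to a disc. -/
def IsStarMesh (M : PolygonalMesh ι) : Prop := ∀ e, ∃ c R, IsStarDisc (M.elem e).carrier c R

/-- `w` is continuous on every closed element. -/
def PiecewiseContinuous (M : PolygonalMesh ι) (w : Plane → ℝ) : Prop :=
  ∀ e, ContinuousOn w (closure (M.elem e).carrier)

theorem mem_closedRegion_univ {e : ι} {x : Plane} (hx : x ∈ closure (M.elem e).carrier) :
    x ∈ M.closedRegion Finset.univ := mem_iUnion₂.2 ⟨e, Finset.mem_univ e, hx⟩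

theorem isClosed_closedRegion (S : Finset ι) : IsClosed (M.closedRegion S) :=
  S.finite_toSet.isClosed_biUnion fun _ _ => isClosed_closure

theorem carrier_subset_domain (e : ι) : (M.elem e).carrier ⊆ M.domain :=
  interior_maximal (fun _ hx => mem_closedRegion_univ (subset_closure hx)) (M.elem e).isOpen_carrier

theorem closure_subset_closure_domain (e : ι) : closure (M.elem e).carrier ⊆ closure M.domain :=
  closure_mono (carrier_subset_domain e)

theorem mem_frontier_carrier {e : ι} {x : Plane} (hx : x ∈ closure (M.elem e).carrier)
    (hx' : x ∈ frontier M.domain) : x ∈ frontier (M.elem e).carrier := by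
  rw [(M.elem e).isOpen_carrier.frontier_eq]
  exact ⟨hx, fun h => notMem_of_mem_frontier isOpen_interior hx' (carrier_subset_domain e h)⟩

theorem memVirtual_of_mem_space (hu : u ∈ M.space k Finset.univ) (e : ι) :
    (M.elem e).MemVirtual k u := hu.1 e (Finset.mem_univ e)

theorem PiecewiseContinuous.of_mem_space (hu : u ∈ M.space k Finset.univ) :
    M.PiecewiseContinuous u := fun e => (memVirtual_of_mem_space hu e).continuousOn

theorem eq_of_mem_space (hu : u ∈ M.space k Finset.univ) (hv : v ∈ M.space k Finset.univ)
    (h : ∀ e, EqOn u v (closure (M.elem e).carrier)) : u = v := by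
  funext x
  by_cases hx : x ∈ M.closedRegion Finset.univ
  · obtain ⟨e, -, he⟩ := mem_iUnion₂.1 hx
    exact h e he
  · rw [hu.2 x hx, hv.2 x hx]

/-- The local interpolants fit together. -/
theorem exists_interpolant (hk : 1 ≤ k) (hM : M.IsStarMesh) (hw : M.PiecewiseContinuous w) :
    ∃ u ∈ M.space k Finset.univ, ∀ e, (M.elem e).SameDof k u w := by
  classical
  choose c R h using hM
  choose U hU hUd using fun e => PolygonElement.exists_local_interpolant hk (h e) (hw e)
  -- On common boundaries an arbitrary adjacent element is chosen. By conformity the point is a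
  -- common vertex or lies on a common edge, where the local interpolants agree.
  let u : Plane → ℝ := fun x =>
    if hx : ∃ e, x ∈ closure (M.elem e).carrier then U hx.choose x else 0
  have huU : ∀ e, EqOn u (U e) (closure (M.elem e).carrier) := by
    intro e x hx
    have hex : ∃ e, x ∈ closure (M.elem e).carrier := ⟨e, hx⟩
    have hu : u x = U hex.choose x := dif_pos hex
    rw [hu]
    have hf := hex.choose_spec
    set f := hex.choose
    by_cases hfe : f = e
    · rw [hfe]
    rcases M.conforming f e hfe x ⟨hf, hx⟩ with ⟨i, j, hi, hj⟩ | ⟨i, j, hij, hi⟩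
    · rw [← hi, (hUd f).1, hi, ← hj, (hUd e).1]
    · exact PolygonElement.eqOn_edge_of_sameDof hk (hU f) (hU e) (hUd f) (hUd e) hij hi
  refine ⟨u, ⟨fun e _ => (hU e).congr (huU e), fun x hx => dif_neg ?_⟩, fun e =>
    (PolygonElement.sameDof_of_eqOn (huU e)).trans (hUd e)⟩
  rintro ⟨e, he⟩
  exact hx (mem_closedRegion_univ he)

theorem interp_mem_space (hk : 1 ≤ k) (hM : M.IsStarMesh) (hw : M.PiecewiseContinuous w) :
    M.interp k w ∈ M.space k Finset.univ := by
  rw [interp, dif_pos (exists_interpolant hk hM hw)]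
  exact (exists_interpolant hk hM hw).choose_spec.1

theorem sameDof_interp (hk : 1 ≤ k) (hM : M.IsStarMesh) (hw : M.PiecewiseContinuous w) (e : ι) :
    (M.elem e).SameDof k (M.interp k w) w := by
  rw [interp, dif_pos (exists_interpolant hk hM hw)]
  exact (exists_interpolant hk hM hw).choose_spec.2 e

theorem interp_eqOn (hk : 1 ≤ k) (hM : M.IsStarMesh) (hw : M.PiecewiseContinuous w) {e : ι}
    (hu : (M.elem e).MemVirtual k u) (hd : (M.elem e).SameDof k u w) :
    EqOn (M.interp k w) u (closure (M.elem e).carrier) := by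
  obtain ⟨c, R, h⟩ := hM e
  exact (memVirtual_of_mem_space (interp_mem_space hk hM hw) e).eqOn_of_sameDof hk h hu
    ((sameDof_interp hk hM hw e).trans hd.symm)

theorem interp_eq (hk : 1 ≤ k) (hM : M.IsStarMesh) (hw : M.PiecewiseContinuous w)
    (hu : u ∈ M.space k Finset.univ) (hd : ∀ e, (M.elem e).SameDof k u w) : M.interp k w = u :=
  eq_of_mem_space (interp_mem_space hk hM hw) hu fun e =>
    interp_eqOn hk hM hw (memVirtual_of_mem_space hu e) (hd e)

theorem interp_of_mem_space (hk : 1 ≤ k) (hM : M.IsStarMesh) (hu : u ∈ M.space k Finset.univ)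
    (h : ∀ x ∈ M.closedRegion Finset.univ, w x = u x) : M.interp k w = u := by
  have he : ∀ e, EqOn w u (closure (M.elem e).carrier) := fun e x hx => h x (mem_closedRegion_univ hx)
  exact interp_eq hk hM (fun e => (PiecewiseContinuous.of_mem_space hu e).congr (he e)) hu fun e =>
    PolygonElement.sameDof_of_eqOn (he e).symm

theorem PiecewiseContinuous.add (hw : M.PiecewiseContinuous w) (hw' : M.PiecewiseContinuous w') :
    M.PiecewiseContinuous (w + w') := fun e => (hw e).add (hw' e)

theorem PiecewiseContinuous.smul (c : ℝ) (hw : M.PiecewiseContinuous w) :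
    M.PiecewiseContinuous (c • w) := fun e => (hw e).const_smul c

theorem PiecewiseContinuous.sum {α : Type*} (s : Finset α) {f : α → Plane → ℝ}
    (hf : ∀ i ∈ s, M.PiecewiseContinuous (f i)) : M.PiecewiseContinuous (∑ i ∈ s, f i) := by
  classical
  induction s using Finset.induction_on with
  | empty => exact fun e => continuousOn_const
  | insert a s ha ih =>
    rw [Finset.sum_insert ha]
    exact (hf a (Finset.mem_insert_self a s)).add
      (ih fun i hi => hf i (Finset.mem_insert_of_mem hi))

theorem interp_add (hk : 1 ≤ k) (hM : M.IsStarMesh) (hw : M.PiecewiseContinuous w)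
    (hw' : M.PiecewiseContinuous w') : M.interp k (w + w') = M.interp k w + M.interp k w' :=
  have h1 := interp_mem_space hk hM hw
  have h2 := interp_mem_space hk hM hw'
  interp_eq hk hM (hw.add hw') (Submodule.add_mem _ h1 h2) fun e =>
    (sameDof_interp hk hM hw e).add (PiecewiseContinuous.of_mem_space h1 e)
      (PiecewiseContinuous.of_mem_space h2 e) (hw e) (hw' e) (sameDof_interp hk hM hw' e)

theorem interp_smul (hk : 1 ≤ k) (hM : M.IsStarMesh) (c : ℝ) (hw : M.PiecewiseContinuous w) :
    M.interp k (c • w) = c • M.interp k w :=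
  interp_eq hk hM (hw.smul c) (Submodule.smul_mem _ c (interp_mem_space hk hM hw)) fun e =>
    (sameDof_interp hk hM hw e).smul c

theorem interp_zero (hk : 1 ≤ k) (hM : M.IsStarMesh) : M.interp k 0 = 0 :=
  interp_of_mem_space hk hM (Submodule.zero_mem _) fun _ _ => rfl

theorem interp_sum (hk : 1 ≤ k) (hM : M.IsStarMesh) {α : Type*} (s : Finset α)
    {f : α → Plane → ℝ} (hf : ∀ i ∈ s, M.PiecewiseContinuous (f i)) :
    M.interp k (∑ i ∈ s, f i) = ∑ i ∈ s, M.interp k (f i) := by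
  classical
  induction s using Finset.induction_on with
  | empty => exact interp_zero hk hM
  | insert a s ha ih =>
    have hs : ∀ i ∈ s, M.PiecewiseContinuous (f i) := fun i hi =>
      hf i (Finset.mem_insert_of_mem hi)
    rw [Finset.sum_insert ha, Finset.sum_insert ha,
      interp_add hk hM (hf a (Finset.mem_insert_self a s)) (.sum s hs), ih hs]

theorem interp_eq_zero_of_eqOn (hk : 1 ≤ k) (hM : M.IsStarMesh) (hw : M.PiecewiseContinuous w)
    {e : ι} (h : ∀ x ∈ closure (M.elem e).carrier, w x = 0) :
    ∀ x ∈ closure (M.elem e).carrier, M.interp k w x = 0 :=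
  interp_eqOn hk hM hw (PolygonElement.MemVirtual.zero k _)
    (PolygonElement.sameDof_of_eqOn fun x hx => (h x hx).symm)

end PolygonalMesh

/-! ### Boundary edges and homogeneous Dirichlet conditions -/

section CommonEdge

variable {c a b : Plane}

theorem one_sub_coord_add (hD : det2 (a - c) (b - c) ≠ 0) (x : Plane) :
    1 - (coordL c a b x + coordR c a b x) = det2 (a - x) (b - x) / det2 (a - c) (b - c) := by
  rw [coordL, coordR, eq_div_iff hD, sub_mul, add_mul, div_mul_cancel₀ _ hD,
    div_mul_cancel₀ _ hD]
  simp [det2]; ring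

theorem IsStarDisc.det2_ne_zero {U : Set Plane} {R : ℝ} (h : IsStarDisc U c R) (hU : IsOpen U)
    (hab : a ≠ b) (hseg : segment ℝ a b ⊆ frontier U) : det2 (a - c) (b - c) ≠ 0 := by
  rw [← abs_pos]
  exact (mul_pos h.pos (dist_pos.2 hab)).trans_le (h.mul_dist_le_det2 hU hab hseg)

/-- A point inside an edge of two disjoint elements is an interior point of their union. -/
theorem union_mem_nhds_of_common_edge {U U' : Set Plane} {c' : Plane} {R R' : ℝ}
    (h : IsStarDisc U c R) (h' : IsStarDisc U' c' R') (hU : IsOpen U) (hU' : IsOpen U')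
    (hdisj : Disjoint U U') (hab : a ≠ b) (hseg : segment ℝ a b ⊆ frontier U)
    (hseg' : segment ℝ a b ⊆ frontier U') {t : ℝ} (ht : t ∈ Ioo (0 : ℝ) 1) :
    closure U ∪ closure U' ∈ 𝓝 (AffineMap.lineMap a b t : Plane) := by
  have hD := h.det2_ne_zero hU hab hseg
  have hD' := h'.det2_ne_zero hU' hab hseg'
  have hpos : ∀ {c : Plane}, det2 (a - c) (b - c) ≠ 0 →
      ∀ᶠ y in 𝓝 (AffineMap.lineMap a b t : Plane), 0 < coordL c a b y ∧ 0 < coordR c a b y := by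
    intro c hD
    have h1 : Continuous (coordL c a b) := (contDiff_coordL (n := 0)).continuous
    have h2 : Continuous (coordR c a b) := (contDiff_coordR (n := 0)).continuous
    obtain ⟨e1, e2⟩ := coord_lineMap hD t
    exact (h1.continuousAt.eventually_const_lt (by rw [e1]; linarith [ht.2])).and
      (h2.continuousAt.eventually_const_lt (by rw [e2]; exact ht.1))
  -- The centres `c` and `c'` lie on opposite sides of the edge. Otherwise the points that one
  -- reaches when going from the edge a little towards `c` would belong to the triangles of both
  -- elements. Near the given point all points lie in both open cones, so the side of the edge
  -- decides to which triangle a point belongs.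
  have hsign : det2 (a - c) (b - c) * det2 (a - c') (b - c') < 0 := by
    by_contra! hsign
    have hsign' := lt_of_le_of_ne hsign (mul_ne_zero hD hD').symm
    set x : Plane := AffineMap.lineMap a b t with hx
    have hlim : Tendsto (fun s : ℝ => x + s • (c - x)) (𝓝[>] 0) (𝓝 x) := by
      have : Continuous fun s : ℝ => x + s • (c - x) := by fun_prop
      have h0 := this.tendsto 0
      simp only [zero_smul, add_zero] at h0
      exact h0.mono_left nhdsWithin_le_nhds
    obtain ⟨s, ⟨h1, h2⟩, hs0⟩ := ((hlim.eventually ((hpos hD).and (hpos hD'))).and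
      self_mem_nhdsWithin).exists
    have hs0' : 0 < s := hs0
    have hval : det2 (a - (x + s • (c - x))) (b - (x + s • (c - x))) =
        s * det2 (a - c) (b - c) := by
      rw [hx, AffineMap.lineMap_apply]; simp [det2]; ring
    refine Set.disjoint_left.1 hdisj
      (h.openTriangle_subset hD hseg (show x + s • (c - x) ∈ _ from ⟨h1.1, h1.2, ?_⟩))
      (h'.openTriangle_subset hD' hseg' ⟨h2.1, h2.2, ?_⟩)
    · rw [← sub_pos, one_sub_coord_add hD, hval, mul_div_cancel_right₀ _ hD]; exact hs0'
    · rw [← sub_pos, one_sub_coord_add hD', hval, mul_div_assoc]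
      exact mul_pos hs0' (by rw [div_pos_iff]; rw [← mul_pos_iff]; exact hsign')
  filter_upwards [hpos hD, hpos hD'] with y hy hy'
  rcases lt_trichotomy (det2 (a - y) (b - y) / det2 (a - c) (b - c)) 0 with hlt | heq | hgt
  · right
    refine subset_closure (h'.openTriangle_subset hD' hseg' ⟨hy'.1, hy'.2, ?_⟩)
    rw [← sub_pos, one_sub_coord_add hD', div_pos_iff, ← mul_pos_iff]
    rw [div_neg_iff, ← mul_neg_iff] at hlt
    by_contra! hle
    nlinarith [mul_nonneg_of_nonpos_of_nonpos hle hsign.le, sq_nonneg (det2 (a - c') (b - c')),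
      mul_pos_of_neg_of_neg hlt hsign, mul_self_pos.2 hD']
  · left
    have h1 : coordL c a b y + coordR c a b y = 1 := by
      have := one_sub_coord_add hD y
      rw [heq] at this; linarith
    have h2 := eq_add_smul_lineMap hD h1.symm one_ne_zero
    rw [one_smul, div_one, add_sub_cancel] at h2
    rw [h2]
    exact frontier_subset_closure (hseg (lineMap_mem_segment_of_mem hy.2.le (by linarith [hy.1])))
  · left
    refine subset_closure (h.openTriangle_subset hD hseg ⟨hy.1, hy.2, ?_⟩)
    rw [← sub_pos, one_sub_coord_add hD]; exact hgt

end CommonEdge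

namespace PolygonalMesh

variable {ι : Type} [Fintype ι] {M : PolygonalMesh ι} {k : ℕ} {S : Finset ι} {u v w w' : Plane → ℝ}

/-- An edge with an inner point on the boundary of the domain is part of this boundary. -/
theorem edge_subset_frontier_domain (hM : M.IsStarMesh) {e : ι} {i : ZMod (M.elem e).n} {t : ℝ}
    (ht : t ∈ Ioo (0 : ℝ) 1)
    (hx : AffineMap.lineMap ((M.elem e).vert i) ((M.elem e).vert (i + 1)) t ∈ frontier M.domain) :
    (M.elem e).edge i ⊆ frontier M.domain := by
  classical
  obtain ⟨c, R, h⟩ := hM e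
  -- No other element has this edge, since then the given inner point would be an interior point of
  -- the domain. By conformity the open edge therefore meets no other closed element.
  have hA : ∀ f, f ≠ e → ∀ j, (M.elem e).edge i ≠ (M.elem f).edge j := by
    intro f hfe j hij
    obtain ⟨c', R', h'⟩ := hM f
    have hnhds := union_mem_nhds_of_common_edge h h' (M.elem e).isOpen_carrier (M.elem f).isOpen_carrier
      (M.disjoint_elem e f hfe.symm) ((M.elem e).vert_ne_vert_add_one i) ((M.elem e).edge_subset_frontier i)
      (hij.subset.trans ((M.elem f).edge_subset_frontier j)) ht
    refine notMem_of_mem_frontier isOpen_interior hx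
      (mem_interior_iff_mem_nhds.2 (mem_of_superset hnhds ?_))
    rintro y (hy | hy)
    · exact mem_closedRegion_univ hy
    · exact mem_closedRegion_univ hy
  have hB : ∀ s ∈ Ioo (0 : ℝ) 1, ∀ f, f ≠ e →
      AffineMap.lineMap ((M.elem e).vert i) ((M.elem e).vert (i + 1)) s ∉ closure (M.elem f).carrier := by
    intro s hs f hfe hmem
    rcases M.conforming e f hfe.symm _ ⟨(M.elem e).lineMap_mem_closure i (Ioo_subset_Icc_self hs), hmem⟩
      with ⟨i', j, hi, -⟩ | ⟨i', j, hij, hi⟩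
    · exact (M.elem e).lineMap_ne_vert hs hi.symm
    · obtain rfl := (M.elem e).eq_of_mem_edge_of_lineMap hs hi
      exact hA f hfe j hij
  -- Near an inner point of the edge the closed mesh is only the closure of `e`, and an exterior ray
  -- leaves this closure at once. So the point is not interior to the domain.
  have hC : ∀ s ∈ Ioo (0 : ℝ) 1,
      AffineMap.lineMap ((M.elem e).vert i) ((M.elem e).vert (i + 1)) s ∈ frontier M.domain := by
    intro s hs
    set y : Plane := AffineMap.lineMap ((M.elem e).vert i) ((M.elem e).vert (i + 1)) s with hy
    have hyE := (M.elem e).lineMap_mem_edge i (Ioo_subset_Icc_self hs)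
    refine ⟨closure_subset_closure_domain e ((M.elem e).lineMap_mem_closure i (Ioo_subset_Icc_self hs)), ?_⟩
    rw [domain, interior_interior, mem_interior_iff_mem_nhds]
    intro hn
    obtain ⟨d, -, hd⟩ := h.exterior_ray (M.elem e).isOpen_carrier ((M.elem e).edge_subset_frontier i hyE)
    have hn' : (M.closedRegion (Finset.univ.erase e))ᶜ ∈ 𝓝 y := by
      refine (isClosed_closedRegion _).isOpen_compl.mem_nhds fun hmem => ?_
      obtain ⟨f, hf, hfy⟩ := mem_iUnion₂.1 hmem
      exact hB s hs f (Finset.ne_of_mem_erase hf) hfy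
    have hlim : Tendsto (fun s : ℝ => y + s • d) (𝓝[>] 0) (𝓝 y) := by
      have : Continuous fun s : ℝ => y + s • d := by fun_prop
      have h0 := this.tendsto 0
      simp only [zero_smul, add_zero] at h0
      exact h0.mono_left nhdsWithin_le_nhds
    obtain ⟨r, ⟨h1, h2⟩, hr⟩ := ((hlim.eventually (inter_mem hn hn')).and
      self_mem_nhdsWithin).exists
    obtain ⟨f, -, hf⟩ := mem_iUnion₂.1 h1
    by_cases hfe : f = e
    · rw [hfe] at hf; exact hd r hr hf
    · exact h2 (mem_iUnion₂.2 ⟨f, Finset.mem_erase.2 ⟨hfe, Finset.mem_univ f⟩, hf⟩)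
  have hcl : IsClosed {s : ℝ | (AffineMap.lineMap ((M.elem e).vert i) ((M.elem e).vert (i + 1)) s : Plane) ∈
      frontier M.domain} :=
    isClosed_frontier.preimage (AffineMap.lineMap_continuous (R := ℝ))
  have hsub := closure_minimal (s := Ioo (0 : ℝ) 1) hC hcl
  rw [closure_Ioo zero_ne_one] at hsub
  intro y hy
  rw [PolygonElement.edge, segment_eq_image_lineMap] at hy
  obtain ⟨s, hs, rfl⟩ := hy
  exact hsub hs

/-- The interpolant inherits homogeneous Dirichlet conditions. -/
theorem interp_eq_zero_of_frontier (hk : 1 ≤ k) (hM : M.IsStarMesh) (hw : M.PiecewiseContinuous w)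
    (h0 : ∀ x ∈ M.closedRegion Finset.univ ∩ frontier M.domain, w x = 0) :
    ∀ x ∈ M.closedRegion Finset.univ ∩ frontier M.domain, M.interp k w x = 0 := by
  rintro x ⟨hx, hx'⟩
  obtain ⟨e, -, he⟩ := mem_iUnion₂.1 hx
  have hd := sameDof_interp hk hM hw e
  have hV := memVirtual_of_mem_space (interp_mem_space hk hM hw) e
  obtain ⟨i, t, ht, rfl⟩ := (M.elem e).exists_lineMap_of_mem_frontier (mem_frontier_carrier he hx')
  rcases ht.1.eq_or_lt with rfl | ht0
  · rw [AffineMap.lineMap_apply_zero] at hx hx' ⊢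
    rw [hd.1, h0 _ ⟨hx, hx'⟩]
  rcases ht.2.eq_or_lt with rfl | ht1
  · rw [AffineMap.lineMap_apply_one] at hx hx' ⊢
    rw [hd.1, h0 _ ⟨hx, hx'⟩]
  -- Now that the whole edge belongs to ∂D, all nodal values of `w` on it vanish, and with them the
  -- interpolating polynomial.
  have hsub := edge_subset_frontier_domain hM ⟨ht0, ht1⟩ hx'
  have hz : ∀ y ∈ (M.elem e).edge i, w y = 0 := fun y hy =>
    h0 y ⟨mem_closedRegion_univ (frontier_subset_closure ((M.elem e).edge_subset_frontier i hy)),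
      hsub hy⟩
  refine eqOn_segment_of_nodes hk (v := 0) (hV.edge_poly i) ⟨0, by simp, by simp⟩ ?_ ?_
    (fun s hs => ?_) ((M.elem e).lineMap_mem_edge i ht)
  · rw [hd.1]; exact hz _ (left_mem_segment ℝ _ _)
  · rw [hd.1]; exact hz _ (right_mem_segment ℝ _ _)
  · rw [hd.2.1 i s hs]; exact hz _ ((M.elem e).lineMap_mem_edge i (Ioo_subset_Icc_self hs.1))

theorem interp_mem_fineSpace (hk : 1 ≤ k) (hM : M.IsStarMesh) (hw : M.PiecewiseContinuous w)
    (h0 : ∀ x ∈ M.closedRegion Finset.univ ∩ frontier M.domain, w x = 0) :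
    M.interp k w ∈ M.fineSpace k :=
  ⟨interp_mem_space hk hM hw, interp_eq_zero_of_frontier hk hM hw h0⟩

end PolygonalMesh

end

/-! ### Spectral splitting and interpolation of cut-off products -/

section

open MeasureTheory Polynomial Set Filter Topology Metric
open scoped Gradient InnerProductSpace Laplacian ENNReal

section SpectralSplitting

variable {W : Type*} [AddCommGroup W] [Module ℝ W]

/-- The splitting of a vector into its parts that belong to the lower and to the upper eigenvalues of
a generalized eigenvalue problem. -/
theorem exists_spectral_splitting (B m : W →ₗ[ℝ] W →ₗ[ℝ] ℝ) {n : ℕ} {ψ : Fin n → W}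
    {lam : Fin n → ℝ} (hspan : ⊤ ≤ Submodule.span ℝ (range ψ))
    (horth : ∀ l j, m (ψ l) (ψ j) = if l = j then 1 else 0)
    (heig : ∀ l w, B (ψ l) w = lam l * m (ψ l) w) (hB : ∀ w, 0 ≤ B w w) (hmono : Monotone lam)
    {L : ℕ} (hL : L < n) (f : W) :
    ∃ c : Fin n → ℝ, ∃ w, f = (∑ l with l.val < L, c l • ψ l) + w ∧ B w w ≤ B f f ∧
      lam ⟨L, hL⟩ * m w w ≤ B f f := by
  obtain ⟨c, hc⟩ := (Submodule.mem_span_range_iff_exists_fun ℝ).1 (hspan (Submodule.mem_top (x := f)))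
  have hlam : ∀ l, 0 ≤ lam l := fun l => by
    have := hB (ψ l)
    rwa [heig, horth, if_pos rfl, mul_one] at this
  have hm : ∀ s : Finset (Fin n), m (∑ l ∈ s, c l • ψ l) (∑ l ∈ s, c l • ψ l) =
      ∑ l ∈ s, c l ^ 2 := fun s => by
    simp only [map_sum, LinearMap.sum_apply, map_smul, LinearMap.smul_apply, horth, smul_eq_mul,
      mul_ite, mul_one, mul_zero, Finset.sum_ite_eq]
    exact Finset.sum_congr rfl fun l hl => by simp [hl, sq]
  have hB' : ∀ s : Finset (Fin n), B (∑ l ∈ s, c l • ψ l) (∑ l ∈ s, c l • ψ l) =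
      ∑ l ∈ s, lam l * c l ^ 2 := fun s => by
    simp only [map_sum, LinearMap.sum_apply, map_smul, LinearMap.smul_apply, heig, horth,
      smul_eq_mul, mul_ite, mul_one, mul_zero, Finset.sum_ite_eq, Finset.sum_ite_eq']
    exact Finset.sum_congr rfl fun l hl => by simp [hl]; ring
  have hf : B f f = ∑ l, lam l * c l ^ 2 := by rw [← hc, hB']
  have hle : ∑ l with ¬l.val < L, lam l * c l ^ 2 ≤ ∑ l, lam l * c l ^ 2 :=
    Finset.sum_le_sum_of_subset_of_nonneg (Finset.filter_subset _ _) fun l _ _ =>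
      mul_nonneg (hlam l) (sq_nonneg _)
  -- The remainder collects the indices from `L` on. As the numbering starts at 0, `lam ⟨L, hL⟩` is
  -- the first discarded eigenvalue, λ_{L+1} in the usual numbering.
  refine ⟨c, ∑ l with ¬l.val < L, c l • ψ l, ?_, ?_, ?_⟩
  · rw [Finset.sum_filter_add_sum_filter_not, hc]
  · rw [hB', hf]; exact hle
  · rw [hm, hf, Finset.mul_sum]
    refine le_trans (Finset.sum_le_sum fun l hl => ?_) hle
    refine mul_le_mul_of_nonneg_right (hmono ?_) (sq_nonneg _)
    rw [Finset.mem_filter] at hl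
    exact not_lt.1 hl.2

end SpectralSplitting

section ProductEstimates

variable {U : Set Plane}

theorem dirichletForm_mul_le (hU : IsOpen U) (hb : Bornology.IsBounded U) {χ w : Plane → ℝ}
    (hχ : MemH1 U χ) (hw : MemH1 U w) (h0 : ∀ x, 0 ≤ χ x) (h1 : ∀ x, χ x ≤ 1) {B : ℝ}
    (hB : ∀ x ∈ U, ‖∇ χ x‖ ≤ B) :
    dirichletForm U (χ * w) (χ * w) ≤ 2 * (dirichletForm U w w + B ^ 2 * ∫ x in U, w x ^ 2) := by
  have i1 := hw.integrableOn_sq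
  have i2 := (hw.memLp hU hb).integrable_sq
  rw [dirichletForm_self, dirichletForm_self, ← integral_const_mul, ← integral_add i1
    (i2.const_mul _), ← integral_const_mul]
  refine setIntegral_mono_on (hχ.mul hU hb hw).integrableOn_sq
    ((i1.add (i2.const_mul _)).const_mul _) hU.measurableSet fun x hx => ?_
  rw [gradient_mul_apply (hχ.contDiffOn.differentiableAt_of_isOpen hU one_ne_zero hx)
    (hw.contDiffOn.differentiableAt_of_isOpen hU one_ne_zero hx)]
  have h2 : ‖χ x • ∇ w x + w x • ∇ χ x‖ ≤ ‖∇ w x‖ + |w x| * B := by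
    refine (norm_add_le _ _).trans (add_le_add ?_ ?_)
    · rw [norm_smul, Real.norm_of_nonneg (h0 x)]
      exact mul_le_of_le_one_left (norm_nonneg _) (h1 x)
    · rw [norm_smul, Real.norm_eq_abs]
      exact mul_le_mul_of_nonneg_left (hB x hx) (abs_nonneg _)
  have h3 := pow_le_pow_left₀ (norm_nonneg _) h2 2
  nlinarith [sq_nonneg (‖∇ w x‖ - |w x| * B), sq_abs (w x)]

theorem integral_sq_mul_le (hU : IsOpen U) (hb : Bornology.IsBounded U) {χ w : Plane → ℝ}
    (hχ : MemH1 U χ) (hw : MemH1 U w) (h0 : ∀ x, 0 ≤ χ x) (h1 : ∀ x, χ x ≤ 1) :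
    ∫ x in U, (χ x * w x) ^ 2 ≤ ∫ x in U, w x ^ 2 := by
  refine integral_mono ((hχ.mul hU hb hw).memLp hU hb).integrable_sq (hw.memLp hU hb).integrable_sq
    fun x => ?_
  simp only [mul_pow]
  exact mul_le_of_le_one_left (sq_nonneg _) (pow_le_one₀ (h0 x) (h1 x))

theorem integral_add_sq_le {α : Type*} [MeasurableSpace α] {μ : Measure α} {f g : α → ℝ}
    (hf : MemLp f 2 μ) (hg : MemLp g 2 μ) :
    ∫ x, (f x + g x) ^ 2 ∂μ ≤ 2 * (∫ x, f x ^ 2 ∂μ + ∫ x, g x ^ 2 ∂μ) := by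
  rw [← integral_add hf.integrable_sq hg.integrable_sq, ← integral_const_mul]
  exact integral_mono (hf.add hg).integrable_sq
    ((hf.integrable_sq.add hg.integrable_sq).const_mul _) fun x => add_sq_le

theorem integral_sum_sq_le {α β : Type*} [MeasurableSpace α] {μ : Measure α} (s : Finset β)
    {f : β → α → ℝ} (hf : ∀ i ∈ s, MemLp (f i) 2 μ) :
    ∫ x, (∑ i ∈ s, f i x) ^ 2 ∂μ ≤ s.card * ∑ i ∈ s, ∫ x, f i x ^ 2 ∂μ := by
  rw [← integral_finsetSum _ fun i hi => (hf i hi).integrable_sq, ← integral_const_mul]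
  exact integral_mono (memLp_finsetSum s hf).integrable_sq
    ((integrable_finsetSum _ fun i hi => (hf i hi).integrable_sq).const_mul _)
    fun x => sq_sum_le_card_mul_sum_sq

end ProductEstimates

namespace PolygonElement

variable {E : PolygonElement} {k : ℕ}

theorem MemVirtual.edgePoly_mul {u v : Plane → ℝ} (hu : E.MemVirtual k u) (hv : E.MemVirtual k v) :
    E.EdgePoly (2 * k) (u * v) := fun i => by
  obtain ⟨p, hp, hp'⟩ := hu.edge_poly i
  obtain ⟨q, hq, hq'⟩ := hv.edge_poly i
  refine ⟨p * q, natDegree_mul_le.trans (by omega), fun t ht => ?_⟩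
  rw [Pi.mul_apply, hp' t ht, hq' t ht, eval_mul]

/-- Stability of the interpolation of products with cut-off functions. -/
def CutoffStability (k : ℕ) (ρ C : ℝ) : Prop :=
  ∀ (E : PolygonElement) (χ u w : Plane → ℝ) (B : ℝ), E.IsShapeRegular ρ →
    E.MemVirtual k u → E.MemVirtual k χ → E.MemVirtual k w → E.SameDof k u (χ * w) →
    (∀ x, 0 ≤ χ x) → (∀ x, χ x ≤ 1) → (∀ x ∈ E.carrier, ‖∇ χ x‖ ≤ B) →
    dirichletForm E.carrier u u ≤
      C * (dirichletForm E.carrier w w + B ^ 2 * ∫ x in E.carrier, w x ^ 2) ∧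
    ∫ x in E.carrier, u x ^ 2 ≤ C * (∫ x in E.carrier, w x ^ 2) + C * diam E.carrier ^ 2 *
      (dirichletForm E.carrier w w + B ^ 2 * ∫ x in E.carrier, w x ^ 2)

/-- The product χw is not virtual, but it is a polynomial of degree at most 2k on each edge, which
is all that the interpolation estimate requires. In 4C + 2 one factor 2 comes from the product rule
and another from writing u as (u − χw) + χw. -/
theorem exists_cutoffStability (k : ℕ) (hk : 1 ≤ k) {ρ : ℝ} (hρ : 0 < ρ) :
    ∃ C : ℝ, 1 ≤ C ∧ CutoffStability k ρ C := by
  obtain ⟨C, hC, hst⟩ := exists_interpolation_stability k hk hρ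
  refine ⟨4 * C + 2, by linarith, fun E χ u w B hE hu hχ hw hd h0 h1 hB => ?_⟩
  have hU := E.isOpen_carrier
  have hb := E.isBounded_carrier
  have hg := hχ.memH1.mul hU hb hw.memH1
  obtain ⟨e1, e2⟩ := hst E u (χ * w) hE hu hg (hχ.edgePoly_mul hw) hd
  have e3 := dirichletForm_mul_le hU hb hχ.memH1 hw.memH1 h0 h1 hB
  have e4 := integral_sq_mul_le hU hb hχ.memH1 hw.memH1 h0 h1
  have e5 := integral_add_sq_le ((hu.memH1.sub hU hg).memLp hU hb) (hg.memLp hU hb)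
  simp only [Pi.sub_apply, Pi.mul_apply, sub_add_cancel] at e2 e5
  have n1 := dirichletForm_self_nonneg E.carrier w
  have n2 : 0 ≤ ∫ x in E.carrier, w x ^ 2 := integral_nonneg fun x => sq_nonneg _
  set q := dirichletForm E.carrier w w
  set m := ∫ x in E.carrier, w x ^ 2
  have n3 : 0 ≤ q + B ^ 2 * m := by positivity
  have e6 := mul_le_mul_of_nonneg_left e3 hC
  have e7 := mul_le_mul_of_nonneg_left e3 (mul_nonneg hC (sq_nonneg (diam E.carrier)))
  constructor
  · nlinarith
  · have n4 : 0 ≤ diam E.carrier ^ 2 * (q + B ^ 2 * m) := by positivity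
    nlinarith [mul_nonneg hC n2]

end PolygonElement

namespace PolygonalMesh

variable {ι : Type} [Fintype ι] {M : PolygonalMesh ι} {k : ℕ} {S : Finset ι} {u v w : Plane → ℝ}
  {κ : Plane → ℝ} {a : ι → ℝ}

theorem pairwise_disjoint_carrier (S : Finset ι) :
    Set.Pairwise (S : Set ι) (Function.onFun Disjoint fun e => (M.elem e).carrier) :=
  fun e _ f _ hef => M.disjoint_elem e f hef

/-- The coefficient becomes a constant factor on each element. All later estimates are made for the
individual summands, so that the jumps of `κ` do not matter. -/
theorem energy_eq_sum (ha : ∀ e, ∀ x ∈ (M.elem e).carrier, κ x = a e)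
    (hu : ∀ e ∈ S, MemH1 (M.elem e).carrier u) (hv : ∀ e ∈ S, MemH1 (M.elem e).carrier v) :
    M.energy κ S u v = ∑ e ∈ S, a e * dirichletForm (M.elem e).carrier u v := by
  have hms := fun e => (M.elem e).isOpen_carrier.measurableSet
  have hc : ∀ e, EqOn (fun x => κ x * ⟪∇ u x, ∇ v x⟫_ℝ) (fun x => a e * ⟪∇ u x, ∇ v x⟫_ℝ)
      (M.elem e).carrier := fun e x hx => by simp only [ha e x hx]
  rw [energy, region, integral_biUnion_finset S (fun e _ => hms e) (pairwise_disjoint_carrier S)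
    fun e he => IntegrableOn.congr_fun (((hu e he).integrableOn_inner (hv e he)).const_mul (a e))
      (hc e).symm (hms e)]
  refine Finset.sum_congr rfl fun e he => ?_
  rw [setIntegral_congr_fun (hms e) (hc e), integral_const_mul, dirichletForm]

theorem mass_eq_sum (ha : ∀ e, ∀ x ∈ (M.elem e).carrier, κ x = a e)
    (hu : ∀ e ∈ S, MemH1 (M.elem e).carrier u) (hv : ∀ e ∈ S, MemH1 (M.elem e).carrier v) :
    M.mass κ S u v = ∑ e ∈ S, a e * ∫ x in (M.elem e).carrier, u x * v x := by
  have hms := fun e => (M.elem e).isOpen_carrier.measurableSet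
  have hc : ∀ e, EqOn (fun x => κ x * u x * v x) (fun x => a e * (u x * v x))
      (M.elem e).carrier := fun e x hx => by simp only [ha e x hx, mul_assoc]
  have hi : ∀ e ∈ S, IntegrableOn (fun x => u x * v x) (M.elem e).carrier := fun e he =>
    ((hu e he).memLp (M.elem e).isOpen_carrier (M.elem e).isBounded_carrier).integrable_mul
      ((hv e he).memLp (M.elem e).isOpen_carrier (M.elem e).isBounded_carrier)
  rw [mass, region, integral_biUnion_finset S (fun e _ => hms e) (pairwise_disjoint_carrier S)
    fun e he => IntegrableOn.congr_fun ((hi e he).const_mul (a e)) (hc e).symm (hms e)]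
  refine Finset.sum_congr rfl fun e he => ?_
  rw [setIntegral_congr_fun (hms e) (hc e), integral_const_mul]

theorem memH1_of_mem_space (hu : u ∈ M.space k S) {e : ι} (he : e ∈ S) :
    MemH1 (M.elem e).carrier u := (hu.1 e he).memH1

/-- The energy as a bilinear form on the functions of a subdomain. -/
noncomputable def energyForm (ha : ∀ e, ∀ x ∈ (M.elem e).carrier, κ x = a e) (k : ℕ)
    (S : Finset ι) : M.dirichletSpace k S →ₗ[ℝ] M.dirichletSpace k S →ₗ[ℝ] ℝ :=
  have hH := fun (u : M.dirichletSpace k S) (e : ι) (he : e ∈ S) => memH1_of_mem_space u.2.1 he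
  have hO := fun e => (M.elem e).isOpen_carrier
  have hadd : ∀ u v w : M.dirichletSpace k S,
      M.energy κ S (u + v : M.dirichletSpace k S) w = M.energy κ S u w + M.energy κ S v w :=
    fun u v w => by
      rw [energy_eq_sum ha (hH _) (hH _), energy_eq_sum ha (hH _) (hH _),
        energy_eq_sum ha (hH _) (hH _), ← Finset.sum_add_distrib]
      refine Finset.sum_congr rfl fun e he => ?_
      rw [← mul_add, ← dirichletForm_add_left (hO e) (hH u e he) (hH v e he) (hH w e he)]
      rfl
  have hsmul : ∀ (c : ℝ) (u v : M.dirichletSpace k S),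
      M.energy κ S (c • u : M.dirichletSpace k S) v = c • M.energy κ S u v :=
    fun c u v => by
      rw [energy_eq_sum ha (hH _) (hH _), energy_eq_sum ha (hH _) (hH _), smul_eq_mul,
        Finset.mul_sum]
      refine Finset.sum_congr rfl fun e he => ?_
      rw [mul_left_comm, ← dirichletForm_smul_left (hO e) c (hH u e he)]
      rfl
  have hsymm : ∀ u v : M.dirichletSpace k S, M.energy κ S u v = M.energy κ S v u := fun u v => by
    simp only [energy, real_inner_comm]
  LinearMap.mk₂ ℝ (fun u v => M.energy κ S u v) hadd hsmul
    (fun u v w => by rw [hsymm, hadd, hsymm v u, hsymm w u])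
    (fun c u v => by rw [hsymm, hsmul, hsymm v u])

theorem energyForm_apply (ha : ∀ e, ∀ x ∈ (M.elem e).carrier, κ x = a e)
    (u v : M.dirichletSpace k S) : energyForm ha k S u v = M.energy κ S u v := rfl

/-- The weighted mass as a bilinear form on the functions of a subdomain. -/
noncomputable def massForm (ha : ∀ e, ∀ x ∈ (M.elem e).carrier, κ x = a e) (k : ℕ)
    (S : Finset ι) : M.dirichletSpace k S →ₗ[ℝ] M.dirichletSpace k S →ₗ[ℝ] ℝ :=
  have hH := fun (u : M.dirichletSpace k S) (e : ι) (he : e ∈ S) => memH1_of_mem_space u.2.1 he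
  have hi := fun (u v : M.dirichletSpace k S) (e : ι) (he : e ∈ S) =>
    MemLp.integrable_mul ((hH u e he).memLp (M.elem e).isOpen_carrier (M.elem e).isBounded_carrier)
      ((hH v e he).memLp (M.elem e).isOpen_carrier (M.elem e).isBounded_carrier)
  have hadd : ∀ u v w : M.dirichletSpace k S,
      M.mass κ S (u + v : M.dirichletSpace k S) w = M.mass κ S u w + M.mass κ S v w :=
    fun u v w => by
      rw [mass_eq_sum ha (hH _) (hH _), mass_eq_sum ha (hH _) (hH _),
        mass_eq_sum ha (hH _) (hH _), ← Finset.sum_add_distrib]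
      refine Finset.sum_congr rfl fun e he => ?_
      have h1 : ∫ x in (M.elem e).carrier, ((u : Plane → ℝ) x * (w : Plane → ℝ) x +
          (v : Plane → ℝ) x * (w : Plane → ℝ) x) = _ := integral_add (hi u w e he) (hi v w e he)
      rw [← mul_add]
      refine congrArg _ (Eq.trans ?_ h1)
      refine integral_congr_ae (Eventually.of_forall fun x => ?_)
      simp [add_mul]
  have hsmul : ∀ (c : ℝ) (u v : M.dirichletSpace k S),
      M.mass κ S (c • u : M.dirichletSpace k S) v = c • M.mass κ S u v :=
    fun c u v => by
      rw [mass_eq_sum ha (hH _) (hH _), mass_eq_sum ha (hH _) (hH _), smul_eq_mul, Finset.mul_sum]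
      refine Finset.sum_congr rfl fun e he => ?_
      rw [mul_left_comm, ← integral_const_mul c]
      refine congrArg (a e * ·) (integral_congr_ae (Eventually.of_forall fun x => ?_))
      simp [mul_assoc]
  have hsymm : ∀ u v : M.dirichletSpace k S, M.mass κ S u v = M.mass κ S v u := fun u v => by
    simp only [mass, mul_assoc, mul_comm ((u : Plane → ℝ) _)]
  LinearMap.mk₂ ℝ (fun u v => M.mass κ S u v) hadd hsmul
    (fun u v w => by rw [hsymm, hadd, hsymm v u, hsymm w u])
    (fun c u v => by rw [hsymm, hsmul, hsymm v u])

theorem massForm_apply (ha : ∀ e, ∀ x ∈ (M.elem e).carrier, κ x = a e)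
    (u v : M.dirichletSpace k S) : massForm ha k S u v = M.mass κ S u v := rfl

theorem energy_self_nonneg (hpos : ∀ e, 0 < a e) (ha : ∀ e, ∀ x ∈ (M.elem e).carrier, κ x = a e)
    (hu : ∀ e ∈ S, MemH1 (M.elem e).carrier u) : 0 ≤ M.energy κ S u u := by
  rw [energy_eq_sum ha hu hu]
  exact Finset.sum_nonneg fun e _ => mul_nonneg (hpos e).le (dirichletForm_self_nonneg _ _)

theorem disjoint_carrier_closedRegion {e : ι} (he : e ∉ S) :
    Disjoint (M.elem e).carrier (M.closedRegion S) := by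
  rw [closedRegion, Set.disjoint_iUnion₂_right]
  intro f hf
  exact (M.disjoint_elem e f (by rintro rfl; exact he hf)).closure_right (M.elem e).isOpen_carrier

theorem eq_zero_on_carrier (hu : ∀ x, x ∉ M.closedRegion S → u x = 0) {e : ι} (he : e ∉ S) :
    EqOn u 0 (M.elem e).carrier := fun x hx =>
  hu x fun hx' => Set.disjoint_left.1 (disjoint_carrier_closedRegion he) hx hx'

/-- A function that is supported in the elements of `S` vanishes on all other closed elements. -/
theorem eq_zero_on_closure (hu : ∀ x, x ∉ M.closedRegion S → u x = 0) {e : ι} (he : e ∉ S)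
    (hc : ContinuousOn u (closure (M.elem e).carrier)) : EqOn u 0 (closure (M.elem e).carrier) :=
  (eq_zero_on_carrier hu he).of_subset_closure hc continuousOn_const subset_closure subset_rfl

theorem dirichletForm_eq_zero_of_eqOn {e : ι} (hu : EqOn u 0 (M.elem e).carrier) :
    dirichletForm (M.elem e).carrier u u = 0 := by
  rw [dirichletForm_congr (M.elem e).isOpen_carrier hu hu]
  have : ∇ (0 : Plane → ℝ) = 0 := by
    funext x
    exact gradient_fun_const x (0 : ℝ)
  simp [dirichletForm, this]

/-- The eigenfunctions split the restriction of a function to the subdomain. -/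
theorem IsEigenbasis.exists_splitting (hpos : ∀ e, 0 < a e)
    (ha : ∀ e, ∀ x ∈ (M.elem e).carrier, κ x = a e) {n : ℕ} {ψ : Fin n → Plane → ℝ}
    {lam : Fin n → ℝ} (h : M.IsEigenbasis k κ S ψ lam) {L : ℕ} (hL : L < n)
    (hv : v ∈ M.fineSpace k) :
    ∃ c : Fin n → ℝ, ∃ w ∈ M.dirichletSpace k S,
      (∀ x ∈ M.closedRegion S, v x = (∑ l with l.val < L, c l • ψ l) x + w x) ∧
      ∑ e ∈ S, a e * dirichletForm (M.elem e).carrier w w ≤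
        ∑ e ∈ S, a e * dirichletForm (M.elem e).carrier v v ∧
      lam ⟨L, hL⟩ * ∑ e ∈ S, a e * ∫ x in (M.elem e).carrier, w x ^ 2 ≤
        ∑ e ∈ S, a e * dirichletForm (M.elem e).carrier v v := by
  have hmem : ∀ l, ψ l ∈ M.dirichletSpace k S := fun l => by
    rw [← h.span_eq]; exact Submodule.subset_span ⟨l, rfl⟩
  -- The restriction of `v` to the subdomain, extended by zero. It may jump across the boundary of
  -- the subdomain, which `dirichletSpace` permits inside D.
  let f := (M.closedRegion S).indicator v
  have hfv : ∀ e ∈ S, EqOn f v (closure (M.elem e).carrier) := fun e he x hx =>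
    indicator_of_mem (mem_iUnion₂.2 ⟨e, he, hx⟩) v
  have hf : f ∈ M.dirichletSpace k S := by
    refine ⟨⟨fun e he => (memVirtual_of_mem_space hv.1 e).congr (hfv e he), fun x hx =>
      indicator_of_notMem hx v⟩, fun x hx => ?_⟩
    change (M.closedRegion S).indicator v x = 0
    rw [indicator_of_mem hx.1]
    obtain ⟨e, -, he⟩ := mem_iUnion₂.1 hx.1
    exact hv.2 x ⟨mem_closedRegion_univ he, hx.2⟩
  have hef : energyForm ha k S ⟨f, hf⟩ ⟨f, hf⟩ =
      ∑ e ∈ S, a e * dirichletForm (M.elem e).carrier v v := by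
    have hH := fun (e : ι) (he : e ∈ S) => memH1_of_mem_space hf.1 he
    rw [energyForm_apply, energy_eq_sum ha hH hH]
    refine Finset.sum_congr rfl fun e he => ?_
    rw [dirichletForm_congr (M.elem e).isOpen_carrier ((hfv e he).mono subset_closure)
      ((hfv e he).mono subset_closure)]
  have hspan : ⊤ ≤ Submodule.span ℝ (range fun l => (⟨ψ l, hmem l⟩ : M.dirichletSpace k S)) := by
    rintro ⟨x, hx⟩ -
    have hx' := hx
    rw [← h.span_eq, Submodule.mem_span_range_iff_exists_fun] at hx'
    obtain ⟨c, hc⟩ := hx'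
    rw [Submodule.mem_span_range_iff_exists_fun]
    exact ⟨c, Subtype.ext (by simpa using hc)⟩
  obtain ⟨c, w, hfw, e1, e2⟩ := exists_spectral_splitting (energyForm ha k S) (massForm ha k S)
    hspan (fun l j => h.orthonormal l j) (fun l w => h.eigen l w w.2)
    (fun w => energy_self_nonneg hpos ha fun e he => memH1_of_mem_space w.2.1 he) h.monotone hL
    ⟨f, hf⟩
  have hHw := fun (e : ι) (he : e ∈ S) => memH1_of_mem_space w.2.1 he
  refine ⟨c, w, w.2, fun x hx => ?_, ?_, ?_⟩
  · have h1 : f x = v x := indicator_of_mem hx v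
    have h2 := congrArg (fun g : M.dirichletSpace k S => (g : Plane → ℝ) x) hfw
    simp only [Submodule.coe_add, Submodule.coe_sum, Submodule.coe_smul, Pi.add_apply] at h2
    rw [← h1, h2]
  · rw [hef, energyForm_apply, energy_eq_sum ha hHw hHw] at e1
    exact e1
  · rw [hef, massForm_apply, mass_eq_sum ha hHw hHw] at e2
    simpa only [sq] using e2

end PolygonalMesh

end

/-! ### Elementwise estimates for the two partitions of unity -/

section

open MeasureTheory Polynomial Set Filter Topology Metric
open scoped Gradient InnerProductSpace Laplacian ENNReal

namespace PolygonalMesh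

variable {ι : Type} [Fintype ι] {M : PolygonalMesh ι} {k N : ℕ} {u v w : Plane → ℝ}
  {κ : Plane → ℝ} {a : ι → ℝ} {ν : Type} [Fintype ν] {S : ν → Finset ι} {χ : ν → Plane → ℝ}
  {B C ρ : ℝ}

theorem isStarMesh (hρ : 0 < ρ) (hreg : ∀ e, (M.elem e).IsShapeRegular ρ) : M.IsStarMesh :=
  fun e => let ⟨c, hc⟩ := (hreg e).exists_isStarDisc hρ; ⟨c, _, hc⟩

theorem IsPartitionOfUnity.eqOn_zero (hχ : M.IsPartitionOfUnity k S χ B) {i : ν} {e : ι}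
    (he : e ∉ S i) : EqOn (χ i) 0 (closure (M.elem e).carrier) :=
  eq_zero_on_closure (hχ.support i) he (PiecewiseContinuous.of_mem_space (hχ.mem i) e)

theorem IsPartitionOfUnity.piecewiseContinuous_mul (hχ : M.IsPartitionOfUnity k S χ B) {i : ν}
    (hw : ∀ e ∈ S i, ContinuousOn w (closure (M.elem e).carrier)) :
    M.PiecewiseContinuous (χ i * w) := fun e => by
  by_cases he : e ∈ S i
  · exact (PiecewiseContinuous.of_mem_space (hχ.mem i) e).mul (hw e he)
  · refine (continuousOn_const (c := (0 : ℝ))).congr fun x hx => ?_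
    simp [hχ.eqOn_zero he hx]

theorem card_filter_le {α : Type} [Fintype α] {p : α → Prop} [DecidablePred p] (h : {i | p i}.ncard ≤ N) :
    (Finset.univ.filter p).card ≤ N := by
  rwa [← Set.ncard_coe_finset, Finset.coe_filter_univ]

open scoped Classical in
/-- Elementwise bounds of a sum of interpolated products with a partition of unity. -/
theorem IsPartitionOfUnity.sum_interp_le (hk : 1 ≤ k) (hM : M.IsStarMesh)
    (hreg : ∀ e, (M.elem e).IsShapeRegular ρ) (hC : PolygonElement.CutoffStability k ρ C)
    (hC1 : 1 ≤ C) (hχ : M.IsPartitionOfUnity k S χ B) {w : ν → Plane → ℝ}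
    (hw : ∀ i, w i ∈ M.space k (S i)) {e : ι} (hN : {i | e ∈ S i}.ncard ≤ N) :
    dirichletForm (M.elem e).carrier (∑ i, M.interp k (χ i * w i)) (∑ i, M.interp k (χ i * w i)) ≤
      N * C * ∑ i with e ∈ S i, (dirichletForm (M.elem e).carrier (w i) (w i) +
        B ^ 2 * ∫ x in (M.elem e).carrier, w i x ^ 2) ∧
    ∫ x in (M.elem e).carrier, (∑ i, M.interp k (χ i * w i) x) ^ 2 ≤
      N * C * ((∑ i with e ∈ S i, ∫ x in (M.elem e).carrier, w i x ^ 2) +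
        diam (M.elem e).carrier ^ 2 * ∑ i with e ∈ S i,
          (dirichletForm (M.elem e).carrier (w i) (w i) +
            B ^ 2 * ∫ x in (M.elem e).carrier, w i x ^ 2)) := by
  set T := Finset.univ.filter fun i => e ∈ S i with hT
  have hO := (M.elem e).isOpen_carrier
  have hb := (M.elem e).isBounded_carrier
  have hTN : (T.card : ℝ) ≤ N := Nat.cast_le.2 (card_filter_le hN)
  have hpc : ∀ i, M.PiecewiseContinuous (χ i * w i) := fun i =>
    hχ.piecewiseContinuous_mul fun e he => ((hw i).1 e he).continuousOn
  have hV : ∀ i, (M.elem e).MemVirtual k (M.interp k (χ i * w i)) := fun i =>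
    memVirtual_of_mem_space (interp_mem_space hk hM (hpc i)) e
  -- The function `w i` is controlled only on the elements of `S i`. On the others the cut-off
  -- function and hence the interpolant vanish, which leaves at most `N` summands.
  have hsum : EqOn (∑ i, M.interp k (χ i * w i)) (∑ i ∈ T, M.interp k (χ i * w i))
      (closure (M.elem e).carrier) := fun x hx => by
    rw [Finset.sum_apply, Finset.sum_apply]
    refine (Finset.sum_subset (Finset.subset_univ T) fun i _ hi => ?_).symm
    refine interp_eq_zero_of_eqOn hk hM (hpc i) (fun x hx => ?_) x hx
    rw [Pi.mul_apply, hχ.eqOn_zero (fun h => hi (by simpa [hT] using h)) hx, Pi.zero_apply, zero_mul]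
  have hest := fun i (hi : i ∈ T) => hC (M.elem e) (χ i) (M.interp k (χ i * w i)) (w i) B (hreg e)
    (hV i) (memVirtual_of_mem_space (hχ.mem i) e)
    ((hw i).1 e (by simpa [hT] using hi)) (sameDof_interp hk hM (hpc i) e) (hχ.nonneg i)
    (hχ.le_one i) (hχ.grad_le i e)
  have hC0 : 0 ≤ C := by linarith
  have hTC : T.card * C ≤ N * C := mul_le_mul_of_nonneg_right hTN hC0
  have hm : ∀ i, 0 ≤ ∫ x in (M.elem e).carrier, w i x ^ 2 := fun i =>
    integral_nonneg fun x => sq_nonneg _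
  have hq : ∀ i, 0 ≤ dirichletForm (M.elem e).carrier (w i) (w i) +
      B ^ 2 * ∫ x in (M.elem e).carrier, w i x ^ 2 := fun i =>
    add_nonneg (dirichletForm_self_nonneg _ _) (mul_nonneg (sq_nonneg _) (hm i))
  constructor
  · rw [dirichletForm_congr hO (hsum.mono subset_closure) (hsum.mono subset_closure)]
    refine (dirichletForm_sum_self_le hO T fun i _ => (hV i).memH1).trans ?_
    refine (mul_le_mul_of_nonneg_left (Finset.sum_le_sum fun i hi => (hest i hi).1)
      (Nat.cast_nonneg _)).trans ?_
    rw [← Finset.mul_sum, ← mul_assoc]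
    exact mul_le_mul_of_nonneg_right hTC (Finset.sum_nonneg fun i _ => hq i)
  · rw [setIntegral_congr_fun hO.measurableSet
      (g := fun x => (∑ i ∈ T, M.interp k (χ i * w i) x) ^ 2) fun x hx => by
        have := hsum (subset_closure hx)
        simp only [Finset.sum_apply] at this
        simp only [this]]
    refine (integral_sum_sq_le T fun i _ => (hV i).memH1.memLp hO hb).trans ?_
    refine (mul_le_mul_of_nonneg_left (Finset.sum_le_sum fun i hi => (hest i hi).2)
      (Nat.cast_nonneg _)).trans ?_
    rw [Finset.sum_add_distrib, ← Finset.mul_sum, ← Finset.mul_sum, mul_assoc C, ← mul_add,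
      ← mul_assoc]
    exact mul_le_mul_of_nonneg_right hTC (add_nonneg (Finset.sum_nonneg fun i _ => hm i)
      (mul_nonneg (sq_nonneg _) (Finset.sum_nonneg fun i _ => hq i)))

theorem isCompact_closedRegion (T : Finset ι) : IsCompact (M.closedRegion T) :=
  T.finite_toSet.isCompact_biUnion fun e _ => (M.elem e).isBounded_carrier.isCompact_closure

/-- An element of an overlapping subdomain that is large with respect to the overlap belongs to the
original subdomain. -/
theorem eq_of_overlap_lt {J : Type} [Fintype J] {sub : ι → J} {D' : J → Finset ι}
    (hsub : Function.Surjective sub) {e : ι} {c : Plane} {R : ℝ}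
    (hc : IsStarDisc (M.elem e).carrier c R) (hR : M.overlap sub D' < R) {j : J} (he : e ∈ D' j) :
    sub e = j := by
  classical
  by_contra hne
  refine hR.not_ge ?_
  have hbdd : BddAbove ((fun x => infDist x (M.closedRegion (block sub j))) ''
      M.closedRegion (D' j)) :=
    (isCompact_closedRegion _).bddAbove_image (continuous_infDist_pt _).continuousOn
  have h1 : infDist c (M.closedRegion (block sub j)) ≤ M.overlap sub D' :=
    (le_csSup hbdd (mem_image_of_mem _ (mem_iUnion₂.2 ⟨e, he, subset_closure hc.center_mem⟩))).trans
      (le_ciSup (f := fun j => sSup ((fun x => infDist x (M.closedRegion (block sub j))) ''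
        M.closedRegion (D' j))) (Set.finite_range _).bddAbove j)
  refine le_trans ?_ h1
  obtain ⟨f, hf⟩ := hsub j
  have hfb : f ∈ block sub j := by simp [block, hf]
  obtain ⟨y, hy⟩ := (M.elem f).isConnected_carrier.nonempty
  -- A point of the subdomain at distance less than `R` from the centre `c` would lie in the open
  -- element `e`. But `e` is not part of the subdomain and hence disjoint from it. So `c` is at
  -- distance at least `R`, more than the overlap.
  refine (le_infDist ⟨y, mem_iUnion₂.2 ⟨f, hfb, subset_closure hy⟩⟩).2 fun z hz => ?_
  by_contra! hlt
  have hz' : z ∈ (M.elem e).carrier := hc.ball_subset (by rwa [mem_ball, dist_comm])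
  refine Set.disjoint_left.1 (disjoint_carrier_closedRegion ?_) hz' hz
  simp [block, hne]

open scoped Classical in
/-- Elementwise bound of the interpolated product with a cut-off function of an overlapping
subdomain. -/
theorem dirichletForm_interp_mul_le (hk : 1 ≤ k) (hρ : 0 < ρ)
    (hreg : ∀ e, (M.elem e).IsShapeRegular ρ) (hC : PolygonElement.CutoffStability k ρ C)
    (hC1 : 1 ≤ C) {J : Type} [Fintype J] {sub : ι → J} {D' : J → Finset ι} {ξ : J → Plane → ℝ}
    {Cξ : ℝ} (hsub : Function.Surjective sub) (hδ : 0 < M.overlap sub D')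
    (hξ : M.IsPartitionOfUnity k D' ξ (Cξ / M.overlap sub D')) {z : Plane → ℝ}
    (hz : z ∈ M.space k Finset.univ) {j : J} {e : ι} (he : e ∈ D' j) {P F G : ℝ} (hP : 0 ≤ P)
    (hF : 0 ≤ F) (hG : 0 ≤ G) (hz1 : dirichletForm (M.elem e).carrier z z ≤ P * F)
    (hz2 : ∫ x in (M.elem e).carrier, z x ^ 2 ≤ P * (G + diam (M.elem e).carrier ^ 2 * F)) :
    dirichletForm (M.elem e).carrier (M.interp k (ξ j * z)) (M.interp k (ξ j * z)) ≤
      P * C * (1 + Cξ ^ 2 / ρ ^ 2 + Cξ ^ 2) * (F + 1 / M.overlap sub D' ^ 2 * G) := by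
  have hM := isStarMesh hρ hreg
  set δ := M.overlap sub D' with hδ_def
  set h := diam (M.elem e).carrier with hh
  have hO := (M.elem e).isOpen_carrier
  have hpc : M.PiecewiseContinuous (ξ j * z) := fun e =>
    (PiecewiseContinuous.of_mem_space (hξ.mem j) e).mul (PiecewiseContinuous.of_mem_space hz e)
  have hPC : 0 ≤ P * C := mul_nonneg hP (by linarith)
  have hcξ : 0 ≤ Cξ ^ 2 / ρ ^ 2 := by positivity
  -- If the element is small compared with the overlap, the term (h/δ)² F from the L² bound of `z`
  -- is at most F/ρ². If it is large, the cut-off function is not differentiated at all.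
  by_cases hsmall : ρ * h ≤ δ
  · have h1 := (hC (M.elem e) (ξ j) (M.interp k (ξ j * z)) z _ (hreg e)
      (memVirtual_of_mem_space (interp_mem_space hk hM hpc) e)
      (memVirtual_of_mem_space (hξ.mem j) e) (memVirtual_of_mem_space hz e)
      (sameDof_interp hk hM hpc e) (hξ.nonneg j) (hξ.le_one j) (hξ.grad_le j e)).1
    have h2 : 1 / δ ^ 2 * h ^ 2 ≤ 1 / ρ ^ 2 := by
      rw [one_div_mul_eq_div, div_le_div_iff₀ (by positivity) (by positivity), one_mul, ← mul_pow,
        mul_comm h]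
      exact pow_le_pow_left₀ (mul_nonneg hρ.le diam_nonneg) hsmall 2
    have h3 : (Cξ / δ) ^ 2 * ∫ x in (M.elem e).carrier, z x ^ 2 ≤
        P * (Cξ ^ 2 * (1 / δ ^ 2 * G) + Cξ ^ 2 / ρ ^ 2 * F) := by
      calc _ ≤ (Cξ / δ) ^ 2 * (P * (G + h ^ 2 * F)) := mul_le_mul_of_nonneg_left hz2 (sq_nonneg _)
        _ = P * (Cξ ^ 2 * (1 / δ ^ 2 * G) + Cξ ^ 2 * F * (1 / δ ^ 2 * h ^ 2)) := by ring
        _ ≤ P * (Cξ ^ 2 * (1 / δ ^ 2 * G) + Cξ ^ 2 * F * (1 / ρ ^ 2)) := by gcongr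
        _ = _ := by ring
    have hG' : 0 ≤ 1 / δ ^ 2 * G := by positivity
    calc _ ≤ _ := h1
      _ ≤ C * (P * F + P * (Cξ ^ 2 * (1 / δ ^ 2 * G) + Cξ ^ 2 / ρ ^ 2 * F)) := by gcongr
      _ = P * C * (F + Cξ ^ 2 / ρ ^ 2 * F + Cξ ^ 2 * (1 / δ ^ 2 * G)) := by ring
      _ ≤ P * C * ((1 + Cξ ^ 2 / ρ ^ 2 + Cξ ^ 2) * (F + 1 / δ ^ 2 * G)) := by
        refine mul_le_mul_of_nonneg_left ?_ hPC
        nlinarith [mul_nonneg (sq_nonneg Cξ) hF, mul_nonneg hcξ hG']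
      _ = _ := by ring
  · obtain ⟨c, hc⟩ := (hreg e).exists_isStarDisc hρ
    -- A large element belongs to one overlapping subdomain only, so all other functions of the
    -- partition of unity vanish on it.
    have hone : ∀ x ∈ closure (M.elem e).carrier, ξ j x = 1 := fun x hx => by
      rw [← hξ.sum_eq_one x (mem_closedRegion_univ hx), Finset.sum_eq_single j]
      · intro j' _ hj'
        refine hξ.eqOn_zero (fun he' => hj' ?_) hx
        rw [← eq_of_overlap_lt hsub hc (not_le.1 hsmall) he,
          ← eq_of_overlap_lt hsub hc (not_le.1 hsmall) he']
      · simp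
    have heq : EqOn (M.interp k (ξ j * z)) z (closure (M.elem e).carrier) :=
      interp_eqOn hk hM hpc (memVirtual_of_mem_space hz e)
        (PolygonElement.sameDof_of_eqOn fun x hx => by simp [hone x hx])
    rw [dirichletForm_congr hO (heq.mono subset_closure) (heq.mono subset_closure)]
    have hG' : 0 ≤ 1 / δ ^ 2 * G := by positivity
    calc _ ≤ _ := hz1
      _ ≤ P * (C * ((1 + Cξ ^ 2 / ρ ^ 2 + Cξ ^ 2) * (F + 1 / δ ^ 2 * G))) := by
        refine mul_le_mul_of_nonneg_left ?_ hP
        have h1 : F ≤ (1 + Cξ ^ 2 / ρ ^ 2 + Cξ ^ 2) * (F + 1 / δ ^ 2 * G) := by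
          nlinarith [mul_nonneg (sq_nonneg Cξ) hF, mul_nonneg hcξ hG', mul_nonneg hcξ hF,
            mul_nonneg (sq_nonneg Cξ) hG']
        nlinarith
      _ = _ := by ring

end PolygonalMesh

end

/-! ### The stable decomposition -/

section

open MeasureTheory Polynomial Set Filter Topology Metric
open scoped Gradient InnerProductSpace Laplacian ENNReal

namespace PolygonalMesh

variable {ι : Type} [Fintype ι] {M : PolygonalMesh ι} {k N : ℕ} {u v w : Plane → ℝ}
  {κ : Plane → ℝ} {a : ι → ℝ} {ν : Type} [Fintype ν] {S : ν → Finset ι} {χ : ν → Plane → ℝ}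
  {B C ρ : ℝ}

theorem mem_closedRegion_of_ne_zero (hχ : M.IsPartitionOfUnity k S χ B) {i : ν} {x : Plane}
    (hx : χ i x ≠ 0) : x ∈ M.closedRegion (S i) := by
  by_contra h
  exact hx (hχ.support i x h)

/-- The interpolated product of a function of a neighborhood with its cut-off function. -/
theorem IsPartitionOfUnity.interp_mul_mem_fineSpace (hk : 1 ≤ k) (hM : M.IsStarMesh)
    (hχ : M.IsPartitionOfUnity k S χ B) {i : ν} (hw : w ∈ M.dirichletSpace k (S i)) :
    M.interp k (χ i * w) ∈ M.fineSpace k := by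
  refine interp_mem_fineSpace hk hM (hχ.piecewiseContinuous_mul fun e he =>
    (hw.1.1 e he).continuousOn) fun x hx => ?_
  rw [Pi.mul_apply]
  by_cases h : χ i x = 0
  · rw [h, zero_mul]
  · rw [hw.2 x ⟨mem_closedRegion_of_ne_zero hχ h, hx.2⟩, mul_zero]

/-- The coarse space consists of the sums of the interpolated products of the cut-off functions and
the selected local eigenfunctions. -/
theorem sum_interp_mem_coarseSpace (hk : 1 ≤ k) (hM : M.IsStarMesh)
    (hχ : M.IsPartitionOfUnity k S χ B) {n : ν → ℕ} {ψ : ∀ i, Fin (n i) → Plane → ℝ}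
    (hψ : ∀ i l, ψ i l ∈ M.dirichletSpace k (S i)) {L : ν → ℕ} (c : ∀ i, Fin (n i) → ℝ)
    {v₀ : M.fineSpace k} (hv : (v₀ : Plane → ℝ) =
      ∑ i, M.interp k (χ i * ∑ l with l.val < L i, c i l • ψ i l)) :
    v₀ ∈ M.coarseSpace k χ ψ L := by
  change (v₀ : Plane → ℝ) ∈ Submodule.span ℝ _
  rw [hv]
  refine Submodule.sum_mem _ fun i _ => ?_
  have hpc : ∀ l, M.PiecewiseContinuous (χ i * ψ i l) := fun l =>
    hχ.piecewiseContinuous_mul fun e he => ((hψ i l).1.1 e he).continuousOn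
  have h1 : χ i * ∑ l with l.val < L i, c i l • ψ i l =
      ∑ l with l.val < L i, c i l • (χ i * ψ i l) := by
    simp only [Finset.mul_sum, mul_smul_comm]
  rw [h1, interp_sum hk hM _ fun l _ => (hpc l).smul _]
  refine Submodule.sum_mem _ fun l hl => ?_
  rw [interp_smul hk hM _ (hpc l)]
  exact Submodule.smul_mem _ _ (Submodule.subset_span ⟨i, l, (Finset.mem_filter.1 hl).2, rfl⟩)

open scoped Classical in
theorem sum_mul_sum_filter_eq (f : ι → ν → ℝ) :
    ∑ e, a e * ∑ i with e ∈ S i, f e i = ∑ i, ∑ e ∈ S i, a e * f e i := by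
  simp only [Finset.mul_sum, Finset.sum_filter]
  rw [Finset.sum_comm]
  refine Finset.sum_congr rfl fun i _ => ?_
  simp only [mul_ite, mul_zero]
  rw [← Finset.sum_filter]
  exact Finset.sum_congr (by ext; simp) fun _ _ => rfl

theorem sum_sum_le (hN : ∀ e, {i | e ∈ S i}.ncard ≤ N) {f : ι → ℝ} (hf : ∀ e, 0 ≤ f e) :
    ∑ i, ∑ e ∈ S i, f e ≤ N * ∑ e, f e := by
  classical
  have h := sum_mul_sum_filter_eq (S := S) (a := f) fun _ _ => 1
  simp only [mul_one, Finset.sum_const, nsmul_eq_mul] at h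
  rw [← h, Finset.mul_sum]
  refine Finset.sum_le_sum fun e _ => ?_
  rw [mul_comm]
  exact mul_le_mul_of_nonneg_right (Nat.cast_le.2 (card_filter_le (hN e))) (hf e)

/-- The splitting of a fine function into a function of the coarse space and functions of the
overlapping subdomains. -/
theorem exists_decomposition (k : ℕ) (hk : 1 ≤ k) {ρ : ℝ} (hρ : 0 < ρ) (N : ℕ) (Cχ Cξ : ℝ) :
    ∃ C : ℝ, 0 < C ∧ ∀ {ι : Type} [Fintype ι] {M : PolygonalMesh ι} {κ : Plane → ℝ} {a : ι → ℝ}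
      {ν : Type} [Fintype ν] {S : ν → Finset ι} {χ : ν → Plane → ℝ}
      {J : Type} [Fintype J] {sub : ι → J} {D' : J → Finset ι} {ξ : J → Plane → ℝ}
      {n : ν → ℕ} {ψ : ∀ i, Fin (n i) → Plane → ℝ} {lam : ∀ i, Fin (n i) → ℝ}
      {L : ν → ℕ} (hL : ∀ i, L i < n i) {H μ : ℝ},
      (∀ e, (M.elem e).IsShapeRegular ρ) → (∀ e, 0 < a e) →
      (∀ e, ∀ x ∈ (M.elem e).carrier, κ x = a e) →
      M.IsPartitionOfUnity k S χ (Cχ / H) → (∀ e, {i | e ∈ S i}.ncard ≤ N) →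
      Function.Surjective sub → 0 < M.overlap sub D' →
      M.IsPartitionOfUnity k D' ξ (Cξ / M.overlap sub D') → (∀ e, {j | e ∈ D' j}.ncard ≤ N) →
      (∀ i, M.IsEigenbasis k κ (S i) (ψ i) (lam i)) → 0 < μ → (∀ i, μ ≤ lam i ⟨L i, hL i⟩) →
      ∀ v : M.fineSpace k, ∃ v₀ ∈ M.coarseSpace k χ ψ L, ∃ w : J → M.fineSpace k,
        (∀ j, w j ∈ M.localSpace k (D' j)) ∧ v = v₀ + ∑ j, w j ∧
        M.energy κ Finset.univ v₀ v₀ + ∑ j, M.energy κ (D' j) (w j) (w j) ≤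
          C * (1 + 1 / (H ^ 2 * μ) + 1 / (M.overlap sub D' ^ 2 * μ)) *
            M.energy κ Finset.univ v v := by
  obtain ⟨C, hC1, hC⟩ := PolygonElement.exists_cutoffStability k hk hρ
  -- One factor `C` belongs to the interpolation that defines z, the other one to the interpolation
  -- of the products of z with the local cut-off functions; `N` bounds the number of neighborhoods
  -- of an element.
  set K : ℝ := N * C * C * (1 + Cξ ^ 2 / ρ ^ 2 + Cξ ^ 2) with hK
  have hcξ : 0 ≤ Cξ ^ 2 / ρ ^ 2 := by positivity
  have hC0 : 0 ≤ C := by linarith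
  have hK0 : 0 ≤ K := by positivity
  refine ⟨2 + (2 + N) * K * N * (1 + Cχ ^ 2), by positivity, ?_⟩
  intro ι _ M κ a ν _ S χ J _ sub D' ξ n ψ lam L hL H μ hreg hpos ha hχ hN hsub hδ hξ hN' hψ hμ hlam v
  classical
  have hM := isStarMesh hρ hreg
  set δ := M.overlap sub D' with hδ_def
  have hψm : ∀ i l, ψ i l ∈ M.dirichletSpace k (S i) := fun i l => by
    rw [← (hψ i).span_eq]; exact Submodule.subset_span ⟨l, rfl⟩
  -- On the i-th neighborhood `v` is the sum of its low modes with coefficients `c i` and of the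
  -- remainder `w i`, whose energy and λ-weighted mass are both bounded by the energy of `v` there.
  choose c w hw hsplit hwE hwM using fun i => (hψ i).exists_splitting hpos ha (hL i) v.2
  let p : ν → Plane → ℝ := fun i => ∑ l with l.val < L i, c i l • ψ i l
  have hp : ∀ i, p i ∈ M.dirichletSpace k (S i) := fun i =>
    Submodule.sum_mem _ fun l _ => Submodule.smul_mem _ _ (hψm i l)
  have hpc : ∀ {i f}, f ∈ M.dirichletSpace k (S i) → M.PiecewiseContinuous (χ i * f) :=
    fun {i f} hf => hχ.piecewiseContinuous_mul fun e he => (hf.1.1 e he).continuousOn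
  let v₀ : M.fineSpace k := ⟨∑ i, M.interp k (χ i * p i), Submodule.sum_mem _ fun i _ =>
    hχ.interp_mul_mem_fineSpace hk hM (hp i)⟩
  let z : M.fineSpace k := ⟨∑ i, M.interp k (χ i * w i), Submodule.sum_mem _ fun i _ =>
    hχ.interp_mul_mem_fineSpace hk hM (hw i)⟩
  -- The cut-off functions sum to 1 and interpolation reproduces `v`. Where a cut-off function does
  -- not vanish, the local splitting of `v` is valid.
  have hvz : v = v₀ + z := by
    refine Subtype.ext ?_
    change (v : Plane → ℝ) = ∑ i, M.interp k (χ i * p i) + ∑ i, M.interp k (χ i * w i)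
    rw [← Finset.sum_add_distrib, ← interp_of_mem_space (w := ∑ i, (χ i * p i + χ i * w i)) hk hM
      v.2.1 fun x hx => ?_, interp_sum hk hM _ fun i _ => (hpc (hp i)).add (hpc (hw i))]
    · exact Finset.sum_congr rfl fun i _ => interp_add hk hM (hpc (hp i)) (hpc (hw i))
    · have h1 : ∀ i, (χ i * p i + χ i * w i) x = χ i x * (v : Plane → ℝ) x := fun i => by
        by_cases h : χ i x = 0
        · simp [h]
        · rw [hsplit i x (mem_closedRegion_of_ne_zero hχ h)]
          simp only [Pi.add_apply, Pi.mul_apply, p, mul_add]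
      rw [Finset.sum_apply, Finset.sum_congr rfl fun i _ => h1 i, ← Finset.sum_mul,
        hχ.sum_eq_one x hx, one_mul]
  have hzs := z.2.1
  have hξz : ∀ j, M.PiecewiseContinuous (ξ j * (z : Plane → ℝ)) := fun j e =>
    (PiecewiseContinuous.of_mem_space (hξ.mem j) e).mul (PiecewiseContinuous.of_mem_space hzs e)
  let y : J → M.fineSpace k := fun j => ⟨M.interp k (ξ j * (z : Plane → ℝ)),
    interp_mem_fineSpace hk hM (hξz j) fun x hx => by rw [Pi.mul_apply, z.2.2 x hx, mul_zero]⟩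
  have hyz : z = ∑ j, y j := by
    refine Subtype.ext ?_
    rw [Submodule.coe_sum]
    change (z : Plane → ℝ) = ∑ j, M.interp k (ξ j * (z : Plane → ℝ))
    rw [← interp_sum hk hM _ fun j _ => hξz j, interp_of_mem_space hk hM hzs fun x hx => ?_]
    rw [← Finset.sum_mul, Pi.mul_apply, Finset.sum_apply, hξ.sum_eq_one x hx, one_mul]
  have hyl : ∀ j, y j ∈ M.localSpace k (D' j) := fun j x hx => by
    change M.interp k (ξ j * (z : Plane → ℝ)) x = 0
    by_cases hx' : x ∈ M.closedRegion Finset.univ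
    · obtain ⟨e, -, he⟩ := mem_iUnion₂.1 hx'
      refine interp_eq_zero_of_eqOn hk hM (hξz j) (fun t ht => ?_) x he
      rw [Pi.mul_apply, hξ.eqOn_zero (fun h => hx (mem_iUnion₂.2 ⟨e, h, he⟩)) ht, Pi.zero_apply,
        zero_mul]
    · exact (interp_mem_space hk hM (hξz j)).2 x hx'
  refine ⟨v₀, sum_interp_mem_coarseSpace hk hM hχ hψm c rfl, y, hyl, by rw [← hyz]; exact hvz, ?_⟩
  let q : ι → ν → ℝ := fun e i => dirichletForm (M.elem e).carrier (w i) (w i)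
  let m : ι → ν → ℝ := fun e i => ∫ x in (M.elem e).carrier, w i x ^ 2
  have hq : ∀ e i, 0 ≤ q e i := fun e i => dirichletForm_self_nonneg _ _
  have hm : ∀ e i, 0 ≤ m e i := fun e i => integral_nonneg fun x => sq_nonneg _
  let F : ι → ℝ := fun e => ∑ i with e ∈ S i, (q e i + (Cχ / H) ^ 2 * m e i)
  let G : ι → ℝ := fun e => ∑ i with e ∈ S i, m e i
  have hF : ∀ e, 0 ≤ F e := fun e => Finset.sum_nonneg fun i _ =>
    add_nonneg (hq e i) (mul_nonneg (sq_nonneg _) (hm e i))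
  have hG : ∀ e, 0 ≤ G e := fun e => Finset.sum_nonneg fun i _ => hm e i
  let P : ι → ℝ := fun e => F e + 1 / δ ^ 2 * G e
  have hP : ∀ e, 0 ≤ P e := fun e => add_nonneg (hF e) (mul_nonneg (by positivity) (hG e))
  have hzest : ∀ e, _ := fun e => hχ.sum_interp_le hk hM hreg hC hC1 (fun i => (hw i).1) (hN e)
  have hz2 : ∀ e, dirichletForm (M.elem e).carrier z z ≤ K * P e := fun e => by
    refine (hzest e).1.trans ?_
    have h1 : (N : ℝ) * C ≤ K := by
      rw [hK, mul_assoc (N * C : ℝ)]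
      refine le_mul_of_one_le_right (by positivity) ?_
      nlinarith [sq_nonneg Cξ]
    exact mul_le_mul h1 (le_add_of_nonneg_right (mul_nonneg (by positivity) (hG e))) (hF e) hK0
  have hyest : ∀ j, ∀ e ∈ D' j, dirichletForm (M.elem e).carrier (y j) (y j) ≤ K * P e :=
    fun j e he => by
      refine dirichletForm_interp_mul_le hk hρ hreg hC hC1 hsub hδ hξ hzs he (by positivity) (hF e)
        (hG e) (hzest e).1 ?_
      have := (hzest e).2
      simpa only [← Finset.sum_apply] using this
  have hH1 : ∀ (u : M.fineSpace k) (e : ι), MemH1 (M.elem e).carrier u := fun u e =>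
    (memVirtual_of_mem_space u.2.1 e).memH1
  have hen : ∀ (T : Finset ι) (u : M.fineSpace k), M.energy κ T u u =
      ∑ e ∈ T, a e * dirichletForm (M.elem e).carrier u u := fun T u =>
    energy_eq_sum ha (fun e _ => hH1 u e) fun e _ => hH1 u e
  set Ev := ∑ e, a e * dirichletForm (M.elem e).carrier v v with hEv
  have hEv0 : 0 ≤ Ev := Finset.sum_nonneg fun e _ =>
    mul_nonneg (hpos e).le (dirichletForm_self_nonneg _ _)
  set τ : ℝ := (Cχ / H) ^ 2 + 1 / δ ^ 2 with hτ
  have hτ0 : 0 ≤ τ := by positivity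
  -- Here the spectral bound enters: both zero-order terms, with factors (Cχ/H)² and 1/δ², are
  -- exchanged for the energy of `v` at the price of 1/μ. Each element is counted in at most `N`
  -- neighborhoods.
  have hQ : ∑ e, a e * P e ≤ N * (1 + τ / μ) * Ev := by
    have h1 : ∀ e, P e = ∑ i with e ∈ S i, (q e i + τ * m e i) := fun e => by
      simp only [P, F, G, Finset.mul_sum, ← Finset.sum_add_distrib]
      exact Finset.sum_congr rfl fun i _ => by ring
    simp only [h1]
    rw [sum_mul_sum_filter_eq]
    have h2 : ∀ i, ∑ e ∈ S i, a e * (q e i + τ * m e i) ≤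
        (1 + τ / μ) * ∑ e ∈ S i, a e * dirichletForm (M.elem e).carrier v v := fun i => by
      have e1 := hwE i
      have e2 : μ * ∑ e ∈ S i, a e * m e i ≤
          ∑ e ∈ S i, a e * dirichletForm (M.elem e).carrier v v :=
        (mul_le_mul_of_nonneg_right (hlam i) (Finset.sum_nonneg fun e _ =>
          mul_nonneg (hpos e).le (hm e i))).trans (hwM i)
      have e3 : ∑ e ∈ S i, a e * m e i ≤
          (∑ e ∈ S i, a e * dirichletForm (M.elem e).carrier v v) / μ := by
        rw [le_div_iff₀ hμ, mul_comm]; exact e2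
      have e4 : ∑ e ∈ S i, a e * (q e i + τ * m e i) =
          ∑ e ∈ S i, a e * q e i + τ * ∑ e ∈ S i, a e * m e i := by
        rw [Finset.mul_sum, ← Finset.sum_add_distrib]
        exact Finset.sum_congr rfl fun e _ => by ring
      have e5 : ∀ X : ℝ, (1 + τ / μ) * X = X + τ * (X / μ) := fun X => by ring
      rw [e4, e5]
      exact add_le_add e1 (mul_le_mul_of_nonneg_left e3 hτ0)
    refine (Finset.sum_le_sum fun i _ => h2 i).trans ?_
    rw [← Finset.mul_sum, mul_comm (N : ℝ), mul_assoc]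
    exact mul_le_mul_of_nonneg_left (sum_sum_le hN fun e =>
      mul_nonneg (hpos e).le (dirichletForm_self_nonneg _ _)) (by positivity)
  have hEz : ∑ e, a e * dirichletForm (M.elem e).carrier z z ≤ K * ∑ e, a e * P e := by
    rw [Finset.mul_sum]
    exact Finset.sum_le_sum fun e _ => by
      rw [mul_left_comm]; exact mul_le_mul_of_nonneg_left (hz2 e) (hpos e).le
  have hEy : ∑ j, M.energy κ (D' j) (y j) (y j) ≤ N * (K * ∑ e, a e * P e) := by
    calc _ ≤ ∑ j, ∑ e ∈ D' j, a e * (K * P e) := Finset.sum_le_sum fun j _ => by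
          rw [hen]
          exact Finset.sum_le_sum fun e he => mul_le_mul_of_nonneg_left (hyest j e he) (hpos e).le
      _ ≤ N * ∑ e, a e * (K * P e) := sum_sum_le hN' fun e =>
          mul_nonneg (hpos e).le (mul_nonneg hK0 (hP e))
      _ = _ := by
          congr 1
          rw [Finset.mul_sum]
          exact Finset.sum_congr rfl fun e _ => by ring
  have hEv₀ : M.energy κ Finset.univ v₀ v₀ ≤ 2 * Ev + 2 * (K * ∑ e, a e * P e) := by
    have h1 : ∀ e, dirichletForm (M.elem e).carrier v₀ v₀ ≤ 2 *
        (dirichletForm (M.elem e).carrier v v + dirichletForm (M.elem e).carrier z z) := fun e => by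
      have hO := (M.elem e).isOpen_carrier
      have e1 : (v₀ : Plane → ℝ) = v + (-1 : ℝ) • (z : Plane → ℝ) := by
        rw [hvz]; simp
      have e2 := dirichletForm_add_self_le hO (hH1 v e) ((hH1 z e).smul hO (-1))
      rw [← e1, dirichletForm_smul_left hO _ (hH1 z e), dirichletForm_comm,
        dirichletForm_comm _ _ ((-1 : ℝ) • (z : Plane → ℝ)),
        dirichletForm_smul_left hO _ (hH1 z e)] at e2
      linarith
    rw [hen]
    calc _ ≤ ∑ e, a e * (2 * (dirichletForm (M.elem e).carrier v v +
          dirichletForm (M.elem e).carrier z z)) := Finset.sum_le_sum fun e _ =>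
          mul_le_mul_of_nonneg_left (h1 e) (hpos e).le
      _ = 2 * Ev + 2 * ∑ e, a e * dirichletForm (M.elem e).carrier z z := by
          rw [hEv, Finset.mul_sum, Finset.mul_sum, ← Finset.sum_add_distrib]
          exact Finset.sum_congr rfl fun e _ => by ring
      _ ≤ _ := by linarith
  have hτμ : 1 + τ / μ ≤ (1 + Cχ ^ 2) * (1 + 1 / (H ^ 2 * μ) + 1 / (δ ^ 2 * μ)) := by
    have e1 : 0 ≤ 1 / (H ^ 2 * μ) := by positivity
    have e2 : 0 ≤ 1 / (δ ^ 2 * μ) := by positivity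
    have e3 : τ / μ = Cχ ^ 2 * (1 / (H ^ 2 * μ)) + 1 / (δ ^ 2 * μ) := by
      rw [hτ, add_div, div_pow, div_div, div_div, mul_one_div]
    rw [e3]
    nlinarith [mul_nonneg (sq_nonneg Cχ) e1, mul_nonneg (sq_nonneg Cχ) e2, sq_nonneg Cχ]
  rw [hen Finset.univ v, ← hEv]
  set Θ := 1 + 1 / (H ^ 2 * μ) + 1 / (δ ^ 2 * μ) with hΘ
  have hΘ1 : 1 ≤ Θ := by
    have e1 : 0 ≤ 1 / (H ^ 2 * μ) := by positivity
    have e2 : 0 ≤ 1 / (δ ^ 2 * μ) := by positivity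
    linarith
  calc _ ≤ 2 * Ev + (2 + N) * K * ∑ e, a e * P e := by linarith
    _ ≤ 2 * (Θ * Ev) + (2 + N) * K * (N * ((1 + Cχ ^ 2) * Θ) * Ev) := by
        refine add_le_add ?_ ?_
        · nlinarith
        · refine mul_le_mul_of_nonneg_left (hQ.trans ?_) (by positivity)
          gcongr
    _ = _ := by ring

end PolygonalMesh

end

/-! ### Additive Schwarz preconditioners -/

section

open MeasureTheory Polynomial Set Filter Topology Metric
open scoped Gradient InnerProductSpace Laplacian ENNReal

section MatrixForms

open Matrix

variable {n : ℕ}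

theorem dotProduct_mulVec_swap {G : Matrix (Fin n) (Fin n) ℝ} (hG : G.PosDef) (x y : Fin n → ℝ) :
    x ⬝ᵥ G *ᵥ y = y ⬝ᵥ G *ᵥ x := by
  have hT : Gᵀ = G := by
    rw [← conjTranspose_eq_transpose_of_trivial]; exact hG.isHermitian
  rw [dotProduct_mulVec, ← mulVec_transpose, hT, dotProduct_comm]

theorem dotProduct_mulVec_self_nonneg {G : Matrix (Fin n) (Fin n) ℝ} (hG : G.PosDef)
    (x : Fin n → ℝ) : 0 ≤ x ⬝ᵥ G *ᵥ x := by
  by_cases hx : x = 0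
  · simp [hx]
  · simpa using (hG.dotProduct_mulVec_pos hx).le

theorem mulVec_inv_mulVec {G : Matrix (Fin n) (Fin n) ℝ} (hG : G.PosDef) (r : Fin n → ℝ) :
    G *ᵥ (G⁻¹ *ᵥ r) = r := by
  rw [mulVec_mulVec, mul_nonsing_inv _ ((isUnit_iff_isUnit_det _).1 hG.isUnit), one_mulVec]

/-- Young's inequality with the dual norm of a positive definite matrix. -/
theorem two_mul_dotProduct_le {G : Matrix (Fin n) (Fin n) ℝ} (hG : G.PosDef) (r y : Fin n → ℝ)
    {t : ℝ} (ht : 0 < t) :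
    2 * (r ⬝ᵥ y) ≤ t * (r ⬝ᵥ G⁻¹ *ᵥ r) + t⁻¹ * (y ⬝ᵥ G *ᵥ y) := by
  have h := dotProduct_mulVec_self_nonneg hG (t • (G⁻¹ *ᵥ r) - y)
  have h1 := mulVec_inv_mulVec hG r
  rw [mulVec_sub, mulVec_smul, h1, sub_dotProduct, dotProduct_sub, dotProduct_sub, smul_dotProduct,
    smul_dotProduct, dotProduct_smul, dotProduct_smul, dotProduct_mulVec_swap hG (G⁻¹ *ᵥ r) y, h1,
    dotProduct_comm (G⁻¹ *ᵥ r) r, dotProduct_comm y r] at h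
  simp only [smul_eq_mul] at h
  have h2 : t * (r ⬝ᵥ G⁻¹ *ᵥ r) + t⁻¹ * (y ⬝ᵥ G *ᵥ y) - 2 * (r ⬝ᵥ y) =
      t⁻¹ * (t * (t * (r ⬝ᵥ G⁻¹ *ᵥ r)) - t * (r ⬝ᵥ y) - (t * (r ⬝ᵥ y) - y ⬝ᵥ G *ᵥ y)) := by
    field_simp; ring
  rw [← sub_nonneg, h2]
  exact mul_nonneg (inv_pos.2 ht).le h

theorem exists_mulVec_eq_smul_of_mem_spectrum {B : Matrix (Fin n) (Fin n) ℝ} {μ : ℝ}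
    (hμ : μ ∈ spectrum ℝ B) : ∃ x ≠ 0, B *ᵥ x = μ • x := by
  rw [spectrum.mem_iff, isUnit_iff_isUnit_det, isUnit_iff_ne_zero, not_not,
    ← exists_mulVec_eq_zero_iff] at hμ
  obtain ⟨x, hx, h⟩ := hμ
  refine ⟨x, hx, ?_⟩
  rw [sub_mulVec, sub_eq_zero, Algebra.algebraMap_eq_smul_one, smul_mulVec, one_mulVec] at h
  exact h.symm

variable {O : Type} [Fintype O] {m : O → ℕ} {A : Matrix (Fin n) (Fin n) ℝ}
  {P : ∀ o, Matrix (Fin n) (Fin (m o)) ℝ}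

/-- The additive Schwarz preconditioner of a family of subspaces. -/
noncomputable def additiveSchwarz (A : Matrix (Fin n) (Fin n) ℝ)
    (P : ∀ o, Matrix (Fin n) (Fin (m o)) ℝ) : Matrix (Fin n) (Fin n) ℝ :=
  ∑ o, P o * (subspaceMatrix A (P o))⁻¹ * (P o).transpose

theorem additiveSchwarz_mulVec (z : Fin n → ℝ) : additiveSchwarz A P *ᵥ z =
    ∑ o, P o *ᵥ ((subspaceMatrix A (P o))⁻¹ *ᵥ ((P o)ᵀ *ᵥ z)) := by
  simp only [additiveSchwarz, sum_mulVec, mulVec_mulVec, Matrix.mul_assoc]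

theorem dotProduct_additiveSchwarz (z x : Fin n → ℝ) : x ⬝ᵥ additiveSchwarz A P *ᵥ z =
    ∑ o, ((P o)ᵀ *ᵥ x) ⬝ᵥ ((subspaceMatrix A (P o))⁻¹ *ᵥ ((P o)ᵀ *ᵥ z)) := by
  rw [additiveSchwarz_mulVec, dotProduct_sum]
  exact Finset.sum_congr rfl fun o _ => by
    rw [dotProduct_mulVec, ← mulVec_transpose (P o) x]

theorem dotProduct_subspaceMatrix (o : O) (y : Fin (m o) → ℝ) :
    y ⬝ᵥ subspaceMatrix A (P o) *ᵥ y = (P o *ᵥ y) ⬝ᵥ A *ᵥ (P o *ᵥ y) := by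
  rw [subspaceMatrix, ← mulVec_mulVec, ← mulVec_mulVec, dotProduct_mulVec, vecMul_transpose]

/-- The quadratic form is the sum of the squared dual norms of the restrictions (P o)ᵀx. If it
vanishes, then x is orthogonal to the range of every `P o`, and these ranges span everything. -/
theorem posDef_additiveSchwarz (hP : ∀ o, (subspaceMatrix A (P o)).PosDef)
    (hspan : ∀ x, ∃ y : ∀ o, Fin (m o) → ℝ, x = ∑ o, P o *ᵥ y o) :
    (additiveSchwarz A P).PosDef := by
  refine posDef_iff_dotProduct_mulVec.2 ⟨?_, fun x hx => ?_⟩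
  · rw [IsHermitian, conjTranspose_eq_transpose_of_trivial, additiveSchwarz, transpose_sum]
    refine Finset.sum_congr rfl fun o _ => ?_
    have hT : ((subspaceMatrix A (P o))⁻¹)ᵀ = (subspaceMatrix A (P o))⁻¹ := by
      rw [← conjTranspose_eq_transpose_of_trivial]; exact (hP o).inv.isHermitian
    rw [transpose_mul, transpose_mul, transpose_transpose, hT, Matrix.mul_assoc]
  · rw [star_trivial, dotProduct_additiveSchwarz]
    have hnn := fun o => dotProduct_mulVec_self_nonneg (hP o).inv ((P o)ᵀ *ᵥ x)
    refine (Finset.sum_nonneg fun o _ => hnn o).lt_of_ne fun h0 => hx ?_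
    have hz := (Finset.sum_eq_zero_iff_of_nonneg fun o _ => hnn o).1 h0.symm
    have hz' : ∀ o, (P o)ᵀ *ᵥ x = 0 := fun o => by
      by_contra hne
      have := (hP o).inv.dotProduct_mulVec_pos hne
      rw [star_trivial, hz o (Finset.mem_univ o)] at this
      exact this.false
    obtain ⟨y, hy⟩ := hspan x
    rw [← dotProduct_self_eq_zero]
    nth_rewrite 2 [hy]
    rw [dotProduct_sum]
    refine Finset.sum_eq_zero fun o _ => ?_
    rw [dotProduct_mulVec, ← mulVec_transpose, hz' o, zero_dotProduct]

/-- The spectral bounds of the additive Schwarz method. -/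
theorem mem_Icc_of_mem_spectrum (hA : A.PosDef) (hP : ∀ o, (subspaceMatrix A (P o)).PosDef)
    {c K : ℝ} (hc : 0 < c)
    (hdec : ∀ x, ∃ y : ∀ o, Fin (m o) → ℝ, x = ∑ o, P o *ᵥ y o ∧
      ∑ o, (P o *ᵥ y o) ⬝ᵥ A *ᵥ (P o *ᵥ y o) ≤ c * (x ⬝ᵥ A *ᵥ x))
    (hK : ∀ y : ∀ o, Fin (m o) → ℝ, (∑ o, P o *ᵥ y o) ⬝ᵥ A *ᵥ (∑ o, P o *ᵥ y o) ≤
      K * ∑ o, (P o *ᵥ y o) ⬝ᵥ A *ᵥ (P o *ᵥ y o))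
    {μ : ℝ} (hμ : μ ∈ spectrum ℝ (additiveSchwarz A P * A)) : 1 / c ≤ μ ∧ μ ≤ K := by
  obtain ⟨x, hx, hev⟩ := exists_mulVec_eq_smul_of_mem_spectrum hμ
  rw [← mulVec_mulVec] at hev
  have hpos : 0 < x ⬝ᵥ A *ᵥ x := by simpa using hA.dotProduct_mulVec_pos hx
  set z := A *ᵥ x with hz
  have hzx : z ⬝ᵥ additiveSchwarz A P *ᵥ z = μ * (x ⬝ᵥ z) := by
    rw [hev, dotProduct_smul, smul_eq_mul, dotProduct_comm]
  have hsum := dotProduct_additiveSchwarz (A := A) (P := P) z z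
  rw [hzx] at hsum
  obtain ⟨y, hy, hye⟩ := hdec x
  -- With z = Ax, Young's inequality with t = c in each subspace gives 2 x·z ≤ cμ x·z + x·z, hence 1
  -- ≤ cμ.
  have hlow : 1 / c ≤ μ := by
    have h1 : 2 * (x ⬝ᵥ z) ≤ c * (μ * (x ⬝ᵥ z)) + c⁻¹ * (c * (x ⬝ᵥ z)) := by
      calc 2 * (x ⬝ᵥ z) = ∑ o, 2 * (((P o)ᵀ *ᵥ z) ⬝ᵥ y o) := by
            nth_rewrite 1 [hy]
            rw [← Finset.mul_sum, dotProduct_comm, dotProduct_sum]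
            refine congrArg (2 * ·) (Finset.sum_congr rfl fun o _ => ?_)
            rw [dotProduct_mulVec, mulVec_transpose]
        _ ≤ ∑ o, (c * (((P o)ᵀ *ᵥ z) ⬝ᵥ (subspaceMatrix A (P o))⁻¹ *ᵥ ((P o)ᵀ *ᵥ z)) +
            c⁻¹ * (y o ⬝ᵥ subspaceMatrix A (P o) *ᵥ y o)) :=
            Finset.sum_le_sum fun o _ => two_mul_dotProduct_le (hP o) _ _ hc
        _ ≤ _ := by
            rw [Finset.sum_add_distrib, ← Finset.mul_sum, ← Finset.mul_sum, ← hsum]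
            simp only [dotProduct_subspaceMatrix]
            gcongr
    rw [inv_mul_cancel_left₀ hc.ne'] at h1
    rw [div_le_iff₀ hc]
    nlinarith
  refine ⟨hlow, ?_⟩
  have hμ0 : 0 < μ := (by positivity : 0 < 1 / c).trans_le hlow
  -- The corrections of the preconditioner applied to z have the sum μx, and their energies add up
  -- to μ x·z. So the assumption reads μ² x·z ≤ Kμ x·z.
  have h2 := hK fun o => (subspaceMatrix A (P o))⁻¹ *ᵥ ((P o)ᵀ *ᵥ z)
  simp only [← dotProduct_subspaceMatrix, mulVec_inv_mulVec (hP _)] at h2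
  rw [← additiveSchwarz_mulVec, hev, mulVec_smul, smul_dotProduct, dotProduct_smul] at h2
  simp only [dotProduct_comm _ ((P _)ᵀ *ᵥ z)] at h2
  rw [← hsum, ← hz, smul_eq_mul, smul_eq_mul] at h2
  have h3 : μ * (x ⬝ᵥ z) > 0 := mul_pos hμ0 hpos
  exact le_of_mul_le_mul_right h2 h3

theorem spectralCond_le {B : Matrix (Fin n) (Fin n) ℝ} {c K : ℝ} (hc : 0 < c) (hK : 0 ≤ K)
    (h : ∀ μ ∈ spectrum ℝ B, 1 / c ≤ μ ∧ μ ≤ K) : spectralCond B ≤ K * c := by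
  rw [spectralCond]
  rcases (spectrum ℝ B).eq_empty_or_nonempty with he | hne
  -- The real spectrum may be empty, as for `n = 0`; then `sSup ∅ = 0` makes the quotient zero.
  · rw [he, Real.sSup_empty, zero_div]; positivity
  · have h1 : 1 / c ≤ sInf (spectrum ℝ B) := le_csInf hne fun μ hμ => (h μ hμ).1
    have h2 : sSup (spectrum ℝ B) ≤ K := csSup_le hne fun μ hμ => (h μ hμ).2
    have h3 : 0 < 1 / c := by positivity
    calc _ ≤ K / (1 / c) := div_le_div₀ hK h2 h3 h1
      _ = K * c := by rw [div_div_eq_mul_div, div_one]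

end MatrixForms

/-! ### Galerkin matrices and definiteness of the energy -/

section Galerkin

open Matrix

variable {V : Type} [AddCommGroup V] [Module ℝ V] {n m : ℕ} (b : Module.Basis (Fin n) ℝ V)

theorem dotProduct_of_mulVec (a : V →ₗ[ℝ] V →ₗ[ℝ] ℝ) (x y : Fin n → ℝ) :
    x ⬝ᵥ (Matrix.of fun p q => a (b p) (b q)) *ᵥ y =
      a (b.equivFun.symm x) (b.equivFun.symm y) := by
  simp only [Module.Basis.equivFun_symm_apply, map_sum, LinearMap.sum_apply, map_smul,
    LinearMap.smul_apply, smul_eq_mul, dotProduct, mulVec, of_apply, Finset.mul_sum]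
  rw [Finset.sum_comm]
  exact Finset.sum_congr rfl fun p _ => Finset.sum_congr rfl fun q _ => by ring

theorem prolongation_mulVec {W : Submodule ℝ V} (c : Module.Basis (Fin m) ℝ W) (y : Fin m → ℝ) :
    prolongation b c *ᵥ y = b.equivFun (c.equivFun.symm y : V) := by
  have h := LinearMap.toMatrix_mulVec_repr c b W.subtype (c.equivFun.symm y)
  have h' : (c.repr (c.equivFun.symm y) : Fin m → ℝ) = y := c.equivFun.apply_symm_apply y
  rw [h'] at h
  exact h

theorem posDef_of_form (a : V →ₗ[ℝ] V →ₗ[ℝ] ℝ) (hsymm : ∀ u v, a u v = a v u)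
    (hpos : ∀ v, v ≠ 0 → 0 < a v v) : (Matrix.of fun p q => a (b p) (b q)).PosDef := by
  refine posDef_iff_dotProduct_mulVec.2 ⟨?_, fun x hx => ?_⟩
  · ext p q
    simp [hsymm (b p) (b q)]
  · rw [star_trivial, dotProduct_of_mulVec]
    exact hpos _ fun h => hx (b.equivFun.symm.map_eq_zero_iff.1 h)

theorem posDef_subspaceMatrix {A : Matrix (Fin n) (Fin n) ℝ} (hA : A.PosDef) {W : Submodule ℝ V}
    (c : Module.Basis (Fin m) ℝ W) : (subspaceMatrix A (prolongation b c)).PosDef := by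
  rw [subspaceMatrix, ← conjTranspose_eq_transpose_of_trivial]
  refine hA.conjTranspose_mul_mul_same fun y y' h => ?_
  simp only [prolongation_mulVec] at h
  exact c.equivFun.symm.injective (Subtype.ext (b.equivFun.injective h))

end Galerkin

namespace PolygonalMesh

variable {ι : Type} [Fintype ι] {M : PolygonalMesh ι} {k N : ℕ} {κ : Plane → ℝ} {a : ι → ℝ}

/-- A function of the fine space without energy is zero. -/
theorem eq_zero_of_energy_eq_zero (hpos : ∀ e, 0 < a e)
    (ha : ∀ e, ∀ x ∈ (M.elem e).carrier, κ x = a e) (v : M.fineSpace k)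
    (hv : M.energy κ Finset.univ v v = 0) : v = 0 := by
  classical
  have hH : ∀ e, MemH1 (M.elem e).carrier v := fun e => (memVirtual_of_mem_space v.2.1 e).memH1
  have hconst : ∀ e, ∃ r, ∀ x ∈ closure (M.elem e).carrier, (v : Plane → ℝ) x = r := by
    intro e
    have hO := (M.elem e).isOpen_carrier
    rw [energy_eq_sum ha (fun e _ => hH e) fun e _ => hH e, Finset.sum_eq_zero_iff_of_nonneg
      fun e _ => mul_nonneg (hpos e).le (dirichletForm_self_nonneg _ _)] at hv
    have h1 := (mul_eq_zero.1 (hv e (Finset.mem_univ e))).resolve_left (hpos e).ne'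
    rw [dirichletForm_self] at h1
    have h2 := (integral_eq_zero_iff_of_nonneg (fun x => sq_nonneg _) (hH e).integrableOn_sq).1 h1
    have h3 := Measure.eqOn_open_of_ae_eq h2 hO
      (((hH e).contDiffOn.continuousOn_gradient hO).norm.pow 2) continuousOn_const
    obtain ⟨r, hr⟩ := hO.exists_is_const_of_fderiv_eq_zero
      (M.elem e).isConnected_carrier.isPreconnected
      ((hH e).contDiffOn.differentiableOn one_ne_zero) fun x hx => by
        have h4 : ‖∇ (v : Plane → ℝ) x‖ ^ 2 = 0 := h3 hx
        rw [norm_gradient_eq] at h4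
        exact norm_eq_zero.1 (pow_eq_zero_iff two_ne_zero |>.1 h4)
    exact ⟨r, EqOn.of_subset_closure (g := fun _ => r) hr (hH e).continuousOn continuousOn_const
      subset_closure subset_rfl⟩
  choose r hr using hconst
  have hzero : ∀ e, r e = 0 := by
    by_contra! hne
    obtain ⟨e₀, he₀⟩ := hne
    -- Connectedness of the domain is not needed. The closed union of the elements with the nonzero
    -- value `r e₀` is compact and so has a frontier point. It has a neighborhood without points of
    -- elements with another value, as `v` has only one value at the point. So the point lies on ∂D,
    -- where `v` vanishes.
    set T := Finset.univ.filter fun e => r e = r e₀ with hT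
    set T' := Finset.univ.filter fun e => r e ≠ r e₀ with hT'
    have hval : ∀ x ∈ M.closedRegion T, (v : Plane → ℝ) x = r e₀ := fun x hx => by
      obtain ⟨e, he, hxe⟩ := mem_iUnion₂.1 hx
      rw [hr e x hxe]; simpa [hT] using he
    have hval' : ∀ x ∈ M.closedRegion T', (v : Plane → ℝ) x ≠ r e₀ := fun x hx => by
      obtain ⟨e, he, hxe⟩ := mem_iUnion₂.1 hx
      rw [hr e x hxe]; simpa [hT'] using he
    obtain ⟨p, hp⟩ := (M.elem e₀).isConnected_carrier.nonempty
    have hne : (M.closedRegion T).Nonempty :=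
      ⟨p, mem_iUnion₂.2 ⟨e₀, by simp [hT], subset_closure hp⟩⟩
    have hfr : (frontier (M.closedRegion T)).Nonempty := by
      rw [nonempty_iff_ne_empty, Ne, frontier_eq_empty_iff, not_or]
      exact ⟨hne.ne_empty, (isCompact_closedRegion T).ne_univ⟩
    obtain ⟨x, hx⟩ := hfr
    have hxT : x ∈ M.closedRegion T := (isClosed_closedRegion T).frontier_subset hx
    obtain ⟨e, he, hxe⟩ := mem_iUnion₂.1 hxT
    have hxT' : (M.closedRegion T')ᶜ ∈ 𝓝 x :=
      (isClosed_closedRegion T').isOpen_compl.mem_nhds fun h => hval' x h (hval x hxT)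
    have hxD : x ∈ frontier M.domain := by
      refine ⟨closure_subset_closure_domain e hxe, ?_⟩
      rw [domain, interior_interior, mem_interior_iff_mem_nhds]
      intro hn
      refine hx.2 (mem_interior_iff_mem_nhds.2 ?_)
      filter_upwards [hn, hxT'] with y hy hy'
      obtain ⟨f, -, hf⟩ := mem_iUnion₂.1 hy
      refine mem_iUnion₂.2 ⟨f, ?_, hf⟩
      by_contra hfT
      exact hy' (mem_iUnion₂.2 ⟨f, by simpa [hT, hT'] using hfT, hf⟩)
    exact he₀ (by rw [← hval x hxT]; exact v.2.2 x ⟨mem_closedRegion_univ hxe, hxD⟩)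
  refine Subtype.ext (eq_of_mem_space v.2.1 (Submodule.zero_mem _) fun e x hx => ?_)
  rw [hr e x hx, hzero e]
  rfl

theorem energy_pos (hpos : ∀ e, 0 < a e) (ha : ∀ e, ∀ x ∈ (M.elem e).carrier, κ x = a e)
    (v : M.fineSpace k) (hv : v ≠ 0) : 0 < M.energy κ Finset.univ v v :=
  (energy_self_nonneg hpos ha fun _ he => memH1_of_mem_space v.2.1 he).lt_of_ne fun h =>
    hv (eq_zero_of_energy_eq_zero hpos ha v h.symm)

/-- The energy of a function of a local space. -/
theorem energy_eq_of_mem_localSpace (ha : ∀ e, ∀ x ∈ (M.elem e).carrier, κ x = a e)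
    {T : Finset ι} {w : M.fineSpace k} (hw : w ∈ M.localSpace k T) :
    M.energy κ T w w = M.energy κ Finset.univ w w := by
  have hH : ∀ e, MemH1 (M.elem e).carrier w := fun e => (memVirtual_of_mem_space w.2.1 e).memH1
  rw [energy_eq_sum ha (fun e _ => hH e) fun e _ => hH e,
    energy_eq_sum ha (fun e _ => hH e) fun e _ => hH e]
  refine Finset.sum_subset (Finset.subset_univ T) fun e _ he => ?_
  rw [dirichletForm_eq_zero_of_eqOn (eq_zero_on_carrier hw he), mul_zero]

/-- The energy of a sum of functions of the coarse space and of the local spaces. -/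
theorem energy_add_sum_le (hpos : ∀ e, 0 < a e) (ha : ∀ e, ∀ x ∈ (M.elem e).carrier, κ x = a e)
    {J : Type} [Fintype J] {D' : J → Finset ι} (hN : ∀ e, {j | e ∈ D' j}.ncard ≤ N)
    (v₀ : M.fineSpace k) {w : J → M.fineSpace k} (hw : ∀ j, w j ∈ M.localSpace k (D' j)) :
    M.energy κ Finset.univ (v₀ + ∑ j, w j : M.fineSpace k) (v₀ + ∑ j, w j : M.fineSpace k) ≤
      (2 + 2 * N) * (M.energy κ Finset.univ v₀ v₀ + ∑ j, M.energy κ Finset.univ (w j) (w j)) := by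
  classical
  have hH : ∀ (u : M.fineSpace k) (e : ι), MemH1 (M.elem e).carrier u := fun u e =>
    (memVirtual_of_mem_space u.2.1 e).memH1
  have hen : ∀ (T : Finset ι) (u : M.fineSpace k), M.energy κ T u u =
      ∑ e ∈ T, a e * dirichletForm (M.elem e).carrier u u := fun T u =>
    energy_eq_sum ha (fun e _ => hH u e) fun e _ => hH u e
  -- Only the functions whose subdomain contains `e` are nonzero on `e`; there are at most `N` of
  -- them, so the constant does not depend on the number of subdomains.
  have hloc : ∀ e, dirichletForm (M.elem e).carrier (∑ j, w j : M.fineSpace k)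
      (∑ j, w j : M.fineSpace k) ≤
      N * ∑ j with e ∈ D' j, dirichletForm (M.elem e).carrier (w j) (w j) := fun e => by
    have hO := (M.elem e).isOpen_carrier
    have heq : EqOn ((∑ j, w j : M.fineSpace k) : Plane → ℝ)
        (∑ j with e ∈ D' j, (w j : Plane → ℝ)) (M.elem e).carrier := fun x hx => by
      rw [Submodule.coe_sum, Finset.sum_apply, Finset.sum_apply]
      exact (Finset.sum_subset (Finset.subset_univ _) fun j _ hj =>
        eq_zero_on_carrier (hw j) (by simpa using hj) hx).symm
    rw [dirichletForm_congr hO heq heq]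
    refine (dirichletForm_sum_self_le hO _ fun j _ => hH (w j) e).trans ?_
    exact mul_le_mul_of_nonneg_right (Nat.cast_le.2 (card_filter_le (hN e)))
      (Finset.sum_nonneg fun j _ => dirichletForm_self_nonneg _ _)
  have h1 : M.energy κ Finset.univ (∑ j, w j : M.fineSpace k) (∑ j, w j : M.fineSpace k) ≤
      N * ∑ j, M.energy κ Finset.univ (w j) (w j) := by
    have h2 : ∑ j, M.energy κ Finset.univ (w j) (w j) = ∑ e, a e * ∑ j with e ∈ D' j,
        dirichletForm (M.elem e).carrier (w j) (w j) := by
      rw [sum_mul_sum_filter_eq (f := fun e j => dirichletForm (M.elem e).carrier (w j) (w j))]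
      exact Finset.sum_congr rfl fun j _ => by rw [← energy_eq_of_mem_localSpace ha (hw j), hen]
    rw [h2, hen, Finset.mul_sum]
    exact Finset.sum_le_sum fun e _ => by
      rw [mul_left_comm]; exact mul_le_mul_of_nonneg_left (hloc e) (hpos e).le
  have h3 : M.energy κ Finset.univ (v₀ + ∑ j, w j : M.fineSpace k)
      (v₀ + ∑ j, w j : M.fineSpace k) ≤ 2 * (M.energy κ Finset.univ v₀ v₀ +
        M.energy κ Finset.univ (∑ j, w j : M.fineSpace k) (∑ j, w j : M.fineSpace k)) := by
    rw [hen, hen, hen, ← Finset.sum_add_distrib, Finset.mul_sum]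
    refine Finset.sum_le_sum fun e _ => ?_
    rw [← mul_add, mul_left_comm]
    exact mul_le_mul_of_nonneg_left (dirichletForm_add_self_le (M.elem e).isOpen_carrier (hH v₀ e)
      (hH (∑ j, w j) e)) (hpos e).le
  have h4 : 0 ≤ M.energy κ Finset.univ v₀ v₀ :=
    energy_self_nonneg hpos ha fun e _ => hH v₀ e
  have h5 : 0 ≤ ∑ j, M.energy κ Finset.univ (w j) (w j) := Finset.sum_nonneg fun j _ =>
    energy_self_nonneg hpos ha fun e _ => hH (w j) e
  have hN0 : (0 : ℝ) ≤ N := Nat.cast_nonneg N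
  nlinarith [mul_nonneg hN0 h4]

end PolygonalMesh

end

/-! ### Assembly of the condition number estimate -/

theorem mainTheorem2 (k : ℕ) (hk : 1 ≤ k) (ρ : ℝ) (hρ : 0 < ρ) (N : ℕ) (Cχ Cξ : ℝ) :
    ∃ C : ℝ, 0 < C ∧
      ∀ {ι : Type} [Fintype ι] (M : PolygonalMesh ι) (κ : Plane → ℝ)
        -- the coarse blocks, the coarse nodes, and the partition of unity of the coarse mesh
        {β : Type} [Fintype β] (blk : ι → β)
        {ν : Type} [Fintype ν] (y : ν → Plane) (χ : ν → Plane → ℝ)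
        -- the subdomains, the overlapping subdomains, and their partition of unity
        {J : Type} [Fintype J] (sub : ι → J) (D' : J → Finset ι) (ξ : J → Plane → ℝ)
        -- the local eigenfunctions and eigenvalues, and the number of them that is selected
        {n : ν → ℕ} (ψ : ∀ i, Fin (n i) → Plane → ℝ) (lam : ∀ i, Fin (n i) → ℝ)
        (L : ν → ℕ) (hL : ∀ i, L i < n i)
        -- bases of the fine space, of the coarse space and of the local spaces
        {m m₀ : ℕ} {mloc : J → ℕ}
        (b : Module.Basis (Fin m) ℝ (M.fineSpace k))
        (b₀ : Module.Basis (Fin m₀) ℝ (M.coarseSpace k χ ψ L))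
        (bloc : ∀ j, Module.Basis (Fin (mloc j)) ℝ (M.localSpace k (D' j))),
        (∀ e, (M.elem e).IsShapeRegular ρ) →
        (∀ e, ∃ c : ℝ, 0 < c ∧ ∀ x ∈ (M.elem e).carrier, κ x = c) →
        Function.Surjective blk →
        (∀ i, ∃ e p, (M.elem e).vert p = y i) →
        M.IsPartitionOfUnity k (fun i => M.nodeNeighborhood blk (y i)) χ
          (Cχ / M.coarseSize blk) →
        (∀ e, {i | e ∈ M.nodeNeighborhood blk (y i)}.ncard ≤ N) →
        Function.Surjective sub →
        (∀ e, e ∈ D' (sub e)) →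
        0 < M.overlap sub D' →
        M.IsPartitionOfUnity k D' ξ (Cξ / M.overlap sub D') →
        (∀ e, {j | e ∈ D' j}.ncard ≤ N) →
        (∀ i, M.IsEigenbasis k κ (M.nodeNeighborhood blk (y i)) (ψ i) (lam i)) →
        (∀ i, 0 < lam i ⟨L i, hL i⟩) →
        let A := M.stiffness k κ b
        let P₀ := prolongation b b₀
        let P := fun j => prolongation b (bloc j)
        let δ := M.overlap sub D'
        let H := M.coarseSize blk
        let lamMin := ⨅ i, lam i ⟨L i, hL i⟩
        A.PosDef ∧ (subspaceMatrix A P₀).PosDef ∧ (∀ j, (subspaceMatrix A (P j)).PosDef) ∧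
        (twoLevelSchwarz A P₀ P).PosDef ∧
        (∀ C₀ : ℝ, 0 < C₀ → M.IsStableDecomposition k κ D' (M.coarseSpace k χ ψ L) C₀ →
          spectralCond (twoLevelSchwarz A P₀ P * A) ≤ C * C₀ ^ 2) ∧
        ∃ C₀ : ℝ, 0 < C₀ ∧ M.IsStableDecomposition k κ D' (M.coarseSpace k χ ψ L) C₀ ∧
          C₀ ^ 2 ≤ C * max (1 + 1 / (δ ^ 2 * lamMin)) (1 + 1 / (H ^ 2 * lamMin)) := by
  obtain ⟨C, hC, hdecomp⟩ := PolygonalMesh.exists_decomposition k hk hρ N Cχ Cξ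
  -- The first number is the bound for the largest eigenvalue. The second belongs to the stable
  -- decomposition, where 1 + s + t ≤ 2 max(1 + s, 1 + t) replaces the sum by a maximum.
  refine ⟨max (2 + 2 * N) (2 * C), by positivity, ?_⟩
  intro ι _ M κ β _ blk ν _ y χ J _ sub D' ξ n ψ lam L hL m m₀ mloc b b₀ bloc hreg hκ hblk hy hχ hN
    hsub hD' hδ hξ hN' hψ hlam A P₀ P δ H lamMin
  choose a hpos ha using hκ
  have hMs := PolygonalMesh.isStarMesh hρ hreg
  -- A supremum over an empty family is 0, so a positive overlap means that there are subdomains,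
  -- hence elements, and hence coarse nodes, because the cut-off functions sum to 1. Thus `lamMin`
  -- is attained and positive, and not the default value 0 of an empty infimum.
  have hJ : Nonempty J := by
    by_contra h
    rw [not_nonempty_iff] at h
    exact hδ.ne' (Real.iSup_of_isEmpty _)
  have hι : Nonempty ι := (hsub hJ.some).nonempty
  have hν : Nonempty ν := by
    by_contra h
    rw [not_nonempty_iff] at h
    have h1 := hχ.sum_eq_one _ (PolygonalMesh.mem_closedRegion_univ
      ((M.elem hι.some).vert_mem_closure 0))
    simp at h1
  have hmin : 0 < lamMin := by
    obtain ⟨i, hi⟩ := exists_eq_ciInf_of_finite (f := fun i => lam i ⟨L i, hL i⟩)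
    change 0 < ⨅ i, lam i ⟨L i, hL i⟩
    rw [← hi]; exact hlam i
  have hmin_le : ∀ i, lamMin ≤ lam i ⟨L i, hL i⟩ := fun i =>
    ciInf_le (Set.finite_range _).bddBelow i
  have hst : ∃ C₀ : ℝ, 0 < C₀ ∧ M.IsStableDecomposition k κ D' (M.coarseSpace k χ ψ L) C₀ ∧
      C₀ ^ 2 ≤ max (2 + 2 * (N : ℝ)) (2 * C) *
        max (1 + 1 / (δ ^ 2 * lamMin)) (1 + 1 / (H ^ 2 * lamMin)) := by
    set Θ := max (1 + 1 / (δ ^ 2 * lamMin)) (1 + 1 / (H ^ 2 * lamMin)) with hΘ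
    have hΘ0 : 0 < Θ := lt_max_of_lt_left (by positivity)
    refine ⟨√(2 * C * Θ), Real.sqrt_pos.2 (by positivity), fun v => ?_, ?_⟩
    · obtain ⟨v₀, hv₀, w, hw, hvw, hle⟩ := hdecomp hL hreg hpos ha hχ hN hsub hδ hξ hN' hψ hmin
        hmin_le v
      refine ⟨v₀, hv₀, w, hw, hvw, hle.trans ?_⟩
      rw [Real.sq_sqrt (by positivity)]
      refine mul_le_mul_of_nonneg_right ?_ (PolygonalMesh.energy_self_nonneg hpos ha fun e he =>
        PolygonalMesh.memH1_of_mem_space v.2.1 he)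
      have h1 : 1 + 1 / (δ ^ 2 * lamMin) ≤ Θ := le_max_left _ _
      have h2 : 1 + 1 / (H ^ 2 * lamMin) ≤ Θ := le_max_right _ _
      rw [mul_comm 2 C, mul_assoc]
      refine mul_le_mul_of_nonneg_left ?_ hC.le
      change 1 + 1 / (H ^ 2 * lamMin) + 1 / (δ ^ 2 * lamMin) ≤ _
      linarith
    · rw [Real.sq_sqrt (by positivity)]
      exact mul_le_mul_of_nonneg_right (le_max_right _ _) hΘ0.le
  let form := PolygonalMesh.energyForm ha k (Finset.univ : Finset ι)
  have hA : A.PosDef := posDef_of_form b form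
    (fun u v => by
      simp only [form, PolygonalMesh.energyForm_apply, PolygonalMesh.energy, real_inner_comm])
    fun v hv => PolygonalMesh.energy_pos hpos ha v hv
  have hP₀ : (subspaceMatrix A P₀).PosDef := posDef_subspaceMatrix b hA b₀
  have hP : ∀ j, (subspaceMatrix A (P j)).PosDef := fun j => posDef_subspaceMatrix b hA (bloc j)
  -- the coarse space and the local spaces as one family
  let m' : Option J → ℕ := fun o => o.elim m₀ mloc
  let P' : ∀ o : Option J, Matrix (Fin m) (Fin (m' o)) ℝ := fun o =>
    match o with
    | none => P₀
    | some j => P j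
  have hP' : ∀ o, (subspaceMatrix A (P' o)).PosDef := fun o =>
    match o with
    | none => hP₀
    | some j => hP j
  have hM : twoLevelSchwarz A P₀ P = additiveSchwarz A P' := by
    rw [twoLevelSchwarz, additiveSchwarz, Fintype.sum_option]
    rfl
  have hform : ∀ x : Fin m → ℝ, x ⬝ᵥ A.mulVec x =
      M.energy κ Finset.univ (b.equivFun.symm x) (b.equivFun.symm x) := fun x =>
    dotProduct_of_mulVec b form x x
  have hdec : ∀ C₀ : ℝ, M.IsStableDecomposition k κ D' (M.coarseSpace k χ ψ L) C₀ →
      ∀ x, ∃ z : ∀ o, Fin (m' o) → ℝ, x = ∑ o, (P' o).mulVec (z o) ∧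
        ∑ o, ((P' o).mulVec (z o)) ⬝ᵥ A.mulVec ((P' o).mulVec (z o)) ≤
          C₀ ^ 2 * (x ⬝ᵥ A.mulVec x) := fun C₀ h x => by
    obtain ⟨v₀, hv₀, w, hw, hvw, hle⟩ := h (b.equivFun.symm x)
    let z : ∀ o, Fin (m' o) → ℝ := fun o =>
      match o with
      | none => b₀.equivFun ⟨v₀, hv₀⟩
      | some j => (bloc j).equivFun ⟨w j, hw j⟩
    have hz₀ : (P' none).mulVec (z none) = b.equivFun v₀ := by
      have := prolongation_mulVec b b₀ (b₀.equivFun ⟨v₀, hv₀⟩)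
      rwa [LinearEquiv.symm_apply_apply] at this
    have hz : ∀ j, (P' (some j)).mulVec (z (some j)) = b.equivFun (w j) := fun j => by
      have := prolongation_mulVec b (bloc j) ((bloc j).equivFun ⟨w j, hw j⟩)
      rwa [LinearEquiv.symm_apply_apply] at this
    refine ⟨z, ?_, ?_⟩
    · rw [Fintype.sum_option, hz₀]
      simp only [hz]
      rw [← map_sum, ← map_add, ← hvw, LinearEquiv.apply_symm_apply]
    · rw [Fintype.sum_option, hz₀]
      simp only [hz, hform, LinearEquiv.symm_apply_apply]
      refine le_trans (le_of_eq ?_) hle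
      congr 1
      exact Finset.sum_congr rfl fun j _ =>
        (PolygonalMesh.energy_eq_of_mem_localSpace ha (hw j)).symm
  have hK : ∀ z : ∀ o, Fin (m' o) → ℝ,
      (∑ o, (P' o).mulVec (z o)) ⬝ᵥ A.mulVec (∑ o, (P' o).mulVec (z o)) ≤
        (2 + 2 * (N : ℝ)) * ∑ o, ((P' o).mulVec (z o)) ⬝ᵥ A.mulVec ((P' o).mulVec (z o)) :=
    fun z => by
      have hz₀ : (P' none).mulVec (z none) = b.equivFun (b₀.equivFun.symm (z none)) :=
        prolongation_mulVec b b₀ (z none)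
      have hz : ∀ j, (P' (some j)).mulVec (z (some j)) =
          b.equivFun ((bloc j).equivFun.symm (z (some j))) := fun j =>
        prolongation_mulVec b (bloc j) (z (some j))
      rw [Fintype.sum_option, Fintype.sum_option, hz₀]
      simp only [hz]
      rw [← map_sum, ← map_add]
      simp only [hform, LinearEquiv.symm_apply_apply]
      exact PolygonalMesh.energy_add_sum_le hpos ha hN' _ fun j =>
        ((bloc j).equivFun.symm (z (some j))).2
  refine ⟨hA, hP₀, hP, ?_, fun C₀ hC₀ hC₀' => ?_, hst⟩
  · obtain ⟨C₀, -, h, -⟩ := hst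
    rw [hM]
    refine posDef_additiveSchwarz hP' fun x => ?_
    obtain ⟨z, hz, -⟩ := hdec C₀ h x
    exact ⟨z, hz⟩
  · rw [hM]
    refine (spectralCond_le (by positivity) (by positivity) fun μ hμ =>
      mem_Icc_of_mem_spectrum hA hP' (c := C₀ ^ 2) (by positivity) (hdec C₀ hC₀') hK hμ).trans ?_
    exact mul_le_mul_of_nonneg_right (le_max_left _ _) (sq_nonneg _)
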